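/- Let $L^2_{\mathrm{even}}=\{\psi\in L^2(\mathbb R^2):\psi(-\mathbf r)=\psi(\mathbf r)\}$ (complex valued), $\mathbf r^\perp=(-y,x)$ for $\mathbf r=(x,y)$, $r=|\mathbf r|$, and for $\alpha\in[0,1]$ put $\mathbf D_\alpha=-i\nabla+\alpha\,\mathbf r^\perp/r^2$ and $H_\alpha=\mathbf D_\alpha^2$, both understood in the sense of distributions on $\mathbb R^2\setminus\{0\}$. Let $$\mathcal F_{\alpha}[\psi]=\int_{\mathbb R^2}|\mathbf D_\alpha\psi|^2\,d\mathbf r,\qquad \mathcal F_{\alpha}[u,v]=\int_{\mathbb R^2}\overline{\mathbf D_\alpha u}\cdot\mathbf D_\alpha v\,d\mathbf r,$$ and let $\mathcal F_{\alpha,\mathrm F}$ be the restriction of $\mathcal F_\alpha$ to the domain $\mathscr D[\mathcal F_{\alpha,\mathrm F}]$ of all $\psi\in L^2_{\mathrm{even}}$ with $\mathbf D_\alpha\psi\in L^2$ for which there are $\varphi_n\in C_0^\infty(\mathbb R^2\setminus\{0\})$ with $\mathcal F_\alpha[\varphi_n-\psi]\to0$. For $n\in\mathbb Z$ let $\psi_n$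 be the component of $\psi$ with angular momentum $n$, i.e. $\psi_n(r,\vartheta)=\frac1{2\pi}\int_0^{2\pi}\psi(r,\vartheta+\theta)e^{-in\theta}\,d\theta$. (1) For every $\alpha\in[0,1]$ the form $\mathcal F_{\alpha,\mathrm F}$ is closed in $L^2_{\mathrm{even}}$ and positive ($\mathcal F_{\alpha,\mathrm F}[\psi]\ge0$). (2) For every $\alpha\in(0,1)$, $\mathscr D[\mathcal F_{\alpha,\mathrm F}]\subset H^1(\mathbb R^2)$. (3) For every $\alpha\in[0,1]$ there is a densely defined self-adjoint operator $H_{\alpha,\mathrm F}$ on $L^2_{\mathrm{even}}$ associated with the form, that is, $v\in\mathscr D(H_{\alpha,\mathrm F})$ and $H_{\alpha,\mathrm F}v=w$ if and only if $v\in\mathscr D[\mathcal F_{\alpha,\mathrm F}]$ and $\mathcal F_{\alpha}[u,v]=\langle u,w\rangle$ for all $u\in\mathscr D[\mathcal F_{\alpha,\mathrm F}]$. It acts as $H_\alpha$: $H_{\alpha,\mathrm F}\psi=H_\alpha\psi$ for all $\psi\in\mathscr D(H_{\alpha,\mathrm F})$, and $$\mathscr D(H_{\alpha,\mathrm F})=\{\psi\in\mathscr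 D[\mathcal F_{\alpha,\mathrm F}]: H_\alpha\psi\in L^2(\mathbb R^2)\}.$$ (4) For every $\alpha\in[0,1)$, $\mathscr D(H_{\alpha,\mathrm F})$ is the set of all $\psi\in L^2_{\mathrm{even}}$ such that - $\psi_n\in H^2(\mathbb R^2)$ for all $n\ne0$, and $\psi-\psi_0=\sum_{n\neq0}\psi_n\in H^2(\mathbb R^2)$; - $\psi_0\in H^1(\mathbb R^2)$, and $\psi_0\in H^2(\{r>\varepsilon\})$ for every $\varepsilon>0$; - there is $c\in\mathbb C$ such that $\psi_0-c\,r^\alpha=o(r)$ as $r\to0^+$ and $\psi_0-c\,r^\alpha\in H^2(\{r<1\})$. -/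

import Mathlib

open MeasureTheory Set Filter Topology Asymptotics
open scoped ContDiff ComplexConjugate

noncomputable section

namespace Anyon

/-- The Euclidean plane. -/
abbrev Plane : Type := EuclideanSpace ℝ (Fin 2)

/-- The Hilbert space of square-integrable complex functions on the plane. -/
abbrev L2 : Type := Lp ℂ 2 (volume : Measure Plane)

lemma ae_neg {p : Plane → Prop} (h : ∀ᵐ x : Plane, p x) : ∀ᵐ x : Plane, p (-x) :=
  (Measure.measurePreserving_neg (volume : Measure Plane)).quasiMeasurePreserving.ae h

/-- The even square-integrable functions, `ψ(-x) = ψ(x)` for almost every `x`. -/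
def L2even : Submodule ℂ L2 where
  carrier := {ψ | ∀ᵐ x : Plane, ψ (-x) = ψ x}
  add_mem' := by
    intro a b ha hb
    have h := Lp.coeFn_add a b
    filter_upwards [ha, hb, h, ae_neg h] with x h1 h2 h3 h4
    simp only [Pi.add_apply] at h3 h4
    rw [h3, h4, h1, h2]
  zero_mem' := by
    have h := Lp.coeFn_zero ℂ 2 (volume : Measure Plane)
    filter_upwards [h, ae_neg h] with x h3 h4
    rw [h3, h4]; rfl
  smul_mem' := by
    intro c a ha
    have h := Lp.coeFn_smul c a
    filter_upwards [ha, h, ae_neg h] with x h1 h3 h4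
    simp only [Pi.smul_apply] at h3 h4
    rw [h3, h4, h1]

lemma isClosed_L2even : IsClosed (L2even : Set L2) := by
  have hm := Measure.measurePreserving_neg (volume : Measure Plane)
  have heq : (L2even : Set L2) = {ψ | Lp.compMeasurePreserving _ hm ψ = ψ} := by
    ext ψ
    have h := Lp.coeFn_compMeasurePreserving ψ hm
    constructor
    · intro hψ
      refine Lp.ext ?_
      filter_upwards [h, (hψ : ∀ᵐ x : Plane, ψ (-x) = ψ x)] with x h1 h2
      rw [h1]; exact h2
    · intro hψ
      change Lp.compMeasurePreserving _ hm ψ = ψ at hψ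
      rw [hψ] at h
      change ∀ᵐ x : Plane, ψ (-x) = ψ x
      filter_upwards [h] with x h1
      exact h1.symm
  rw [heq]
  exact isClosed_eq (Lp.isometry_compMeasurePreserving hm).continuous continuous_id

instance : CompleteSpace L2even := isClosed_L2even.completeSpace_coe

/-- A function representing an element of `L2even`. -/
def rep (ψ : L2even) : Plane → ℂ := ((ψ : L2) : Plane → ℂ)

/-! ### Weak derivatives and Sobolev spaces -/

/-- The coordinate unit vector `e_j`. -/
def e (j : Fin 2) : Plane := EuclideanSpace.single j 1

/-- Smooth complex functions with compact support contained in `Ω`. -/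
def IsTest (Ω : Set Plane) (φ : Plane → ℂ) : Prop :=
  ContDiff ℝ ∞ φ ∧ HasCompactSupport φ ∧ tsupport φ ⊆ Ω

/-- `v` is the weak partial derivative `∂_j u` on the open set `Ω`. -/
def HasWeakDeriv (Ω : Set Plane) (j : Fin 2) (u v : Plane → ℂ) : Prop :=
  LocallyIntegrableOn u Ω ∧ LocallyIntegrableOn v Ω ∧
    ∀ φ : Plane → ℂ, IsTest Ω φ →
      ∫ x in Ω, fderiv ℝ φ x (e j) * u x = - ∫ x in Ω, φ x * v x

/-- The Sobolev space `H^k(Ω)`: all weak derivatives of order at most `k` are in `L²(Ω)`. -/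
def MemH : ℕ → Set Plane → (Plane → ℂ) → Prop
  | 0, Ω, u => MemLp u 2 (volume.restrict Ω)
  | k + 1, Ω, u => MemLp u 2 (volume.restrict Ω) ∧
      ∀ j : Fin 2, ∃ v : Plane → ℂ, HasWeakDeriv Ω j u v ∧ MemH k Ω v

open Classical in
/-- The weak partial derivative `∂_j u` on `Ω` (a.e. unique; zero if there is none). -/
def weakDeriv (Ω : Set Plane) (j : Fin 2) (u : Plane → ℂ) : Plane → ℂ :=
  if h : ∃ v : Plane → ℂ, HasWeakDeriv Ω j u v then h.choose else 0

/-! ### The Aharonov-Bohm operator -/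

/-- The plane without the origin. -/
def punctured : Set Plane := {(0 : Plane)}ᶜ

/-- The vector potential `α x^⊥ / |x|²`, where `x^⊥ = (-x₂, x₁)`. -/
def potential (α : ℝ) (j : Fin 2) (x : Plane) : ℂ :=
  ((α * (![-(x 1), x 0] j) / ‖x‖ ^ 2 : ℝ) : ℂ)

/-- The `j`-th component of `D_α u = (-i∇ + α x^⊥/|x|²) u`, with the gradient taken weakly
on the punctured plane. -/
def weakD (α : ℝ) (j : Fin 2) (u : Plane → ℂ) (x : Plane) : ℂ :=
  - Complex.I * weakDeriv punctured j u x + potential α j x * u x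

/-- The `j`-th component of `D_α φ` for a smooth function `φ`. -/
def classicalD (α : ℝ) (j : Fin 2) (φ : Plane → ℂ) (x : Plane) : ℂ :=
  - Complex.I * fderiv ℝ φ x (e j) + potential α j x * φ x

/-- `H_α φ = (-i∇ + α x^⊥/|x|²)² φ` for a smooth function `φ`. -/
def classicalH (α : ℝ) (φ : Plane → ℂ) (x : Plane) : ℂ :=
  ∑ j : Fin 2, classicalD α j (classicalD α j φ) x

/-- `H_α ψ = f` in the sense of distributions on the punctured plane (`H_α` is formally
symmetric). -/
def IsH (α : ℝ) (ψ f : Plane → ℂ) : Prop :=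
  LocallyIntegrableOn ψ punctured ∧ LocallyIntegrableOn f punctured ∧
    ∀ φ : Plane → ℂ, IsTest punctured φ →
      ∫ x in punctured, conj (classicalH α φ x) * ψ x = ∫ x in punctured, conj (φ x) * f x

/-! ### The quadratic form -/

/-- `D_α u` exists weakly on the punctured plane and is square integrable. -/
def FiniteEnergy (α : ℝ) (u : Plane → ℂ) : Prop :=
  ∀ j : Fin 2, (∃ v : Plane → ℂ, HasWeakDeriv punctured j u v) ∧ MemLp (weakD α j u) 2 volume

/-- The quadratic form `F_α[u] = ∫ |D_α u|²`, the square of the norm `‖u‖_α`. -/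
def form (α : ℝ) (u : Plane → ℂ) : ℝ :=
  ∫ x : Plane, ∑ j : Fin 2, ‖weakD α j u x‖ ^ 2

/-- The associated sesquilinear form, antilinear in the first argument. -/
def sesqForm (α : ℝ) (u v : Plane → ℂ) : ℂ :=
  ∫ x : Plane, ∑ j : Fin 2, conj (weakD α j u x) * weakD α j v x

/-- The form domain: the even square-integrable functions in the `‖·‖_α`-closure of the smooth
functions with compact support in the punctured plane. -/
def formDomain (α : ℝ) : Set L2even :=
  {ψ | FiniteEnergy α (rep ψ) ∧
    ∃ φ : ℕ → Plane → ℂ, (∀ n, IsTest punctured (φ n)) ∧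
      Tendsto (fun n => form α (φ n - rep ψ)) atTop (𝓝 0)}

/-- The form is closed: an `L²`-convergent sequence in the form domain that is Cauchy for the form
has its limit in the form domain and converges to it in the sense of the form. -/
def FormIsClosed (α : ℝ) : Prop :=
  ∀ (ψ : ℕ → L2even) (ψlim : L2even), (∀ n, ψ n ∈ formDomain α) →
    Tendsto ψ atTop (𝓝 ψlim) →
    Tendsto (fun p : ℕ × ℕ => form α (rep (ψ p.1 - ψ p.2))) atTop (𝓝 0) →
    ψlim ∈ formDomain α ∧ Tendsto (fun n => form α (rep (ψ n - ψlim))) atTop (𝓝 0)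

/-- `H` is the operator associated with the form: `v ∈ dom H` and `H v = w` precisely when `v` is in
the form domain and `F_α[u, v] = ⟨u, w⟩` for every `u` in the form domain. -/
def IsAssociatedOperator (α : ℝ) (H : L2even →ₗ.[ℂ] L2even) : Prop :=
  ∀ v w : L2even, (v, w) ∈ H.graph ↔
    v ∈ formDomain α ∧ ∀ u ∈ formDomain α, sesqForm α (rep u) (rep v) = inner ℂ u w

/-! ### Angular momentum sectors -/

/-- Rotation of the plane by the angle `θ`. -/
def rot (θ : ℝ) (x : Plane) : Plane :=
  !₂[Real.cos θ * x 0 - Real.sin θ * x 1, Real.sin θ * x 0 + Real.cos θ * x 1]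

/-- The component of `u` with angular momentum `n`, a function on the plane of the form
`u_n(r) e^{inϑ}`. -/
def sector (n : ℤ) (u : Plane → ℂ) (x : Plane) : ℂ :=
  ((2 * Real.pi)⁻¹ : ℂ) *
    ∫ θ in (0 : ℝ)..(2 * Real.pi), u (rot θ x) * Complex.exp (-(n * θ * Complex.I))

/-- The explicit operator domain. Each component of non-zero angular momentum, and also their sum
`u - u_0`, is in `H²(ℝ²)`. The s-wave component `u_0` is in `H¹(ℝ²)`, is `H²` outside every disc
around the origin, and is `c r^α + o(r)` at the origin with a remainder that is `H²` near the
origin. -/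
def explicitDomain (α : ℝ) : Set L2even :=
  {ψ | (∀ n : ℤ, n ≠ 0 → MemH 2 univ (sector n (rep ψ))) ∧
    MemH 2 univ (rep ψ - sector 0 (rep ψ)) ∧
    (∀ ε : ℝ, 0 < ε → MemH 2 (Metric.closedBall (0 : Plane) ε)ᶜ (sector 0 (rep ψ))) ∧
    MemH 1 univ (sector 0 (rep ψ)) ∧
    ∃ c : ℂ,
      ((fun x : Plane => sector 0 (rep ψ) x - c * ((‖x‖ ^ α : ℝ) : ℂ))
        =o[ae (volume : Measure Plane) ⊓ 𝓝 0] fun x : Plane => ‖x‖) ∧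
      MemH 2 (Metric.ball (0 : Plane) 1)
        (fun x : Plane => sector 0 (rep ψ) x - c * ((‖x‖ ^ α : ℝ) : ℂ))}

end Anyon

end

/-! The engine is one computation: `‖x‖` times the tangential component of `D_α` is `-i∂_θ + α`,
which acts on the sector of angular momentum `n` as multiplication by `n + α` (`InV.sector_tangD`).
Even functions have only even `n`, so `|n + α| ≥ α` for `α ∈ [0, 1]`, and `|n + α| ≥ 2 - α` once the
s-wave is removed. Summing over sectors with Parseval's identity on circles gives angular Hardy
inequalities: for finite energy, `u / r` is square integrable when `α > 0`, and `(u - u_0) / r` is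
so for every `α`. Hence the plain gradient is square integrable, and since a point is removable in
the plane for square-integrable fields (`test_extend`), `u` is in `H¹`.

Let `T` be the maximal covariant gradient on even functions. Its graph `formGraph` is cut out by
pairings with test functions, hence closed. An element `r` of the graph orthogonal to all even test
functions solves `H_α r = -r` weakly. By `InOp.eq_of_inV` such an equation may be tested with any
function of finite energy, the gradients of the cut-offs being absorbed by the Hardy inequality;
testing with `r` itself gives `r = 0`. So test functions are dense in the graph
(`formGraph_le_closure`), and the form domain is the set of all even functions of finite energy
(`mem_formDomain_iff`). Closedness of the form is closedness of the graph, and von Neumann's theorem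
on `T† T` (`exists_selfAdjoint`) produces the operator. The same testing lemma identifies its graph
with the weak equation `H_α ψ = f`, where `f` is square integrable.

For the explicit domain let `α < 1`. Off the s-wave a Rellich inequality (`InOp.rellich`) is
obtained by testing with `u / (r² + δ)`; it works because the Hardy constant `(2 - α)²` exceeds `1`.
It puts `u / r²` and `∂_θ u / r²` in `L²`, so `Δu` is in `L²` and elliptic regularity
(`memH_two_of_weak_laplacian`) gives `H²`. The radial profile `g` of the s-wave solves `(r g')' = α²
g / r - r f`, which factors into first order equations for `r^α (r g' - α g)` and `r^(-α) g`. Finite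
energy excludes the singular solution `r^(-α)` (the logarithm if `α = 0`), and integration leaves `c
r^α` plus a remainder that is `o(r)` and square integrable against `r^(-4)` (`radial_asymptotics`).
The cut-off of `r^α` is itself in the operator domain, because `-Δ + α² / r²` annihilates `r^α`;
subtracting it leaves an `H²` function.

Conversely, the same estimates with `α = 0`, applied to an even `H²` function that has no s-wave, or
that is radial and `o(r)`, show that its inverse-square terms are in `L²`. Such a function is
therefore in the operator domain for every `α`, and a function satisfying the explicit conditions is
a sum of two of these and a multiple of the cut-off `r^α`. -/

noncomputable section

namespace Anyon

/-! ### Test functions and weak derivatives -/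

/-- The classical partial derivative. -/
abbrev pd (j : Fin 2) (φ : Plane → ℂ) (x : Plane) : ℂ := fderiv ℝ φ x (e j)

lemma isOpen_punctured : IsOpen punctured := isOpen_compl_singleton

lemma mem_punctured {x : Plane} : x ∈ punctured ↔ x ≠ 0 := Iff.rfl

lemma volume_punctured_compl : (volume : Measure Plane) puncturedᶜ = 0 := by
  simp [punctured]

lemma restrict_punctured : (volume : Measure Plane).restrict punctured = volume :=
  restrict_compl_singleton 0

namespace IsTest

variable {Ω : Set Plane} {φ η : Plane → ℂ}

lemma contDiff (h : IsTest Ω φ) : ContDiff ℝ ∞ φ := h.1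
lemma compact (h : IsTest Ω φ) : HasCompactSupport φ := h.2.1
lemma tsub (h : IsTest Ω φ) : tsupport φ ⊆ Ω := h.2.2
lemma continuous (h : IsTest Ω φ) : Continuous φ := h.1.continuous
lemma differentiable (h : IsTest Ω φ) : Differentiable ℝ φ := h.1.differentiable (by simp)

lemma mono {Ω' : Set Plane} (h : IsTest Ω φ) (hs : Ω ⊆ Ω') : IsTest Ω' φ :=
  ⟨h.1, h.2.1, h.2.2.trans hs⟩

lemma eq_zero (h : IsTest Ω φ) {x : Plane} (hx : x ∉ Ω) : φ x = 0 :=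
  image_eq_zero_of_notMem_tsupport fun hh => hx (h.tsub hh)

lemma add (h : IsTest Ω φ) (h' : IsTest Ω η) : IsTest Ω (fun x => φ x + η x) :=
  ⟨h.1.add h'.1, h.2.1.add h'.2.1,
    (tsupport_add φ η).trans (union_subset h.2.2 h'.2.2)⟩

lemma const_mul (h : IsTest Ω φ) (c : ℂ) : IsTest Ω (fun x => c * φ x) :=
  ⟨contDiff_const.mul h.1, h.2.1.mul_left,
    (tsupport_mul_subset_right (f := fun _ : Plane => c) (g := φ)).trans h.2.2⟩

lemma conjugate (h : IsTest Ω φ) : IsTest Ω (fun x => conj (φ x)) := by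
  refine ⟨Complex.conjCLE.contDiff.comp h.1, h.2.1.comp_left (g := fun z : ℂ => conj z) (by simp), ?_⟩
  refine Subset.trans (closure_mono ?_) h.2.2
  intro x hx hx0
  exact hx (by simp [hx0])

lemma pd (h : IsTest Ω φ) (j : Fin 2) : IsTest Ω (pd j φ) := by
  refine ⟨?_, ?_, (tsupport_fderiv_apply_subset ℝ (e j)).trans h.2.2⟩
  · exact (h.1.fderiv_right (m := ∞) (by simp)).clm_apply contDiff_const
  · exact h.2.1.fderiv_apply ℝ (e j)

lemma mul_contDiffOn (h : IsTest Ω φ) {χ : Plane → ℂ} (hΩ : IsOpen Ω) (hχ : ContDiffOn ℝ ∞ χ Ω) :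
    IsTest Ω (fun x => χ x * φ x) := by
  refine ⟨?_, h.2.1.mul_left, (tsupport_mul_subset_right (f := χ) (g := φ)).trans h.2.2⟩
  rw [contDiff_iff_contDiffAt]
  intro x
  by_cases hx : x ∈ Ω
  · exact (hχ.contDiffAt (hΩ.mem_nhds hx)).mul h.1.contDiffAt
  · have : (fun x => χ x * φ x) =ᶠ[𝓝 x] fun _ => 0 := by
      have hx' : x ∉ tsupport φ := fun hh => hx (h.2.2 hh)
      filter_upwards [(notMem_tsupport_iff_eventuallyEq.1 hx')] with y hy
      simp [hy]
    exact contDiffAt_const.congr_of_eventuallyEq this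

lemma mul_contDiff (h : IsTest Ω φ) {χ : Plane → ℂ} (hχ : ContDiff ℝ ∞ χ) :
    IsTest Ω (fun x => χ x * φ x) :=
  ⟨hχ.mul h.1, h.2.1.mul_left, (tsupport_mul_subset_right (f := χ) (g := φ)).trans h.2.2⟩

lemma memLp (h : IsTest Ω φ) (p : ENNReal) : MemLp φ p volume :=
  h.continuous.memLp_of_hasCompactSupport h.compact

lemma integrable (h : IsTest Ω φ) : Integrable φ :=
  h.continuous.integrable_of_hasCompactSupport h.compact

lemma exists_bound (h : IsTest Ω φ) : ∃ C : ℝ, 0 ≤ C ∧ ∀ x, ‖φ x‖ ≤ C := by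
  obtain ⟨C, hC⟩ := h.compact.exists_bound_of_continuous h.continuous
  exact ⟨C, (norm_nonneg _).trans (hC 0), hC⟩

lemma comp_lin (h : IsTest Ω φ) (g : Plane ≃L[ℝ] Plane) (hg : ∀ x, g x ∈ Ω → x ∈ Ω) :
    IsTest Ω (fun x => φ (g x)) := by
  refine ⟨h.1.comp g.contDiff, h.2.1.comp_homeomorph g.toHomeomorph, ?_⟩
  have := tsupport_comp_eq_preimage φ g.toHomeomorph
  intro x hx
  have hx' : x ∈ tsupport (φ ∘ g.toHomeomorph) := hx
  rw [this] at hx'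
  exact hg x (h.2.2 hx')

lemma integrable_mul (h : IsTest Ω φ) {u : Plane → ℂ} (hu : LocallyIntegrableOn u Ω) :
    Integrable (fun x => φ x * u x) := by
  have h1 : IntegrableOn u (tsupport φ) := hu.integrableOn_compact_subset h.tsub h.compact
  have h2 : IntegrableOn (fun x => φ x * u x) (tsupport φ) :=
    h1.continuousOn_mul h.continuous.continuousOn h.compact
  refine (integrableOn_iff_integrable_of_support_subset ?_).1 h2
  intro x hx
  exact subset_tsupport _ (fun h0 => hx (by simp [h0]))

lemma setIntegral_mul (h : IsTest Ω φ) (u : Plane → ℂ) :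
    ∫ x in Ω, φ x * u x = ∫ x, φ x * u x :=
  setIntegral_eq_integral_of_forall_compl_eq_zero fun x hx => by simp [h.eq_zero hx]

end IsTest

lemma pd_mul {φ η : Plane → ℂ} {x : Plane} (hφ : DifferentiableAt ℝ φ x)
    (hη : DifferentiableAt ℝ η x) (j : Fin 2) :
    pd j (fun y => φ y * η y) x = φ x * pd j η x + pd j φ x * η x := by
  simp only [pd]
  rw [fderiv_fun_mul hφ hη]
  simp [mul_comm]

lemma pd_add {φ η : Plane → ℂ} {x : Plane} (hφ : DifferentiableAt ℝ φ x)
    (hη : DifferentiableAt ℝ η x) (j : Fin 2) :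
    pd j (fun y => φ y + η y) x = pd j φ x + pd j η x := by
  simp only [pd]
  rw [fderiv_fun_add hφ hη]
  simp

lemma pd_const_mul {φ : Plane → ℂ} {x : Plane} (hφ : DifferentiableAt ℝ φ x) (c : ℂ) (j : Fin 2) :
    pd j (fun y => c * φ y) x = c * pd j φ x := by
  simp only [pd]
  rw [fderiv_const_mul hφ]
  simp

lemma pd_conj {φ : Plane → ℂ} {x : Plane} (hφ : DifferentiableAt ℝ φ x) (j : Fin 2) :
    pd j (fun y => conj (φ y)) x = conj (pd j φ x) := by
  have := (Complex.conjCLE.hasFDerivAt (x := φ x)).comp x hφ.hasFDerivAt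
  have h2 : fderiv ℝ (fun y => conj (φ y)) x = _ := this.fderiv
  simp only [pd]
  rw [h2]; simp

/-- Integration by parts when one function is a test function and the other one is smooth on the
open set carrying it. -/
lemma integral_pd_mul_test {Ω : Set Plane} {φ χ : Plane → ℂ} (h : IsTest Ω φ) (hΩ : IsOpen Ω)
    (hχ : ContDiffOn ℝ ∞ χ Ω) (j : Fin 2) :
    ∫ x, pd j φ x * χ x = - ∫ x, φ x * pd j χ x := by
  have hχd : ∀ x ∈ Ω, DifferentiableAt ℝ χ x := fun x hx =>
    (hχ.contDiffAt (hΩ.mem_nhds hx)).differentiableAt (by simp)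
  have hpd : ContDiffOn ℝ ∞ (pd j χ) Ω :=
    (hχ.fderiv_of_isOpen hΩ (m := ∞) (by simp)).clm_apply contDiffOn_const
  rw [integral_mul_fderiv_eq_neg_fderiv_mul_of_integrable (f := φ) (g := χ), neg_neg]
  · have := (h.pd j).mul_contDiffOn hΩ hχ
    exact this.integrable.congr (by filter_upwards with x; simp [pd, mul_comm])
  · have := h.mul_contDiffOn hΩ hpd
    exact this.integrable.congr (by filter_upwards with x; simp [pd, mul_comm])
  · have := h.mul_contDiffOn hΩ hχ
    exact this.integrable.congr (by filter_upwards with x; simp [mul_comm])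
  · exact fun x _ => h.differentiable x
  · exact fun x hx => hχd x (h.tsub hx)

/-- Test functions and their derivatives vanish off `Ω`, so nothing changes when the integrals run
over the plane. This is the working form of the definition. -/
lemma hasWeakDeriv_iff {Ω : Set Plane} {j : Fin 2} {u v : Plane → ℂ} :
    HasWeakDeriv Ω j u v ↔ LocallyIntegrableOn u Ω ∧ LocallyIntegrableOn v Ω ∧
      ∀ φ, IsTest Ω φ → ∫ x, pd j φ x * u x = - ∫ x, φ x * v x := by
  unfold HasWeakDeriv
  refine and_congr_right fun _ => and_congr_right fun _ => forall₂_congr fun φ hφ => ?_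
  rw [hφ.setIntegral_mul, (hφ.pd j).setIntegral_mul]

lemma LocallyIntegrableOn.contDiffOn_mul {Ω : Set Plane} {χ u : Plane → ℂ} (hΩ : IsOpen Ω)
    (hu : LocallyIntegrableOn u Ω) (hχ : ContinuousOn χ Ω) :
    LocallyIntegrableOn (fun x => χ x * u x) Ω :=
  hu.continuousOn_mul hχ hΩ.isLocallyClosed

/-- Two locally integrable functions with equal integrals against all test functions agree. -/
lemma ae_eq_of_test {Ω : Set Plane} (hΩ : IsOpen Ω) {u v : Plane → ℂ}
    (hu : LocallyIntegrableOn u Ω) (hv : LocallyIntegrableOn v Ω)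
    (h : ∀ φ, IsTest Ω φ → ∫ x, φ x * u x = ∫ x, φ x * v x) :
    ∀ᵐ x : Plane, x ∈ Ω → u x = v x := by
  have key := hΩ.ae_eq_zero_of_integral_contDiff_smul_eq_zero (μ := volume) (hu.sub hv) (by
    intro g hg hgc hgs
    have ht : IsTest Ω (fun x => (g x : ℂ)) := by
      refine ⟨Complex.ofRealCLM.contDiff.comp hg, hgc.comp_left (g := fun r : ℝ => (r : ℂ)) (by simp), ?_⟩
      refine Subset.trans (closure_mono ?_) hgs
      intro x hx hx0
      exact hx (by simp [hx0])
    have h1 := h _ ht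
    have h2 : (fun x => g x • (u - v) x) = fun x => (g x : ℂ) * u x - (g x : ℂ) * v x := by
      ext x; simp [mul_sub]
    rw [h2, integral_sub (ht.integrable_mul hu) (ht.integrable_mul hv), h1, sub_self])
  filter_upwards [key] with x hx hxo
  exact sub_eq_zero.1 (hx hxo)

lemma ae_mem_punctured : ∀ᵐ x : Plane, x ∈ punctured := by
  rw [ae_iff]; exact volume_punctured_compl

lemma ae_eq_of_test_punctured {u v : Plane → ℂ}
    (hu : LocallyIntegrableOn u punctured) (hv : LocallyIntegrableOn v punctured)
    (h : ∀ φ, IsTest punctured φ → ∫ x, φ x * u x = ∫ x, φ x * v x) : u =ᵐ[volume] v := by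
  filter_upwards [ae_eq_of_test isOpen_punctured hu hv h, ae_mem_punctured] with x h1 h2 using h1 h2

namespace HasWeakDeriv

variable {Ω : Set Plane} {j : Fin 2} {u v u' v' : Plane → ℂ}

lemma test (h : HasWeakDeriv Ω j u v) {φ : Plane → ℂ} (hφ : IsTest Ω φ) :
    ∫ x, pd j φ x * u x = - ∫ x, φ x * v x := (hasWeakDeriv_iff.1 h).2.2 φ hφ

lemma mono {Ω' : Set Plane} (h : HasWeakDeriv Ω j u v) (hs : Ω' ⊆ Ω) : HasWeakDeriv Ω' j u v :=
  hasWeakDeriv_iff.2 ⟨h.1.mono_set hs, h.2.1.mono_set hs, fun _ hφ => h.test (hφ.mono hs)⟩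

lemma congr (h : HasWeakDeriv Ω j u v) (hΩ : IsOpen Ω) (hu : u =ᵐ[volume.restrict Ω] u')
    (hv : v =ᵐ[volume.restrict Ω] v') : HasWeakDeriv Ω j u' v' := by
  refine ⟨h.1.congr hu, h.2.1.congr hv, fun φ hφ => ?_⟩
  have h1 := h.2.2 φ hφ
  have e1 : ∫ x in Ω, fderiv ℝ φ x (e j) * u' x = ∫ x in Ω, fderiv ℝ φ x (e j) * u x :=
    integral_congr_ae (by filter_upwards [hu] with x hx; rw [hx])
  have e2 : ∫ x in Ω, φ x * v' x = ∫ x in Ω, φ x * v x :=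
    integral_congr_ae (by filter_upwards [hv] with x hx; rw [hx])
  rw [e1, e2, h1]

lemma congr_ae (h : HasWeakDeriv Ω j u v) (hΩ : IsOpen Ω) (hu : u =ᵐ[volume] u')
    (hv : v =ᵐ[volume] v') : HasWeakDeriv Ω j u' v' :=
  h.congr hΩ (ae_restrict_of_ae hu) (ae_restrict_of_ae hv)

lemma unique (h : HasWeakDeriv Ω j u v) (h' : HasWeakDeriv Ω j u v') (hΩ : IsOpen Ω) :
    ∀ᵐ x : Plane, x ∈ Ω → v x = v' x :=
  ae_eq_of_test hΩ h.2.1 h'.2.1 fun φ hφ => by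
    have h1 := h.test hφ
    have h2 := h'.test hφ
    rw [h1] at h2
    exact neg_injective h2

lemma unique_punctured (h : HasWeakDeriv punctured j u v) (h' : HasWeakDeriv punctured j u v') :
    v =ᵐ[volume] v' := by
  filter_upwards [h.unique h' isOpen_punctured, ae_mem_punctured] with x h1 h2 using h1 h2

lemma add (h : HasWeakDeriv Ω j u v) (h' : HasWeakDeriv Ω j u' v') :
    HasWeakDeriv Ω j (fun x => u x + u' x) (fun x => v x + v' x) := by
  refine hasWeakDeriv_iff.2 ⟨h.1.add h'.1, h.2.1.add h'.2.1, fun φ hφ => ?_⟩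
  simp only [mul_add]
  rw [integral_add ((hφ.pd j).integrable_mul h.1) ((hφ.pd j).integrable_mul h'.1),
    integral_add (hφ.integrable_mul h.2.1) (hφ.integrable_mul h'.2.1), h.test hφ, h'.test hφ]
  ring

lemma const_mul (h : HasWeakDeriv Ω j u v) (c : ℂ) :
    HasWeakDeriv Ω j (fun x => c * u x) (fun x => c * v x) := by
  refine hasWeakDeriv_iff.2 ⟨h.1.smul c, h.2.1.smul c, fun φ hφ => ?_⟩
  have e1 : ∀ w w' : Plane → ℂ, ∫ x, w x * (c * w' x) = c * ∫ x, w x * w' x := fun w w' => by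
    rw [← integral_const_mul]; congr 1; ext x; ring
  rw [e1, e1, h.test hφ]; ring

lemma sub (h : HasWeakDeriv Ω j u v) (h' : HasWeakDeriv Ω j u' v') :
    HasWeakDeriv Ω j (fun x => u x - u' x) (fun x => v x - v' x) := by
  have := h.add (h'.const_mul (-1))
  simpa [sub_eq_add_neg] using this

/-- The function `χ * φ` is again a test function on `Ω`; test `u` with it. Smoothness of `χ` on `Ω`
alone is enough, which admits multipliers singular at the origin, such as powers of `‖x‖`. -/
lemma mul_smooth (h : HasWeakDeriv Ω j u v) (hΩ : IsOpen Ω) {χ : Plane → ℂ}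
    (hχ : ContDiffOn ℝ ∞ χ Ω) :
    HasWeakDeriv Ω j (fun x => χ x * u x) (fun x => χ x * v x + pd j χ x * u x) := by
  have hpd : ContDiffOn ℝ ∞ (pd j χ) Ω :=
    (hχ.fderiv_of_isOpen hΩ (m := ∞) (by simp)).clm_apply contDiffOn_const
  refine hasWeakDeriv_iff.2 ⟨LocallyIntegrableOn.contDiffOn_mul hΩ h.1 hχ.continuousOn,
    (LocallyIntegrableOn.contDiffOn_mul hΩ h.2.1 hχ.continuousOn).add
      (LocallyIntegrableOn.contDiffOn_mul hΩ h.1 hpd.continuousOn), fun φ hφ => ?_⟩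
  have ht := hφ.mul_contDiffOn hΩ hχ
  have h1 := h.test ht
  have hd : ∀ x, pd j (fun x => χ x * φ x) x * u x
      = pd j φ x * (χ x * u x) + φ x * (pd j χ x * u x) := by
    intro x
    by_cases hx : x ∈ Ω
    · rw [pd_mul ((hχ.contDiffAt (hΩ.mem_nhds hx)).differentiableAt (by simp)) (hφ.differentiable x)]
      ring
    · rw [(ht.pd j).eq_zero hx, (hφ.pd j).eq_zero hx, hφ.eq_zero hx]; ring
  simp only [hd] at h1
  have i1 : Integrable (fun x => pd j φ x * (χ x * u x)) :=
    (hφ.pd j).integrable_mul (LocallyIntegrableOn.contDiffOn_mul hΩ h.1 hχ.continuousOn)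
  have i2 : Integrable (fun x => φ x * (pd j χ x * u x)) :=
    hφ.integrable_mul (LocallyIntegrableOn.contDiffOn_mul hΩ h.1 hpd.continuousOn)
  have i3 : Integrable (fun x => φ x * (χ x * v x)) :=
    hφ.integrable_mul (LocallyIntegrableOn.contDiffOn_mul hΩ h.2.1 hχ.continuousOn)
  rw [integral_add i1 i2] at h1
  simp only [mul_add]
  rw [integral_add i3 i2]
  have e3 : ∫ x, φ x * (χ x * v x) = ∫ x, χ x * φ x * v x := by congr 1; ext x; ring
  rw [e3]
  linear_combination h1

/-- Smooth functions are weakly differentiable. -/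
lemma of_contDiffOn (hΩ : IsOpen Ω) {χ : Plane → ℂ} (hχ : ContDiffOn ℝ ∞ χ Ω) (j : Fin 2) :
    HasWeakDeriv Ω j χ (pd j χ) := by
  have hpd : ContDiffOn ℝ ∞ (pd j χ) Ω :=
    (hχ.fderiv_of_isOpen hΩ (m := ∞) (by simp)).clm_apply contDiffOn_const
  exact hasWeakDeriv_iff.2 ⟨hχ.continuousOn.locallyIntegrableOn hΩ.measurableSet,
    hpd.continuousOn.locallyIntegrableOn hΩ.measurableSet, fun φ hφ => integral_pd_mul_test hφ hΩ hχ j⟩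

end HasWeakDeriv

lemma weakDeriv_spec {Ω : Set Plane} {j : Fin 2} {u : Plane → ℂ}
    (h : ∃ v : Plane → ℂ, HasWeakDeriv Ω j u v) : HasWeakDeriv Ω j u (weakDeriv Ω j u) := by
  unfold weakDeriv
  rw [dif_pos h]
  exact h.choose_spec

lemma locallyIntegrableOn_of_memLp {u : Plane → ℂ} (hu : MemLp u 2 volume) (Ω : Set Plane) :
    LocallyIntegrableOn u Ω :=
  (hu.locallyIntegrable (by norm_num)).locallyIntegrableOn Ω

/-! ### Square-integrable functions -/

lemma memLp_two_iff {f : Plane → ℂ} (hf : AEStronglyMeasurable f volume) :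
    MemLp f 2 volume ↔ Integrable (fun x => ‖f x‖ ^ 2) := by
  rw [memLp_two_iff_integrable_sq_norm hf]

lemma MemLp.integrable_mul_two {f g : Plane → ℂ} (hf : MemLp f 2 volume) (hg : MemLp g 2 volume) :
    Integrable (fun x => f x * g x) := hf.integrable_mul hg

lemma norm_integral_mul_le {f g : Plane → ℂ} (hf : MemLp f 2 volume) (hg : MemLp g 2 volume) :
    ‖∫ x, f x * g x‖ ≤ √(∫ x, ‖f x‖ ^ 2) * √(∫ x, ‖g x‖ ^ 2) := by
  have h := integral_mul_norm_le_Lp_mul_Lq (μ := (volume : Measure Plane))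
    Real.HolderConjugate.two_two (f := f) (g := g) (by simpa using hf) (by simpa using hg)
  simp only [Real.rpow_two] at h
  rw [← Real.sqrt_eq_rpow, ← Real.sqrt_eq_rpow] at h
  refine (norm_integral_le_integral_norm _).trans (le_trans (le_of_eq ?_) h)
  simp

lemma tendsto_integral_mul_of_bounded {κ : ℕ → Plane → ℂ} {κ' F : Plane → ℂ} {C : ℝ}
    (hF : Integrable F) (hm : ∀ n, AEStronglyMeasurable (κ n) volume) (hb : ∀ n x, ‖κ n x‖ ≤ C)
    (hl : ∀ᵐ x, Tendsto (fun n => κ n x) atTop (𝓝 (κ' x))) :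
    Tendsto (fun n => ∫ x, κ n x * F x) atTop (𝓝 (∫ x, κ' x * F x)) := by
  refine tendsto_integral_of_dominated_convergence (fun x => C * ‖F x‖)
    (fun n => (hm n).mul hF.aestronglyMeasurable) (hF.norm.const_mul C) (fun n => ?_) ?_
  · filter_upwards with x
    rw [norm_mul]
    exact mul_le_mul_of_nonneg_right (hb n x) (norm_nonneg _)
  · filter_upwards [hl] with x hx
    exact hx.mul_const _

lemma memLp_bdd_mul {κ f : Plane → ℂ} {C : ℝ} (hf : MemLp f 2 volume)
    (hm : AEStronglyMeasurable κ volume) (hb : ∀ᵐ x, ‖κ x‖ ≤ C) :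
    MemLp (fun x => κ x * f x) 2 volume := by
  refine MemLp.of_le_mul (c := C) hf (hm.mul hf.1) ?_
  filter_upwards [hb] with x hx
  rw [norm_mul]
  exact mul_le_mul_of_nonneg_right hx (norm_nonneg _)

/-! ### Radial cut-off functions -/

/-- A smooth radial function that vanishes for `‖x‖ ≤ ε` and is `1` for `‖x‖ ≥ 2ε`. -/
def chi (ε : ℝ) (x : Plane) : ℂ := (Real.smoothTransition (‖x‖ ^ 2 / ε ^ 2 - 1) : ℝ)

lemma chi_contDiff (ε : ℝ) : ContDiff ℝ ∞ (chi ε) := by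
  refine Complex.ofRealCLM.contDiff.comp (Real.smoothTransition.contDiff.comp ?_)
  exact ((contDiff_norm_sq ℝ).div_const _).sub contDiff_const

lemma norm_chi_le (ε : ℝ) (x : Plane) : ‖chi ε x‖ ≤ 1 := by
  unfold chi
  rw [Complex.norm_real, Real.norm_of_nonneg (Real.smoothTransition.nonneg _)]
  exact Real.smoothTransition.le_one _

lemma chi_eq_zero {ε : ℝ} (hε : 0 < ε) {x : Plane} (hx : ‖x‖ ≤ ε) : chi ε x = 0 := by
  unfold chi
  rw [Real.smoothTransition.zero_of_nonpos, Complex.ofReal_zero]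
  rw [sub_nonpos, div_le_one (by positivity)]
  gcongr

lemma chi_eq_one {ε : ℝ} (hε : 0 < ε) {x : Plane} (hx : 2 * ε ≤ ‖x‖) : chi ε x = 1 := by
  unfold chi
  rw [Real.smoothTransition.one_of_one_le, Complex.ofReal_one]
  have : (2 * ε) ^ 2 ≤ ‖x‖ ^ 2 := by gcongr
  rw [le_sub_iff_add_le, le_div_iff₀ (by positivity)]
  nlinarith [sq_nonneg ε]

lemma pd_chi_eq_zero {ε : ℝ} (hε : 0 < ε) {x : Plane} (hx : ‖x‖ < ε ∨ 2 * ε < ‖x‖) (j : Fin 2) :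
    pd j (chi ε) x = 0 := by
  rcases hx with hx | hx
  · have : chi ε =ᶠ[𝓝 x] fun _ => 0 := by
      filter_upwards [(isOpen_lt continuous_norm continuous_const).mem_nhds hx] with y hy
      exact chi_eq_zero hε (le_of_lt hy)
    simp [pd, this.fderiv_eq]
  · have : chi ε =ᶠ[𝓝 x] fun _ => 1 := by
      filter_upwards [(isOpen_lt continuous_const continuous_norm).mem_nhds hx] with y hy
      exact chi_eq_one hε (le_of_lt hy)
    simp [pd, this.fderiv_eq]

lemma chi_scale {ε : ℝ} (hε : 0 < ε) (x : Plane) : chi ε x = chi 1 (ε⁻¹ • x) := by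
  unfold chi
  rw [norm_smul, Real.norm_of_nonneg (by positivity)]
  congr 3
  field_simp

lemma pd_chi_scale {ε : ℝ} (hε : 0 < ε) (x : Plane) (j : Fin 2) :
    pd j (chi ε) x = (ε⁻¹ : ℝ) * pd j (chi 1) (ε⁻¹ • x) := by
  have : chi ε = fun y => chi 1 (ε⁻¹ • y) := funext (chi_scale hε)
  simp only [pd]
  rw [this, fderiv_comp_smul]
  simp

lemma isTest_one_sub_chi {ε : ℝ} (hε : 0 < ε) : IsTest univ (fun x => 1 - chi ε x) := by
  refine ⟨contDiff_const.sub (chi_contDiff ε), ?_, subset_univ _⟩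
  refine HasCompactSupport.intro (isCompact_closedBall (0 : Plane) (2 * ε)) fun x hx => ?_
  rw [chi_eq_one hε, sub_self]
  simpa using (not_le.1 (by simpa using hx)).le

/-- All the cut-offs are dilates of `chi 1`, which costs a factor `1 / ε` in the gradient; as the
gradient lives in `‖x‖ ≤ 2 * ε`, multiplying by `‖x‖` undoes this factor. The second,
scale-invariant bound is the one that the Hardy inequality can pay for. -/
lemma exists_pd_chi_le : ∃ C : ℝ, 0 < C ∧ ∀ ε : ℝ, 0 < ε → ∀ j x,
    ‖pd j (chi ε) x‖ ≤ C / ε ∧ ‖x‖ * ‖pd j (chi ε) x‖ ≤ C := by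
  -- `1 - chi 1` has compact support and, up to sign, the same gradient as `chi 1`.
  have h : ∀ j, ∃ C, 0 ≤ C ∧ ∀ x, ‖pd j (fun x => 1 - chi 1 x) x‖ ≤ C := fun j =>
    ((isTest_one_sub_chi one_pos).pd j).exists_bound
  choose C hC0 hC using h
  have hC' : ∀ j x, ‖pd j (chi 1) x‖ ≤ C j := by
    intro j x
    have := hC j x
    simp only [pd] at this
    rw [fderiv_const_sub] at this
    simpa using this
  have hb : ∀ ε : ℝ, 0 < ε → ∀ j x, ‖pd j (chi ε) x‖ ≤ (C 0 + C 1 + 1) / ε := by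
    intro ε hε j x
    rw [pd_chi_scale hε, norm_mul, Complex.norm_real, Real.norm_of_nonneg (by positivity),
      div_eq_inv_mul]
    have : C j ≤ C 0 + C 1 + 1 := by
      fin_cases j
      · simp; linarith [hC0 1]
      · simp; linarith [hC0 0]
    gcongr
    exact (hC' _ _).trans this
  have hp : 0 < C 0 + C 1 + 1 := by have := hC0 0; have := hC0 1; linarith
  refine ⟨2 * (C 0 + C 1 + 1), by linarith, fun ε hε j x => ⟨(hb ε hε j x).trans ?_, ?_⟩⟩
  · gcongr; linarith
  · by_cases hx : 2 * ε < ‖x‖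
    · rw [pd_chi_eq_zero hε (Or.inr hx)]; simp; linarith
    · have := hb ε hε j x
      calc ‖x‖ * ‖pd j (chi ε) x‖ ≤ (2 * ε) * ((C 0 + C 1 + 1) / ε) := by
            gcongr; exact not_lt.1 hx
        _ = _ := by field_simp

lemma isTest_chi_mul {φ : Plane → ℂ} (hφ : IsTest univ φ) {ε : ℝ} (hε : 0 < ε) :
    IsTest punctured (fun x => chi ε x * φ x) := by
  have h := hφ.mul_contDiff (chi_contDiff ε)
  refine ⟨h.1, h.2.1, fun x hx => ?_⟩
  rw [mem_punctured]
  rintro rfl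
  refine (notMem_tsupport_iff_eventuallyEq.2 ?_) hx
  filter_upwards [Metric.ball_mem_nhds (0 : Plane) hε] with y hy
  simp [chi_eq_zero hε (le_of_lt (by simpa using hy))]

/-- The outer cut-off, equal to `1` on the ball of radius `n + 1`. -/
def outerCut (n : ℕ) (x : Plane) : ℂ := 1 - chi (n + 1) x

/-- The cut-off near the origin and near infinity. -/
def annulusCut (n : ℕ) (x : Plane) : ℂ := chi (1 / ((n : ℝ) + 1)) x * outerCut n x

lemma isTest_outerCut (n : ℕ) : IsTest univ (outerCut n) :=
  isTest_one_sub_chi (by positivity)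

lemma isTest_annulusCut (n : ℕ) : IsTest punctured (annulusCut n) :=
  isTest_chi_mul (isTest_outerCut n) (by positivity)

lemma norm_outerCut_le (n : ℕ) (x : Plane) : ‖outerCut n x‖ ≤ 1 := by
  unfold outerCut chi
  rw [← Complex.ofReal_one, ← Complex.ofReal_sub, Complex.norm_real, Real.norm_of_nonneg]
  · linarith [Real.smoothTransition.nonneg (‖x‖ ^ 2 / ((n : ℝ) + 1) ^ 2 - 1)]
  · linarith [Real.smoothTransition.le_one (‖x‖ ^ 2 / ((n : ℝ) + 1) ^ 2 - 1)]

lemma norm_annulusCut_le (n : ℕ) (x : Plane) : ‖annulusCut n x‖ ≤ 1 := by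
  unfold annulusCut
  rw [norm_mul]
  exact mul_le_one₀ (norm_chi_le _ _) (norm_nonneg _) (norm_outerCut_le _ _)

lemma eventually_outerCut (x : Plane) : ∀ᶠ n : ℕ in atTop, ‖x‖ < (n : ℝ) + 1 := by
  filter_upwards [tendsto_natCast_atTop_atTop.eventually_gt_atTop ‖x‖] with n hn
  linarith

lemma eventually_annulusCut {x : Plane} (hx : x ≠ 0) :
    ∀ᶠ n : ℕ in atTop, 2 * (1 / ((n : ℝ) + 1)) < ‖x‖ := by
  have h : Tendsto (fun n : ℕ => 2 * (1 / ((n : ℝ) + 1))) atTop (𝓝 (2 * 0)) :=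
    tendsto_one_div_add_atTop_nhds_zero_nat.const_mul 2
  rw [mul_zero] at h
  exact h.eventually_lt_const (norm_pos_iff.2 hx)

lemma outerCut_eq_one {n : ℕ} {x : Plane} (h : ‖x‖ < (n : ℝ) + 1) : outerCut n x = 1 := by
  rw [outerCut, chi_eq_zero (by positivity) h.le, sub_zero]

lemma pd_outerCut (n : ℕ) (j : Fin 2) (x : Plane) :
    pd j (outerCut n) x = - pd j (chi (n + 1)) x := by
  change fderiv ℝ (fun x => 1 - chi (n + 1) x) x (e j) = _
  rw [fderiv_const_sub]; simp

lemma pd_outerCut_eq_zero {n : ℕ} {x : Plane} (h : ‖x‖ < (n : ℝ) + 1) (j : Fin 2) :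
    pd j (outerCut n) x = 0 := by
  rw [pd_outerCut, pd_chi_eq_zero (by positivity) (Or.inl h), neg_zero]

lemma pd_annulusCut (n : ℕ) (j : Fin 2) (x : Plane) :
    pd j (annulusCut n) x = chi (1 / ((n : ℝ) + 1)) x * pd j (outerCut n) x
      + pd j (chi (1 / ((n : ℝ) + 1))) x * outerCut n x :=
  pd_mul ((chi_contDiff _).differentiable (by simp) x) ((isTest_outerCut n).differentiable x) j

lemma tendsto_outerCut (x : Plane) : Tendsto (fun n => outerCut n x) atTop (𝓝 1) :=
  tendsto_const_nhds.congr' (by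
    filter_upwards [eventually_outerCut x] with n hn using (outerCut_eq_one hn).symm)

lemma tendsto_pd_outerCut (j : Fin 2) (x : Plane) :
    Tendsto (fun n => pd j (outerCut n) x) atTop (𝓝 0) :=
  tendsto_const_nhds.congr' (by
    filter_upwards [eventually_outerCut x] with n hn using (pd_outerCut_eq_zero hn j).symm)

lemma tendsto_annulusCut {x : Plane} (hx : x ≠ 0) : Tendsto (fun n => annulusCut n x) atTop (𝓝 1) :=
  tendsto_const_nhds.congr' (by
    filter_upwards [eventually_outerCut x, eventually_annulusCut hx] with n hn hn'
    rw [annulusCut, outerCut_eq_one hn, chi_eq_one (by positivity) hn'.le, one_mul])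

lemma tendsto_pd_annulusCut {x : Plane} (hx : x ≠ 0) (j : Fin 2) :
    Tendsto (fun n => pd j (annulusCut n) x) atTop (𝓝 0) :=
  tendsto_const_nhds.congr' (by
    filter_upwards [eventually_outerCut x, eventually_annulusCut hx] with n hn hn'
    rw [pd_annulusCut, pd_outerCut_eq_zero hn, pd_chi_eq_zero (by positivity) (Or.inr hn')]
    simp)

/-- The two bounds serve two ways of removing a cut-off in `weak_identity_of_cut`: the outer cut-off
with weight `1` when `α = 0`, and the annular cut-off with weight `‖x‖` when `u / ‖x‖` is known to
be square integrable. -/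
lemma exists_pd_cut_le : ∃ C : ℝ, 0 < C ∧ ∀ n j x, ‖pd j (outerCut n) x‖ ≤ C ∧
    ‖x‖ * ‖pd j (annulusCut n) x‖ ≤ C := by
  obtain ⟨C, hC, h⟩ := exists_pd_chi_le
  refine ⟨2 * C, by linarith, fun n j x => ⟨?_, ?_⟩⟩
  · rw [pd_outerCut, norm_neg]
    refine (h (n + 1) (by positivity) j x).1.trans ?_
    rw [div_le_iff₀ (by positivity)]
    nlinarith [(Nat.cast_nonneg n : (0 : ℝ) ≤ n)]
  · have h1 := (h (n + 1) (by positivity) j x).2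
    have h2 := (h (1 / (n + 1)) (by positivity) j x).2
    rw [pd_annulusCut, pd_outerCut]
    calc _ ≤ ‖x‖ * (1 * ‖pd j (chi (n + 1)) x‖ + ‖pd j (chi (1 / ((n : ℝ) + 1))) x‖ * 1) := by
          gcongr
          refine (norm_add_le _ _).trans ?_
          rw [norm_mul, norm_mul, norm_neg]
          gcongr
          · exact norm_chi_le _ _
          · exact norm_outerCut_le _ _
      _ ≤ _ := by linarith

/-! ### A point is removable -/

/-- A divergence identity with square-integrable fields extends across the origin. -/
lemma test_extend {G : Fin 2 → Plane → ℂ} {F : Plane → ℂ} (hG : ∀ j, MemLp (G j) 2 volume)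
    (hF : LocallyIntegrable F)
    (h : ∀ φ, IsTest punctured φ → ∫ x, ∑ j, pd j φ x * G j x = ∫ x, φ x * F x) :
    ∀ φ, IsTest univ φ → ∫ x, ∑ j, pd j φ x * G j x = ∫ x, φ x * F x := by
  intro φ hφ
  obtain ⟨C, hC, hχ⟩ := exists_pd_chi_le
  obtain ⟨M, hM0, hM⟩ := hφ.exists_bound
  set ε : ℕ → ℝ := fun n => 1 / ((n : ℝ) + 1) with hε
  have hε0 : ∀ n, 0 < ε n := fun n => by positivity
  have hl : ∀ᵐ x : Plane, Tendsto (fun n => chi (ε n) x) atTop (𝓝 1) := by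
    filter_upwards [ae_mem_punctured] with x hx
    refine tendsto_const_nhds.congr' ?_
    filter_upwards [eventually_annulusCut hx] with n hn
    rw [chi_eq_one (hε0 n) hn.le]
  have hFi : Integrable (fun x => φ x * F x) := hφ.integrable_mul (hF.locallyIntegrableOn _)
  have hpG : ∀ j, Integrable (fun x => pd j φ x * G j x) := fun j =>
    (hφ.pd j).integrable_mul (locallyIntegrableOn_of_memLp (hG j) _)
  have hGi : Integrable (fun x => ∑ j, pd j φ x * G j x) := integrable_finsetSum _ fun j _ => hpG j
  have t1 := tendsto_integral_mul_of_bounded hFi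
    (fun n => (chi_contDiff (ε n)).continuous.aestronglyMeasurable) (fun n x => norm_chi_le _ x) hl
  have t2 := tendsto_integral_mul_of_bounded hGi
    (fun n => (chi_contDiff (ε n)).continuous.aestronglyMeasurable) (fun n x => norm_chi_le _ x) hl
  simp only [one_mul] at t1 t2
  have mpd : ∀ n j, MemLp (fun x => pd j (chi (ε n)) x) 2 volume := by
    intro n j
    have := ((isTest_one_sub_chi (hε0 n)).pd j).memLp 2
    have e1 : (pd j fun x => 1 - chi (ε n) x) = fun x => - pd j (chi (ε n)) x := by
      ext x; simp only [pd]; rw [fderiv_const_sub]; simp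
    rw [e1] at this
    simpa [Pi.neg_def] using this.neg
  have ipd : ∀ n j, Integrable (fun x => pd j (chi (ε n)) x * (φ x * G j x)) := by
    intro n j
    have h1 : MemLp (fun x => φ x * G j x) 2 volume :=
      memLp_bdd_mul (hG j) hφ.continuous.aestronglyMeasurable (ae_of_all _ hM)
    exact MemLp.integrable_mul_two (mpd n j) h1
  -- the error term
  have t3 : ∀ j, Tendsto (fun n => ∫ x, pd j (chi (ε n)) x * (φ x * G j x)) atTop (𝓝 0) := by
    intro j
    -- Here the dimension enters: the squared gradient is at most `C² / ε²` on a disc of area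
    -- proportional to `ε²`, so its integral stays bounded.
    have hball : ∀ n, ∫ x, ‖pd j (chi (ε n)) x‖ ^ 2 ≤
        C ^ 2 * 4 * (volume : Measure Plane).real (Metric.closedBall 0 1) := by
      intro n
      have h1 : ∀ x, ‖pd j (chi (ε n)) x‖ ^ 2 ≤
          (Metric.closedBall (0 : Plane) (2 * ε n)).indicator (fun _ => (C / ε n) ^ 2) x := by
        intro x
        by_cases hx : x ∈ Metric.closedBall (0 : Plane) (2 * ε n)
        · rw [indicator_of_mem hx]
          exact pow_le_pow_left₀ (norm_nonneg _) (hχ _ (hε0 n) j x).1 2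
        · rw [indicator_of_notMem hx, pd_chi_eq_zero (hε0 n) (Or.inr (by simpa using hx))]
          simp
      refine (integral_mono ((memLp_two_iff (mpd n j).1).1 (mpd n j)) ?_ h1).trans (le_of_eq ?_)
      · exact (integrable_indicator_iff measurableSet_closedBall).2
          (integrableOn_const (measure_closedBall_lt_top.ne))
      · rw [integral_indicator measurableSet_closedBall, setIntegral_const, smul_eq_mul,
          measureReal_def, measureReal_def, Measure.addHaar_closedBall' _ _ (by positivity)]
        simp only [finrank_euclideanSpace, Fintype.card_fin, ENNReal.toReal_mul]
        rw [ENNReal.toReal_ofReal (by positivity)]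
        have := (hε0 n).ne'
        field_simp
        ring
    set K := C ^ 2 * 4 * (volume : Measure Plane).real (Metric.closedBall 0 1)
    -- The gradients of the cut-offs are only bounded in `L²`, not small; smallness comes from the
    -- mass of `φ * G j` on the shrinking discs that carry them.
    have hsm : Tendsto (fun n => ∫ x, ‖(Metric.closedBall (0 : Plane) (2 * ε n)).indicator
        (fun x => φ x * G j x) x‖ ^ 2) atTop (𝓝 (∫ _ : Plane, (0 : ℝ))) := by
      have hm : MemLp (fun x => φ x * G j x) 2 volume :=
        memLp_bdd_mul (hG j) hφ.continuous.aestronglyMeasurable (ae_of_all _ hM)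
      refine tendsto_integral_of_dominated_convergence (fun x => ‖φ x * G j x‖ ^ 2)
        (fun n => ((hm.1.indicator measurableSet_closedBall).norm.pow 2))
        ((memLp_two_iff hm.1).1 hm) (fun n => ?_) ?_
      · filter_upwards with x
        rw [Real.norm_of_nonneg (by positivity)]
        exact pow_le_pow_left₀ (norm_nonneg _) (norm_indicator_le_norm_self _ _) 2
      · filter_upwards [ae_mem_punctured] with x hx
        refine tendsto_const_nhds.congr' ?_
        filter_upwards [eventually_annulusCut hx] with n hn
        rw [indicator_of_notMem (by simpa only [Metric.mem_closedBall, dist_zero_right, not_le] using hn)]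
        simp
    rw [integral_zero] at hsm
    have hsm' : Tendsto (fun n => √K * √(∫ x, ‖(Metric.closedBall (0 : Plane) (2 * ε n)).indicator
        (fun x => φ x * G j x) x‖ ^ 2)) atTop (𝓝 0) := by
      have := (Real.continuous_sqrt.tendsto 0).comp hsm
      rw [Real.sqrt_zero] at this
      simpa using this.const_mul (√K)
    refine squeeze_zero_norm (fun n => ?_) hsm'
    have e1 : ∫ x, pd j (chi (ε n)) x * (φ x * G j x) = ∫ x, pd j (chi (ε n)) x *
        (Metric.closedBall (0 : Plane) (2 * ε n)).indicator (fun x => φ x * G j x) x := by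
      congr 1
      ext x
      by_cases hx : x ∈ Metric.closedBall (0 : Plane) (2 * ε n)
      · rw [indicator_of_mem hx]
      · rw [pd_chi_eq_zero (hε0 n) (Or.inr (by simpa using hx))]; simp
    rw [e1]
    have hm : MemLp (fun x => φ x * G j x) 2 volume :=
      memLp_bdd_mul (hG j) hφ.continuous.aestronglyMeasurable (ae_of_all _ hM)
    refine (norm_integral_mul_le (mpd n j) (hm.indicator measurableSet_closedBall)).trans ?_
    gcongr
    exact hball n
  have t4 : Tendsto (fun n => ∫ x, chi (ε n) x * ∑ j, pd j φ x * G j x) atTop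
      (𝓝 (∫ x, φ x * F x)) := by
    have t5 : Tendsto (fun n => (∫ x, chi (ε n) x * (φ x * F x)) -
        ∑ j, ∫ x, pd j (chi (ε n)) x * (φ x * G j x)) atTop
        (𝓝 (∫ x, φ x * F x - ∑ j : Fin 2, 0)) := by
      rw [show (∫ x, φ x * F x - ∑ j : Fin 2, (0:ℂ)) = (∫ x, φ x * F x) - ∑ j : Fin 2, (0 : ℂ) by simp]
      exact t1.sub (tendsto_finsetSum _ fun j _ => t3 j)
    simp only [Finset.sum_const_zero, sub_zero] at t5
    refine t5.congr fun n => ?_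
    have hn := h _ (isTest_chi_mul hφ (hε0 n))
    have e2 : ∀ x, ∑ j, pd j (fun x => chi (ε n) x * φ x) x * G j x =
        chi (ε n) x * (∑ j, pd j φ x * G j x) + ∑ j, pd j (chi (ε n)) x * (φ x * G j x) := by
      intro x
      rw [Finset.mul_sum, ← Finset.sum_add_distrib]
      refine Finset.sum_congr rfl fun j _ => ?_
      rw [pd_mul ((chi_contDiff _).differentiable (by simp) x) (hφ.differentiable x)]
      ring
    simp only [e2] at hn
    rw [integral_add, integral_finsetSum _ fun j _ => ipd n j] at hn
    · have e3 : ∫ x, chi (ε n) x * φ x * F x = ∫ x, chi (ε n) x * (φ x * F x) := by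
        congr 1; ext x; ring
      rw [e3] at hn
      rw [← hn]; ring
    · exact hGi.bdd_mul (chi_contDiff _).continuous.aestronglyMeasurable
        (ae_of_all _ fun x => norm_chi_le _ x)
    · exact integrable_finsetSum _ fun j _ => ipd n j
  exact tendsto_nhds_unique t2 t4

/-- A square-integrable function with a locally integrable weak derivative off the origin is weakly
differentiable on the plane. -/
lemma HasWeakDeriv.extend {j : Fin 2} {u v : Plane → ℂ} (h : HasWeakDeriv punctured j u v)
    (hu : MemLp u 2 volume) (hv : LocallyIntegrable v) : HasWeakDeriv univ j u v := by
  refine hasWeakDeriv_iff.2 ⟨locallyIntegrableOn_of_memLp hu _, hv.locallyIntegrableOn _,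
    fun φ hφ => ?_⟩
  -- For the field whose only nonzero component is `u` in direction `j`, the divergence identity is
  -- the definition of the weak derivative.
  have key := test_extend (G := fun k => if k = j then u else 0) (F := fun x => - v x)
    (fun k => by
      by_cases hk : k = j
      · simpa [hk] using hu
      · simp [hk]) hv.neg (fun φ hφ => by
      have := h.test hφ
      simp only [mul_neg, integral_neg]
      rw [← this]
      congr 1
      ext x
      rw [Finset.sum_eq_single j] <;> simp +contextual) φ hφ
  simp only [mul_neg, integral_neg] at key
  rw [← key]
  congr 1
  ext x
  rw [Finset.sum_eq_single j] <;> simp +contextual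

/-! ### Mollification -/

lemma MemLp.conjugate {f : Plane → ℂ} (hf : MemLp f 2 volume) :
    MemLp (fun x => conj (f x)) 2 volume := hf.star

lemma inner_toLp {f g : Plane → ℂ} (hf : MemLp f 2 volume) (hg : MemLp g 2 volume) :
    inner ℂ (hf.toLp f) (hg.toLp g) = ∫ x, conj (f x) * g x := by
  rw [L2.inner_def]
  refine integral_congr_ae ?_
  filter_upwards [hf.coeFn_toLp, hg.coeFn_toLp] with x h1 h2
  rw [h1, h2, RCLike.inner_apply, mul_comm]

/-- Pairing a square-integrable function, moved by a continuous family of measure preserving maps,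
with a fixed one depends continuously on the parameter. -/
lemma continuous_integral_comp {Z : Type*} [TopologicalSpace Z] (g : C(Z × Plane, Plane))
    (hg : ∀ z, MeasurePreserving (fun x => g (z, x)) (volume : Measure Plane) volume)
    {w h : Plane → ℂ} (hw : MemLp w 2 volume) (hh : MemLp h 2 volume) :
    Continuous fun z => ∫ x, w (g (z, x)) * h x := by
  have hg' : ∀ z, MeasurePreserving (g.curry z) (volume : Measure Plane) volume := hg
  have hc : Continuous fun z => Lp.compMeasurePreserving (g.curry z) (hg' z) (hw.toLp w) :=
    Continuous.compMeasurePreservingLp continuous_const g.curry.continuous hg' (by norm_num)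
  have h1 : Continuous fun z => inner ℂ ((MemLp.conjugate hh).toLp _)
      (Lp.compMeasurePreserving (g.curry z) (hg' z) (hw.toLp w)) := continuous_const.inner hc
  refine h1.congr fun z => ?_
  rw [Lp.toLp_compMeasurePreserving, inner_toLp]
  congr 1
  ext x
  simp [mul_comm]

lemma measurePreserving_sub_right' (y : Plane) :
    MeasurePreserving (fun x : Plane => x - y) volume volume := measurePreserving_sub_right volume y

/-- The translate pairing `y ↦ ∫ w (x - y) h x`. -/
def translatePairing (w h : Plane → ℂ) (y : Plane) : ℂ := ∫ x, w (x - y) * h x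

lemma continuous_translatePairing {w h : Plane → ℂ} (hw : MemLp w 2 volume)
    (hh : MemLp h 2 volume) : Continuous (translatePairing w h) :=
  continuous_integral_comp ⟨fun p : Plane × Plane => p.2 - p.1, by fun_prop⟩
    measurePreserving_sub_right' hw hh

/-- Cauchy-Schwarz and translation invariance. The bound is uniform in `y`, which supplies the
majorant for Fubini's theorem in `integral_convolution_mul`. -/
lemma translatePairing_bound {w h : Plane → ℂ} (hw : MemLp w 2 volume) (hh : MemLp h 2 volume)
    (y : Plane) : ∫ x, ‖w (x - y) * h x‖ ≤ √(∫ x, ‖w x‖ ^ 2) * √(∫ x, ‖h x‖ ^ 2) := by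
  have hwy : MemLp (fun x => w (x - y)) 2 volume :=
    hw.comp_measurePreserving (measurePreserving_sub_right' y)
  have h1 := norm_integral_mul_le (f := fun x => (‖w (x - y)‖ : ℂ)) (g := fun x => (‖h x‖ : ℂ))
    hwy.norm.ofReal hh.norm.ofReal
  have e1 : ∫ x, (‖w (x - y)‖ : ℂ) * (‖h x‖ : ℂ) = ((∫ x, ‖w (x - y) * h x‖ : ℝ) : ℂ) := by
    rw [← integral_complex_ofReal]; congr 1; ext x; simp
  rw [e1, Complex.norm_real, Real.norm_of_nonneg (integral_nonneg fun x => norm_nonneg _)] at h1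
  refine h1.trans (le_of_eq ?_)
  simp only [Complex.norm_real, norm_norm]
  rw [integral_sub_right_eq_self (fun x => ‖w x‖ ^ 2) y]

/-- Convolution with an integrable kernel, paired with a square-integrable function. -/
lemma integral_convolution_mul {ρ : Plane → ℝ} (hρ : Integrable ρ) {w h : Plane → ℂ}
    (hw : MemLp w 2 volume) (hh : MemLp h 2 volume) :
    ∫ x, (∫ y, (ρ y : ℂ) * w (x - y)) * h x = ∫ y, (ρ y : ℂ) * translatePairing w h y := by
  have hm : AEStronglyMeasurable (fun p : Plane × Plane => (ρ p.2 : ℂ) * w (p.1 - p.2) * h p.1)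
      ((volume : Measure Plane).prod volume) := by
    refine AEStronglyMeasurable.mul ?_ hh.1.comp_fst
    have h1 := AEStronglyMeasurable.convolution_integrand (μ := (volume : Measure Plane))
      (ν := (volume : Measure Plane)) (ContinuousLinearMap.mul ℝ ℂ)
      (hρ.ofReal (𝕜 := ℂ)).aestronglyMeasurable hw.1
    exact h1
  have hi : Integrable (fun p : Plane × Plane => (ρ p.2 : ℂ) * w (p.1 - p.2) * h p.1)
      ((volume : Measure Plane).prod volume) := by
    rw [integrable_prod_iff' hm]
    have hwy : ∀ y, Integrable (fun x => w (x - y) * h x) := fun y =>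
      MemLp.integrable_mul_two (hw.comp_measurePreserving (measurePreserving_sub_right' y)) hh
    constructor
    · refine ae_of_all _ fun y => ?_
      simp only [mul_assoc]
      exact (hwy y).const_mul _
    · refine Integrable.mono' (hρ.norm.mul_const (√(∫ x, ‖w x‖ ^ 2) * √(∫ x, ‖h x‖ ^ 2))) ?_ ?_
      · exact hm.norm.prod_swap.integral_prod_right'
      · refine ae_of_all _ fun y => ?_
        rw [Real.norm_of_nonneg (integral_nonneg fun x => norm_nonneg _)]
        simp only [mul_assoc]
        simp only [norm_mul (ρ y : ℂ)]
        rw [integral_const_mul]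
        simp only [Complex.norm_real]
        exact mul_le_mul_of_nonneg_left (translatePairing_bound hw hh y) (norm_nonneg _)
  have h2 := integral_integral_swap (f := fun x y => (ρ y : ℂ) * w (x - y) * h x) hi
  calc _ = ∫ x, ∫ y, (ρ y : ℂ) * w (x - y) * h x := by
        congr 1; ext x; rw [← integral_mul_const]
    _ = _ := h2
    _ = _ := by
      congr 1; ext y
      rw [translatePairing, ← integral_const_mul]
      congr 1; ext x; ring

lemma translatePairing_pd {w v ψ : Plane → ℂ} {j : Fin 2} (h : HasWeakDeriv univ j w v)
    (hψ : IsTest univ ψ) (y : Plane) :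
    translatePairing w (pd j ψ) y = - translatePairing v ψ y := by
  have e1 : ∀ u η : Plane → ℂ, translatePairing u η y = ∫ x, η (x + y) * u x := fun u η => by
    rw [translatePairing, ← integral_add_right_eq_self _ y]
    congr 1; ext x; simp [mul_comm]
  have ht : IsTest univ (fun x => ψ (x + y)) := by
    refine ⟨hψ.1.comp (contDiff_id.add contDiff_const),
      hψ.2.1.comp_homeomorph (Homeomorph.addRight y), subset_univ _⟩
  rw [e1, e1, ← h.test ht]
  congr 1; ext x
  simp only [pd]
  rw [fderiv_comp_add_right]

/-- A compactly supported weakly differentiable function is a weak limit of test functions together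
with its gradient. -/
lemma exists_test_approx {Ω K : Set Plane} (hΩ : IsOpen Ω) (hK : IsCompact K) (hKΩ : K ⊆ Ω)
    {w : Plane → ℂ} {v : Fin 2 → Plane → ℂ} (hw : MemLp w 2 volume) (hv : ∀ j, MemLp (v j) 2 volume)
    (hd : ∀ j, HasWeakDeriv univ j w (v j)) (h0 : ∀ x ∉ K, w x = 0) :
    ∃ φ : ℕ → Plane → ℂ, (∀ n, IsTest Ω (φ n)) ∧ ∀ h, MemLp h 2 volume →
      Tendsto (fun n => ∫ x, φ n x * h x) atTop (𝓝 (∫ x, w x * h x)) ∧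
      ∀ j, Tendsto (fun n => ∫ x, pd j (φ n) x * h x) atTop (𝓝 (∫ x, v j x * h x)) := by
  -- Kernels of radius at most `δ` keep the supports of the mollified functions inside `Ω`.
  obtain ⟨δ, hδ, hδΩ⟩ := hK.exists_cthickening_subset_open hΩ hKΩ
  let ρ : ℕ → ContDiffBump (0 : Plane) := fun n =>
    ⟨δ / (n + 1) / 2, δ / (n + 1), by positivity, half_lt_self (by positivity)⟩
  have hρ0 : Tendsto (fun n => (ρ n).rOut) atTop (𝓝 0) := by
    have := (tendsto_one_div_add_atTop_nhds_zero_nat (𝕜 := ℝ)).const_mul δ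
    simpa [ρ, div_eq_mul_inv] using this
  have hρle : ∀ n, (ρ n).rOut ≤ δ := fun n => by
    simp only [ρ]
    exact div_le_self hδ.le (by linarith [(Nat.cast_nonneg n : (0 : ℝ) ≤ n)])
  let k : ℕ → Plane → ℝ := fun n => (ρ n).normed volume
  have hki : ∀ n, Integrable (k n) := fun n =>
    (ρ n).contDiff_normed (n := 0) |>.continuous.integrable_of_hasCompactSupport
      (ρ n).hasCompactSupport_normed
  let φ : ℕ → Plane → ℂ := fun n x => ∫ y, (k n y : ℂ) * w (x - y)
  have hφc : ∀ n, φ n = convolution (k n) w (ContinuousLinearMap.lsmul ℝ ℝ) volume := fun n => by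
    ext x; simp [φ, convolution]
  have hsupp : ∀ n, tsupport (φ n) ⊆ Metric.cthickening δ K := by
    intro n
    refine closure_minimal ?_ Metric.isClosed_cthickening
    intro x hx
    by_contra hxn
    refine hx ?_
    simp only [φ]
    refine integral_eq_zero_of_ae (ae_of_all _ fun y => ?_)
    by_cases hy : y ∈ Metric.ball (0 : Plane) (ρ n).rOut
    · have : x - y ∉ K := fun hxy => hxn (Metric.mem_cthickening_of_dist_le x (x - y) δ K hxy (by
        rw [dist_eq_norm]; simp only [sub_sub_cancel]
        exact (le_of_lt (by simpa using hy)).trans (hρle n)))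
      simp [h0 _ this]
    · have : k n y = 0 := by
        have hs := (ρ n).support_normed_eq (μ := (volume : Measure Plane))
        by_contra hne
        exact hy (hs ▸ hne)
      simp [this]
  have hφt : ∀ n, IsTest Ω (φ n) := fun n => by
    refine ⟨?_, ?_, (hsupp n).trans hδΩ⟩
    · rw [hφc]
      exact (ρ n).hasCompactSupport_normed.contDiff_convolution_left (n := (⊤ : ℕ∞)) _
        (ρ n).contDiff_normed (hw.locallyIntegrable (by norm_num))
    · exact hK.cthickening.of_isClosed_subset (isClosed_tsupport _) (hsupp n)
  -- Pairing a mollification with `h` amounts to averaging the continuous function `y ↦ ∫ u (x - y)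
  -- h x` near `y = 0`. Only weak convergence is needed later, so no strong approximation is proved.
  have lim : ∀ {u h : Plane → ℂ}, MemLp u 2 volume → MemLp h 2 volume →
      Tendsto (fun n => ∫ y, (k n y : ℂ) * translatePairing u h y) atTop (𝓝 (∫ x, u x * h x)) := by
    intro u h hu hh
    have hc : Continuous fun y => translatePairing u h (-y) :=
      (continuous_translatePairing hu hh).comp continuous_neg
    have := ContDiffBump.convolution_tendsto_right_of_continuous (μ := (volume : Measure Plane))
      hρ0 hc 0
    simp only [convolution, ContinuousLinearMap.lsmul_apply, zero_sub, neg_neg, neg_zero] at this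
    simpa [translatePairing, k] using this
  refine ⟨φ, hφt, fun h hh => ⟨?_, fun j => ?_⟩⟩
  · refine (lim hw hh).congr fun n => ?_
    rw [← integral_convolution_mul (hki n) hw hh]
  · refine (lim (hv j) hh).congr fun n => ?_
    rw [← integral_convolution_mul (hki n) (hv j) hh]
    -- the gradient of the mollified function
    set g : Plane → ℂ := fun x => ∫ y, (k n y : ℂ) * v j (x - y) with hg
    have hgc : g = convolution (k n) (v j) (ContinuousLinearMap.lsmul ℝ ℝ) volume := by
      ext x; simp [g, convolution]
    have hgcont : Continuous g := by
      rw [hgc]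
      exact ((ρ n).hasCompactSupport_normed.contDiff_convolution_left (n := 0) _
        (ρ n).contDiff_normed ((hv j).locallyIntegrable (by norm_num))).continuous
    -- The gradient of the mollification is the mollified gradient; this is checked by testing both
    -- against `ψ`, where the derivative moves onto the translates of `ψ`.
    have hae : g =ᵐ[volume] pd j (φ n) := by
      have hm : ∀ᵐ x : Plane, x ∈ univ → g x = pd j (φ n) x := by
        refine ae_eq_of_test isOpen_univ (hgcont.locallyIntegrable.locallyIntegrableOn _)
          (((hφt n).pd j).continuous.locallyIntegrable.locallyIntegrableOn _) fun ψ hψ => ?_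
        have h1 := integral_pd_mul_test hψ isOpen_univ (hφt n).contDiff.contDiffOn j
        have h2 := integral_convolution_mul (hki n) hw ((hψ.pd j).memLp 2)
        have h3 := integral_convolution_mul (hki n) (hv j) (hψ.memLp 2)
        simp only [translatePairing_pd (hd j) hψ, mul_neg, integral_neg] at h2
        rw [← h3] at h2
        have e1 : ∫ x, pd j ψ x * φ n x = ∫ x, (∫ y, (k n y : ℂ) * w (x - y)) * pd j ψ x := by
          congr 1; ext x; rw [mul_comm]
        have e2 : ∫ x, ψ x * g x = ∫ x, (∫ y, (k n y : ℂ) * v j (x - y)) * ψ x := by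
          congr 1; ext x; rw [mul_comm]
        rw [e2]
        rw [e1, h2] at h1
        exact neg_injective h1
      filter_upwards [hm] with x hx using hx (mem_univ _)
    exact integral_congr_ae (by filter_upwards [hae] with x hx; rw [← hx])

/-! ### Rotations -/

@[simp] lemma rot_apply_zero (θ : ℝ) (x : Plane) :
    rot θ x 0 = Real.cos θ * x 0 - Real.sin θ * x 1 := rfl

@[simp] lemma rot_apply_one (θ : ℝ) (x : Plane) :
    rot θ x 1 = Real.sin θ * x 0 + Real.cos θ * x 1 := rfl

lemma plane_ext {x y : Plane} (h0 : x 0 = y 0) (h1 : x 1 = y 1) : x = y := by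
  ext i; fin_cases i
  · exact h0
  · exact h1

lemma norm_sq_plane (x : Plane) : ‖x‖ ^ 2 = x 0 ^ 2 + x 1 ^ 2 := by
  rw [EuclideanSpace.norm_sq_eq]; simp [Fin.sum_univ_two]

lemma rot_rot (s t : ℝ) (x : Plane) : rot s (rot t x) = rot (s + t) x := by
  apply plane_ext
  · simp only [rot_apply_zero, rot_apply_one, Real.cos_add, Real.sin_add]; ring
  · simp only [rot_apply_zero, rot_apply_one, Real.cos_add, Real.sin_add]; ring

@[simp] lemma rot_zero (x : Plane) : rot 0 x = x := by apply plane_ext <;> simp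

lemma rot_pi (x : Plane) : rot Real.pi x = -x := by apply plane_ext <;> simp

lemma rot_add_two_pi (θ : ℝ) (x : Plane) : rot (θ + 2 * Real.pi) x = rot θ x := by
  apply plane_ext <;> simp

lemma norm_rot (θ : ℝ) (x : Plane) : ‖rot θ x‖ = ‖x‖ := by
  have : ‖rot θ x‖ ^ 2 = ‖x‖ ^ 2 := by
    rw [norm_sq_plane, norm_sq_plane, rot_apply_zero, rot_apply_one]
    linear_combination (x 0 ^ 2 + x 1 ^ 2) * Real.sin_sq_add_cos_sq θ
  exact (pow_left_inj₀ (norm_nonneg _) (norm_nonneg _) two_ne_zero).1 this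

lemma continuous_rot : Continuous fun p : ℝ × Plane => rot p.1 p.2 := by
  unfold rot
  refine (PiLp.continuous_toLp 2 _).comp (continuous_pi fun i => ?_)
  fin_cases i
  · simp; fun_prop
  · simp; fun_prop

/-- Rotation as a linear isometry. -/
def rotL (θ : ℝ) : Plane ≃ₗᵢ[ℝ] Plane where
  toFun := rot θ
  invFun := rot (-θ)
  left_inv x := by simp [rot_rot]
  right_inv x := by simp [rot_rot]
  map_add' x y := by apply plane_ext <;> simp <;> ring
  map_smul' c x := by apply plane_ext <;> simp <;> ring
  norm_map' x := norm_rot θ x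

lemma measurePreserving_rot (θ : ℝ) : MeasurePreserving (rot θ) (volume : Measure Plane) volume :=
  (rotL θ).measurePreserving

lemma integral_comp_rot (θ : ℝ) (f : Plane → ℂ) : ∫ x, f (rot θ x) = ∫ x, f x :=
  (measurePreserving_rot θ).integral_comp (rotL θ).toHomeomorph.measurableEmbedding f

/-- The arc-length measure on a full turn. -/
abbrev turn : Measure ℝ := volume.restrict (Ioc 0 (2 * Real.pi))

lemma two_pi_pos : (0 : ℝ) < 2 * Real.pi := by positivity

lemma turn_univ : turn univ = ENNReal.ofReal (2 * Real.pi) := by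
  simp [turn]

/-- The skew map `(θ, x) ↦ (θ, rot θ x)` preserves the product measure because each rotation
preserves area. Consequently almost-everywhere statements on the plane hold almost everywhere on
almost every circle. -/
lemma quasiMeasurePreserving_rot :
    Measure.QuasiMeasurePreserving (fun p : Plane × ℝ => rot p.2 p.1)
      ((volume : Measure Plane).prod turn) volume := by
  have h1 : MeasurePreserving (fun p : ℝ × Plane => (p.1, rot p.1 p.2))
      (turn.prod (volume : Measure Plane)) (turn.prod (volume : Measure Plane)) :=
    (MeasurePreserving.id turn).skew_product (g := fun θ x => rot θ x)
      continuous_rot.measurable (ae_of_all _ fun θ => (measurePreserving_rot θ).map_eq)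
  have h2 := (Measure.quasiMeasurePreserving_snd (μ := turn) (ν := (volume : Measure Plane))).comp
    h1.quasiMeasurePreserving
  have h3 := h2.comp (Measure.measurePreserving_swap
    (μ := (volume : Measure Plane)) (ν := turn)).quasiMeasurePreserving
  exact h3

lemma ae_rot {p : Plane → Prop} (h : ∀ᵐ x : Plane, p x) : ∀ᵐ x : Plane, ∀ᵐ θ ∂turn, p (rot θ x) :=
  Measure.ae_ae_of_ae_prod (quasiMeasurePreserving_rot.ae h)

lemma aestronglyMeasurable_rot {u : Plane → ℂ} (hu : AEStronglyMeasurable u volume) :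
    AEStronglyMeasurable (fun p : Plane × ℝ => u (rot p.2 p.1))
      ((volume : Measure Plane).prod turn) :=
  hu.comp_quasiMeasurePreserving quasiMeasurePreserving_rot

lemma lintegral_rot {f : Plane → ENNReal} (hf : AEMeasurable f) :
    ∫⁻ x : Plane, ∫⁻ θ, f (rot θ x) ∂turn = ENNReal.ofReal (2 * Real.pi) * ∫⁻ x, f x := by
  rw [lintegral_lintegral_swap (f := fun x θ => f (rot θ x))
    (hf.comp_quasiMeasurePreserving quasiMeasurePreserving_rot)]
  have : ∀ θ, ∫⁻ x, f (rot θ x) = ∫⁻ x, f x := fun θ =>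
    (measurePreserving_rot θ).lintegral_comp_emb (rotL θ).toHomeomorph.measurableEmbedding f
  simp only [this, lintegral_const, turn_univ]
  rw [mul_comm]

/-- By Tonelli the circle integrals of `‖u‖²` integrate over the plane to `2π` times the squared
norm of `u`, so almost all of them are finite. -/
lemma ae_memLp_rot {u : Plane → ℂ} (hu : MemLp u 2 volume) :
    ∀ᵐ x : Plane, MemLp (fun θ => u (rot θ x)) 2 turn := by
  have h1 : ∫⁻ x : Plane, ∫⁻ θ, ‖u (rot θ x)‖ₑ ^ 2 ∂turn < ⊤ := by
    rw [lintegral_rot (hu.1.enorm.pow_const 2)]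
    refine ENNReal.mul_lt_top ENNReal.ofReal_lt_top ?_
    have := hu.2
    rw [eLpNorm_lt_top_iff_lintegral_rpow_enorm_lt_top (by norm_num) (by norm_num)] at this
    simpa using this
  have h2 := ae_lt_top' (hu.1.enorm.pow_const 2 |>.comp_quasiMeasurePreserving
    quasiMeasurePreserving_rot).lintegral_prod_right' h1.ne
  filter_upwards [h2, (aestronglyMeasurable_rot hu.1).prodMk_left] with x hx hm
  refine ⟨hm, ?_⟩
  rw [eLpNorm_lt_top_iff_lintegral_rpow_enorm_lt_top (by norm_num) (by norm_num)]
  simpa using hx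

lemma ae_integrable_rot {u : Plane → ℂ} (hu : MemLp u 2 volume) :
    ∀ᵐ x : Plane, IntervalIntegrable (fun θ => u (rot θ x)) volume 0 (2 * Real.pi) := by
  filter_upwards [ae_memLp_rot hu] with x hx
  rw [intervalIntegrable_iff_integrableOn_Ioc_of_le two_pi_pos.le]
  have : IsFiniteMeasure turn := ⟨by rw [turn_univ]; exact ENNReal.ofReal_lt_top⟩
  exact hx.integrable (by norm_num)

/-! ### Angular momentum sectors -/

/-- The angular phase. -/
abbrev phase (n : ℤ) (θ : ℝ) : ℂ := Complex.exp (-(n * θ * Complex.I))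

lemma norm_phase (n : ℤ) (θ : ℝ) : ‖phase n θ‖ = 1 := by
  rw [phase, show -((n : ℂ) * θ * Complex.I) = ((-(n * θ) : ℝ) : ℂ) * Complex.I by push_cast; ring]
  exact Complex.norm_exp_ofReal_mul_I _

lemma continuous_phase (n : ℤ) : Continuous (phase n) := by unfold phase; fun_prop

lemma phase_add_two_pi (n : ℤ) (θ : ℝ) : phase n (θ + 2 * Real.pi) = phase n θ := by
  unfold phase
  rw [Complex.exp_eq_exp_iff_exists_int]
  exact ⟨-n, by push_cast; ring⟩

lemma phase_add (n : ℤ) (s t : ℝ) : phase n (s + t) = phase n s * phase n t := by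
  rw [phase, phase, phase, ← Complex.exp_add]; congr 1; push_cast; ring

lemma phase_add_left (m n : ℤ) (t : ℝ) : phase (m + n) t = phase m t * phase n t := by
  rw [phase, phase, phase, ← Complex.exp_add]; congr 1; push_cast; ring

lemma phase_neg_mul (n : ℤ) (t : ℝ) : phase (-n) t * phase n t = 1 := by
  rw [← phase_add_left]; simp [phase]

lemma conj_phase (n : ℤ) (t : ℝ) : conj (phase n t) = phase (-n) t := by
  rw [phase, phase, ← Complex.exp_conj]; congr 1; simp

lemma sector_def (n : ℤ) (u : Plane → ℂ) (x : Plane) :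
    sector n u x = ((2 * Real.pi)⁻¹ : ℂ) * ∫ θ in (0 : ℝ)..(2 * Real.pi), u (rot θ x) * phase n θ :=
  rfl

lemma integral_phase (n : ℤ) :
    ∫ θ in (0 : ℝ)..(2 * Real.pi), phase n θ = if n = 0 then (2 * Real.pi : ℂ) else 0 := by
  split_ifs with h
  · simp [phase, h]
  · have h0 : (-(n * Complex.I) : ℂ) ≠ 0 := by simp [h]
    have := integral_exp_mul_complex (a := 0) (b := 2 * Real.pi) h0
    have e1 : ∀ θ : ℝ, phase n θ = Complex.exp (-(n * Complex.I) * θ) := fun θ => by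
      rw [phase]; congr 1; ring
    simp only [e1, this]
    rw [div_eq_zero_iff]; left
    rw [sub_eq_zero, Complex.exp_eq_exp_iff_exists_int]
    exact ⟨-n, by push_cast; ring⟩

/-- The integrand is `2π`-periodic in the angle, so a shift by `τ` leaves only a phase. -/
lemma sector_rot (n : ℤ) (u : Plane → ℂ) (τ : ℝ) (x : Plane) :
    sector n u (rot τ x) = phase (-n) τ * sector n u x := by
  have hper : Function.Periodic (fun θ => u (rot θ x) * phase n θ) (2 * Real.pi) := fun θ => by
    simp only [rot_add_two_pi, phase_add_two_pi]
  have e1 : ∀ θ, u (rot θ (rot τ x)) * phase n θ =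
      phase (-n) τ * ((fun θ => u (rot θ x) * phase n θ) (θ + τ)) := fun θ => by
    simp only [rot_rot, phase_add]
    linear_combination (- u (rot (θ + τ) x) * phase n θ) * phase_neg_mul n τ
  rw [sector_def, sector_def]
  simp only [e1]
  rw [intervalIntegral.integral_const_mul,
    intervalIntegral.integral_comp_add_right (fun θ => u (rot θ x) * phase n θ), zero_add,
    add_comm (2 * Real.pi) τ, hper.intervalIntegral_add_eq τ 0, zero_add]
  ring

lemma sector_zero_rot (u : Plane → ℂ) (τ : ℝ) (x : Plane) : sector 0 u (rot τ x) = sector 0 u x := by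
  rw [sector_rot]; simp [phase]

/-- A factor of pure angular momentum `k` comes out of the angular average and shifts the index. The
cases needed are `k = 0` for radial multipliers and `k = ±1` for the combinations `A₀ ± i A₁` of the
vector potential. -/
lemma sector_equivariant_mul {k : ℤ} {w : Plane → ℂ}
    (hw : ∀ θ x, w (rot θ x) = phase (-k) θ * w x) (n : ℤ) (u : Plane → ℂ) (x : Plane) :
    sector (n + k) (fun y => w y * u y) x = w x * sector n u x := by
  rw [sector_def, sector_def]
  have : ∀ θ, w (rot θ x) * u (rot θ x) * phase (n + k) θ = w x * (u (rot θ x) * phase n θ) :=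
    fun θ => by
      rw [hw, phase_add_left]
      linear_combination w x * u (rot θ x) * phase n θ * phase_neg_mul k θ
  simp only [this]
  rw [intervalIntegral.integral_const_mul]; ring

lemma sector_radial_mul {w : Plane → ℂ} (hw : ∀ θ x, w (rot θ x) = w x) (n : ℤ) (u : Plane → ℂ)
    (x : Plane) : sector n (fun y => w y * u y) x = w x * sector n u x := by
  have := sector_equivariant_mul (k := 0) (w := w) (by simpa [phase] using hw) n u x
  simpa using this

lemma sector_sector (m n : ℤ) (u : Plane → ℂ) (x : Plane) :
    sector m (sector n u) x = if m = n then sector n u x else 0 := by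
  rw [sector_def]
  have : ∀ θ, sector n u (rot θ x) * phase m θ = sector n u x * phase (m - n) θ := fun θ => by
    rw [sector_rot, sub_eq_add_neg, phase_add_left]; ring
  simp only [this]
  rw [intervalIntegral.integral_const_mul, integral_phase]
  by_cases h : m = n
  · simp only [h, sub_self, if_true]
    have : (Real.pi : ℂ) ≠ 0 := by exact_mod_cast Real.pi_ne_zero
    field_simp
  · simp [h, sub_eq_zero]

lemma sector_congr_ae {u v : Plane → ℂ} (h : u =ᵐ[volume] v) (n : ℤ) :
    sector n u =ᵐ[volume] sector n v := by
  filter_upwards [ae_rot h] with x hx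
  rw [sector_def, sector_def, intervalIntegral.integral_of_le two_pi_pos.le,
    intervalIntegral.integral_of_le two_pi_pos.le]
  congr 1
  exact integral_congr_ae (by filter_upwards [hx] with θ hθ; rw [hθ])

lemma integrable_mul_phase {f : ℝ → ℂ} (hf : IntervalIntegrable f volume 0 (2 * Real.pi)) (n : ℤ) :
    IntervalIntegrable (fun θ => f θ * phase n θ) volume 0 (2 * Real.pi) :=
  hf.mul_continuousOn (continuous_phase n).continuousOn

lemma sector_add {u v : Plane → ℂ} (hu : MemLp u 2 volume) (hv : MemLp v 2 volume) (n : ℤ) :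
    sector n (fun x => u x + v x) =ᵐ[volume] fun x => sector n u x + sector n v x := by
  filter_upwards [ae_integrable_rot hu, ae_integrable_rot hv] with x h1 h2
  rw [sector_def, sector_def, sector_def, ← mul_add, ← intervalIntegral.integral_add
    (integrable_mul_phase h1 n) (integrable_mul_phase h2 n)]
  simp only [add_mul]

lemma sector_const_mul (c : ℂ) (u : Plane → ℂ) (n : ℤ) (x : Plane) :
    sector n (fun x => c * u x) x = c * sector n u x :=
  sector_radial_mul (w := fun _ => c) (fun _ _ => rfl) n u x

lemma sector_sub {u v : Plane → ℂ} (hu : MemLp u 2 volume) (hv : MemLp v 2 volume) (n : ℤ) :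
    sector n (fun x => u x - v x) =ᵐ[volume] fun x => sector n u x - sector n v x := by
  have h := sector_add hu (hv.const_mul (-1)) n
  have e1 : (fun x => u x - v x) = fun x => u x + -1 * v x := by ext x; ring
  rw [e1]
  filter_upwards [h] with x hx
  rw [hx, sector_const_mul]; ring

lemma aestronglyMeasurable_sector {u : Plane → ℂ} (hu : AEStronglyMeasurable u volume) (n : ℤ) :
    AEStronglyMeasurable (sector n u) volume := by
  have h1 : AEStronglyMeasurable (fun p : Plane × ℝ => u (rot p.2 p.1) * phase n p.2)
      ((volume : Measure Plane).prod turn) :=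
    (aestronglyMeasurable_rot hu).mul
      ((continuous_phase n).comp continuous_snd).aestronglyMeasurable
  have h2 := h1.integral_prod_right'.const_mul ((2 * Real.pi)⁻¹ : ℂ)
  refine h2.congr (ae_of_all _ fun x => ?_)
  rw [sector_def, intervalIntegral.integral_of_le two_pi_pos.le]

/-- **Parseval's identity** on almost every circle. -/
lemma hasSum_sector {u : Plane → ℂ} (hu : MemLp u 2 volume) :
    ∀ᵐ x : Plane, HasSum (fun n : ℤ => ‖sector n u x‖ ^ 2)
      ((2 * Real.pi)⁻¹ * ∫ θ, ‖u (rot θ x)‖ ^ 2 ∂turn) := by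
  filter_upwards [ae_memLp_rot hu] with x hx
  have h := hasSum_sq_fourierCoeffOn (f := fun θ => u (rot θ x)) two_pi_pos hx
  rw [intervalIntegral.integral_of_le two_pi_pos.le, smul_eq_mul, sub_zero] at h
  have key : ∀ n, fourierCoeffOn two_pi_pos (fun θ => u (rot θ x)) n = sector n u x := fun n => by
    rw [fourierCoeffOn_eq_integral, sector_def, sub_zero, one_div, Complex.real_smul]
    push_cast
    congr 1
    refine intervalIntegral.integral_congr fun θ _ => ?_
    simp only [fourier_coe_apply, smul_eq_mul]
    rw [mul_comm, phase]
    congr 2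
    have : (Real.pi : ℂ) ≠ 0 := by exact_mod_cast Real.pi_ne_zero
    push_cast
    field_simp
  simpa only [key] using h

instance : IsFiniteMeasure turn := ⟨by rw [turn_univ]; exact ENNReal.ofReal_lt_top⟩

lemma memLp_two_iff_lintegral {X : Type*} [MeasurableSpace X] {μ : Measure X} {f : X → ℂ} :
    MemLp f 2 μ ↔ AEStronglyMeasurable f μ ∧ ∫⁻ x, ‖f x‖ₑ ^ 2 ∂μ < ⊤ := by
  refine and_congr_right fun _ => ?_
  rw [eLpNorm_lt_top_iff_lintegral_rpow_enorm_lt_top (by norm_num) (by norm_num)]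
  simp

lemma ofReal_integral_sq {X : Type*} [MeasurableSpace X] {μ : Measure X} {f : X → ℂ}
    (hf : MemLp f 2 μ) :
    ENNReal.ofReal (∫ x, ‖f x‖ ^ 2 ∂μ) = ∫⁻ x, ‖f x‖ₑ ^ 2 ∂μ := by
  rw [ofReal_integral_eq_lintegral_ofReal ((memLp_two_iff_integrable_sq_norm hf.1).1 hf)
    (ae_of_all _ fun x => by positivity)]
  congr 1; ext x
  rw [ENNReal.ofReal_pow (norm_nonneg _), ofReal_norm]

/-! ### Radially weighted norms compared sector by sector -/

lemma measurable_weight {W : ℝ → ENNReal} (hW : Measurable W) :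
    Measurable fun x : Plane => W ‖x‖ := hW.comp measurable_norm

lemma lintegral_weight_rot {f : Plane → ENNReal} (hf : AEMeasurable f) {W : ℝ → ENNReal}
    (hW : Measurable W) :
    ∫⁻ x : Plane, W ‖x‖ * ∫⁻ θ, f (rot θ x) ∂turn
      = ENNReal.ofReal (2 * Real.pi) * ∫⁻ x, W ‖x‖ * f x := by
  have h0 := lintegral_rot (f := fun x => W ‖x‖ * f x) ((measurable_weight hW).aemeasurable.mul hf)
  rw [← h0]
  have hm : ∀ᵐ x : Plane, AEMeasurable (fun θ => f (rot θ x)) turn := by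
    have h1 : AEMeasurable (fun p : Plane × ℝ => f (rot p.2 p.1))
      ((volume : Measure Plane).prod turn) :=
      hf.comp_quasiMeasurePreserving quasiMeasurePreserving_rot
    obtain ⟨g, hg, hfg⟩ := h1
    filter_upwards [Measure.ae_ae_of_ae_prod hfg] with x hx
    exact ⟨fun θ => g (x, θ), hg.comp measurable_prodMk_left, hx⟩
  refine lintegral_congr_ae ?_
  filter_upwards [hm] with x hx
  rw [← lintegral_const_mul'' _ hx]
  simp only [norm_rot]

/-- On each circle the weight is constant and a single term of Parseval's sum is at most the whole
sum; integrate over the plane. -/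
lemma weighted_sector_le {u : Plane → ℂ} (hu : MemLp u 2 volume) (n : ℤ) {W : ℝ → ENNReal}
    (hW : Measurable W) :
    ∫⁻ x, W ‖x‖ * ‖sector n u x‖ₑ ^ 2 ≤ ∫⁻ x, W ‖x‖ * ‖u x‖ₑ ^ 2 := by
  have h2 : ENNReal.ofReal (2 * Real.pi) ≠ 0 := by simp [Real.pi_pos]
  have h3 := lintegral_weight_rot (hu.1.enorm.pow_const 2) hW
  rw [← ENNReal.mul_le_mul_iff_right h2 ENNReal.ofReal_ne_top, ← h3,
    ← lintegral_const_mul' _ _ ENNReal.ofReal_ne_top]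
  refine lintegral_mono_ae ?_
  filter_upwards [hasSum_sector hu, ae_memLp_rot hu] with x hx hm
  have h4 := le_hasSum hx n fun i _ => by positivity
  have h5 : 2 * Real.pi * ‖sector n u x‖ ^ 2 ≤ ∫ θ, ‖u (rot θ x)‖ ^ 2 ∂turn := by
    rwa [← div_eq_inv_mul, le_div_iff₀' two_pi_pos] at h4
  rw [← ofReal_integral_sq hm, mul_left_comm]
  refine mul_le_mul_right ?_ _
  refine le_trans (le_of_eq ?_) (ENNReal.ofReal_le_ofReal h5)
  rw [ENNReal.ofReal_mul two_pi_pos.le, ENNReal.ofReal_pow (norm_nonneg _), ofReal_norm]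

lemma memLp_sector {u : Plane → ℂ} (hu : MemLp u 2 volume) (n : ℤ) :
    MemLp (sector n u) 2 volume := by
  refine memLp_two_iff_lintegral.2 ⟨aestronglyMeasurable_sector hu.1 n, ?_⟩
  have := weighted_sector_le hu n (W := fun _ => 1) measurable_const
  simp only [one_mul] at this
  exact this.trans_lt (memLp_two_iff_lintegral.1 hu).2

/-- A comparison of all sectors gives a comparison of weighted norms. -/
lemma weighted_le_of_sector {p q : Plane → ℂ} (hp : MemLp p 2 volume) (hq : MemLp q 2 volume)
    {c : ℝ} (hc : 0 ≤ c)
    (h : ∀ n : ℤ, ∀ᵐ x : Plane, c * ‖sector n p x‖ ≤ ‖x‖ * ‖sector n q x‖)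
    {W : ℝ → ENNReal} (hW : Measurable W) :
    ENNReal.ofReal (c ^ 2) * ∫⁻ x, W ‖x‖ * ‖p x‖ₑ ^ 2 ≤
      ∫⁻ x : Plane, W ‖x‖ * ENNReal.ofReal (‖x‖ ^ 2) * ‖q x‖ₑ ^ 2 := by
  have h2 : ENNReal.ofReal (2 * Real.pi) ≠ 0 := by simp [Real.pi_pos]
  have h3 := lintegral_weight_rot (hp.1.enorm.pow_const 2) hW
  have hW' : Measurable fun r => W r * ENNReal.ofReal (r ^ 2) := by fun_prop
  have h4 := lintegral_weight_rot (hq.1.enorm.pow_const 2) hW'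
  rw [← ENNReal.mul_le_mul_iff_right h2 ENNReal.ofReal_ne_top, ← h4, mul_left_comm, ← h3,
    ← lintegral_const_mul' _ _ ENNReal.ofReal_ne_top]
  refine lintegral_mono_ae ?_
  filter_upwards [hasSum_sector hp, hasSum_sector hq, ae_memLp_rot hp, ae_memLp_rot hq,
    ae_all_iff.2 h] with x h5 h6 h7 h8 h9
  -- On a fixed circle `‖x‖` is a constant, so the sector inequalities can be squared and summed
  -- term by term by Parseval.
  have h10 := hasSum_le (fun n => ?_) (h5.mul_left (c ^ 2)) (h6.mul_left (‖x‖ ^ 2))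
  · have h11 : c ^ 2 * ∫ θ, ‖p (rot θ x)‖ ^ 2 ∂turn ≤ ‖x‖ ^ 2 * ∫ θ, ‖q (rot θ x)‖ ^ 2 ∂turn := by
      rw [mul_left_comm, mul_left_comm (‖x‖ ^ 2)] at h10
      exact le_of_mul_le_mul_left h10 (by positivity)
    rw [← ofReal_integral_sq h7, ← ofReal_integral_sq h8, mul_left_comm, mul_assoc,
      ← ENNReal.ofReal_mul (by positivity), ← ENNReal.ofReal_mul (by positivity)]
    exact mul_le_mul_right (ENNReal.ofReal_le_ofReal h11) _
  · rw [← mul_pow, ← mul_pow]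
    exact pow_le_pow_left₀ (by positivity) (h9 n) 2

/-- The rotation pairing. -/
def rotPairing (φ u : Plane → ℂ) (θ : ℝ) : ℂ := ∫ x, φ x * u (rot θ x)

lemma continuous_rotPairing {φ u : Plane → ℂ} (hφ : MemLp φ 2 volume) (hu : MemLp u 2 volume) :
    Continuous (rotPairing φ u) := by
  have := continuous_integral_comp ⟨fun p : ℝ × Plane => rot p.1 p.2, continuous_rot⟩
    measurePreserving_rot hu hφ
  refine this.congr fun θ => ?_
  simp [rotPairing, mul_comm]

lemma rotPairing_add_two_pi (φ u : Plane → ℂ) (θ : ℝ) :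
    rotPairing φ u (θ + 2 * Real.pi) = rotPairing φ u θ := by
  simp only [rotPairing, rot_add_two_pi]

lemma rotPairing_eq (φ u : Plane → ℂ) (θ : ℝ) :
    rotPairing φ u θ = ∫ x, φ (rot (-θ) x) * u x := by
  rw [rotPairing, ← integral_comp_rot θ (fun x => φ (rot (-θ) x) * u x)]
  simp [rot_rot]

/-- Fubini, with Cauchy-Schwarz giving a majorant uniform in the angle. The pairing with a sector
becomes a Fourier coefficient of a continuous periodic function of one variable, and this is how
weak identities are transferred to sectors. -/
lemma integral_mul_sector {φ u : Plane → ℂ} (hφ : MemLp φ 2 volume) (hu : MemLp u 2 volume) (n : ℤ) :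
    ∫ x, φ x * sector n u x =
      ((2 * Real.pi)⁻¹ : ℂ) * ∫ θ in (0 : ℝ)..(2 * Real.pi), rotPairing φ u θ * phase n θ := by
  have hm : AEStronglyMeasurable (fun p : Plane × ℝ => φ p.1 * (u (rot p.2 p.1) * phase n p.2))
      ((volume : Measure Plane).prod turn) :=
    hφ.1.comp_fst.mul ((aestronglyMeasurable_rot hu.1).mul
      ((continuous_phase n).comp continuous_snd).aestronglyMeasurable)
  have hur : ∀ θ, MemLp (fun x => u (rot θ x)) 2 volume := fun θ =>
    hu.comp_measurePreserving (measurePreserving_rot θ)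
  have hi : Integrable (fun p : Plane × ℝ => φ p.1 * (u (rot p.2 p.1) * phase n p.2))
      ((volume : Measure Plane).prod turn) := by
    rw [integrable_prod_iff' hm]
    constructor
    · refine ae_of_all _ fun θ => ?_
      have := (MemLp.integrable_mul_two hφ (hur θ)).mul_const (phase n θ)
      simpa only [mul_assoc] using this
    · refine Integrable.mono' (integrable_const (√(∫ x, ‖φ x‖ ^ 2) * √(∫ x, ‖u x‖ ^ 2))) ?_ ?_
      · exact hm.norm.prod_swap.integral_prod_right'
      · refine ae_of_all _ fun θ => ?_
        rw [Real.norm_of_nonneg (integral_nonneg fun x => norm_nonneg _)]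
        have h1 := norm_integral_mul_le (f := fun x => (‖φ x‖ : ℂ))
          (g := fun x => (‖u (rot θ x)‖ : ℂ)) hφ.norm.ofReal (hur θ).norm.ofReal
        have e1 : ∫ x, (‖φ x‖ : ℂ) * (‖u (rot θ x)‖ : ℂ) =
            ((∫ x, ‖φ x * (u (rot θ x) * phase n θ)‖ : ℝ) : ℂ) := by
          rw [← integral_complex_ofReal]; congr 1; ext x; simp [norm_phase]
        rw [e1, Complex.norm_real, Real.norm_of_nonneg (integral_nonneg fun x => norm_nonneg _)] at h1
        refine h1.trans (le_of_eq ?_)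
        simp only [Complex.norm_real, norm_norm]
        congr 2
        exact (measurePreserving_rot θ).integral_comp
          (rotL θ).toHomeomorph.measurableEmbedding fun x => ‖u x‖ ^ 2
  have h2 := integral_integral_swap (f := fun x θ => φ x * (u (rot θ x) * phase n θ)) hi
  have e2 : ∀ x, φ x * sector n u x =
      ((2 * Real.pi)⁻¹ : ℂ) * ∫ θ, φ x * (u (rot θ x) * phase n θ) ∂turn := fun x => by
    rw [sector_def, intervalIntegral.integral_of_le two_pi_pos.le, integral_const_mul]; ring
  simp only [e2]
  rw [integral_const_mul, h2, intervalIntegral.integral_of_le two_pi_pos.le]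
  congr 1
  refine integral_congr_ae (ae_of_all _ fun θ => ?_)
  simp only [rotPairing]
  rw [← integral_mul_const]
  congr 1; ext x; ring

/-- The sector projections are symmetric. -/
lemma integral_conj_mul_sector {a b : Plane → ℂ} (ha : MemLp a 2 volume) (hb : MemLp b 2 volume)
    (n : ℤ) : ∫ x, conj (a x) * sector n b x = ∫ x, conj (sector n a x) * b x := by
  have h1 := integral_mul_sector (MemLp.conjugate ha) hb n
  have h2 := integral_mul_sector (MemLp.conjugate hb) ha n
  have e1 : ∫ x, conj (sector n a x) * b x = conj (∫ x, conj (b x) * sector n a x) := by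
    rw [← integral_conj]; congr 1; ext x; simp [mul_comm]
  have hinv : conj ((2 * Real.pi : ℂ)⁻¹) = (2 * Real.pi : ℂ)⁻¹ := by
    rw [map_inv₀, map_mul, Complex.conj_ofReal, Complex.conj_ofNat]
  rw [e1, h1, h2, map_mul, hinv]
  congr 1
  rw [intervalIntegral.integral_of_le two_pi_pos.le (f := fun θ => rotPairing (fun x => conj (b x)) a θ
    * phase n θ), ← integral_conj, ← intervalIntegral.integral_of_le two_pi_pos.le]
  set F : ℝ → ℂ := fun θ => rotPairing (fun x => conj (a x)) b θ * phase n θ with hF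
  have hper : Function.Periodic F (2 * Real.pi) := fun θ => by
    simp only [hF, rotPairing_add_two_pi, phase_add_two_pi]
  -- The adjoint of a rotation is the inverse rotation, so exchanging the two functions reverses the
  -- angle; periodicity then makes the two integrals over a full turn agree.
  have e2 : ∀ θ, conj (rotPairing (fun x => conj (b x)) a θ * phase n θ) = F (-θ) := fun θ => by
    simp only [hF]
    rw [map_mul, conj_phase, rotPairing_eq (fun x => conj (a x)), neg_neg, rotPairing, ← integral_conj]
    congr 1
    · congr 1; ext x; simp [mul_comm]
    · rw [phase, phase]; congr 1; push_cast; ring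
  simp only [e2]
  rw [intervalIntegral.integral_comp_neg F, neg_zero]
  have := hper.intervalIntegral_add_eq (-(2 * Real.pi)) 0
  simpa using this.symm

/-- Even functions have no odd sectors. -/
lemma sector_odd_eq_zero {u : Plane → ℂ} (hu : ∀ᵐ x : Plane, u (-x) = u x) {n : ℤ} (hn : Odd n) :
    sector n u =ᵐ[volume] 0 := by
  have h1 := sector_congr_ae (u := fun x => u (-x)) (v := u) hu n
  filter_upwards [h1] with x hx
  have h2 := sector_rot n u Real.pi x
  have h3 : sector n (fun x => u (-x)) x = sector n u (rot Real.pi x) := by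
    rw [sector_def, sector_def]
    simp only [← rot_pi, rot_rot, add_comm]
  have h4 : phase (-n) Real.pi = -1 := by
    obtain ⟨k, rfl⟩ := hn
    rw [phase, ← Complex.exp_pi_mul_I, Complex.exp_eq_exp_iff_exists_int]
    exact ⟨k, by push_cast; ring⟩
  rw [← h3, hx, h4] at h2
  have h5 : (2 : ℂ) * sector n u x = 0 := by linear_combination h2
  simpa using h5

/-! ### The angular derivative -/

/-- The angular derivative of a smooth function. -/
def angD (φ : Plane → ℂ) (x : Plane) : ℂ := x 0 * pd 1 φ x - x 1 * pd 0 φ x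

lemma contDiff_coord (i : Fin 2) : ContDiff ℝ ∞ fun x : Plane => ((x i : ℝ) : ℂ) :=
  Complex.ofRealCLM.contDiff.comp (contDiff_piLp_apply (p := 2) (i := i))

lemma IsTest.angD {Ω : Set Plane} {φ : Plane → ℂ} (h : IsTest Ω φ) : IsTest Ω (angD φ) := by
  have h1 := (((h.pd 1).mul_contDiff (contDiff_coord 0))).add
    ((((h.pd 0).mul_contDiff (contDiff_coord 1))).const_mul (-1))
  convert h1 using 1
  ext x; simp [Anyon.angD]; ring

/-- The point rotated by a right angle. -/
def perp (x : Plane) : Plane := !₂[-(x 1), x 0]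

lemma fderiv_decomp (φ : Plane → ℂ) (x y : Plane) :
    fderiv ℝ φ x y = y 0 * pd 0 φ x + y 1 * pd 1 φ x := by
  have : y = y 0 • e 0 + y 1 • e 1 := by
    apply plane_ext <;> simp [e]
  conv_lhs => rw [this]
  rw [map_add, map_smul, map_smul]
  simp

lemma angD_eq (φ : Plane → ℂ) (x : Plane) : angD φ x = fderiv ℝ φ x (perp x) := by
  rw [fderiv_decomp]; simp [angD, perp]; ring

lemma hasDerivAt_rot (x : Plane) (s : ℝ) :
    HasDerivAt (fun s => rot s x) (perp (rot s x)) s := by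
  have h : HasDerivAt (fun s => (![Real.cos s * x 0 - Real.sin s * x 1,
      Real.sin s * x 0 + Real.cos s * x 1] : Fin 2 → ℝ))
      ![-(rot s x 1), rot s x 0] s := by
    rw [hasDerivAt_pi]
    intro i
    fin_cases i
    · simp only [Fin.zero_eta, Matrix.cons_val_zero, rot_apply_one]
      exact (((Real.hasDerivAt_cos s).mul_const (x 0)).sub
        ((Real.hasDerivAt_sin s).mul_const (x 1))).congr_deriv (by ring)
    · simp only [Fin.mk_one, Matrix.cons_val_one, Matrix.cons_val_fin_one, rot_apply_zero]
      exact (((Real.hasDerivAt_sin s).mul_const (x 0)).add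
        ((Real.hasDerivAt_cos s).mul_const (x 1))).congr_deriv (by ring)
  exact ((EuclideanSpace.equiv (Fin 2) ℝ).symm.toContinuousLinearMap.hasFDerivAt.comp_hasDerivAt s h)

lemma hasDerivAt_comp_rot {φ : Plane → ℂ} (hφ : Differentiable ℝ φ) (x : Plane) (s : ℝ) :
    HasDerivAt (fun s => φ (rot s x)) (angD φ (rot s x)) s := by
  rw [angD_eq]
  exact (hφ (rot s x)).hasFDerivAt.comp_hasDerivAt s (hasDerivAt_rot x s)

lemma IsTest.comp_rot {φ : Plane → ℂ} {Ω : Set Plane} (h : IsTest Ω φ)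
    (hΩ : ∀ θ x, rot θ x ∈ Ω → x ∈ Ω) (θ : ℝ) : IsTest Ω (fun x => φ (rot θ x)) :=
  h.comp_lin (rotL θ).toContinuousLinearEquiv fun x hx => hΩ θ x hx

lemma rot_mem_punctured (θ : ℝ) (x : Plane) (h : rot θ x ∈ punctured) : x ∈ punctured := by
  rw [mem_punctured] at *
  rintro rfl
  apply h
  rw [← norm_eq_zero, norm_rot, norm_zero]

/-- Both sides are the derivative at `s = 0` of `φ (rot (s + θ) x)`. -/
lemma angD_comp_rot {φ : Plane → ℂ} (hφ : Differentiable ℝ φ) (θ : ℝ) (x : Plane) :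
    angD (fun y => φ (rot θ y)) x = angD φ (rot θ x) := by
  have h1 := hasDerivAt_comp_rot (φ := fun y => φ (rot θ y))
    (hφ.comp (rotL θ).toContinuousLinearEquiv.differentiable) x 0
  have h2 := (hasDerivAt_comp_rot hφ (rot θ x) 0)
  simp only [rot_rot, add_comm θ, rot_zero, zero_add] at h1 h2
  exact h1.unique h2

/-- `g` is the weak angular derivative of `u` off the origin. -/
def HasAngDeriv (u g : Plane → ℂ) : Prop :=
  ∀ φ, IsTest punctured φ → ∫ x, angD φ x * u x = - ∫ x, φ x * g x

/-- The rotation is moved onto the smooth function `φ`, where differentiation under the integral is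
allowed; the weak hypothesis is then applied to the rotated test function. -/
lemma HasAngDeriv.hasDerivAt {u g : Plane → ℂ} (hu : MemLp u 2 volume)
    (h : HasAngDeriv u g) {φ : Plane → ℂ} (hφ : IsTest punctured φ) (θ : ℝ) :
    HasDerivAt (rotPairing φ u) (rotPairing φ g θ) θ := by
  -- derivative of `s ↦ ∫ φ (rot (-s) x) u x`
  obtain ⟨M, hM0, hM⟩ := hφ.angD.exists_bound
  obtain ⟨R, hR⟩ := hφ.compact.isCompact.isBounded.subset_closedBall (0 : Plane)
  -- Rotations preserve the norm, so one ball contains the supports of all rotated test functions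
  -- and yields a dominating function independent of `s`.
  have hbig : ∀ x : Plane, R < ‖x‖ → ∀ s, angD φ (rot s x) = 0 := by
    intro x hx s
    have : rot s x ∉ tsupport φ := fun hh => by
      have := hR hh
      rw [mem_closedBall_zero_iff, norm_rot] at this
      linarith
    have h0 : φ =ᶠ[𝓝 (rot s x)] 0 := notMem_tsupport_iff_eventuallyEq.1 this
    rw [angD_eq, h0.fderiv_eq]; simp
  have hint : IntegrableOn u (Metric.closedBall 0 R) :=
    (hu.locallyIntegrable (by norm_num)).integrableOn_isCompact (isCompact_closedBall _ _)
  have hφr : ∀ s, IsTest punctured (fun x => φ (rot (-s) x)) := fun s =>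
    hφ.comp_rot rot_mem_punctured (-s)
  have hlu := locallyIntegrableOn_of_memLp hu punctured
  have key := hasDerivAt_integral_of_dominated_loc_of_deriv_le (μ := (volume : Measure Plane))
    (F := fun s x => φ (rot (-s) x) * u x) (F' := fun s x => - angD φ (rot (-s) x) * u x) (x₀ := θ)
    (s := univ) (bound := (Metric.closedBall (0 : Plane) R).indicator fun x => M * ‖u x‖)
    univ_mem (Eventually.of_forall fun s => ((hφr s).integrable_mul hlu).aestronglyMeasurable)
    ((hφr θ).integrable_mul hlu)
    (((hφ.angD.continuous.comp (rotL (-θ)).continuous).neg.aestronglyMeasurable).mul hu.1)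
    (ae_of_all _ fun x s _ => ?_)
    ((integrable_indicator_iff measurableSet_closedBall).2 (hint.norm.const_mul M))
    (ae_of_all _ fun x s _ => ?_)
  · have h1 := key.2
    have e1 : (fun s => ∫ x, φ (rot (-s) x) * u x) = rotPairing φ u := by
      ext s; rw [rotPairing_eq]
    rw [e1] at h1
    refine h1.congr_deriv ?_
    rw [rotPairing_eq]
    have h2 := h _ (hφr θ)
    simp only [angD_comp_rot hφ.differentiable] at h2
    simp only [neg_mul, integral_neg]
    rw [h2, neg_neg]
  · by_cases hx : x ∈ Metric.closedBall (0 : Plane) R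
    · rw [indicator_of_mem hx, norm_mul, norm_neg]
      exact mul_le_mul_of_nonneg_right (hM _) (norm_nonneg _)
    · rw [indicator_of_notMem hx, hbig x (by simpa using hx)]; simp
  · have h1 := (hasDerivAt_comp_rot hφ.differentiable x (-s)).scomp s (hasDerivAt_neg s)
    have h2 := h1.mul_const (u x)
    simpa using h2

/-- Sectors diagonalize the angular derivative. -/
lemma HasAngDeriv.sector_eq {u g : Plane → ℂ} (hu : MemLp u 2 volume) (hg : MemLp g 2 volume)
    (h : HasAngDeriv u g) (n : ℤ) :
    sector n g =ᵐ[volume] fun x => n * Complex.I * sector n u x := by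
  refine ae_eq_of_test_punctured (locallyIntegrableOn_of_memLp (memLp_sector hg n) _)
    (locallyIntegrableOn_of_memLp ((memLp_sector hu n).const_mul _) _) fun φ hφ => ?_
  -- The derivative of a periodic function integrates to zero over a full turn; by
  -- `integral_mul_sector` this says exactly that the sectors of `g` and `u` differ by the factor `n
  -- i`.
  have hd : ∀ θ, HasDerivAt (fun θ => rotPairing φ u θ * phase n θ)
      (rotPairing φ g θ * phase n θ - n * Complex.I * (rotPairing φ u θ * phase n θ)) θ := by
    intro θ
    have h1 : HasDerivAt (phase n) (-(n * Complex.I) * phase n θ) θ := by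
      have : HasDerivAt (fun θ : ℝ => (-(n * θ * Complex.I) : ℂ)) (-(n * Complex.I)) θ := by
        have := ((hasDerivAt_id θ).ofReal_comp.const_mul (n : ℂ)).mul_const Complex.I |>.neg
        exact this.congr_deriv (by simp)
      have h2 := this.cexp
      rw [mul_comm] at h2
      exact h2
    exact ((h.hasDerivAt hu hφ θ).mul h1).congr_deriv (by ring)
  have c1 : Continuous fun θ => rotPairing φ g θ * phase n θ :=
    (continuous_rotPairing (hφ.memLp 2) hg).mul (continuous_phase n)
  have c2 : Continuous fun θ => n * Complex.I * (rotPairing φ u θ * phase n θ) :=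
    continuous_const.mul ((continuous_rotPairing (hφ.memLp 2) hu).mul (continuous_phase n))
  have h0 := intervalIntegral.integral_eq_sub_of_hasDerivAt (a := 0) (b := 2 * Real.pi)
    (fun θ _ => hd θ) ((c1.sub c2).intervalIntegrable _ _)
  have e0 : rotPairing φ u (2 * Real.pi) * phase n (2 * Real.pi) = rotPairing φ u 0 * phase n 0 := by
    have h1 := rotPairing_add_two_pi φ u 0
    have h2 := phase_add_two_pi n 0
    rw [zero_add] at h1 h2
    rw [h1, h2]
  rw [e0, sub_self, intervalIntegral.integral_sub (c1.intervalIntegrable _ _)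
    (c2.intervalIntegrable _ _), sub_eq_zero, intervalIntegral.integral_const_mul] at h0
  rw [integral_mul_sector (hφ.memLp 2) hg n, h0]
  have e3 : ∫ x, φ x * (n * Complex.I * sector n u x) =
      n * Complex.I * ∫ x, φ x * sector n u x := by
    rw [← integral_const_mul]; congr 1; ext x; ring
  rw [e3, integral_mul_sector (hφ.memLp 2) hu n]
  ring

/-! ### Weak derivatives of sectors -/

lemma phase_eq (n : ℤ) (θ : ℝ) : phase n θ = Real.cos (n * θ) - Real.sin (n * θ) * Complex.I := by
  rw [phase, show -((n : ℂ) * θ * Complex.I) = ((-(n * θ) : ℝ) : ℂ) * Complex.I by push_cast; ring,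
    Complex.exp_mul_I, ← Complex.ofReal_cos, ← Complex.ofReal_sin, Real.cos_neg, Real.sin_neg]
  push_cast; ring

lemma pd_comp_rot {φ : Plane → ℂ} (hφ : Differentiable ℝ φ) (θ : ℝ) (x : Plane) :
    pd 0 (fun y => φ (rot θ y)) x = Real.cos θ * pd 0 φ (rot θ x) + Real.sin θ * pd 1 φ (rot θ x) ∧
    pd 1 (fun y => φ (rot θ y)) x = -Real.sin θ * pd 0 φ (rot θ x)
      + Real.cos θ * pd 1 φ (rot θ x) := by
  have h : ∀ j, pd j (fun y => φ (rot θ y)) x = fderiv ℝ φ (rot θ x) (rot θ (e j)) := fun j => by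
    have h1 : HasFDerivAt (fun y => rot θ y)
        ((rotL θ).toContinuousLinearEquiv : Plane →L[ℝ] Plane) x :=
      (rotL θ).toContinuousLinearEquiv.hasFDerivAt
    have h2 := (hφ (rot θ x)).hasFDerivAt.comp x h1
    simp only [pd]
    have h3 : fderiv ℝ (fun y => φ (rot θ y)) x = _ := h2.fderiv
    rw [h3]; rfl
  constructor
  · rw [h, fderiv_decomp]; simp [e]
  · rw [h, fderiv_decomp]; simp [e]

/-- The combination `∂₀ + σ i ∂₁` raises the angular momentum by `σ = ±1`. -/
lemma integral_pd_sector {Ω : Set Plane} (hΩ : ∀ θ x, rot θ x ∈ Ω → x ∈ Ω) {u : Plane → ℂ}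
    {v : Fin 2 → Plane → ℂ} (hu : MemLp u 2 volume) (hv : ∀ j, MemLp (v j) 2 volume)
    (h : ∀ j, HasWeakDeriv Ω j u (v j)) (n : ℤ) {σ : ℤ} (hσ : σ = 1 ∨ σ = -1) {φ : Plane → ℂ}
    (hφ : IsTest Ω φ) :
    ∫ x, (pd 0 φ x + σ * Complex.I * pd 1 φ x) * sector n u x =
      - ∫ x, φ x * sector (n + σ) (fun y => v 0 y + σ * Complex.I * v 1 y) x := by
  have hvσ : MemLp (fun y => v 0 y + σ * Complex.I * v 1 y) 2 volume :=
    (hv 0).add ((hv 1).const_mul _)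
  have hpd : IsTest Ω fun x => pd 0 φ x + σ * Complex.I * pd 1 φ x :=
    (hφ.pd 0).add ((hφ.pd 1).const_mul _)
  rw [integral_mul_sector (hpd.memLp 2) hu, integral_mul_sector (hφ.memLp 2) hvσ, ← mul_neg,
    ← intervalIntegral.integral_neg]
  congr 1
  refine intervalIntegral.integral_congr fun θ _ => ?_
  have key : rotPairing (fun x => pd 0 φ x + σ * Complex.I * pd 1 φ x) u θ =
      - (phase σ θ * rotPairing φ (fun y => v 0 y + σ * Complex.I * v 1 y) θ) := by
    have ht := hφ.comp_rot hΩ (-θ)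
    have h0 := (h 0).test ht
    have h1 := (h 1).test ht
    -- The operator `∂₀ + σ i ∂₁` commutes with rotations up to the phase of index `σ`, and this
    -- phase is what shifts the sector index.
    have hpoint : ∀ x, pd 0 φ (rot (-θ) x) + σ * Complex.I * pd 1 φ (rot (-θ) x) =
        phase σ θ * (pd 0 (fun y => φ (rot (-θ) y)) x
          + σ * Complex.I * pd 1 (fun y => φ (rot (-θ) y)) x) := by
      intro x
      obtain ⟨p0, p1⟩ := pd_comp_rot hφ.differentiable (-θ) x
      rw [p0, p1, phase_eq]
      have hcs : (Real.cos θ : ℂ) ^ 2 + (Real.sin θ : ℂ) ^ 2 = 1 := by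
        norm_cast; rw [add_comm]; exact Real.sin_sq_add_cos_sq θ
      rcases hσ with rfl | rfl
      · simp only [Real.cos_neg, Real.sin_neg, Int.cast_one, one_mul]
        push_cast
        push_cast at hcs
        linear_combination (-(pd 0 φ (rot (-θ) x) + Complex.I * pd 1 φ (rot (-θ) x))) * hcs
          + (Complex.sin θ * (Complex.sin θ * pd 0 φ (rot (-θ) x)
            + Complex.cos θ * pd 1 φ (rot (-θ) x))) * Complex.I_sq
      · simp only [Real.cos_neg, Real.sin_neg, Int.cast_neg, Int.cast_one, neg_mul, one_mul]
        push_cast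
        push_cast at hcs
        linear_combination (-(pd 0 φ (rot (-θ) x) - Complex.I * pd 1 φ (rot (-θ) x))) * hcs
          + (Complex.sin θ * (Complex.sin θ * pd 0 φ (rot (-θ) x)
            + Complex.cos θ * pd 1 φ (rot (-θ) x))) * Complex.I_sq
    rw [rotPairing_eq, rotPairing_eq]
    simp only [hpoint]
    have i0 := (ht.pd 0).integrable_mul (h 0).1
    have i1 := (ht.pd 1).integrable_mul (h 0).1
    have j0 := ht.integrable_mul (h 0).2.1
    have j1 := ht.integrable_mul (h 1).2.1
    have e1 : ∫ x, phase σ θ * (pd 0 (fun y => φ (rot (-θ) y)) x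
          + σ * Complex.I * pd 1 (fun y => φ (rot (-θ) y)) x) * u x =
        phase σ θ * ((∫ x, pd 0 (fun y => φ (rot (-θ) y)) x * u x) +
          σ * Complex.I * ∫ x, pd 1 (fun y => φ (rot (-θ) y)) x * u x) := by
      rw [← integral_const_mul, ← integral_add i0 (i1.const_mul _), ← integral_const_mul]
      congr 1; ext x; ring
    have e2 : ∫ x, φ (rot (-θ) x) * (v 0 x + σ * Complex.I * v 1 x) =
        (∫ x, φ (rot (-θ) x) * v 0 x) + σ * Complex.I * ∫ x, φ (rot (-θ) x) * v 1 x := by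
      rw [← integral_const_mul, ← integral_add j0 (j1.const_mul _)]
      congr 1; ext x; ring
    rw [e1, e2, h0, h1]; ring
  simp only [key, phase_add_left]; ring

/-- The gradient of a sector. -/
def sectorGrad (n : ℤ) (v : Fin 2 → Plane → ℂ) (j : Fin 2) (x : Plane) : ℂ :=
  ![(1 / 2) * (sector (n + 1) (fun y => v 0 y + Complex.I * v 1 y) x
      + sector (n - 1) (fun y => v 0 y - Complex.I * v 1 y) x),
    (-Complex.I / 2) * (sector (n + 1) (fun y => v 0 y + Complex.I * v 1 y) x
      - sector (n - 1) (fun y => v 0 y - Complex.I * v 1 y) x)] j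

lemma memLp_sectorGrad {v : Fin 2 → Plane → ℂ} (hv : ∀ j, MemLp (v j) 2 volume) (n : ℤ)
    (j : Fin 2) : MemLp (sectorGrad n v j) 2 volume := by
  have hp : MemLp (fun y => v 0 y + Complex.I * v 1 y) 2 volume := (hv 0).add ((hv 1).const_mul _)
  have hm : MemLp (fun y => v 0 y - Complex.I * v 1 y) 2 volume := (hv 0).sub ((hv 1).const_mul _)
  fin_cases j
  · exact ((memLp_sector hp _).add (memLp_sector hm _)).const_mul _
  · exact ((memLp_sector hp _).sub (memLp_sector hm _)).const_mul _

/-- The two partial derivatives are recovered by linear combination from `integral_pd_sector` with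
`σ = 1` and `σ = -1`. -/
lemma HasWeakDeriv.sector_deriv {Ω : Set Plane} (hΩ : ∀ θ x, rot θ x ∈ Ω → x ∈ Ω) {u : Plane → ℂ}
    {v : Fin 2 → Plane → ℂ} (hu : MemLp u 2 volume) (hv : ∀ j, MemLp (v j) 2 volume)
    (h : ∀ j, HasWeakDeriv Ω j u (v j)) (n : ℤ) (j : Fin 2) :
    HasWeakDeriv Ω j (sector n u) (sectorGrad n v j) := by
  refine hasWeakDeriv_iff.2 ⟨locallyIntegrableOn_of_memLp (memLp_sector hu n) _,
    locallyIntegrableOn_of_memLp (memLp_sectorGrad hv n j) _, fun φ hφ => ?_⟩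
  have h1 := integral_pd_sector hΩ hu hv h n (σ := 1) (Or.inl rfl) hφ
  have h2 := integral_pd_sector hΩ hu hv h n (σ := -1) (Or.inr rfl) hφ
  simp only [Int.cast_one, one_mul, Int.cast_neg, neg_mul, ← sub_eq_add_neg] at h1 h2
  have hs := locallyIntegrableOn_of_memLp (memLp_sector hu n) Ω
  have hp : MemLp (fun y => v 0 y + Complex.I * v 1 y) 2 volume := (hv 0).add ((hv 1).const_mul _)
  have hm : MemLp (fun y => v 0 y - Complex.I * v 1 y) 2 volume := (hv 0).sub ((hv 1).const_mul _)
  have i0 := (hφ.pd 0).integrable_mul hs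
  have i1 := (hφ.pd 1).integrable_mul hs
  have k1 := hφ.integrable_mul (locallyIntegrableOn_of_memLp (memLp_sector hp (n + 1)) Ω)
  have k2 := hφ.integrable_mul (locallyIntegrableOn_of_memLp (memLp_sector hm (n - 1)) Ω)
  have e1 : ∫ x, (pd 0 φ x + Complex.I * pd 1 φ x) * sector n u x =
      (∫ x, pd 0 φ x * sector n u x) + Complex.I * ∫ x, pd 1 φ x * sector n u x := by
    rw [← integral_const_mul, ← integral_add i0 (i1.const_mul _)]; congr 1; ext x; ring
  have e2 : ∫ x, (pd 0 φ x - Complex.I * pd 1 φ x) * sector n u x =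
      (∫ x, pd 0 φ x * sector n u x) - Complex.I * ∫ x, pd 1 φ x * sector n u x := by
    rw [← integral_const_mul, ← integral_sub i0 (i1.const_mul _)]; congr 1; ext x; ring
  rw [e1] at h1
  rw [e2] at h2
  fin_cases j
  · have e3 : ∫ x, φ x * sectorGrad n v 0 x = (1 / 2) *
        ((∫ x, φ x * sector (n + 1) (fun y => v 0 y + Complex.I * v 1 y) x) +
          ∫ x, φ x * sector (n - 1) (fun y => v 0 y - Complex.I * v 1 y) x) := by
      rw [← integral_add k1 k2, ← integral_const_mul]; congr 1; ext x; simp [sectorGrad]; ring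
    simp only [Fin.zero_eta]
    rw [e3]
    linear_combination (1 / 2) * h1 + (1 / 2) * h2
  · have e3 : ∫ x, φ x * sectorGrad n v 1 x = (-Complex.I / 2) *
        ((∫ x, φ x * sector (n + 1) (fun y => v 0 y + Complex.I * v 1 y) x) -
          ∫ x, φ x * sector (n - 1) (fun y => v 0 y - Complex.I * v 1 y) x) := by
      rw [← integral_sub k1 k2, ← integral_const_mul]; congr 1; ext x; simp [sectorGrad]; ring
    simp only [Fin.mk_one]
    rw [e3]
    linear_combination (-Complex.I / 2) * h1 + (Complex.I / 2) * h2 +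
      (∫ x, pd 1 φ x * sector n u x) * Complex.I_sq

/-! ### Sobolev spaces -/

lemma MemH.memLp {k : ℕ} {Ω : Set Plane} {u : Plane → ℂ} (h : MemH k Ω u) :
    MemLp u 2 (volume.restrict Ω) := by
  cases k with
  | zero => exact h
  | succ k => exact h.1

lemma MemH.add {k : ℕ} {Ω : Set Plane} {u u' : Plane → ℂ} (h : MemH k Ω u) (h' : MemH k Ω u') :
    MemH k Ω (fun x => u x + u' x) := by
  induction k generalizing u u' with
  | zero => exact MemLp.add h h'
  | succ k ih =>
    refine ⟨MemLp.add h.1 h'.1, fun j => ?_⟩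
    obtain ⟨v, hv, hv2⟩ := h.2 j
    obtain ⟨v', hv', hv2'⟩ := h'.2 j
    exact ⟨_, hv.add hv', ih hv2 hv2'⟩

lemma MemH.const_mul {k : ℕ} {Ω : Set Plane} {u : Plane → ℂ} (h : MemH k Ω u) (c : ℂ) :
    MemH k Ω (fun x => c * u x) := by
  induction k generalizing u with
  | zero => exact MemLp.const_mul h c
  | succ k ih =>
    refine ⟨MemLp.const_mul h.1 c, fun j => ?_⟩
    obtain ⟨v, hv, hv2⟩ := h.2 j
    exact ⟨_, hv.const_mul c, ih hv2⟩

lemma MemH.mono {k : ℕ} {Ω Ω' : Set Plane} {u : Plane → ℂ} (h : MemH k Ω u) (hs : Ω' ⊆ Ω) :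
    MemH k Ω' u := by
  induction k generalizing u with
  | zero => exact MemLp.mono_measure (Measure.restrict_mono hs le_rfl) h
  | succ k ih =>
    refine ⟨MemLp.mono_measure (Measure.restrict_mono hs le_rfl) h.1, fun j => ?_⟩
    obtain ⟨v, hv, hv2⟩ := h.2 j
    exact ⟨v, hv.mono hs, ih hv2⟩

lemma MemH.congr {k : ℕ} {Ω : Set Plane} (hΩ : IsOpen Ω) {u u' : Plane → ℂ} (h : MemH k Ω u)
    (hu : u =ᵐ[volume.restrict Ω] u') : MemH k Ω u' := by
  cases k with
  | zero => exact MemLp.ae_eq hu h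
  | succ k =>
    refine ⟨MemLp.ae_eq hu h.1, fun j => ?_⟩
    obtain ⟨v, hv, hv2⟩ := h.2 j
    exact ⟨v, hv.congr hΩ hu ae_eq_rfl, hv2⟩

/-- The gradient of a sector is built from the sectors of index `n ± 1` of combinations of the first
derivatives, so the induction on `k` has to carry all `n` at once. -/
lemma MemH.sector {k : ℕ} {u : Plane → ℂ} (h : MemH k univ u) (n : ℤ) :
    MemH k univ (sector n u) := by
  induction k generalizing u n with
  | zero =>
    have h' : MemLp u 2 (volume.restrict univ) := h
    rw [Measure.restrict_univ] at h'
    have := memLp_sector h' n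
    change MemLp _ 2 (volume.restrict univ)
    rwa [Measure.restrict_univ]
  | succ k ih =>
    have h' : MemLp u 2 (volume.restrict univ) := h.1
    rw [Measure.restrict_univ] at h'
    refine ⟨by rw [Measure.restrict_univ]; exact memLp_sector h' n, fun j => ?_⟩
    choose v hv hv2 using h.2
    have hvL : ∀ j, MemLp (v j) 2 volume := fun j => by
      have := (hv2 j).memLp
      rwa [Measure.restrict_univ] at this
    refine ⟨sectorGrad n v j, HasWeakDeriv.sector_deriv (fun _ _ _ => mem_univ _) h' hvL hv n j, ?_⟩
    have hp : MemH k univ fun y => v 0 y + Complex.I * v 1 y := (hv2 0).add ((hv2 1).const_mul _)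
    have hm : MemH k univ fun y => v 0 y - Complex.I * v 1 y := by
      have := (hv2 0).add ((hv2 1).const_mul (-Complex.I))
      simpa [sub_eq_add_neg] using this
    fin_cases j
    · exact ((ih hp (n + 1)).add (ih hm (n - 1))).const_mul _
    · have := ((ih hp (n + 1)).add ((ih hm (n - 1)).const_mul (-1))).const_mul (-Complex.I / 2)
      convert this using 1
      ext x
      simp [sectorGrad]; ring

/-! ### Functions of finite energy and the angular Hardy inequality -/

/-- The component of the covariant derivative built from a weak derivative. -/
def covD (α : ℝ) (j : Fin 2) (u v : Plane → ℂ) (x : Plane) : ℂ :=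
  -Complex.I * v x + potential α j x * u x

lemma contDiffOn_inv_norm_sq : ContDiffOn ℝ ∞ (fun x : Plane => (‖x‖ ^ 2)⁻¹) punctured :=
  ((contDiff_norm_sq ℝ).contDiffOn).inv fun x hx => by
    have := mem_punctured.1 hx
    simpa using this

lemma contDiffOn_potential (α : ℝ) (j : Fin 2) : ContDiffOn ℝ ∞ (potential α j) punctured := by
  refine Complex.ofRealCLM.contDiff.comp_contDiffOn ?_
  refine ContDiffOn.mul ?_ contDiffOn_inv_norm_sq
  refine (contDiff_const.mul ?_).contDiffOn
  fin_cases j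
  · exact (contDiff_piLp_apply (p := 2) (i := (1 : Fin 2))).neg
  · exact contDiff_piLp_apply (p := 2) (i := (0 : Fin 2))

lemma conj_potential (α : ℝ) (j : Fin 2) (x : Plane) : conj (potential α j x) = potential α j x :=
  Complex.conj_ofReal _

lemma abs_coord_le (x : Plane) (i : Fin 2) : |x i| ≤ ‖x‖ := by
  have h := norm_sq_plane x
  refine abs_le_of_sq_le_sq ?_ (norm_nonneg _)
  fin_cases i
  · simp only [Fin.zero_eta]; nlinarith [sq_nonneg (x 1)]
  · simp only [Fin.mk_one]; nlinarith [sq_nonneg (x 0)]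

lemma norm_potential_le (α : ℝ) (j : Fin 2) (x : Plane) : ‖potential α j x‖ ≤ |α| * ‖x‖⁻¹ := by
  unfold potential
  rw [Complex.norm_real, Real.norm_eq_abs, abs_div, abs_mul, abs_of_nonneg (sq_nonneg ‖x‖)]
  have h : |(![-(x 1), x 0] j)| ≤ ‖x‖ := by
    fin_cases j
    · simpa using abs_coord_le x 1
    · simpa using abs_coord_le x 0
  by_cases hx : x = 0
  · simp [hx]
  · have : 0 < ‖x‖ := norm_pos_iff.2 hx
    rw [div_le_iff₀ (by positivity)]
    calc |α| * |(![-(x 1), x 0] j)| ≤ |α| * ‖x‖ := by gcongr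
      _ = _ := by field_simp

lemma aestronglyMeasurable_of_contDiffOn {χ : Plane → ℂ} (h : ContDiffOn ℝ ∞ χ punctured) :
    AEStronglyMeasurable χ volume := by
  have := h.continuousOn.aestronglyMeasurable (μ := volume) isOpen_punctured.measurableSet
  rwa [restrict_punctured] at this

/-- `u` is even, square integrable, with weak gradient `v` off the origin and finite energy. -/
structure InV (α : ℝ) (u : Plane → ℂ) (v : Fin 2 → Plane → ℂ) : Prop where
  memLp : MemLp u 2 volume
  even : ∀ᵐ x : Plane, u (-x) = u x
  deriv : ∀ j, HasWeakDeriv punctured j u (v j)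
  memLp_cov : ∀ j, MemLp (covD α j u (v j)) 2 volume

/-- The tangential component of the covariant derivative. -/
def tangD (α : ℝ) (u : Plane → ℂ) (v : Fin 2 → Plane → ℂ) (x : Plane) : ℂ :=
  ((-(x 1) * ‖x‖⁻¹ : ℝ) : ℂ) * covD α 0 u (v 0) x + ((x 0 * ‖x‖⁻¹ : ℝ) : ℂ) * covD α 1 u (v 1) x

lemma measurable_coord (i : Fin 2) : Measurable fun x : Plane => x i :=
  (contDiff_piLp_apply (𝕜 := ℝ) (n := 0) (p := 2) (i := i)).continuous.measurable

lemma abs_coord_mul_inv_le (x : Plane) (i : Fin 2) : |x i * ‖x‖⁻¹| ≤ 1 := by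
  by_cases hx : x = 0
  · simp [hx]
  · have : 0 < ‖x‖ := norm_pos_iff.2 hx
    rw [abs_mul, abs_of_nonneg (inv_nonneg.2 this.le), ← div_eq_mul_inv, div_le_one this]
    exact abs_coord_le x i

lemma memLp_unit_mul {f : Plane → ℂ} (hf : MemLp f 2 volume) (i : Fin 2) :
    MemLp (fun x => ((x i * ‖x‖⁻¹ : ℝ) : ℂ) * f x) 2 volume := by
  refine memLp_bdd_mul (C := 1) hf ?_ (ae_of_all _ fun x => ?_)
  · exact (Complex.measurable_ofReal.comp
      ((measurable_coord i).mul measurable_norm.inv)).aestronglyMeasurable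
  · rw [Complex.norm_real]; exact abs_coord_mul_inv_le x i

lemma InV.memLp_tangD {α : ℝ} {u : Plane → ℂ} {v : Fin 2 → Plane → ℂ} (h : InV α u v) :
    MemLp (tangD α u v) 2 volume := by
  have := (memLp_unit_mul (h.memLp_cov 1) 0).sub (memLp_unit_mul (h.memLp_cov 0) 1)
  convert this using 1
  ext x
  simp [tangD]; ring

/-- The vector potential is purely tangential, of length `α / ‖x‖`, so after multiplication by `‖x‖`
it contributes the constant `α` next to `-i∂_θ`. -/
lemma norm_mul_tangD (α : ℝ) (u : Plane → ℂ) (v : Fin 2 → Plane → ℂ) {x : Plane} (hx : x ≠ 0) :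
    (‖x‖ : ℂ) * tangD α u v x = -Complex.I * (x 0 * v 1 x - x 1 * v 0 x) + α * u x := by
  have h0 : (‖x‖ : ℂ) ≠ 0 := by exact_mod_cast (norm_pos_iff.2 hx).ne'
  have h1 : (‖x‖ : ℂ) ^ 2 = (x 0 : ℂ) ^ 2 + (x 1 : ℂ) ^ 2 := by exact_mod_cast norm_sq_plane x
  simp only [tangD, covD, potential, Matrix.cons_val_zero, Matrix.cons_val_one,
    Matrix.cons_val_fin_one]
  push_cast
  field_simp
  rw [h1]
  ring

/-- In `x₀ ∂₁ - x₁ ∂₀` neither coefficient depends on the variable being differentiated, so it may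
be moved onto the test function. -/
lemma hasAngDeriv_of_hasWeakDeriv {u : Plane → ℂ} {v : Fin 2 → Plane → ℂ}
    (h : ∀ j, HasWeakDeriv punctured j u (v j)) :
    HasAngDeriv u (fun x => x 0 * v 1 x - x 1 * v 0 x) := by
  intro φ hφ
  have t0 := hφ.mul_contDiff (contDiff_coord 0)
  have t1 := hφ.mul_contDiff (contDiff_coord 1)
  have h1 := (h 1).test t0
  have h0 := (h 0).test t1
  have p1 : ∀ x, pd 1 (fun y => ((y 0 : ℝ) : ℂ) * φ y) x = x 0 * pd 1 φ x := fun x => by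
    rw [pd_mul ((contDiff_coord 0).differentiable (by simp) x) (hφ.differentiable x)]
    have : pd 1 (fun y : Plane => ((y 0 : ℝ) : ℂ)) x = 0 := by
      have hc : HasFDerivAt (fun y : Plane => ((y 0 : ℝ) : ℂ))
        (Complex.ofRealCLM.comp (EuclideanSpace.proj (0 : Fin 2))) x :=
        (Complex.ofRealCLM.comp (EuclideanSpace.proj (0 : Fin 2))).hasFDerivAt
      simp only [pd]
      rw [hc.fderiv]; simp [e]
    rw [this]; ring
  have p0 : ∀ x, pd 0 (fun y => ((y 1 : ℝ) : ℂ) * φ y) x = x 1 * pd 0 φ x := fun x => by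
    rw [pd_mul ((contDiff_coord 1).differentiable (by simp) x) (hφ.differentiable x)]
    have : pd 0 (fun y : Plane => ((y 1 : ℝ) : ℂ)) x = 0 := by
      have hc : HasFDerivAt (fun y : Plane => ((y 1 : ℝ) : ℂ))
        (Complex.ofRealCLM.comp (EuclideanSpace.proj (1 : Fin 2))) x :=
        (Complex.ofRealCLM.comp (EuclideanSpace.proj (1 : Fin 2))).hasFDerivAt
      simp only [pd]
      rw [hc.fderiv]; simp [e]
    rw [this]; ring
  have i1 := (t0.pd 1).integrable_mul (h 1).1
  have i0 := (t1.pd 0).integrable_mul (h 0).1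
  have j1 := t0.integrable_mul (h 1).2.1
  have j0 := t1.integrable_mul (h 0).2.1
  simp only [p1] at h1 i1
  simp only [p0] at h0 i0
  have e1 : ∫ x, angD φ x * u x = (∫ x, x 0 * pd 1 φ x * u x) - ∫ x, x 1 * pd 0 φ x * u x := by
    rw [← integral_sub i1 i0]; congr 1; ext x; simp [angD]; ring
  have e2 : ∫ x, φ x * (x 0 * v 1 x - x 1 * v 0 x) =
      (∫ x, x 0 * φ x * v 1 x) - ∫ x, x 1 * φ x * v 0 x := by
    rw [← integral_sub j1 j0]; congr 1; ext x; ring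
  rw [e1, e2, h1, h0]; ring

lemma chi_rot (ε : ℝ) (θ : ℝ) (x : Plane) : chi ε (rot θ x) = chi ε x := by
  simp only [chi, norm_rot]

lemma outerCut_rot (n : ℕ) (θ : ℝ) (x : Plane) : outerCut n (rot θ x) = outerCut n x := by
  simp only [outerCut, chi_rot]

lemma angD_radial {w : Plane → ℂ} {x : Plane} (hw : DifferentiableAt ℝ w x)
    (hr : ∀ θ, w (rot θ x) = w x) : angD w x = 0 := by
  have h1 : HasDerivAt (fun s => rot s x) (perp x) 0 := by
    simpa using hasDerivAt_rot x 0
  have h2 : HasFDerivAt w (fderiv ℝ w x) (rot 0 x) := by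
    rw [rot_zero]; exact hw.hasFDerivAt
  have h := h2.comp_hasDerivAt 0 h1
  rw [← angD_eq] at h
  simp only [Function.comp_def, hr] at h
  exact h.unique (hasDerivAt_const _ _)

lemma angD_mul {a b : Plane → ℂ} {x : Plane} (ha : DifferentiableAt ℝ a x)
    (hb : DifferentiableAt ℝ b x) :
    angD (fun y => a y * b y) x = a x * angD b x + angD a x * b x := by
  simp only [angD]
  rw [pd_mul ha hb, pd_mul ha hb]; ring

lemma HasAngDeriv.radial_mul {u g : Plane → ℂ} (h : HasAngDeriv u g) {w : Plane → ℂ}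
    (hw : ContDiffOn ℝ ∞ w punctured) (hr : ∀ θ x, w (rot θ x) = w x) :
    HasAngDeriv (fun x => w x * u x) (fun x => w x * g x) := by
  intro φ hφ
  have h1 := h _ (hφ.mul_contDiffOn isOpen_punctured hw)
  have e1 : ∫ x, angD (fun y => w y * φ y) x * u x = ∫ x, angD φ x * (w x * u x) := by
    refine integral_congr_ae ?_
    filter_upwards [ae_mem_punctured] with x hx
    have hwx : DifferentiableAt ℝ w x :=
      (hw.contDiffAt (isOpen_punctured.mem_nhds hx)).differentiableAt (by simp)
    rw [angD_mul hwx (hφ.differentiable x), angD_radial hwx fun θ => hr θ x]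
    ring
  rw [← e1, h1]
  congr 2; ext x; ring

/-- Each sector is an eigenfunction of the tangential covariant derivative. -/
lemma InV.sector_tangD {α : ℝ} {u : Plane → ℂ} {v : Fin 2 → Plane → ℂ} (h : InV α u v) (n : ℤ) :
    ∀ᵐ x : Plane, (‖x‖ : ℂ) * sector n (tangD α u v) x = (n + α) * sector n u x := by
  have hang := hasAngDeriv_of_hasWeakDeriv h.deriv
  -- `‖x‖ * tangD` need not be square integrable at infinity, while sectors are only diagonalised
  -- for square-integrable functions; a radial cut-off commutes with all sectors and is removed at
  -- the end.
  have key : ∀ N : ℕ, ∀ᵐ x : Plane,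
      outerCut N x * ((‖x‖ : ℂ) * sector n (tangD α u v) x) =
        outerCut N x * ((n + α) * sector n u x) := by
    intro N
    set κ := outerCut N with hκ
    have hκm : AEStronglyMeasurable κ volume := (isTest_outerCut N).continuous.aestronglyMeasurable
    have h1 : MemLp (fun x => κ x * u x) 2 volume :=
      memLp_bdd_mul h.memLp hκm (ae_of_all _ (norm_outerCut_le N))
    have h2 : MemLp (fun x => (κ x * ‖x‖) * tangD α u v x) 2 volume := by
      refine memLp_bdd_mul (C := 2 * (N + 1)) h.memLp_tangD
        (hκm.mul (Complex.measurable_ofReal.comp measurable_norm).aestronglyMeasurable)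
        (ae_of_all _ fun x => ?_)
      rw [norm_mul, Complex.norm_real, norm_norm]
      by_cases hx : 2 * ((N : ℝ) + 1) ≤ ‖x‖
      · rw [hκ, outerCut, chi_eq_one (by positivity) hx]; simp; positivity
      · calc ‖κ x‖ * ‖x‖ ≤ 1 * (2 * (N + 1)) := by
              gcongr
              · exact norm_outerCut_le N x
              · exact (not_le.1 hx).le
          _ = _ := by ring
    have h3 : MemLp (fun x => Complex.I * ((κ x * ‖x‖) * tangD α u v x) -
        Complex.I * α * (κ x * u x)) 2 volume := (h2.const_mul _).sub (h1.const_mul _)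
    have hae : (fun x => κ x * (x 0 * v 1 x - x 1 * v 0 x)) =ᵐ[volume]
        fun x => Complex.I * ((κ x * ‖x‖) * tangD α u v x) - Complex.I * α * (κ x * u x) := by
      filter_upwards [ae_mem_punctured] with x hx
      have := norm_mul_tangD α u v (mem_punctured.1 hx)
      rw [mul_assoc (κ x), this]
      linear_combination (κ x * (x 0 * v 1 x - x 1 * v 0 x)) * Complex.I_sq
    have hw := hang.radial_mul (isTest_outerCut N).contDiff.contDiffOn (outerCut_rot N)
    have hw' : HasAngDeriv (fun x => κ x * u x) (fun x => Complex.I * ((κ x * ‖x‖) * tangD α u v x) -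
        Complex.I * α * (κ x * u x)) := fun φ hφ => by
      rw [hw φ hφ]
      congr 1
      exact integral_congr_ae (by filter_upwards [hae] with x hx; rw [← hx])
    have h4 := hw'.sector_eq h1 h3 n
    have h5 := sector_sub (h2.const_mul Complex.I) (h1.const_mul (Complex.I * α)) n
    filter_upwards [h4, h5] with x h6 h7
    rw [h7, sector_const_mul, sector_const_mul, sector_radial_mul (w := κ) (outerCut_rot N),
      sector_radial_mul (w := fun x => κ x * ‖x‖)
        (fun θ x => by rw [hκ, outerCut_rot, norm_rot])] at h6
    linear_combination (-Complex.I) * h6 + (κ x * (‖x‖ * sector n (tangD α u v) x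
      - (n + α) * sector n u x)) * Complex.I_sq
  filter_upwards [ae_all_iff.2 key] with x hx
  obtain ⟨N, hN⟩ := (eventually_outerCut x).exists
  have := hx N
  rwa [outerCut_eq_one hN, one_mul, one_mul] at this

/-- The competitors are `n = 0`, giving `α`, and `n = -2`, giving `2 - α`, which is at least `α`
since `α ≤ 1`. Parity is essential: `n = -1` would give `1 - α`. -/
lemma le_abs_even_add {α : ℝ} (h0 : 0 ≤ α) (h1 : α ≤ 1) {n : ℤ} (hn : Even n) :
    α ≤ |(n : ℝ) + α| := by
  obtain ⟨k, rfl⟩ := hn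
  rcases lt_trichotomy k 0 with hk | rfl | hk
  · have : (k : ℝ) ≤ -1 := by exact_mod_cast Int.le_sub_one_of_lt hk
    rw [abs_of_neg (by push_cast; linarith)]; push_cast; linarith
  · simp [abs_of_nonneg h0]
  · have : (1 : ℝ) ≤ k := by exact_mod_cast hk
    rw [abs_of_nonneg (by push_cast; linarith)]; push_cast; linarith

/-- The extremal case is `n = -2`. This constant governs everything outside the s-wave. -/
lemma le_abs_even_add' {α : ℝ} (h0 : 0 ≤ α) {n : ℤ} (hn : Even n) (hn0 : n ≠ 0) :
    2 - α ≤ |(n : ℝ) + α| := by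
  obtain ⟨k, rfl⟩ := hn
  rcases lt_trichotomy k 0 with hk | rfl | hk
  · have : (k : ℝ) ≤ -1 := by exact_mod_cast Int.le_sub_one_of_lt hk
    rw [← abs_neg]
    refine le_trans ?_ (le_abs_self _)
    push_cast; linarith
  · simp at hn0
  · have : (1 : ℝ) ≤ k := by exact_mod_cast hk
    rw [abs_of_nonneg (by push_cast; linarith)]; push_cast; linarith

/-! ### Angular Hardy inequalities and their consequences for the gradient -/

section

variable {α : ℝ} {u : Plane → ℂ} {v : Fin 2 → Plane → ℂ}

/-- A spectral bound is required only for even `n`, because the odd sectors of an even function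
vanish. -/
lemma InV.norm_sector_le (h : InV α u v) (n : ℤ) {c : ℝ}
    (hc : Even n → c ≤ |(n : ℝ) + α|) :
    ∀ᵐ x : Plane, c * ‖sector n u x‖ ≤ ‖x‖ * ‖sector n (tangD α u v) x‖ := by
  rcases Int.even_or_odd n with hn | hn
  · filter_upwards [h.sector_tangD n] with x hx
    have := congrArg norm hx
    rw [norm_mul, norm_mul, Complex.norm_real, norm_norm] at this
    rw [this, show ((n : ℂ) + (α : ℂ)) = ((n + α : ℝ) : ℂ) by push_cast; ring, Complex.norm_real,
      Real.norm_eq_abs]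
    exact mul_le_mul_of_nonneg_right (hc hn) (norm_nonneg _)
  · filter_upwards [sector_odd_eq_zero h.even hn] with x hx
    rw [hx]; simp; positivity

/-- Weighted angular Hardy inequality for even functions. -/
lemma InV.hardy_weight (h : InV α u v) (h0 : 0 ≤ α) (h1 : α ≤ 1) {W : ℝ → ENNReal}
    (hW : Measurable W) :
    ENNReal.ofReal (α ^ 2) * ∫⁻ x, W ‖x‖ * ‖u x‖ₑ ^ 2 ≤
      ∫⁻ x : Plane, W ‖x‖ * ENNReal.ofReal (‖x‖ ^ 2) * ‖tangD α u v x‖ₑ ^ 2 :=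
  weighted_le_of_sector h.memLp h.memLp_tangD h0
    (fun n => h.norm_sector_le n fun hn => le_abs_even_add h0 h1 hn) hW

lemma memLp_sub_sector (h : MemLp u 2 volume) : MemLp (fun x => u x - sector 0 u x) 2 volume :=
  h.sub (memLp_sector h 0)

lemma sector_sub_sector_zero (h : MemLp u 2 volume) (n : ℤ) :
    sector n (fun x => u x - sector 0 u x) =ᵐ[volume]
      fun x => if n = 0 then 0 else sector n u x := by
  filter_upwards [sector_sub h (memLp_sector h 0) n] with x hx
  rw [hx, sector_sector]
  by_cases hn : n = 0 <;> simp [hn]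

/-- Weighted angular Hardy inequality off the `s`-wave. -/
lemma InV.hardy_weight_perp (h : InV α u v) (h0 : 0 ≤ α) (h1 : α ≤ 1) {W : ℝ → ENNReal}
    (hW : Measurable W) :
    ENNReal.ofReal ((2 - α) ^ 2) * ∫⁻ x, W ‖x‖ * ‖u x - sector 0 u x‖ₑ ^ 2 ≤
      ∫⁻ x : Plane, W ‖x‖ * ENNReal.ofReal (‖x‖ ^ 2) * ‖tangD α u v x‖ₑ ^ 2 := by
  refine weighted_le_of_sector (memLp_sub_sector h.memLp) h.memLp_tangD (by linarith)
    (fun n => ?_) hW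
  by_cases hn : n = 0
  · filter_upwards [sector_sub_sector_zero h.memLp n] with x hx
    rw [hx]; simp [hn]; positivity
  · filter_upwards [sector_sub_sector_zero h.memLp n, h.norm_sector_le n (c := 2 - α)
      fun hn' => le_abs_even_add' h0 hn' hn] with x hx hx'
    rw [hx]; simpa [hn] using hx'

/-- Not stated as an equality, because at the origin the inverse is `0` by convention. -/
lemma lintegral_inv_weight_le {f : Plane → ℂ} :
    ∫⁻ x : Plane, ENNReal.ofReal ((‖x‖ ^ 2)⁻¹) * ENNReal.ofReal (‖x‖ ^ 2) * ‖f x‖ₑ ^ 2 ≤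
      ∫⁻ x, ‖f x‖ₑ ^ 2 := by
  refine lintegral_mono fun x => ?_
  rw [← ENNReal.ofReal_mul (by positivity)]
  refine (mul_le_mul_left (ENNReal.ofReal_le_one.2 ?_) _).trans (le_of_eq (one_mul _))
  exact inv_mul_le_one

lemma memLp_inv_norm_mul {f : Plane → ℂ} (hf : AEStronglyMeasurable f volume)
    (h : ∫⁻ x : Plane, ENNReal.ofReal ((‖x‖ ^ 2)⁻¹) * ‖f x‖ₑ ^ 2 < ⊤) :
    MemLp (fun x => ((‖x‖⁻¹ : ℝ) : ℂ) * f x) 2 volume := by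
  refine memLp_two_iff_lintegral.2 ⟨?_, ?_⟩
  · exact (Complex.measurable_ofReal.comp measurable_norm.inv).aestronglyMeasurable.mul hf
  · refine lt_of_eq_of_lt (lintegral_congr fun x => ?_) h
    rw [enorm_mul, mul_pow]
    congr 1
    rw [← ofReal_norm, ← ENNReal.ofReal_pow (norm_nonneg _), Complex.norm_real,
      Real.norm_of_nonneg (by positivity), inv_pow]

/-- Hardy's inequality with weight `r^(-2)`; positivity of `α` makes the constant `α²` nonzero, so
finiteness can be divided out. -/
lemma InV.memLp_inv (h : InV α u v) (h0 : 0 < α) (h1 : α ≤ 1) :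
    MemLp (fun x => ((‖x‖⁻¹ : ℝ) : ℂ) * u x) 2 volume := by
  refine memLp_inv_norm_mul h.memLp.1 ?_
  have h2 := h.hardy_weight h0.le h1 (W := fun r => ENNReal.ofReal ((r ^ 2)⁻¹)) (by fun_prop)
  have h3 := (h2.trans lintegral_inv_weight_le).trans_lt
    (memLp_two_iff_lintegral.1 h.memLp_tangD).2
  exact (ENNReal.mul_lt_top_iff.1 h3).elim (fun h => h.2) fun h => h.elim
    (fun h => absurd h (by simp [h0.ne'])) fun h => by rw [h]; exact ENNReal.zero_lt_top

/-- Without the s-wave the constant is `(2 - α)²`, which does not degenerate at `α = 0`. -/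
lemma InV.memLp_inv_perp (h : InV α u v) (h0 : 0 ≤ α) (h1 : α ≤ 1) :
    MemLp (fun x => ((‖x‖⁻¹ : ℝ) : ℂ) * (u x - sector 0 u x)) 2 volume := by
  refine memLp_inv_norm_mul (memLp_sub_sector h.memLp).1 ?_
  have h2 := h.hardy_weight_perp h0 h1 (W := fun r => ENNReal.ofReal ((r ^ 2)⁻¹)) (by fun_prop)
  have h3 := (h2.trans lintegral_inv_weight_le).trans_lt
    (memLp_two_iff_lintegral.1 h.memLp_tangD).2
  have h4 : (2 - α) ≠ 0 := by linarith
  exact (ENNReal.mul_lt_top_iff.1 h3).elim (fun h => h.2) fun h => h.elim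
    (fun h => absurd h (by simp [h4])) fun h => by rw [h]; exact ENNReal.zero_lt_top

lemma memLp_potential_mul {f : Plane → ℂ} (j : Fin 2) (hf : AEStronglyMeasurable f volume)
    (h : MemLp (fun x => ((‖x‖⁻¹ : ℝ) : ℂ) * f x) 2 volume) :
    MemLp (fun x => potential α j x * f x) 2 volume := by
  refine MemLp.of_le_mul (c := |α|) h ((aestronglyMeasurable_of_contDiffOn
    (contDiffOn_potential α j)).mul hf) (ae_of_all _ fun x => ?_)
  rw [norm_mul, norm_mul, Complex.norm_real, Real.norm_of_nonneg (by positivity), ← mul_assoc]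
  exact mul_le_mul_of_nonneg_right (norm_potential_le α j x) (norm_nonneg _)

lemma potential_zero (j : Fin 2) (x : Plane) : potential 0 j x = 0 := by simp [potential]

lemma InV.memLp_potential_mul (h : InV α u v) (h0 : 0 ≤ α) (h1 : α ≤ 1) (j : Fin 2) :
    MemLp (fun x => potential α j x * u x) 2 volume := by
  rcases h0.eq_or_lt with rfl | h0
  · simp [potential_zero]
  · exact Anyon.memLp_potential_mul j h.memLp.1 (h.memLp_inv h0 h1)

/-- The gradient is `i (D_α u - A u)`, and `A u` is controlled by the Hardy inequality, or vanishes
if `α = 0`. -/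
lemma InV.memLp_grad (h : InV α u v) (h0 : 0 ≤ α) (h1 : α ≤ 1) (j : Fin 2) :
    MemLp (v j) 2 volume := by
  have := ((h.memLp_cov j).sub (h.memLp_potential_mul h0 h1 j)).const_mul Complex.I
  convert this using 1
  ext x
  simp only [covD, Pi.sub_apply]
  linear_combination (v j x) * Complex.I_sq

lemma InV.hasWeakDeriv_univ (h : InV α u v) (h0 : 0 ≤ α) (h1 : α ≤ 1) (j : Fin 2) :
    HasWeakDeriv univ j u (v j) :=
  (h.deriv j).extend h.memLp ((h.memLp_grad h0 h1 j).locallyIntegrable (by norm_num))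

lemma InV.memH_one (h : InV α u v) (h0 : 0 ≤ α) (h1 : α ≤ 1) : MemH 1 univ u := by
  refine ⟨by rw [Measure.restrict_univ]; exact h.memLp, fun j =>
    ⟨v j, h.hasWeakDeriv_univ h0 h1 j, ?_⟩⟩
  change MemLp _ 2 (volume.restrict univ)
  rw [Measure.restrict_univ]
  exact h.memLp_grad h0 h1 j

end

/-! ### Elliptic regularity -/

section

open TemperedDistribution LineDeriv
open scoped SchwartzMap Laplacian LineDeriv

lemma sum_mul_single (a : Fin 2 → ℂ) (j : Fin 2) (u : Plane → ℂ) (x : Plane) :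
    ∑ k, a k * (if k = j then u else 0) x = a j * u x := by
  rw [Finset.sum_eq_single j (fun k _ hk => by simp [hk]) (by simp), if_pos rfl]

/-- A divergence identity for compactly supported test functions holds for Schwartz functions. -/
lemma schwartz_extend {G : Fin 2 → Plane → ℂ} {F : Plane → ℂ} (hG : ∀ j, MemLp (G j) 2 volume)
    (hF : MemLp F 2 volume)
    (h : ∀ φ, IsTest univ φ → ∫ x, ∑ j, pd j φ x * G j x = ∫ x, φ x * F x)
    (φ : 𝓢(Plane, ℂ)) : ∫ x, ∑ j, pd j φ x * G j x = ∫ x, φ x * F x := by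
  obtain ⟨C, hC, hκ⟩ := exists_pd_cut_le
  have hφ2 : MemLp φ 2 volume := φ.memLp 2
  have hφd : ∀ j, MemLp (pd j φ) 2 volume := fun j => by
    have := (∂_{e j} φ : 𝓢(Plane, ℂ)).memLp 2 volume
    exact this
  have hi1 : ∀ j, Integrable fun x => pd j φ x * G j x := fun j => Anyon.MemLp.integrable_mul_two (hφd j) (hG j)
  have hi2 : ∀ j, Integrable fun x => φ x * G j x := fun j => Anyon.MemLp.integrable_mul_two hφ2 (hG j)
  have hi3 : Integrable fun x => φ x * F x := Anyon.MemLp.integrable_mul_two hφ2 hF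
  have hm : ∀ n, AEStronglyMeasurable (outerCut n) volume := fun n =>
    (isTest_outerCut n).continuous.aestronglyMeasurable
  have hmd : ∀ j n, AEStronglyMeasurable (pd j (outerCut n)) volume := fun j n =>
    ((isTest_outerCut n).pd j).continuous.aestronglyMeasurable
  have hid : ∀ j n, Integrable fun x => pd j (outerCut n) x * (φ x * G j x) := fun j n =>
    (hi2 j).bdd_mul (hmd j n) (ae_of_all _ fun x => (hκ n j x).1)
  have hi : ∀ j n, Integrable fun x => outerCut n x * (pd j φ x * G j x) := fun j n =>
    (hi1 j).bdd_mul (hm n) (ae_of_all _ (norm_outerCut_le n))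
  have heq : ∀ n, ∑ j, ((∫ x, outerCut n x * (pd j φ x * G j x))
      + ∫ x, pd j (outerCut n) x * (φ x * G j x)) = ∫ x, outerCut n x * (φ x * F x) := fun n => by
    have ht : IsTest univ fun x => φ x * outerCut n x :=
      (isTest_outerCut n).mul_contDiff (φ.smooth ⊤)
    have := h _ ht
    rw [show (∫ x, outerCut n x * (φ x * F x)) = ∫ x, (φ x * outerCut n x) * F x by
      congr 1; ext x; ring, ← this, integral_finsetSum]
    · refine Finset.sum_congr rfl fun j _ => ?_
      rw [← integral_add (hi j n) (hid j n)]
      congr 1; ext x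
      rw [pd_mul φ.differentiableAt ((isTest_outerCut n).differentiable x)]
      ring
    · intro j _
      refine ((hi j n).add (hid j n)).congr (ae_of_all _ fun x => ?_)
      simp only [Pi.add_apply]
      rw [pd_mul φ.differentiableAt ((isTest_outerCut n).differentiable x)]
      ring
  have hl1 : Tendsto (fun n => ∑ j, ((∫ x, outerCut n x * (pd j φ x * G j x))
      + ∫ x, pd j (outerCut n) x * (φ x * G j x))) atTop
      (𝓝 (∑ j, ((∫ x, 1 * (pd j φ x * G j x)) + ∫ x, 0 * (φ x * G j x)))) :=
    tendsto_finsetSum _ fun j _ => (tendsto_integral_mul_of_bounded (hi1 j) hm norm_outerCut_le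
      (ae_of_all _ tendsto_outerCut)).add (tendsto_integral_mul_of_bounded (hi2 j) (hmd j)
      (fun n x => (hκ n j x).1) (ae_of_all _ (tendsto_pd_outerCut j)))
  have hl2 := tendsto_integral_mul_of_bounded hi3 hm norm_outerCut_le
    (ae_of_all _ tendsto_outerCut)
  have := tendsto_nhds_unique (hl1.congr heq) hl2
  rw [integral_finsetSum _ fun j _ => hi1 j]
  simpa using this

/-- The tempered distribution of a square-integrable function. -/
abbrev tdist {u : Plane → ℂ} (hu : MemLp u 2 volume) : 𝓢'(Plane, ℂ) := (hu.toLp u : Lp ℂ 2 volume)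

lemma tdist_apply {u : Plane → ℂ} (hu : MemLp u 2 volume) (φ : 𝓢(Plane, ℂ)) :
    tdist hu φ = ∫ x, φ x * u x := by
  rw [tdist, Lp.toTemperedDistribution_apply]
  refine integral_congr_ae ?_
  filter_upwards [hu.coeFn_toLp] with x hx
  rw [hx, smul_eq_mul]

/-- Weak derivatives are tested with compactly supported functions and tempered ones with Schwartz
functions; `schwartz_extend` bridges the gap. -/
lemma lineDeriv_tdist {j : Fin 2} {u g : Plane → ℂ} (hu : MemLp u 2 volume) (hg : MemLp g 2 volume)
    (h : HasWeakDeriv univ j u g) : ∂_{e j} (tdist hu) = tdist hg := by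
  ext φ
  have key := schwartz_extend (G := fun k => if k = j then u else 0) (F := fun x => - g x)
    (fun k => by
      by_cases hk : k = j
      · simpa [hk] using hu
      · simp [hk]) hg.neg (fun φ hφ => by
      simpa only [sum_mul_single, mul_neg, integral_neg] using (hasWeakDeriv_iff.1 h).2.2 φ hφ) φ
  simp only [sum_mul_single, mul_neg, integral_neg] at key
  rw [lineDerivOp_apply_apply, map_neg, tdist_apply, tdist_apply, neg_eq_iff_eq_neg]
  exact key

lemma hasWeakDeriv_of_tdist {j : Fin 2} {u g : Plane → ℂ} (hu : MemLp u 2 volume)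
    (hg : MemLp g 2 volume) (h : ∂_{e j} (tdist hu) = tdist hg) : HasWeakDeriv univ j u g := by
  refine hasWeakDeriv_iff.2 ⟨locallyIntegrableOn_of_memLp hu _, locallyIntegrableOn_of_memLp hg _,
    fun φ hφ => ?_⟩
  have := congrArg (fun T : 𝓢'(Plane, ℂ) => T (hφ.2.1.toSchwartzMap hφ.1)) h
  simp only [lineDerivOp_apply_apply, tdist_apply, map_neg] at this
  exact neg_eq_iff_eq_neg.1 this

/-- Since the fields are square integrable, the identity `-Δu = F` extends across the origin and
then to Schwartz functions. On the Fourier side `(1 + ‖ξ‖²) û` is square integrable, so all second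
derivatives are in `L²`. -/
theorem memH_two_of_weak_laplacian {u F : Plane → ℂ} {g : Fin 2 → Plane → ℂ}
    (hu : MemLp u 2 volume) (hg : ∀ j, MemLp (g j) 2 volume) (hF : MemLp F 2 volume)
    (hd : ∀ j, HasWeakDeriv univ j u (g j))
    (h : ∀ φ, IsTest punctured φ → ∫ x, ∑ j, pd j φ x * g j x = ∫ x, φ x * F x) :
    MemH 2 univ u := by
  have h' := schwartz_extend hg hF (test_extend hg
    (hF.locallyIntegrable (by norm_num)) h)
  have hlap : Δ (tdist hu) = - tdist hF := by
    rw [laplacian_eq_sum (EuclideanSpace.basisFun (Fin 2) ℝ)]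
    ext φ
    have hi : ∀ j, Integrable fun x => pd j φ x * g j x := fun j =>
      Anyon.MemLp.integrable_mul_two (by
        have := (∂_{e j} φ : 𝓢(Plane, ℂ)).memLp 2 volume
        exact this) (hg j)
    have h1 : ∀ j : Fin 2, (∂_{EuclideanSpace.basisFun (Fin 2) ℝ j}
        (∂_{EuclideanSpace.basisFun (Fin 2) ℝ j} (tdist hu))) φ = - ∫ x, pd j φ x * g j x := by
      intro j
      rw [EuclideanSpace.basisFun_apply]
      change (∂_{e j} (∂_{e j} (tdist hu))) φ = _
      rw [lineDeriv_tdist hu (hg j) (hd j), lineDerivOp_apply_apply, map_neg, tdist_apply]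
      rfl
    have h2 := h' φ
    rw [integral_finsetSum _ fun j _ => hi j, ← tdist_apply hF] at h2
    rw [Fin.sum_univ_two] at h2 ⊢
    rw [add_apply, neg_apply, ← h2, h1, h1]
    ring
  have hS : MemSobolev 2 2 (tdist hu) := by
    -- With the Fourier kernel `exp (-2πi x·ξ)` the Laplacian has symbol `-(2π)² ‖ξ‖²`, whence the
    -- factor `(2π)^(-2)`.
    have hb : besselPotential Plane ℂ 2 (tdist hu)
        = tdist hu - ((((2 * Real.pi) ^ 2)⁻¹ : ℝ) : ℂ) • Δ (tdist hu) := by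
      have h1 : (fun x : Plane => (((1 + ‖x‖ ^ 2) ^ ((2 : ℝ) / 2) : ℝ) : ℂ)) =
          (fun _ => (1 : ℂ)) + fun x : Plane => ((‖x‖ ^ 2 : ℝ) : ℂ) := by
        ext x
        simp
      rw [laplacian_eq_fourierMultiplierCLM, besselPotential, h1, fourierMultiplierCLM_apply,
        smulLeftCLM_add (by fun_prop) (by fun_prop), add_apply,
        FourierTransform.fourierInv_add, ← fourierMultiplierCLM_apply,
        ← fourierMultiplierCLM_apply, fourierMultiplierCLM_const, ← Complex.coe_smul, smul_smul]
      have h2 : ((((2 * Real.pi) ^ 2)⁻¹ : ℝ) : ℂ) * ((-(2 * Real.pi) ^ 2 : ℝ) : ℂ) = -1 := by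
        rw [← Complex.ofReal_mul, mul_neg, inv_mul_cancel₀ (by positivity)]
        simp
      rw [h2]
      simp
    rw [hlap] at hb
    refine ⟨hu.toLp u + ((((2 * Real.pi) ^ 2)⁻¹ : ℝ) : ℂ) • hF.toLp F, ?_⟩
    rw [hb, ← Lp.toTemperedDistributionCLM_apply, map_add, map_smul]
    simp
  -- Two derivatives lower the Sobolev order from `2` to `0`, and order `0` means being given by an
  -- `L²` function.
  have hS2 : ∀ j k, ∃ f : Plane → ℂ, ∃ hf : MemLp f 2 volume, ∂_{e k} (tdist (hg j)) = tdist hf := by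
    intro j k
    have := (hS.lineDerivOp (m := e j)).lineDerivOp (m := e k)
    rw [lineDeriv_tdist hu (hg j) (hd j)] at this
    norm_num at this
    obtain ⟨f, hf⟩ := memSobolev_zero_iff.1 this
    refine ⟨f, Lp.memLp f, ?_⟩
    rw [hf, tdist, Lp.toLp_coeFn]
  refine ⟨by simpa using hu, fun j => ⟨g j, hd j, by simpa using hg j, fun k => ?_⟩⟩
  obtain ⟨f, hf, hfe⟩ := hS2 j k
  exact ⟨f, hasWeakDeriv_of_tdist (hg j) hf hfe, by simpa [MemH] using hf⟩

end

/-! ### Extending weak identities from test functions to the energy space -/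

lemma HasWeakDeriv.conjugate {Ω : Set Plane} {j : Fin 2} {u v : Plane → ℂ}
    (h : HasWeakDeriv Ω j u v) :
    HasWeakDeriv Ω j (fun x => conj (u x)) (fun x => conj (v x)) := by
  refine hasWeakDeriv_iff.2 ⟨?_, ?_, fun φ hφ => ?_⟩
  · exact fun x hx => (h.1 x hx).imp fun s hs => ⟨hs.1, Complex.conjCLE.integrable_comp_iff.2 hs.2⟩
  · exact fun x hx => (h.2.1 x hx).imp fun s hs =>
      ⟨hs.1, Complex.conjCLE.integrable_comp_iff.2 hs.2⟩
  · have := congrArg conj ((hasWeakDeriv_iff.1 h).2.2 _ hφ.conjugate)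
    rw [map_neg, ← integral_conj, ← integral_conj] at this
    refine Eq.trans (integral_congr_ae (ae_of_all _ fun x => ?_)) (this.trans
      (congrArg Neg.neg (integral_congr_ae (ae_of_all _ fun x => ?_))))
    · simp [pd_conj (hφ.differentiable x)]
    · simp

/-- A weak identity holds for functions of compact support with square-integrable gradient. -/
lemma weak_identity_of_compact {Ω K : Set Plane} (hΩ : IsOpen Ω) (hK : IsCompact K) (hKΩ : K ⊆ Ω)
    {w F : Plane → ℂ} {v G : Fin 2 → Plane → ℂ} (hw : MemLp w 2 volume)
    (hv : ∀ j, MemLp (v j) 2 volume) (hd : ∀ j, HasWeakDeriv univ j w (v j))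
    (h0 : ∀ x ∉ K, w x = 0) (hG : ∀ j, MemLp (G j) 2 volume) (hF : MemLp F 2 volume)
    (h : ∀ φ, IsTest Ω φ → ∫ x, ∑ j, pd j φ x * G j x = ∫ x, φ x * F x) :
    ∫ x, ∑ j, v j x * G j x = ∫ x, w x * F x := by
  obtain ⟨φ, hφ, hl⟩ := exists_test_approx hΩ hK hKΩ hw hv hd h0
  have h1 : Tendsto (fun n => ∑ j, ∫ x, pd j (φ n) x * G j x) atTop
      (𝓝 (∑ j, ∫ x, v j x * G j x)) :=
    tendsto_finsetSum _ fun j _ => (hl _ (hG j)).2 j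
  have h2 : ∀ n, ∑ j, ∫ x, pd j (φ n) x * G j x = ∫ x, φ n x * F x := fun n => by
    rw [← h _ (hφ n), integral_finsetSum _ fun j _ =>
      Anyon.MemLp.integrable_mul_two (((hφ n).pd j).memLp 2) (hG j)]
  rw [integral_finsetSum _ fun j _ => Anyon.MemLp.integrable_mul_two (hv j) (hG j)]
  exact tendsto_nhds_unique h1 ((hl _ hF).1.congr fun n => (h2 n).symm)

/-- Removing a sequence of cut-offs from a weak identity. -/
lemma weak_identity_of_cut {κ : ℕ → Plane → ℂ} {ρ : Plane → ℝ} {C : ℝ}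
    (hκ : ∀ n, IsTest univ (κ n)) (hκ1 : ∀ n x, ‖κ n x‖ ≤ 1)
    (hκC : ∀ n j x, ρ x * ‖pd j (κ n) x‖ ≤ C) (hρ : ∀ᵐ x, 0 < ρ x) (hρm : Measurable ρ)
    (hρ0 : ∀ x, 0 ≤ ρ x)
    (hl : ∀ᵐ x, Tendsto (fun n => κ n x) atTop (𝓝 1))
    (hld : ∀ j, ∀ᵐ x, Tendsto (fun n => pd j (κ n) x) atTop (𝓝 0))
    {w F : Plane → ℂ} {v G : Fin 2 → Plane → ℂ} (hv : ∀ j, MemLp (v j) 2 volume)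
    (hwρ : MemLp (fun x => (((ρ x)⁻¹ : ℝ) : ℂ) * w x) 2 volume)
    (hG : ∀ j, MemLp (G j) 2 volume) (hF : Integrable fun x => w x * F x)
    (h : ∀ n, ∫ x, ∑ j, (κ n x * v j x + pd j (κ n) x * w x) * G j x = ∫ x, κ n x * w x * F x) :
    ∫ x, ∑ j, v j x * G j x = ∫ x, w x * F x := by
  have hi1 : ∀ j, Integrable fun x => v j x * G j x := fun j =>
    Anyon.MemLp.integrable_mul_two (hv j) (hG j)
  have hi2 : ∀ j, Integrable fun x => (((ρ x)⁻¹ : ℝ) : ℂ) * w x * G j x := fun j =>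
    Anyon.MemLp.integrable_mul_two hwρ (hG j)
  have hm : ∀ n, AEStronglyMeasurable (κ n) volume := fun n =>
    (hκ n).continuous.aestronglyMeasurable
  have hmd : ∀ j n, AEStronglyMeasurable (fun x => (ρ x : ℂ) * pd j (κ n) x) volume := fun j n =>
    (Complex.measurable_ofReal.comp hρm).aestronglyMeasurable.mul
      ((hκ n).pd j).continuous.aestronglyMeasurable
  have hb : ∀ j n x, ‖(ρ x : ℂ) * pd j (κ n) x‖ ≤ C := fun j n x => by
    rw [norm_mul, Complex.norm_real, Real.norm_of_nonneg (hρ0 x)]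
    exact hκC n j x
  have hi1' : ∀ j n, Integrable fun x => κ n x * (v j x * G j x) := fun j n =>
    (hi1 j).bdd_mul (hm n) (ae_of_all _ (hκ1 n))
  -- The term in which the derivative falls on the cut-off is written as `(ρ ∂κ) * (ρ⁻¹ w)`: a
  -- bounded factor tending to zero times a fixed `L²` function, so dominated convergence kills it.
  have hi2' : ∀ j n, Integrable fun x =>
      ((ρ x : ℂ) * pd j (κ n) x) * ((((ρ x)⁻¹ : ℝ) : ℂ) * w x * G j x) := fun j n =>
    (hi2 j).bdd_mul (hmd j n) (ae_of_all _ (hb j n))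
  have heq : ∀ n, ∑ j, ((∫ x, κ n x * (v j x * G j x))
      + ∫ x, ((ρ x : ℂ) * pd j (κ n) x) * ((((ρ x)⁻¹ : ℝ) : ℂ) * w x * G j x))
        = ∫ x, κ n x * (w x * F x) := fun n => by
    simp only [← mul_assoc (κ n _) (w _)]
    rw [← h n]
    have : ∀ j, (fun x => (κ n x * v j x + pd j (κ n) x * w x) * G j x) =ᵐ[volume] fun x =>
        κ n x * (v j x * G j x) +
          ((ρ x : ℂ) * pd j (κ n) x) * ((((ρ x)⁻¹ : ℝ) : ℂ) * w x * G j x) := fun j => by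
      filter_upwards [hρ] with x hx
      have h1 : (ρ x : ℂ) * (((ρ x)⁻¹ : ℝ) : ℂ) = 1 := by
        rw [← Complex.ofReal_mul, mul_inv_cancel₀ hx.ne', Complex.ofReal_one]
      linear_combination (- pd j (κ n) x * w x * G j x) * h1
    rw [integral_finsetSum _ fun j _ => ((hi1' j n).add (hi2' j n)).congr (this j).symm]
    refine Finset.sum_congr rfl fun j _ => ?_
    rw [integral_congr_ae (this j), integral_add (hi1' j n) (hi2' j n)]
  have hl1 : Tendsto (fun n => ∑ j, ((∫ x, κ n x * (v j x * G j x))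
      + ∫ x, ((ρ x : ℂ) * pd j (κ n) x) * ((((ρ x)⁻¹ : ℝ) : ℂ) * w x * G j x))) atTop
      (𝓝 (∑ j, ((∫ x, 1 * (v j x * G j x))
        + ∫ x, 0 * ((((ρ x)⁻¹ : ℝ) : ℂ) * w x * G j x)))) :=
    tendsto_finsetSum _ fun j _ => (tendsto_integral_mul_of_bounded (hi1 j) hm hκ1 hl).add
      (tendsto_integral_mul_of_bounded (hi2 j) (hmd j) (hb j) (by
        filter_upwards [hld j] with x hx
        simpa using hx.const_mul (ρ x : ℂ)))
  have := tendsto_nhds_unique (hl1.congr heq) (tendsto_integral_mul_of_bounded hF hm hκ1 hl)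
  rw [integral_finsetSum _ fun j _ => hi1 j]
  simpa using this

/-- `u` has finite energy and `H_α u = f` weakly off the origin. -/
structure InOp (α : ℝ) (u : Plane → ℂ) (v : Fin 2 → Plane → ℂ) (f : Plane → ℂ) : Prop
    extends InV α u v where
  memLp_rhs : MemLp f 2 volume
  eq : ∀ φ, IsTest punctured φ →
    ∫ x, ∑ j, conj (covD α j φ (pd j φ) x) * covD α j u (v j) x = ∫ x, conj (φ x) * f x

lemma conj_covD_conj (α : ℝ) (j : Fin 2) (u v : Plane → ℂ) (x : Plane) :
    conj (covD α j (fun y => conj (u y)) (fun y => conj (v y)) x)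
      = Complex.I * v x + potential α j x * u x := by
  simp [covD, conj_potential]

/-- The covariant identity in divergence form. -/
lemma divergence_form_iff {α : ℝ} {W : Fin 2 → Plane → ℂ} {f : Plane → ℂ}
    (hW : ∀ j, MemLp (W j) 2 volume) (hf : MemLp f 2 volume) :
    (∀ φ, IsTest punctured φ →
      ∫ x, ∑ j, conj (covD α j φ (pd j φ) x) * W j x = ∫ x, conj (φ x) * f x) ↔
    ∀ φ, IsTest punctured φ →
      ∫ x, ∑ j, pd j φ x * (Complex.I * W j x)
        = ∫ x, φ x * (f x - ∑ j, potential α j x * W j x) := by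
  -- Testing with `conj φ` removes the antilinearity: the conjugate of `D_α (conj φ)` is `i ∂φ + A
  -- φ`.
  have hconv : ∀ φ, IsTest punctured φ →
      ((∫ x, ∑ j, conj (covD α j (fun y => conj (φ y)) (pd j (fun y => conj (φ y))) x) * W j x
        = ∫ x, conj (conj (φ x)) * f x) ↔
      ∫ x, ∑ j, pd j φ x * (Complex.I * W j x)
        = ∫ x, φ x * (f x - ∑ j, potential α j x * W j x)) := fun φ hφ => by
    have hi1 : ∀ j, Integrable fun x => pd j φ x * (Complex.I * W j x) := fun j =>
      Anyon.MemLp.integrable_mul_two ((hφ.pd j).memLp 2) ((hW j).const_mul _)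
    have hi2 : ∀ j, Integrable fun x => potential α j x * φ x * W j x := fun j =>
      Anyon.MemLp.integrable_mul_two ((hφ.mul_contDiffOn isOpen_punctured
        (contDiffOn_potential α j)).memLp 2) (hW j)
    have hi3 : Integrable fun x => φ x * f x := Anyon.MemLp.integrable_mul_two (hφ.memLp 2) hf
    have e1 : (∫ x, ∑ j, conj (covD α j (fun y => conj (φ y)) (pd j (fun y => conj (φ y))) x) * W j x)
        = (∫ x, ∑ j, pd j φ x * (Complex.I * W j x))
          + ∫ x, ∑ j, potential α j x * φ x * W j x := by
      rw [← integral_add (integrable_finsetSum _ fun j _ => hi1 j)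
        (integrable_finsetSum _ fun j _ => hi2 j)]
      congr 1; ext x
      rw [← Finset.sum_add_distrib]
      refine Finset.sum_congr rfl fun j _ => ?_
      have : pd j (fun y => conj (φ y)) = fun y => conj (pd j φ y) := funext fun y => pd_conj (hφ.differentiable y) j
      rw [this, conj_covD_conj]
      ring
    have e2 : (∫ x, φ x * (f x - ∑ j, potential α j x * W j x))
        = (∫ x, φ x * f x) - ∫ x, ∑ j, potential α j x * φ x * W j x := by
      rw [← integral_sub hi3 (integrable_finsetSum _ fun j _ => hi2 j)]
      congr 1; ext x
      rw [mul_sub, Finset.mul_sum]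
      congr 1
      exact Finset.sum_congr rfl fun j _ => by ring
    rw [e1, e2]
    simp only [Complex.conj_conj]
    exact eq_sub_iff_add_eq.symm
  refine ⟨fun h φ hφ => (hconv φ hφ).1 (h _ hφ.conjugate), fun h φ hφ => ?_⟩
  have := (hconv _ hφ.conjugate).2 (h _ hφ.conjugate)
  simpa only [Complex.conj_conj] using this

/-- The equation for an element of the operator domain may be tested with any function of finite
energy. -/
theorem InOp.eq_of_inV {α : ℝ} (h0 : 0 ≤ α) (h1 : α ≤ 1) {w f : Plane → ℂ}
    {z : Fin 2 → Plane → ℂ} (hw : InOp α w z f) {u : Plane → ℂ} {v : Fin 2 → Plane → ℂ}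
    (hu : InV α u v) :
    ∫ x, ∑ j, conj (covD α j u (v j) x) * covD α j w (z j) x = ∫ x, conj (u x) * f x := by
  set W : Fin 2 → Plane → ℂ := fun j => covD α j w (z j) with hWdef
  have hW : ∀ j, MemLp (W j) 2 volume := hw.memLp_cov
  have hdiv := (divergence_form_iff hW hw.memLp_rhs).1 hw.eq
  have hIW : ∀ j, MemLp (fun x => Complex.I * W j x) 2 volume := fun j => (hW j).const_mul _
  have hA : ∀ j, MemLp (fun x => potential α j x * conj (u x)) 2 volume := fun j => by
    have := MemLp.conjugate (hu.memLp_potential_mul h0 h1 j)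
    simpa [conj_potential] using this
  have hi2 : ∀ j, Integrable fun x => potential α j x * conj (u x) * W j x := fun j =>
    Anyon.MemLp.integrable_mul_two (hA j) (hW j)
  have hi3 : Integrable fun x => conj (u x) * f x :=
    Anyon.MemLp.integrable_mul_two (MemLp.conjugate hu.memLp) hw.memLp_rhs
  have hv : ∀ j, MemLp (fun x => conj (v j x)) 2 volume := fun j =>
    MemLp.conjugate (hu.memLp_grad h0 h1 j)
  have hi1 : ∀ j, Integrable fun x => conj (v j x) * (Complex.I * W j x) := fun j =>
    Anyon.MemLp.integrable_mul_two (hv j) (hIW j)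
  have hd : ∀ j, HasWeakDeriv univ j (fun x => conj (u x)) (fun x => conj (v j x)) := fun j =>
    (hu.hasWeakDeriv_univ h0 h1 j).conjugate
  have hsplit : (fun x => conj (u x) * (f x - ∑ j, potential α j x * W j x)) =
      fun x => conj (u x) * f x - ∑ j, potential α j x * conj (u x) * W j x := by
    ext x
    rw [mul_sub, Finset.mul_sum]
    congr 1
    exact Finset.sum_congr rfl fun j _ => by ring
  have hiF : Integrable fun x => conj (u x) * (f x - ∑ j, potential α j x * W j x) := by
    rw [hsplit]
    exact hi3.sub (integrable_finsetSum _ fun j _ => hi2 j)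
  suffices key : ∫ x, ∑ j, conj (v j x) * (Complex.I * W j x)
      = ∫ x, conj (u x) * (f x - ∑ j, potential α j x * W j x) by
    rw [hsplit, integral_sub hi3 (integrable_finsetSum _ fun j _ => hi2 j),
      eq_sub_iff_add_eq, ← integral_add (integrable_finsetSum _ fun j _ => hi1 j)
      (integrable_finsetSum _ fun j _ => hi2 j)] at key
    rw [← key]
    congr 1; ext x
    rw [← Finset.sum_add_distrib]
    refine Finset.sum_congr rfl fun j _ => ?_
    simp only [covD, map_add, map_mul, map_neg, Complex.conj_I, conj_potential, hWdef]
    ring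
  obtain ⟨C, hC, hκ⟩ := exists_pd_cut_le
  have hcutd : ∀ {κ : Plane → ℂ}, IsTest univ κ → ∀ j, HasWeakDeriv univ j
      (fun x => κ x * conj (u x)) (fun x => κ x * conj (v j x) + pd j κ x * conj (u x)) :=
    fun hκ j => (hd j).mul_smooth isOpen_univ hκ.contDiff.contDiffOn
  have hcut2 : ∀ {κ : Plane → ℂ} {g : Plane → ℂ}, IsTest univ κ → MemLp g 2 volume →
      MemLp (fun x => κ x * g x) 2 volume := fun hκ hg => by
    obtain ⟨M, _, hM⟩ := hκ.exists_bound
    exact memLp_bdd_mul hg hκ.continuous.aestronglyMeasurable (ae_of_all _ hM)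
  -- If `α = 0` the right-hand side is `f` itself, the identity extends across the origin, and only
  -- infinity needs a cut-off. If `α > 0` the right-hand side contains `A · W`, controlled only away
  -- from the origin, so the cut-off is annular, and `u / ‖x‖` being in `L²` pays for its gradient.
  rcases h0.eq_or_lt with rfl | hpos
  · have hF : (fun x => f x - ∑ j, potential 0 j x * W j x) = f := by
      ext x; simp [potential_zero]
    simp only [fun x => congrFun hF x] at hdiv hiF ⊢
    have hdiv' := test_extend hIW (hw.memLp_rhs.locallyIntegrable (by norm_num)) hdiv
    refine weak_identity_of_cut (κ := outerCut) (ρ := fun _ => 1) (C := C) isTest_outerCut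
      norm_outerCut_le (fun n j x => by simpa using (hκ n j x).1) (by simp) (by fun_prop) (by simp)
      (ae_of_all _ tendsto_outerCut) (fun j => ae_of_all _ (tendsto_pd_outerCut j)) hv
      (by simpa using MemLp.conjugate hu.memLp) hIW hiF fun n => ?_
    refine weak_identity_of_compact isOpen_univ (isTest_outerCut n).compact (subset_univ _)
      (hcut2 (isTest_outerCut n) (MemLp.conjugate hu.memLp))
      (fun j => (hcut2 (isTest_outerCut n) (hv j)).add
        (hcut2 ((isTest_outerCut n).pd j) (MemLp.conjugate hu.memLp)))
      (hcutd (isTest_outerCut n)) (fun x hx => ?_) hIW hw.memLp_rhs hdiv'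
    rw [image_eq_zero_of_notMem_tsupport hx, zero_mul]
  · refine weak_identity_of_cut (κ := annulusCut) (ρ := fun x => ‖x‖) (C := C)
      (fun n => (isTest_annulusCut n).mono (subset_univ _))
      norm_annulusCut_le (fun n j x => (hκ n j x).2) ?_ (by fun_prop) (by simp)
      ?_ (fun j => ?_) hv ?_ hIW hiF fun n => ?_
    · filter_upwards [ae_mem_punctured] with x hx using norm_pos_iff.2 hx
    · filter_upwards [ae_mem_punctured] with x hx using tendsto_annulusCut hx
    · filter_upwards [ae_mem_punctured] with x hx using tendsto_pd_annulusCut hx j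
    · have := MemLp.conjugate (hu.memLp_inv hpos h1)
      simpa using this
    have ht := (isTest_annulusCut n).mono (subset_univ _)
    -- On `‖x‖ > δ` the vector potential is bounded, so the right-hand side restricted to this set
    -- is square integrable and `weak_identity_of_compact` applies.
    obtain ⟨δ, hδ, hδK⟩ : ∃ δ > 0, tsupport (annulusCut n) ⊆ {x | δ < ‖x‖} := by
      have hc : IsClosed (tsupport (annulusCut n)) := isClosed_tsupport _
      have h0 : (0 : Plane) ∈ (tsupport (annulusCut n))ᶜ := fun h =>
        (isTest_annulusCut n).tsub h rfl
      obtain ⟨ε, hε, hb⟩ := Metric.isOpen_iff.1 hc.isOpen_compl 0 h0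
      refine ⟨ε / 2, half_pos hε, fun x hx => ?_⟩
      by_contra hlt
      refine hb (?_ : x ∈ _) hx
      rw [mem_ball_zero_iff]
      have : ‖x‖ ≤ ε / 2 := not_lt.1 hlt
      linarith
    set S : Set Plane := {x | δ < ‖x‖}
    have hSo : IsOpen S := isOpen_lt continuous_const continuous_norm
    have hSp : S ⊆ punctured := fun x hx => by
      rw [mem_punctured]
      exact norm_pos_iff.1 (hδ.trans hx)
    set F : Plane → ℂ := fun x => f x - ∑ j, potential α j x * W j x
    have hF : MemLp (S.indicator F) 2 volume := by
      have : S.indicator F = fun x => S.indicator f x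
          - ∑ j, S.indicator (potential α j) x * W j x := by
        ext x
        by_cases hx : x ∈ S <;> simp [hx, F]
      rw [this]
      refine (hw.memLp_rhs.indicator hSo.measurableSet).sub (memLp_finsetSum _ fun j _ => ?_)
      refine memLp_bdd_mul (C := |α| * δ⁻¹) (hW j) ((aestronglyMeasurable_of_contDiffOn
        (contDiffOn_potential α j)).indicator hSo.measurableSet) (ae_of_all _ fun x => ?_)
      by_cases hx : x ∈ S
      · rw [indicator_of_mem hx]
        refine (norm_potential_le α j x).trans ?_
        have : δ < ‖x‖ := hx
        gcongr
      · rw [indicator_of_notMem hx, norm_zero]; positivity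
    have key := weak_identity_of_compact (F := S.indicator F) hSo ht.compact hδK
      (hcut2 ht (MemLp.conjugate hu.memLp))
      (fun j => (hcut2 ht (hv j)).add (hcut2 (ht.pd j) (MemLp.conjugate hu.memLp)))
      (hcutd ht) (fun x hx => by
        rw [image_eq_zero_of_notMem_tsupport hx, zero_mul]) hIW hF fun φ hφ => by
        rw [hdiv φ (hφ.mono hSp)]
        congr 1; ext x
        by_cases hx : x ∈ S
        · rw [indicator_of_mem hx]
        · rw [hφ.eq_zero hx, zero_mul, zero_mul]
    refine key.trans ?_
    congr 1; ext x
    by_cases hx : x ∈ S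
    · rw [indicator_of_mem hx]
    · rw [image_eq_zero_of_notMem_tsupport fun h => hx (hδK h)]; simp

/-! ### Parity -/

lemma IsTest.comp_neg {φ : Plane → ℂ} (h : IsTest punctured φ) :
    IsTest punctured (fun x => φ (-x)) := by
  have := h.comp_rot rot_mem_punctured Real.pi
  simpa only [rot_pi] using this

lemma pd_comp_neg (φ : Plane → ℂ) (j : Fin 2) (x : Plane) :
    pd j (fun y => φ (-y)) x = - pd j φ (-x) := by
  simp only [pd]
  have := congrArg (fun L => L (e j))
    ((ContinuousLinearEquiv.neg ℝ (M := Plane)).comp_right_fderiv (f := φ) (x := x))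
  simpa [Function.comp_def] using this

lemma potential_neg (α : ℝ) (j : Fin 2) (x : Plane) : potential α j (-x) = - potential α j x := by
  fin_cases j <;> simp [potential] <;> ring

lemma covD_comp_neg (α : ℝ) (φ : Plane → ℂ) (j : Fin 2) (x : Plane) :
    covD α j (fun y => φ (-y)) (pd j fun y => φ (-y)) x = - covD α j φ (pd j φ) (-x) := by
  simp only [covD, pd_comp_neg, potential_neg]
  ring

variable {α : ℝ} {u f : Plane → ℂ} {v : Fin 2 → Plane → ℂ}

/-- Evenness of `u` makes `-v j (-x)` a weak derivative of `u` as well, so uniqueness makes the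
gradient odd; the potential is odd by inspection. -/
lemma InV.odd (h : InV α u v) (j : Fin 2) :
    ∀ᵐ x, covD α j u (v j) (-x) = - covD α j u (v j) x := by
  have hl : ∀ {g : Plane → ℂ}, LocallyIntegrableOn g punctured →
      LocallyIntegrableOn (fun x => g (-x)) punctured := by
    intro g hg
    rw [locallyIntegrableOn_iff isOpen_punctured.isLocallyClosed] at hg ⊢
    intro K hK hKc
    have h1 := hg (-K) (fun x hx => by
      have := hK hx
      rw [mem_punctured] at this ⊢
      exact fun h => this (by rw [h, neg_zero])) hKc.neg
    have hm := (Measure.measurePreserving_neg (volume : Measure Plane))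
    have := (hm.restrict_preimage_emb (MeasurableEquiv.neg Plane).measurableEmbedding
      (-K)).integrable_comp_of_integrable h1
    simpa [IntegrableOn, Function.comp_def] using this
  have hd : HasWeakDeriv punctured j u (fun x => - v j (-x)) := by
    refine hasWeakDeriv_iff.2 ⟨(h.deriv j).1, (hl (h.deriv j).2.1).neg, fun φ hφ => ?_⟩
    have h1 := (h.deriv j).test hφ.comp_neg
    rw [← integral_neg_eq_self, ← integral_neg_eq_self (fun x => φ (- x) * v j x)] at h1
    simp only [pd_comp_neg, neg_neg] at h1
    have h2 : ∫ x, pd j φ x * u x = ∫ x, pd j φ x * u (-x) :=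
      integral_congr_ae (by filter_upwards [h.even] with x hx; rw [hx])
    simp only [neg_mul, integral_neg, mul_neg] at h1 ⊢
    rw [h2, ← h1]
    ring
  have := (h.deriv j).unique_punctured hd
  filter_upwards [this, h.even] with x h1 h2
  simp only [covD, potential_neg, h1, h2]
  ring

/-- The weak form is invariant under reflection of the test function. -/
lemma InV.integral_comp_neg (h : InV α u v) (φ : Plane → ℂ) :
    ∫ x, ∑ j, conj (covD α j (fun y => φ (-y)) (pd j fun y => φ (-y)) x) * covD α j u (v j) x
      = ∫ x, ∑ j, conj (covD α j φ (pd j φ) x) * covD α j u (v j) x := by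
  rw [← integral_neg_eq_self]
  refine integral_congr_ae ?_
  filter_upwards [h.odd 0, h.odd 1] with x h0 h1
  simp only [covD_comp_neg, Fin.sum_univ_two, h0, h1, neg_neg, map_neg, neg_mul_neg]

/-- It suffices to test with even functions. -/
lemma InV.inOp_of_even_tests (h : InV α u v) (hf : MemLp f 2 volume)
    (hfe : ∀ᵐ x : Plane, f (-x) = f x)
    (heq : ∀ φ, IsTest punctured φ → (∀ x, φ (-x) = φ x) →
      ∫ x, ∑ j, conj (covD α j φ (pd j φ) x) * covD α j u (v j) x = ∫ x, conj (φ x) * f x) :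
    InOp α u v f := by
  refine ⟨h, hf, fun φ hφ => ?_⟩
  -- Symmetrising the test function doubles both sides, since `u` and `f` are even.
  have h1 := heq _ (hφ.add hφ.comp_neg) (fun x => by rw [neg_neg, add_comm])
  have hcov : ∀ {φ : Plane → ℂ}, IsTest punctured φ → ∀ j, MemLp (covD α j φ (pd j φ)) 2 volume :=
    fun hφ j => (((hφ.pd j).memLp 2).const_mul _).add
      ((hφ.mul_contDiffOn isOpen_punctured (contDiffOn_potential α j)).memLp 2)
  have hi : ∀ {φ : Plane → ℂ}, IsTest punctured φ → Integrable fun x =>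
      ∑ j, conj (covD α j φ (pd j φ) x) * covD α j u (v j) x := fun hφ =>
    integrable_finsetSum _ fun j _ => Anyon.MemLp.integrable_mul_two
      (MemLp.conjugate (hcov hφ j)) (h.memLp_cov j)
  have e1 : (∫ x, ∑ j, conj (covD α j (fun x => φ x + φ (-x)) (pd j fun x => φ x + φ (-x)) x) *
      covD α j u (v j) x) = 2 * ∫ x, ∑ j, conj (covD α j φ (pd j φ) x) * covD α j u (v j) x := by
    rw [two_mul]
    nth_rw 2 [← h.integral_comp_neg φ]
    rw [← integral_add (hi hφ) (hi hφ.comp_neg)]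
    congr 1; ext x
    rw [← Finset.sum_add_distrib]
    refine Finset.sum_congr rfl fun j _ => ?_
    simp only [covD]
    rw [pd_add (hφ.differentiable x) (hφ.comp_neg.differentiable x)]
    simp only [map_add, map_mul]
    ring
  have e2 : ∫ x, conj (φ x + φ (-x)) * f x = 2 * ∫ x, conj (φ x) * f x := by
    have hi3 : ∀ {φ : Plane → ℂ}, IsTest punctured φ → Integrable fun x => conj (φ x) * f x :=
      fun hφ => Anyon.MemLp.integrable_mul_two (MemLp.conjugate (hφ.memLp 2)) hf
    have : ∫ x, conj (φ (-x)) * f x = ∫ x, conj (φ x) * f x := by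
      rw [← integral_neg_eq_self]
      refine integral_congr_ae ?_
      filter_upwards [hfe] with x hx
      rw [neg_neg, hx]
    rw [two_mul]
    nth_rw 2 [← this]
    rw [← integral_add (hi3 hφ) (hi3 hφ.comp_neg)]
    congr 1; ext x
    rw [map_add, add_mul]
  rw [e1, e2] at h1
  exact mul_left_cancel₀ two_ne_zero h1

/-- The left-hand side of the weak equation is unchanged when the test function is reflected, so `f`
and its reflection have the same pairings. -/
lemma InOp.even_rhs (h : InOp α u v f) : ∀ᵐ x : Plane, f (-x) = f x := by
  have hn : MemLp (fun x => f (-x)) 2 volume :=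
    h.memLp_rhs.comp_measurePreserving (Measure.measurePreserving_neg _)
  refine ae_eq_of_test_punctured (locallyIntegrableOn_of_memLp hn _)
    (locallyIntegrableOn_of_memLp h.memLp_rhs _) fun φ hφ => ?_
  have h1 := h.eq _ hφ.conjugate
  have h2 := h.eq _ hφ.conjugate.comp_neg
  rw [h.toInV.integral_comp_neg (fun x => conj (φ x)), h1] at h2
  have h3 : ∫ x, φ (-x) * f x = ∫ x, φ x * f (-x) := by
    rw [← integral_neg_eq_self]
    simp
  rw [← h3]
  simpa using h2.symm

/-- Weak covariant derivatives in terms of the symmetric pairing with test functions. -/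
lemma hasWeakDeriv_iff_covariant {j : Fin 2} {d : Plane → ℂ} (hu : MemLp u 2 volume)
    (hd : MemLp d 2 volume) :
    HasWeakDeriv punctured j u (fun x => Complex.I * (d x - potential α j x * u x)) ↔
    ∀ φ, IsTest punctured φ →
      ∫ x, conj (covD α j φ (pd j φ) x) * u x = ∫ x, conj (φ x) * d x := by
  have hA : LocallyIntegrableOn (fun x => potential α j x * u x) punctured :=
    LocallyIntegrableOn.contDiffOn_mul isOpen_punctured (locallyIntegrableOn_of_memLp hu _)
      (contDiffOn_potential α j).continuousOn
  have hloc : LocallyIntegrableOn (fun x => Complex.I * (d x - potential α j x * u x)) punctured :=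
    fun x hx => (((locallyIntegrableOn_of_memLp hd _).sub hA) x hx).imp fun s hs =>
      ⟨hs.1, hs.2.const_mul _⟩
  have hconv : ∀ φ, IsTest punctured φ →
      ((∫ x, conj (covD α j (fun y => conj (φ y)) (pd j (fun y => conj (φ y))) x) * u x
        = ∫ x, conj (conj (φ x)) * d x) ↔
      ∫ x, pd j φ x * u x = - ∫ x, φ x * (Complex.I * (d x - potential α j x * u x))) :=
    fun φ hφ => by
    have hi1 : Integrable fun x => pd j φ x * u x :=
      Anyon.MemLp.integrable_mul_two ((hφ.pd j).memLp 2) hu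
    have hi2 : Integrable fun x => potential α j x * φ x * u x :=
      Anyon.MemLp.integrable_mul_two ((hφ.mul_contDiffOn isOpen_punctured
        (contDiffOn_potential α j)).memLp 2) hu
    have hi3 : Integrable fun x => φ x * d x := Anyon.MemLp.integrable_mul_two (hφ.memLp 2) hd
    have e1 : (∫ x, conj (covD α j (fun y => conj (φ y)) (pd j (fun y => conj (φ y))) x) * u x)
        = Complex.I * (∫ x, pd j φ x * u x) + ∫ x, potential α j x * φ x * u x := by
      rw [← integral_const_mul, ← integral_add (hi1.const_mul _) hi2]
      congr 1; ext x
      have : pd j (fun y => conj (φ y)) = fun y => conj (pd j φ y) :=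
        funext fun y => pd_conj (hφ.differentiable y) j
      rw [this, conj_covD_conj]
      ring
    have e2 : (∫ x, φ x * (Complex.I * (d x - potential α j x * u x)))
        = Complex.I * ((∫ x, φ x * d x) - ∫ x, potential α j x * φ x * u x) := by
      rw [← integral_sub hi3 hi2, ← integral_const_mul]
      congr 1; ext x
      ring
    rw [e1, e2]
    simp only [Complex.conj_conj]
    constructor <;> intro h
    · linear_combination (-Complex.I) * h + (∫ x, pd j φ x * u x) * Complex.I_sq
    · linear_combination Complex.I * h - ((∫ x, φ x * d x) -
        ∫ x, potential α j x * φ x * u x) * Complex.I_sq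
  constructor
  · intro h φ hφ
    have := (hconv _ hφ.conjugate).2 (h.test hφ.conjugate)
    simpa only [Complex.conj_conj] using this
  · intro h
    exact hasWeakDeriv_iff.2 ⟨locallyIntegrableOn_of_memLp hu _, hloc, fun φ hφ =>
      (hconv φ hφ).1 (h _ hφ.conjugate)⟩

/-! ### The self-adjoint operator of a closed, densely defined form -/

section Abstract

variable {E Y : Type*} [NormedAddCommGroup E] [InnerProductSpace ℂ E]
  [NormedAddCommGroup Y] [InnerProductSpace ℂ Y]

/-- For a subspace `W`, the graph of a closed operator `T`, this is the graph of `T† T`. -/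
def squareGraph (W : Submodule ℂ (WithLp 2 (E × Y))) : Submodule ℂ (E × E) where
  carrier := {p | ∃ d : Y, WithLp.toLp 2 (p.1, d) ∈ W ∧
    ∀ x ∈ W, inner ℂ x.snd d = inner ℂ x.fst p.2}
  add_mem' := by
    rintro p q ⟨d, hd, hd'⟩ ⟨d', he, he'⟩
    refine ⟨d + d', W.add_mem hd he, fun x hx => ?_⟩
    rw [inner_add_right, hd' x hx, he' x hx, Prod.snd_add, inner_add_right]
  zero_mem' := ⟨0, W.zero_mem, fun x _ => by simp⟩
  smul_mem' := by
    rintro c p ⟨d, hd, hd'⟩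
    refine ⟨c • d, W.smul_mem c hd, fun x hx => ?_⟩
    rw [inner_smul_right, hd' x hx, Prod.smul_snd, inner_smul_right]

variable {W : Submodule ℂ (WithLp 2 (E × Y))}

lemma mem_squareGraph {p : E × E} : p ∈ squareGraph W ↔ ∃ d : Y, WithLp.toLp 2 (p.1, d) ∈ W ∧
    ∀ x ∈ W, inner ℂ x.snd d = inner ℂ x.fst p.2 := Iff.rfl

/-- Project `(h, 0)` orthogonally onto the closed graph. Orthogonality of the residual to `W`, read
in components, says that `(1 + T† T) v = h`. -/
lemma exists_squareGraph [CompleteSpace E] [CompleteSpace Y]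
    (hW : IsClosed (W : Set (WithLp 2 (E × Y)))) (h : E) :
    ∃ (v : E) (d : Y), WithLp.toLp 2 (v, d) ∈ W ∧
      ∀ x ∈ W, inner ℂ x.snd d = inner ℂ x.fst (h - v) := by
  have : CompleteSpace W := hW.completeSpace_coe
  set z : WithLp 2 (E × Y) := WithLp.toLp 2 (h, 0)
  set p : WithLp 2 (E × Y) := W.starProjection z
  have hp : p ∈ W := W.starProjection_apply_mem z
  refine ⟨p.fst, p.snd, hp, fun x hx => ?_⟩
  have := W.starProjection_inner_eq_zero z x hx
  rw [← inner_conj_symm, map_eq_zero] at this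
  have h0 : inner ℂ x z = inner ℂ x.fst h := by
    rw [WithLp.prod_inner_apply]
    change inner ℂ x.fst h + inner ℂ x.snd (0 : Y) = _
    rw [inner_zero_right, add_zero]
  have h1 : inner ℂ x p = inner ℂ x.fst p.fst + inner ℂ x.snd p.snd := WithLp.prod_inner_apply _ _
  rw [inner_sub_right, h0, h1] at this
  rw [inner_sub_right]
  linear_combination -this

/-- Von Neumann's theorem: `T† T` is symmetric and `1 + T† T` maps onto the whole space, and these
two facts force density of the domain and self-adjointness. -/
theorem exists_selfAdjoint [CompleteSpace E] [CompleteSpace Y]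
    (hW : IsClosed (W : Set (WithLp 2 (E × Y))))
    (hg : ∀ d : Y, WithLp.toLp 2 (0, d) ∈ W → d = 0)
    (hd : Dense {v : E | ∃ d : Y, WithLp.toLp 2 (v, d) ∈ W}) :
    ∃ H : E →ₗ.[ℂ] E, H.graph = squareGraph W ∧ Dense (H.domain : Set E) ∧ IsSelfAdjoint H := by
  have h1 : ∀ p ∈ squareGraph W, p.1 = 0 → p.2 = 0 := by
    rintro ⟨p, w⟩ ⟨d, hd1, hd2⟩ hp
    obtain rfl : p = 0 := hp
    obtain rfl := hg d hd1
    -- Single-valuedness of `T† T`: if its argument is `0` then `d = 0`, so `w` is orthogonal to the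
    -- domain of `T`, which is dense.
    have h2 : (fun v : E => inner ℂ v w) = fun _ => 0 :=
      Continuous.ext_on hd (by fun_prop) continuous_const fun v hv => by
        obtain ⟨e, he⟩ := hv
        have := hd2 _ he
        rw [inner_zero_right] at this
        exact this.symm
    exact inner_self_eq_zero.1 (congrFun h2 w)
  have hgr := Submodule.toLinearPMap_graph_eq (squareGraph W) h1
  set H := (squareGraph W).toLinearPMap
  have hsurj : ∀ h : E, ∃ v : H.domain, H v = h - v := fun h => by
    obtain ⟨v, d, hv, hvd⟩ := exists_squareGraph hW h
    have : (v, h - v) ∈ H.graph := by rw [hgr]; exact ⟨d, hv, hvd⟩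
    obtain ⟨y, hy1, hy2⟩ := (LinearPMap.mem_graph_iff H).1 this
    exact ⟨y, by rw [hy2]; simp [hy1]⟩
  have hmem : ∀ v : H.domain, ∃ d : Y, WithLp.toLp 2 ((v : E), d) ∈ W ∧
      ∀ x ∈ W, inner ℂ x.snd d = inner ℂ x.fst (H v) := fun v => by
    have := H.mem_graph v
    rw [hgr] at this
    exact this
  have hsymm : ∀ x y : H.domain, inner ℂ (H x) (y : E) = inner ℂ (x : E) (H y) := fun x y => by
    obtain ⟨d, hd1, hd2⟩ := hmem x
    obtain ⟨d', he1, he2⟩ := hmem y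
    have h3 := hd2 _ he1
    have h4 := he2 _ hd1
    change inner ℂ d' d = inner ℂ (y : E) (H x) at h3
    change inner ℂ d d' = inner ℂ (x : E) (H y) at h4
    rw [← h4, ← inner_conj_symm, ← h3, inner_conj_symm]
  have hdense : Dense (H.domain : Set E) := by
    rw [Submodule.dense_iff_topologicalClosure_eq_top, Submodule.topologicalClosure_eq_top_iff,
      Submodule.eq_bot_iff]
    intro x hx
    -- For `x` orthogonal to the domain, solve `(1 + H) v = x` and pair with `v`: the result `‖d‖² =
    -- -‖v‖²` forces `v = 0`, hence `x = 0`.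
    obtain ⟨v, hv⟩ := hsurj x
    obtain ⟨d, hd1, hd2⟩ := hmem v
    have h3 := hd2 _ hd1
    have h4 : inner ℂ (v : E) x = 0 := (Submodule.mem_orthogonal _ _).1 hx v v.2
    change inner ℂ d d = inner ℂ (v : E) (H v) at h3
    rw [hv, inner_sub_right, h4, inner_self_eq_norm_sq_to_K, inner_self_eq_norm_sq_to_K,
      zero_sub] at h3
    have h5 : ‖d‖ ^ 2 = -‖(v : E)‖ ^ 2 := by
      have := congrArg Complex.re h3
      norm_cast at this
    have h6 : (v : E) = 0 := by
      rw [← norm_eq_zero]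
      nlinarith [sq_nonneg ‖d‖, sq_nonneg ‖(v : E)‖]
    have h7 : v = 0 := Subtype.ext h6
    rw [h7] at hv
    simpa using hv.symm
  refine ⟨H, hgr, hdense, ?_⟩
  rw [LinearPMap.isSelfAdjoint_def]
  have hle : H ≤ H.adjoint := LinearPMap.IsFormalAdjoint.le_adjoint hdense (fun x y => hsymm x y)
  refine le_antisymm ?_ hle
  have hdom : ∀ y : H.adjoint.domain, (y : E) ∈ H.domain := fun y => by
    -- With `(1 + H) v = (1 + H†) y`, the difference `v - y` is orthogonal to the range of `1 + H`,
    -- which is everything; so `y = v` lies in the domain of `H`.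
    obtain ⟨v, hv⟩ := hsurj (y + H.adjoint y)
    have key : ∀ x : H.domain, inner ℂ ((v : E) - y) (H x + x) = 0 := fun x => by
      have h3 := LinearPMap.adjoint_isFormalAdjoint hdense y x
      rw [inner_add_right, inner_sub_left, inner_sub_left, ← h3, ← hsymm v x, hv, inner_sub_left,
        inner_add_left]
      ring
    obtain ⟨x, hx⟩ := hsurj ((v : E) - y)
    have := key x
    rw [hx, sub_add_cancel, inner_self_eq_zero, sub_eq_zero] at this
    rw [← this]
    exact v.2
  exact ⟨fun y hy => hdom ⟨y, hy⟩, fun x y hxy => by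
    have := hle.2 (x := ⟨x, hdom x⟩) (y := x) rfl
    rw [← this]
    congr 1
    exact Subtype.ext hxy⟩

end Abstract

/-! ### The graph of the covariant gradient -/

/-- Square-integrable vector fields. -/
abbrev L2Vec : Type := PiLp 2 fun _ : Fin 2 => L2

lemma inner_toLp_left {f : Plane → ℂ} (hf : MemLp f 2 volume) (g : L2) :
    inner ℂ (hf.toLp f) g = ∫ x, conj (f x) * g x := by
  rw [L2.inner_def]
  refine integral_congr_ae ?_
  filter_upwards [hf.coeFn_toLp] with x h1
  rw [h1, RCLike.inner_apply, mul_comm]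

lemma inner_L2 (f g : L2) : inner ℂ f g = ∫ x, conj (f x) * g x := by
  rw [← inner_toLp_left (Lp.memLp f), Lp.toLp_coeFn]

lemma norm_sq_L2 (f : L2) : ‖f‖ ^ 2 = ∫ x, ‖f x‖ ^ 2 := by
  have h := inner_self_eq_norm_sq_to_K (𝕜 := ℂ) f
  rw [inner_L2] at h
  have h2 : (∫ x, conj (f x) * f x) = ((∫ x, ‖f x‖ ^ 2 : ℝ) : ℂ) := by
    rw [← integral_complex_ofReal]
    congr 1; ext x
    rw [Complex.conj_mul']
    push_cast; rfl
  rw [h2] at h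
  exact Complex.ofReal_injective (by rw [h]; push_cast; rfl)

lemma norm_sq_L2Vec (g : L2Vec) : ‖g‖ ^ 2 = ∫ x, ∑ j, ‖g j x‖ ^ 2 := by
  rw [PiLp.norm_sq_eq_of_L2, integral_finsetSum _ fun j _ => (memLp_two_iff_integrable_sq_norm
    (Lp.memLp (g j)).1).1 (Lp.memLp (g j))]
  simp only [norm_sq_L2]

lemma inner_L2Vec (g h : L2Vec) : inner ℂ g h = ∫ x, ∑ j, conj (g j x) * h j x := by
  rw [PiLp.inner_apply, integral_finsetSum _ fun j _ => Anyon.MemLp.integrable_mul_two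
    (MemLp.conjugate (Lp.memLp (g j))) (Lp.memLp (h j))]
  simp only [inner_L2]

lemma memLp_rep (ψ : L2even) : MemLp (rep ψ) 2 volume := Lp.memLp _

lemma rep_even (ψ : L2even) : ∀ᵐ x, rep ψ (-x) = rep ψ x := ψ.2

lemma inner_L2even (φ ψ : L2even) : inner ℂ φ ψ = ∫ x, conj (rep φ x) * rep ψ x :=
  inner_L2 _ _

lemma memLp_covD_test {φ : Plane → ℂ} (hφ : IsTest punctured φ) (α : ℝ) (j : Fin 2) :
    MemLp (covD α j φ (pd j φ)) 2 volume :=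
  (((hφ.pd j).memLp 2).const_mul _).add
    ((hφ.mul_contDiffOn isOpen_punctured (contDiffOn_potential α j)).memLp 2)

lemma weakD_ae {α : ℝ} {j : Fin 2} {u v : Plane → ℂ} (h : HasWeakDeriv punctured j u v) :
    weakD α j u =ᵐ[volume] covD α j u v := by
  filter_upwards [(weakDeriv_spec ⟨v, h⟩).unique_punctured h] with x hx
  rw [weakD, covD, hx]

lemma inV_of_isTest {φ : Plane → ℂ} (hφ : IsTest punctured φ) (he : ∀ x, φ (-x) = φ x) (α : ℝ) :
    InV α φ fun j => pd j φ :=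
  ⟨hφ.memLp 2, ae_of_all _ he, fun j => HasWeakDeriv.of_contDiffOn isOpen_punctured
    hφ.contDiff.contDiffOn j, fun j => memLp_covD_test hφ α j⟩

/-- The graph of the covariant gradient on even functions. -/
def formGraph (α : ℝ) : Submodule ℂ (WithLp 2 (L2even × L2Vec)) where
  carrier := {x | ∀ (φ : Plane → ℂ) (hφ : IsTest punctured φ) (j : Fin 2),
    inner ℂ ((memLp_covD_test hφ α j).toLp _) (x.fst : L2) = inner ℂ ((hφ.memLp 2).toLp _) (x.snd j)}
  add_mem' := by
    intro a b ha hb φ hφ j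
    simp only [WithLp.add_fst, WithLp.add_snd, Submodule.coe_add, PiLp.add_apply, inner_add_right,
      ha φ hφ j, hb φ hφ j]
  zero_mem' := by
    intro φ hφ j
    simp
  smul_mem' := by
    intro c a ha φ hφ j
    simp only [WithLp.smul_fst, WithLp.smul_snd, Submodule.coe_smul, PiLp.smul_apply,
      inner_smul_right, ha φ hφ j]

/-- Each defining condition compares two continuous functionals. This is the reason for describing
the graph by pairings with test functions rather than by weak derivatives. -/
lemma isClosed_formGraph (α : ℝ) : IsClosed (formGraph α : Set (WithLp 2 (L2even × L2Vec))) := by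
  have : (formGraph α : Set (WithLp 2 (L2even × L2Vec))) =
      ⋂ (φ : Plane → ℂ) (hφ : IsTest punctured φ) (j : Fin 2), {x |
    inner ℂ ((memLp_covD_test hφ α j).toLp _) (x.fst : L2) = inner ℂ ((hφ.memLp 2).toLp _) (x.snd j)} := by
    ext x; simp only [mem_iInter]; rfl
  rw [this]
  refine isClosed_iInter fun φ => isClosed_iInter fun hφ => isClosed_iInter fun j =>
    isClosed_eq ?_ ?_
  · have h1 : Continuous fun x : WithLp 2 (L2even × L2Vec) => (x.fst : L2) := by fun_prop
    exact continuous_const.inner h1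
  · have h1 : Continuous fun x : WithLp 2 (L2even × L2Vec) => x.snd j := by fun_prop
    exact continuous_const.inner h1

/-- Translation between the pairing description and weak gradients: from `d = -i v + A u` the
gradient is recovered as `i (d - A u)`. -/
lemma mem_formGraph {α : ℝ} {x : WithLp 2 (L2even × L2Vec)} : x ∈ formGraph α ↔
    ∀ j, HasWeakDeriv punctured j (rep x.fst)
      (fun y => Complex.I * (x.snd j y - potential α j y * rep x.fst y)) := by
  simp only [hasWeakDeriv_iff_covariant (memLp_rep _) (Lp.memLp _)]
  constructor
  · intro h j φ hφ
    have := h φ hφ j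
    rwa [inner_toLp_left, inner_toLp_left] at this
  · intro h φ hφ j
    rw [inner_toLp_left, inner_toLp_left]
    exact h j φ hφ

lemma covD_gradient (α : ℝ) (j : Fin 2) (u d : Plane → ℂ) (x : Plane) :
    covD α j u (fun y => Complex.I * (d y - potential α j y * u y)) x = d x := by
  simp only [covD]
  linear_combination (potential α j x * u x - d x) * Complex.I_sq

lemma inV_of_mem_formGraph {α : ℝ} {x : WithLp 2 (L2even × L2Vec)} (h : x ∈ formGraph α) :
    InV α (rep x.fst) fun j y => Complex.I * (x.snd j y - potential α j y * rep x.fst y) := by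
  refine ⟨memLp_rep _, rep_even _, mem_formGraph.1 h, fun j => ?_⟩
  have : covD α j (rep x.fst) (fun y => Complex.I * (x.snd j y - potential α j y * rep x.fst y))
      = x.snd j := funext (covD_gradient α j _ _)
  rw [this]
  exact Lp.memLp _

lemma weakD_of_mem_formGraph {α : ℝ} {x : WithLp 2 (L2even × L2Vec)} (h : x ∈ formGraph α)
    (j : Fin 2) : weakD α j (rep x.fst) =ᵐ[volume] x.snd j :=
  (weakD_ae (mem_formGraph.1 h j)).trans (ae_of_all _ (covD_gradient α j _ _))

lemma mem_formGraph_of_ae {α : ℝ} {ψ : L2even} {d : L2Vec} {u : Plane → ℂ}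
    {v : Fin 2 → Plane → ℂ} (hu : rep ψ =ᵐ[volume] u)
    (hd : ∀ j, d j =ᵐ[volume] covD α j u (v j)) (hv : ∀ j, HasWeakDeriv punctured j u (v j)) :
    WithLp.toLp 2 (ψ, d) ∈ formGraph α := by
  refine mem_formGraph.2 fun j => (hv j).congr_ae isOpen_punctured hu.symm ?_
  filter_upwards [hu, hd j] with x h1 h2
  change _ = Complex.I * (d j x - potential α j x * rep ψ x)
  rw [h1, h2, covD]
  linear_combination v j x * Complex.I_sq

lemma exists_mem_formGraph {α : ℝ} {ψ : L2even} {v : Fin 2 → Plane → ℂ} (h : InV α (rep ψ) v) :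
    ∃ d : L2Vec, WithLp.toLp 2 (ψ, d) ∈ formGraph α ∧
      ∀ j, d j =ᵐ[volume] covD α j (rep ψ) (v j) :=
  ⟨WithLp.toLp 2 fun j => (h.memLp_cov j).toLp _, mem_formGraph_of_ae (ae_eq_refl _)
    (fun j => (h.memLp_cov j).coeFn_toLp) h.deriv, fun j => (h.memLp_cov j).coeFn_toLp⟩

lemma finiteEnergy_iff {α : ℝ} {ψ : L2even} :
    FiniteEnergy α (rep ψ) ↔ ∃ d, WithLp.toLp 2 (ψ, d) ∈ formGraph α := by
  constructor
  · intro h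
    have : InV α (rep ψ) fun j => weakDeriv punctured j (rep ψ) :=
      ⟨memLp_rep ψ, rep_even ψ, fun j => weakDeriv_spec (h j).1, fun j => (h j).2⟩
    obtain ⟨d, hd, -⟩ := exists_mem_formGraph this
    exact ⟨d, hd⟩
  · rintro ⟨d, hd⟩ j
    exact ⟨⟨_, mem_formGraph.1 hd j⟩, (Lp.memLp (d j)).ae_eq (weakD_of_mem_formGraph hd j).symm⟩

lemma form_eq_norm_sq {α : ℝ} {u : Plane → ℂ} {d : L2Vec}
    (h : ∀ j, weakD α j u =ᵐ[volume] d j) : form α u = ‖d‖ ^ 2 := by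
  rw [form, norm_sq_L2Vec]
  refine integral_congr_ae ?_
  filter_upwards [h 0, h 1] with x h0 h1
  simp only [Fin.sum_univ_two, h0, h1]

lemma sesqForm_eq_inner {α : ℝ} {u v : Plane → ℂ} {d d' : L2Vec}
    (h : ∀ j, weakD α j u =ᵐ[volume] d j) (h' : ∀ j, weakD α j v =ᵐ[volume] d' j) :
    sesqForm α u v = inner ℂ d d' := by
  rw [sesqForm, inner_L2Vec]
  refine integral_congr_ae ?_
  filter_upwards [h 0, h 1, h' 0, h' 1] with x h0 h1 h2 h3
  simp only [Fin.sum_univ_two, h0, h1, h2, h3]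

lemma formGraph_zero {α : ℝ} {d : L2Vec} (h : WithLp.toLp 2 ((0 : L2even), d) ∈ formGraph α) :
    d = 0 := by
  ext1 j
  refine Lp.ext (Filter.EventuallyEq.trans ?_ (Lp.coeFn_zero ℂ 2 volume).symm)
  refine ae_eq_of_test_punctured (locallyIntegrableOn_of_memLp (Lp.memLp _) _)
    (locallyIntegrableOn_of_memLp (MemLp.zero' (p := 2)) _) fun φ hφ => ?_
  have := h _ hφ.conjugate j
  rw [inner_toLp_left (hφ.conjugate.memLp 2)] at this
  simp only [Complex.conj_conj, WithLp.toLp_fst, WithLp.toLp_snd, ZeroMemClass.coe_zero,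
    inner_zero_right] at this
  rw [← this]
  simp

/-- An even test function as a vector. -/
lemma exists_test_mem_formGraph (α : ℝ) {φ : Plane → ℂ} (hφ : IsTest punctured φ)
    (he : ∀ x, φ (-x) = φ x) : ∃ x ∈ formGraph α, rep x.fst =ᵐ[volume] φ ∧
      ∀ j, x.snd j =ᵐ[volume] covD α j φ (pd j φ) := by
  have h1 := (hφ.memLp 2).coeFn_toLp
  let ψ : L2even := ⟨(hφ.memLp 2).toLp φ, by
    change ∀ᵐ x : Plane, _
    filter_upwards [h1, ae_neg h1] with x h2 h3
    rw [h3, h2, he]⟩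
  refine ⟨WithLp.toLp 2 (ψ, WithLp.toLp 2 fun j => (memLp_covD_test hφ α j).toLp _), ?_, h1,
    fun j => (memLp_covD_test hφ α j).coeFn_toLp⟩
  exact mem_formGraph_of_ae h1 (fun j => (memLp_covD_test hφ α j).coeFn_toLp) (inV_of_isTest hφ he α).deriv

/-- Already the even test functions are dense: a vector orthogonal to them is even, hence orthogonal
to every test function after symmetrisation, hence zero. -/
lemma dense_formGraph_fst (α : ℝ) :
    Dense {v : L2even | ∃ d : L2Vec, WithLp.toLp 2 (v, d) ∈ formGraph α} := by
  have : {v : L2even | ∃ d : L2Vec, WithLp.toLp 2 (v, d) ∈ formGraph α} =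
      ((formGraph α).map (WithLp.fstₗ 2 ℂ L2even L2Vec) : Submodule ℂ L2even) := by
    ext v
    exact ⟨fun ⟨d, hd⟩ => ⟨_, hd, rfl⟩, fun ⟨x, hx, hv⟩ => ⟨x.snd, by rw [← hv]; exact hx⟩⟩
  rw [this, Submodule.dense_iff_topologicalClosure_eq_top, Submodule.topologicalClosure_eq_top_iff,
    Submodule.eq_bot_iff]
  intro w hw
  have hw' : ∀ φ, IsTest punctured φ → (∀ x, φ (-x) = φ x) → ∫ x, conj (φ x) * rep w x = 0 := by
    intro φ hφ he
    obtain ⟨x, hx, hx1, -⟩ := exists_test_mem_formGraph α hφ he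
    have := (Submodule.mem_orthogonal _ _).1 hw x.fst ⟨x, hx, rfl⟩
    rw [inner_L2even] at this
    rw [← this]
    refine integral_congr_ae ?_
    filter_upwards [hx1] with y hy
    rw [hy]
  have : rep w =ᵐ[volume] 0 := by
    refine ae_eq_of_test_punctured (locallyIntegrableOn_of_memLp (memLp_rep w) _)
      (locallyIntegrableOn_of_memLp (MemLp.zero' (p := 2)) _) fun φ hφ => ?_
    have h1 := hw' _ (hφ.conjugate.add hφ.conjugate.comp_neg)
      (fun x => by simp only [neg_neg]; rw [add_comm])
    simp only [map_add, Complex.conj_conj, add_mul] at h1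
    rw [integral_add (Anyon.MemLp.integrable_mul_two (hφ.memLp 2) (memLp_rep w))
      (Anyon.MemLp.integrable_mul_two (hφ.comp_neg.memLp 2) (memLp_rep w))] at h1
    have h2 : ∫ x, φ (-x) * rep w x = ∫ x, φ x * rep w x := by
      rw [← integral_neg_eq_self]
      refine integral_congr_ae ?_
      filter_upwards [rep_even w] with x hx
      rw [neg_neg, hx]
    rw [h2, ← two_mul] at h1
    simpa using h1
  exact Subtype.ext (Lp.ext (this.trans (Lp.coeFn_zero ℂ 2 volume).symm))

/-- The closure of the even test functions in the energy norm. -/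
lemma formGraph_le_closure {α : ℝ} (h0 : 0 ≤ α) (h1 : α ≤ 1) :
    formGraph α ≤ (Submodule.span ℂ {x | x ∈ formGraph α ∧ ∃ φ, IsTest punctured φ ∧
      rep x.fst =ᵐ[volume] φ ∧ ∀ j, x.snd j =ᵐ[volume] covD α j φ (pd j φ)}).topologicalClosure := by
  set T := Submodule.span ℂ {x | x ∈ formGraph α ∧ ∃ φ, IsTest punctured φ ∧
      rep x.fst =ᵐ[volume] φ ∧ ∀ j, x.snd j =ᵐ[volume] covD α j φ (pd j φ)}
  have hT : T.topologicalClosure ≤ formGraph α :=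
    Submodule.topologicalClosure_minimal _ (Submodule.span_le.2 fun x hx => hx.1)
      (isClosed_formGraph α)
  intro x hx
  have : CompleteSpace T.topologicalClosure := T.isClosed_topologicalClosure.completeSpace_coe
  set p := T.topologicalClosure.starProjection x
  have hp : p ∈ T.topologicalClosure := T.topologicalClosure.starProjection_apply_mem x
  set r := x - p
  have hr : r ∈ formGraph α := (formGraph α).sub_mem hx (hT hp)
  have horth : ∀ y ∈ T, inner ℂ y r = 0 := fun y hy => by
    have := T.topologicalClosure.starProjection_inner_eq_zero x y (T.le_topologicalClosure hy)
    rwa [← inner_conj_symm, map_eq_zero] at this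
  have hV := inV_of_mem_formGraph hr
  have hcov : ∀ j y, covD α j (rep r.fst)
      (fun y => Complex.I * (r.snd j y - potential α j y * rep r.fst y)) y = r.snd j y :=
    fun j => covD_gradient α j _ _
  -- Orthogonality of `r` to the even test functions in the graph inner product is the weak equation
  -- `H_α r = -r`.
  have hop : InOp α (rep r.fst) (fun j y => Complex.I * (r.snd j y - potential α j y * rep r.fst y))
      (fun y => - rep r.fst y) := by
    refine hV.inOp_of_even_tests (memLp_rep _).neg ?_ fun φ hφ he => ?_
    · filter_upwards [rep_even r.fst] with y hy
      rw [hy]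
    · obtain ⟨y, hy, hy1, hy2⟩ := exists_test_mem_formGraph α hφ he
      have h2 := horth y (Submodule.subset_span ⟨hy, φ, hφ, hy1, hy2⟩)
      rw [WithLp.prod_inner_apply] at h2
      change inner ℂ y.fst r.fst + inner ℂ y.snd r.snd = 0 at h2
      rw [inner_L2even, inner_L2Vec] at h2
      simp only [hcov, mul_neg, integral_neg]
      rw [eq_neg_iff_add_eq_zero, add_comm, ← h2]
      congr 1
      · refine integral_congr_ae ?_
        filter_upwards [hy1] with z hz
        rw [hz]
      · refine integral_congr_ae ?_
        filter_upwards [hy2 0, hy2 1] with z hz hz'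
        simp only [Fin.sum_univ_two, hz, hz']
  -- Testing the equation with `r` itself makes its graph norm vanish.
  have h2 := hop.eq_of_inV h0 h1 hV
  simp only [hcov, mul_neg, integral_neg] at h2
  rw [← inner_L2Vec, ← inner_L2even, eq_neg_iff_add_eq_zero, add_comm] at h2
  have h3 : inner ℂ r r = 0 := by
    rw [WithLp.prod_inner_apply]
    exact h2
  have h4 : x = p := sub_eq_zero.1 (inner_self_eq_zero.1 h3)
  rw [h4]
  exact hp

/-- By the density of test functions in the graph, the approximation condition in the form domain is
automatic: on even functions the minimal and the maximal form coincide. -/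
lemma mem_formDomain_iff {α : ℝ} (h0 : 0 ≤ α) (h1 : α ≤ 1) {ψ : L2even} :
    ψ ∈ formDomain α ↔ ∃ d, WithLp.toLp 2 (ψ, d) ∈ formGraph α := by
  refine ⟨fun h => finiteEnergy_iff.1 h.1, fun h => ⟨finiteEnergy_iff.2 h, ?_⟩⟩
  obtain ⟨d, hd⟩ := h
  have hc := formGraph_le_closure h0 h1 hd
  rw [← SetLike.mem_coe, Submodule.topologicalClosure_coe, mem_closure_iff_seq_limit] at hc
  obtain ⟨x, hx, hl⟩ := hc
  -- The span contains nothing new, because test functions form a linear space and `D_α` is linear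
  -- on them.
  have hx' : ∀ n, ∃ φ, IsTest punctured φ ∧ rep (x n).fst =ᵐ[volume] φ ∧
      ∀ j, (x n).snd j =ᵐ[volume] covD α j φ (pd j φ) := fun n => by
    refine Submodule.span_induction (p := fun y _ => ∃ φ, IsTest punctured φ ∧
      rep y.fst =ᵐ[volume] φ ∧ ∀ j, y.snd j =ᵐ[volume] covD α j φ (pd j φ)) ?_ ?_ ?_ ?_ (hx n)
    · exact fun y hy => hy.2
    · refine ⟨fun _ => 0, ⟨contDiff_const, HasCompactSupport.zero, ?_⟩, Lp.coeFn_zero ℂ 2 volume,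
        fun j => ?_⟩
      · simp [tsupport]
      · filter_upwards [Lp.coeFn_zero ℂ 2 (volume : Measure Plane)] with y hy
        rw [show covD α j (fun _ => 0) (pd j fun _ => 0) y = 0 by simp [covD, pd]]
        exact hy
    · rintro y z - - ⟨φ, hφ, hy1, hy2⟩ ⟨η, hη, hz1, hz2⟩
      refine ⟨_, hφ.add hη, ?_, fun j => ?_⟩
      · filter_upwards [hy1, hz1, Lp.coeFn_add (y.fst : L2) z.fst] with t h2 h3 h4
        exact h4.trans (congrArg₂ (· + ·) h2 h3)
      · filter_upwards [hy2 j, hz2 j, Lp.coeFn_add (y.snd j) (z.snd j)] with t h2 h3 h4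
        refine h4.trans ((congrArg₂ (· + ·) h2 h3).trans ?_)
        simp only [covD]
        rw [pd_add (hφ.differentiable t) (hη.differentiable t)]
        ring
    · rintro c y - ⟨φ, hφ, hy1, hy2⟩
      refine ⟨_, hφ.const_mul c, ?_, fun j => ?_⟩
      · filter_upwards [hy1, Lp.coeFn_smul c (y.fst : L2)] with t h2 h4
        exact h4.trans (congrArg (c * ·) h2)
      · filter_upwards [hy2 j, Lp.coeFn_smul c (y.snd j)] with t h2 h4
        refine h4.trans ((congrArg (c * ·) h2).trans ?_)
        simp only [covD]
        rw [pd_const_mul (hφ.differentiable t)]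
        ring
  choose φ hφ hφ1 hφ2 using hx'
  refine ⟨φ, hφ, ?_⟩
  have key : ∀ n, form α (φ n - rep ψ) = ‖(x n).snd - d‖ ^ 2 := fun n => by
    refine form_eq_norm_sq fun j => ?_
    have h3 := (HasWeakDeriv.of_contDiffOn isOpen_punctured (hφ n).contDiff.contDiffOn j).sub
      (mem_formGraph.1 hd j)
    refine (weakD_ae h3).trans ?_
    filter_upwards [hφ2 n j, Lp.coeFn_sub ((x n).snd j) (d j)] with t h4 h5
    refine Eq.trans ?_ h5.symm
    rw [Pi.sub_apply, h4]
    change covD α j (fun x => φ n x - rep ψ x) (fun x => pd j (φ n) x -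
      Complex.I * (d j x - potential α j x * rep ψ x)) t = _
    simp only [covD]
    linear_combination (d j t - potential α j t * rep ψ t) * Complex.I_sq
  simp only [key]
  have h3 : Tendsto (fun n => (x n).snd - d) atTop (𝓝 (d - d)) := by
    have : Continuous fun y : WithLp 2 (L2even × L2Vec) => y.snd := by fun_prop
    exact ((this.tendsto _).comp hl).sub_const d
  have := (h3.norm).pow 2
  simpa using this

/-! ### Closedness of the form and the associated operator -/

lemma weakD_of_toLp_mem {α : ℝ} {ψ : L2even} {d : L2Vec} (h : WithLp.toLp 2 (ψ, d) ∈ formGraph α)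
    (j : Fin 2) : weakD α j (rep ψ) =ᵐ[volume] d j :=
  weakD_of_mem_formGraph h j

lemma toLp_sub_mem {α : ℝ} {φ η : L2even} {a b : L2Vec}
    (ha : WithLp.toLp 2 (φ, a) ∈ formGraph α) (hb : WithLp.toLp 2 (η, b) ∈ formGraph α) :
    WithLp.toLp 2 (φ - η, a - b) ∈ formGraph α := by
  have := (formGraph α).sub_mem ha hb
  rwa [← WithLp.toLp_sub, Prod.mk_sub_mk] at this

/-- A sequence that is Cauchy for the form has convergent covariant gradients, and closedness of the
graph identifies their limit. -/
theorem formIsClosed {α : ℝ} (h0 : 0 ≤ α) (h1 : α ≤ 1) : FormIsClosed α := by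
  intro ψ ψlim hψ hl hc
  choose d hd using fun n => (mem_formDomain_iff h0 h1).1 (hψ n)
  have hsub : ∀ {φ η : L2even} {a b : L2Vec}, WithLp.toLp 2 (φ, a) ∈ formGraph α →
      WithLp.toLp 2 (η, b) ∈ formGraph α → form α (rep (φ - η)) = ‖a - b‖ ^ 2 := by
    intro φ η a b ha hb
    exact form_eq_norm_sq (weakD_of_toLp_mem (toLp_sub_mem ha hb))
  have hcauchy : CauchySeq d := by
    rw [cauchySeq_iff_tendsto_dist_atTop_0, ← prod_atTop_atTop_eq]
    rw [← prod_atTop_atTop_eq] at hc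
    have := (Real.continuous_sqrt.tendsto 0).comp hc
    rw [Real.sqrt_zero] at this
    refine this.congr fun p => ?_
    simp only [Function.comp]
    rw [hsub (hd p.1) (hd p.2), Real.sqrt_sq (norm_nonneg _), dist_eq_norm]
  obtain ⟨dlim, hdl⟩ := cauchySeq_tendsto_of_complete hcauchy
  have hlim : WithLp.toLp 2 (ψlim, dlim) ∈ formGraph α := by
    refine (isClosed_formGraph α).mem_of_tendsto (b := atTop)
      (f := fun n => WithLp.toLp 2 (ψ n, d n)) ?_ (Eventually.of_forall hd)
    exact ((WithLp.prod_continuous_toLp 2 L2even L2Vec).tendsto _).comp (hl.prodMk_nhds hdl)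
  refine ⟨(mem_formDomain_iff h0 h1).2 ⟨_, hlim⟩, ?_⟩
  simp only [fun n => hsub (hd n) hlim]
  have := ((hdl.sub_const dlim).norm).pow 2
  simpa using this

lemma form_nonneg (α : ℝ) (u : Plane → ℂ) : 0 ≤ form α u :=
  integral_nonneg fun _ => Finset.sum_nonneg fun _ _ => sq_nonneg _

/-! ### The distributional operator, the weak equation and the self-adjoint operator -/

variable {α : ℝ} {u f : Plane → ℂ} {v : Fin 2 → Plane → ℂ}

/-- Each `D_j φ` is again a test function off the origin, so one of the two covariant derivatives
can be moved from it onto `u`. -/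
lemma InV.integral_classicalH (h : InV α u v) {φ : Plane → ℂ} (hφ : IsTest punctured φ) :
    ∫ x, conj (classicalH α φ x) * u x
      = ∫ x, ∑ j, conj (covD α j φ (pd j φ) x) * covD α j u (v j) x := by
  have hη : ∀ j, IsTest punctured (covD α j φ (pd j φ)) := fun j =>
    ((hφ.pd j).const_mul _).add (hφ.mul_contDiffOn isOpen_punctured (contDiffOn_potential α j))
  have hd : ∀ j, HasWeakDeriv punctured j u
      (fun x => Complex.I * (covD α j u (v j) x - potential α j x * u x)) := fun j => by
    refine (h.deriv j).congr_ae isOpen_punctured (ae_eq_refl _) (ae_of_all _ fun x => ?_)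
    simp only [covD]
    linear_combination v j x * Complex.I_sq
  have key := fun j => (hasWeakDeriv_iff_covariant h.memLp (h.memLp_cov j)).1 (hd j) _ (hη j)
  rw [integral_finsetSum _ fun j _ => Anyon.MemLp.integrable_mul_two
    (MemLp.conjugate ((hη j).memLp 2)) (h.memLp_cov j)]
  simp only [← key]
  rw [← integral_finsetSum _ fun j _ => Anyon.MemLp.integrable_mul_two
    (MemLp.conjugate (memLp_covD_test (hη j) α j)) h.memLp]
  congr 1; ext x
  rw [← Finset.sum_mul, ← map_sum]
  rfl

lemma InV.isH_iff (h : InV α u v) (hf : MemLp f 2 volume) : IsH α u f ↔ InOp α u v f := by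
  unfold IsH
  simp only [restrict_punctured]
  constructor
  · rintro ⟨-, -, he⟩
    exact ⟨h, hf, fun φ hφ => by rw [← h.integral_classicalH hφ]; exact he φ hφ⟩
  · intro ho
    exact ⟨locallyIntegrableOn_of_memLp h.memLp _, locallyIntegrableOn_of_memLp hf _,
      fun φ hφ => by rw [h.integral_classicalH hφ]; exact ho.eq φ hφ⟩

lemma InOp.congr_rhs {f' : Plane → ℂ} (h : InOp α u v f) (hf : f =ᵐ[volume] f') :
    InOp α u v f' :=
  ⟨h.toInV, h.memLp_rhs.ae_eq hf, fun φ hφ => by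
    rw [h.eq φ hφ]
    exact integral_congr_ae (by filter_upwards [hf] with x hx; rw [hx])⟩

/-- From left to right it is enough to test with even test functions (`InV.inOp_of_even_tests`);
from right to left the weak equation must be tested with all of the form domain, which is
`InOp.eq_of_inV`. -/
lemma mem_squareGraph_formGraph (h0 : 0 ≤ α) (h1 : α ≤ 1) {ψ w : L2even} :
    (ψ, w) ∈ squareGraph (formGraph α) ↔ ∃ v, InOp α (rep ψ) v (rep w) := by
  rw [mem_squareGraph]
  constructor
  · rintro ⟨d, hd, hd'⟩
    have hV := inV_of_mem_formGraph hd
    refine ⟨_, hV.inOp_of_even_tests (memLp_rep w) (rep_even w) fun φ hφ he => ?_⟩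
    obtain ⟨x, hx, hx1, hx2⟩ := exists_test_mem_formGraph α hφ he
    have h2 := hd' x hx
    rw [inner_L2even, inner_L2Vec] at h2
    refine Eq.trans (integral_congr_ae ?_) (h2.trans (integral_congr_ae ?_))
    · filter_upwards [hx2 0, hx2 1] with y hy hy'
      have := fun j => covD_gradient α j (rep ψ) (d j) y
      simp only [Fin.sum_univ_two, hy, hy']
      exact congrArg₂ (· + ·) (congrArg _ (this 0)) (congrArg _ (this 1))
    · filter_upwards [hx1] with y hy
      rw [hy]
  · rintro ⟨v, hv⟩
    obtain ⟨d, hd, hd'⟩ := exists_mem_formGraph hv.toInV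
    refine ⟨d, hd, fun x hx => ?_⟩
    have h2 := hv.eq_of_inV h0 h1 (inV_of_mem_formGraph hx)
    rw [inner_L2even, inner_L2Vec]
    refine Eq.trans (integral_congr_ae ?_) h2
    filter_upwards [hd' 0, hd' 1] with y hy hy'
    simp only [Fin.sum_univ_two, hy, hy', covD_gradient]

/-- Von Neumann's theorem applied to the covariant gradient. The last clause, membership as
solvability of the weak equation, is the form in which the explicit domain is computed. -/
theorem exists_operator (h0 : 0 ≤ α) (h1 : α ≤ 1) : ∃ H : L2even →ₗ.[ℂ] L2even,
    IsAssociatedOperator α H ∧ Dense (H.domain : Set L2even) ∧ IsSelfAdjoint H ∧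
    (∀ ψ : H.domain, IsH α (rep (ψ : L2even)) (rep (H ψ))) ∧
    (H.domain : Set L2even) =
      {ψ | ψ ∈ formDomain α ∧ ∃ f : Plane → ℂ, MemLp f 2 volume ∧ IsH α (rep ψ) f} ∧
    ∀ ψ, ψ ∈ H.domain ↔ ∃ v f, InOp α (rep ψ) v f := by
  obtain ⟨H, hgr, hdense, hsa⟩ := exists_selfAdjoint (isClosed_formGraph α)
    (fun d => formGraph_zero) (dense_formGraph_fst α)
  have hdom : ∀ ψ, ψ ∈ H.domain ↔ ∃ v f, InOp α (rep ψ) v f := fun ψ => by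
    rw [LinearPMap.mem_domain_iff, hgr]
    simp only [mem_squareGraph_formGraph h0 h1]
    constructor
    · rintro ⟨w, v, h⟩
      exact ⟨v, _, h⟩
    · rintro ⟨v, f, h⟩
      -- The right-hand side is a priori only a function in `L²`; it must be shown even to be a
      -- value of the operator.
      have hf := h.memLp_rhs.coeFn_toLp
      refine ⟨⟨h.memLp_rhs.toLp f, ?_⟩, v, h.congr_rhs hf.symm⟩
      change ∀ᵐ x : Plane, _
      filter_upwards [hf, ae_neg hf, h.even_rhs] with x h2 h3 h4
      rw [h2, h3, h4]
  refine ⟨H, fun ψ w => ?_, hdense, hsa, fun ψ => ?_, ?_, hdom⟩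
  · rw [hgr, mem_squareGraph]
    simp only [mem_formDomain_iff h0 h1]
    constructor
    · rintro ⟨d, hd, hd'⟩
      refine ⟨⟨d, hd⟩, fun u ⟨d', hu⟩ => ?_⟩
      rw [sesqForm_eq_inner (weakD_of_toLp_mem hu) (weakD_of_toLp_mem hd)]
      exact hd' _ hu
    · rintro ⟨⟨d, hd⟩, hd'⟩
      refine ⟨d, hd, fun x hx => ?_⟩
      rw [← hd' x.fst ⟨x.snd, hx⟩,
        sesqForm_eq_inner (weakD_of_mem_formGraph hx) (weakD_of_toLp_mem hd)]
  · have := H.mem_graph ψ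
    rw [hgr, mem_squareGraph_formGraph h0 h1] at this
    obtain ⟨v, hv⟩ := this
    exact (hv.toInV.isH_iff (memLp_rep _)).2 hv
  · ext ψ
    rw [SetLike.mem_coe, hdom]
    constructor
    · rintro ⟨v, f, h⟩
      obtain ⟨d, hd, -⟩ := exists_mem_formGraph h.toInV
      exact ⟨(mem_formDomain_iff h0 h1).2 ⟨d, hd⟩, f, h.memLp_rhs,
        (h.toInV.isH_iff h.memLp_rhs).2 h⟩
    · rintro ⟨hψ, f, hf, hH⟩
      obtain ⟨d, hd⟩ := (mem_formDomain_iff h0 h1).1 hψ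
      exact ⟨_, f, ((inV_of_mem_formGraph hd).isH_iff hf).1 hH⟩

lemma memH_one_of_mem_formDomain (h0 : 0 ≤ α) (h1 : α ≤ 1) {ψ : L2even}
    (hψ : ψ ∈ formDomain α) : MemH 1 univ (rep ψ) := by
  obtain ⟨d, hd⟩ := (mem_formDomain_iff h0 h1).1 hψ
  exact (inV_of_mem_formGraph hd).memH_one h0 h1

/-! ### Reduction to angular momentum sectors -/

variable {α : ℝ} {u f : Plane → ℂ} {v : Fin 2 → Plane → ℂ}

/-- In complex notation `A₀ ± i A₁ = ± i α e^(±iϑ) / r`, a function of pure angular momentum `±1`.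
-/
lemma potential_pm_rot (α : ℝ) (θ : ℝ) (x : Plane) :
    potential α 0 (rot θ x) + Complex.I * potential α 1 (rot θ x)
      = phase (-1) θ * (potential α 0 x + Complex.I * potential α 1 x) ∧
    potential α 0 (rot θ x) - Complex.I * potential α 1 (rot θ x)
      = phase 1 θ * (potential α 0 x - Complex.I * potential α 1 x) := by
  simp only [potential, norm_rot, rot_apply_zero, rot_apply_one, Matrix.cons_val_zero,
    Matrix.cons_val_one, Matrix.cons_val_fin_one, phase_eq]
  push_cast
  simp only [neg_mul, one_mul, Complex.cos_neg, Complex.sin_neg]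
  constructor
  · linear_combination (-(α : ℂ) * Complex.sin θ * x 0 / ‖x‖ ^ 2) * Complex.I_sq
  · linear_combination (-(α : ℂ) * Complex.sin θ * x 0 / ‖x‖ ^ 2) * Complex.I_sq

/-- The combinations `D₀ ± i D₁` shift angular momentum by `±1`, in their gradient part and in their
potential part alike, so they intertwine the sector projections. -/
lemma InV.sector_pm (h : InV α u v) (h0 : 0 ≤ α) (h1 : α ≤ 1) (n : ℤ) :
    (∀ᵐ x, covD α 0 (sector n u) (sectorGrad n v 0) x
        + Complex.I * covD α 1 (sector n u) (sectorGrad n v 1) x =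
      sector (n + 1) (fun y => covD α 0 u (v 0) y + Complex.I * covD α 1 u (v 1) y) x) ∧
    ∀ᵐ x, covD α 0 (sector n u) (sectorGrad n v 0) x
        - Complex.I * covD α 1 (sector n u) (sectorGrad n v 1) x =
      sector (n - 1) (fun y => covD α 0 u (v 0) y - Complex.I * covD α 1 u (v 1) y) x := by
  have hv := h.memLp_grad h0 h1
  have hA := h.memLp_potential_mul h0 h1
  constructor
  · have e1 := sector_add (((hv 0).add ((hv 1).const_mul Complex.I)).const_mul (-Complex.I))
      ((hA 0).add ((hA 1).const_mul Complex.I)) (n + 1)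
    filter_upwards [e1] with x hx
    have e2 : sector (n + 1) (fun y => covD α 0 u (v 0) y + Complex.I * covD α 1 u (v 1) y) x
        = sector (n + 1) (fun y => -Complex.I * (v 0 y + Complex.I * v 1 y)
          + (potential α 0 y * u y + Complex.I * (potential α 1 y * u y))) x := by
      congr 1; ext y; simp only [covD]; ring
    have e3 : sector (n + 1) (fun y => potential α 0 y * u y + Complex.I * (potential α 1 y * u y)) x
        = (potential α 0 x + Complex.I * potential α 1 x) * sector n u x := by
      rw [← sector_equivariant_mul (k := 1)
        (w := fun x => potential α 0 x + Complex.I * potential α 1 x)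
        fun θ x => (potential_pm_rot α θ x).1]
      congr 1; ext y; ring
    rw [e2]
    refine Eq.trans ?_ hx.symm
    refine Eq.trans ?_ (congrArg₂ (· + ·) (sector_const_mul _ _ _ _).symm e3.symm)
    simp only [covD, sectorGrad, Matrix.cons_val_zero, Matrix.cons_val_one,
      Matrix.cons_val_fin_one]
    linear_combination (1 / 2 * Complex.I *
      (sector (n + 1) (fun y => v 0 y + Complex.I * v 1 y) x
        - sector (n - 1) (fun y => v 0 y - Complex.I * v 1 y) x)) * Complex.I_sq
  · have e1 := sector_add (((hv 0).sub ((hv 1).const_mul Complex.I)).const_mul (-Complex.I))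
      ((hA 0).sub ((hA 1).const_mul Complex.I)) (n - 1)
    filter_upwards [e1] with x hx
    have e2 : sector (n - 1) (fun y => covD α 0 u (v 0) y - Complex.I * covD α 1 u (v 1) y) x
        = sector (n - 1) (fun y => -Complex.I * (v 0 y - Complex.I * v 1 y)
          + (potential α 0 y * u y - Complex.I * (potential α 1 y * u y))) x := by
      congr 1; ext y; simp only [covD]; ring
    have e3 : sector (n - 1) (fun y => potential α 0 y * u y - Complex.I * (potential α 1 y * u y)) x
        = (potential α 0 x - Complex.I * potential α 1 x) * sector n u x := by
      rw [← sector_equivariant_mul (k := -1)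
        (w := fun x => potential α 0 x - Complex.I * potential α 1 x)
        fun θ x => by rw [neg_neg]; exact (potential_pm_rot α θ x).2]
      congr 1; ext y; ring
    rw [e2]
    refine Eq.trans ?_ hx.symm
    refine Eq.trans ?_ (congrArg₂ (· + ·) (sector_const_mul _ _ _ _).symm e3.symm)
    simp only [covD, sectorGrad, Matrix.cons_val_zero, Matrix.cons_val_one,
      Matrix.cons_val_fin_one]
    linear_combination (-1 / 2 * Complex.I *
      (sector (n + 1) (fun y => v 0 y + Complex.I * v 1 y) x
        - sector (n - 1) (fun y => v 0 y - Complex.I * v 1 y) x)) * Complex.I_sq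

lemma InV.memLp_plus (h : InV α u v) :
    MemLp (fun y => covD α 0 u (v 0) y + Complex.I * covD α 1 u (v 1) y) 2 volume :=
  (h.memLp_cov 0).add ((h.memLp_cov 1).const_mul _)

lemma InV.memLp_minus (h : InV α u v) :
    MemLp (fun y => covD α 0 u (v 0) y - Complex.I * covD α 1 u (v 1) y) 2 volume :=
  (h.memLp_cov 0).sub ((h.memLp_cov 1).const_mul _)

lemma InV.sector_zero (h : InV α u v) (h0 : 0 ≤ α) (h1 : α ≤ 1) :
    InV α (sector 0 u) (sectorGrad 0 v) := by
  refine ⟨memLp_sector h.memLp 0, ae_of_all _ fun x => ?_, fun j =>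
    HasWeakDeriv.sector_deriv rot_mem_punctured h.memLp (h.memLp_grad h0 h1) h.deriv 0 j, fun j => ?_⟩
  · rw [← rot_pi, sector_zero_rot]
  obtain ⟨hp, hm⟩ := h.sector_pm h0 h1 0
  have hP := memLp_sector h.memLp_plus (0 + 1)
  have hM := memLp_sector h.memLp_minus (0 - 1)
  fin_cases j
  · refine ((hP.add hM).const_mul (1 / 2)).ae_eq ?_
    filter_upwards [hp, hm] with x h2 h3
    simp only [Pi.add_apply, ← h2, ← h3]
    ring_nf; rfl
  · refine ((hP.sub hM).const_mul (-Complex.I / 2)).ae_eq ?_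
    filter_upwards [hp, hm] with x h2 h3
    simp only [Pi.sub_apply, ← h2, ← h3]
    change _ = covD α 1 (sector 0 u) (sectorGrad 0 v 1) x
    linear_combination (-covD α 1 (sector 0 u) (sectorGrad 0 v 1) x) * Complex.I_sq

/-- Projection on a sector is symmetric for the form. -/
lemma InV.form_sector {a b : Plane → ℂ} {va vb : Fin 2 → Plane → ℂ} (ha : InV α a va)
    (hb : InV α b vb) (h0 : 0 ≤ α) (h1 : α ≤ 1) (n : ℤ) :
    ∫ x, ∑ j, conj (covD α j a (va j) x) * covD α j (sector n b) (sectorGrad n vb j) x =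
      ∫ x, ∑ j, conj (covD α j (sector n a) (sectorGrad n va j) x) * covD α j b (vb j) x := by
  -- The energy density is rewritten in the frame `D₀ ± i D₁`, in which projections act by plain
  -- sector projections; these are symmetric in `L²`.
  have hid : ∀ p q r s : ℂ, conj p * r + conj q * s = 1 / 2 * (conj (p + Complex.I * q) *
      (r + Complex.I * s)) + 1 / 2 * (conj (p - Complex.I * q) * (r - Complex.I * s)) := by
    intro p q r s
    simp only [map_add, map_sub, map_mul, Complex.conj_I]
    linear_combination (conj q * s) * Complex.I_sq
  simp only [Fin.sum_univ_two, hid]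
  obtain ⟨hap, ham⟩ := ha.sector_pm h0 h1 n
  obtain ⟨hbp, hbm⟩ := hb.sector_pm h0 h1 n
  have e1 := integral_conj_mul_sector ha.memLp_plus hb.memLp_plus (n + 1)
  have e2 := integral_conj_mul_sector ha.memLp_minus hb.memLp_minus (n - 1)
  have i1 := Anyon.MemLp.integrable_mul_two (MemLp.conjugate ha.memLp_plus)
    (memLp_sector hb.memLp_plus (n + 1))
  have i2 := Anyon.MemLp.integrable_mul_two (MemLp.conjugate ha.memLp_minus)
    (memLp_sector hb.memLp_minus (n - 1))
  have i3 := Anyon.MemLp.integrable_mul_two (MemLp.conjugate (memLp_sector ha.memLp_plus (n + 1)))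
    hb.memLp_plus
  have i4 := Anyon.MemLp.integrable_mul_two (MemLp.conjugate (memLp_sector ha.memLp_minus (n - 1)))
    hb.memLp_minus
  have l1 := integral_add (i1.const_mul (1 / 2)) (i2.const_mul (1 / 2))
  have l2 := integral_add (i3.const_mul (1 / 2)) (i4.const_mul (1 / 2))
  rw [integral_const_mul, integral_const_mul] at l1 l2
  rw [e1, e2, ← l2] at l1
  refine Eq.trans (integral_congr_ae ?_) (l1.trans (integral_congr_ae ?_))
  · filter_upwards [hbp, hbm] with x h2 h3
    rw [h2, h3]
  · filter_upwards [hap, ham] with x h2 h3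
    rw [h2, h3]

/-- The projection is moved onto the test function. The projected test function is treated merely as
a function of finite energy, which `InOp.eq_of_inV` accepts. -/
theorem InOp.sector_zero (h : InOp α u v f) (h0 : 0 ≤ α) (h1 : α ≤ 1) :
    InOp α (sector 0 u) (sectorGrad 0 v) (sector 0 f) := by
  refine (h.toInV.sector_zero h0 h1).inOp_of_even_tests (memLp_sector h.memLp_rhs 0)
    (ae_of_all _ fun x => by rw [← rot_pi, sector_zero_rot]) fun φ hφ he => ?_
  have hφV := inV_of_isTest hφ he α
  rw [hφV.form_sector h.toInV h0 h1 0, h.eq_of_inV h0 h1 (hφV.sector_zero h0 h1),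
    integral_conj_mul_sector (hφ.memLp 2) h.memLp_rhs]

lemma covD_sub (α : ℝ) (j : Fin 2) (u v u' v' : Plane → ℂ) (x : Plane) :
    covD α j (fun x => u x - u' x) (fun x => v x - v' x) x = covD α j u v x - covD α j u' v' x := by
  simp only [covD]; ring

lemma InV.sub {u' : Plane → ℂ} {v' : Fin 2 → Plane → ℂ} (h : InV α u v) (h' : InV α u' v') :
    InV α (fun x => u x - u' x) (fun j x => v j x - v' j x) := by
  refine ⟨h.memLp.sub h'.memLp, ?_, fun j => (h.deriv j).sub (h'.deriv j), fun j => ?_⟩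
  · filter_upwards [h.even, h'.even] with x h1 h2
    rw [h1, h2]
  · exact ((h.memLp_cov j).sub (h'.memLp_cov j)).ae_eq
      (ae_of_all _ fun x => (covD_sub α j u (v j) u' (v' j) x).symm)

lemma InOp.sub {u' f' : Plane → ℂ} {v' : Fin 2 → Plane → ℂ} (h : InOp α u v f)
    (h' : InOp α u' v' f') :
    InOp α (fun x => u x - u' x) (fun j x => v j x - v' j x) (fun x => f x - f' x) := by
  refine ⟨h.toInV.sub h'.toInV, h.memLp_rhs.sub h'.memLp_rhs, fun φ hφ => ?_⟩
  have hc := fun j => MemLp.conjugate (memLp_covD_test hφ α j)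
  have hcφ := MemLp.conjugate (hφ.memLp 2)
  have := congrArg₂ (· - ·) (h.eq φ hφ) (h'.eq φ hφ)
  rw [← integral_sub (integrable_finsetSum _ fun j _ => Anyon.MemLp.integrable_mul_two (hc j)
      (h.memLp_cov j)) (integrable_finsetSum _ fun j _ => Anyon.MemLp.integrable_mul_two (hc j)
      (h'.memLp_cov j)), ← integral_sub (Anyon.MemLp.integrable_mul_two hcφ h.memLp_rhs)
      (Anyon.MemLp.integrable_mul_two hcφ h'.memLp_rhs)] at this
  simp only [← mul_sub, ← Finset.sum_sub_distrib] at this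
  simpa only [covD_sub] using this

/-! ### The weak Laplacian off the origin -/

/-- `v` is the weak gradient of `u` and `-Δ u = F` weakly off the origin. -/
structure WeakLap (u : Plane → ℂ) (v : Fin 2 → Plane → ℂ) (F : Plane → ℂ) : Prop where
  deriv : ∀ j, HasWeakDeriv punctured j u (v j)
  locInt : LocallyIntegrableOn F punctured
  eq : ∀ φ, IsTest punctured φ → ∫ x, ∑ j, pd j φ x * v j x = ∫ x, φ x * F x

variable {α : ℝ} {u F f : Plane → ℂ} {v : Fin 2 → Plane → ℂ}

lemma ContDiffOn.pd {Ω : Set Plane} (hΩ : IsOpen Ω) {χ : Plane → ℂ} (hχ : ContDiffOn ℝ ∞ χ Ω)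
    (j : Fin 2) : ContDiffOn ℝ ∞ (pd j χ) Ω :=
  (hχ.fderiv_of_isOpen hΩ (m := ∞) (by simp)).clm_apply contDiffOn_const

lemma WeakLap.congr_ae (h : WeakLap u v F) {u' F' : Plane → ℂ} {v' : Fin 2 → Plane → ℂ}
    (hu : u =ᵐ[volume] u') (hv : ∀ j, v j =ᵐ[volume] v' j) (hF : F =ᵐ[volume] F') :
    WeakLap u' v' F' := by
  refine ⟨fun j => (h.deriv j).congr_ae isOpen_punctured hu (hv j), ?_, fun φ hφ => ?_⟩
  · exact fun x hx => (h.locInt x hx).imp fun s hs => ⟨hs.1, hs.2.congr (ae_restrict_of_ae hF)⟩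
  · refine Eq.trans (integral_congr_ae ?_) ((h.eq φ hφ).trans (integral_congr_ae ?_))
    · filter_upwards [hv 0, hv 1] with x h0 h1
      simp only [Fin.sum_univ_two, h0, h1]
    · filter_upwards [hF] with x hx
      rw [hx]

/-- The Laplacian of a product with a smooth function. -/
lemma WeakLap.mul_smooth (h : WeakLap u v F) {χ : Plane → ℂ} (hχ : ContDiffOn ℝ ∞ χ punctured) :
    WeakLap (fun x => χ x * u x) (fun j x => χ x * v j x + pd j χ x * u x)
      (fun x => χ x * F x - 2 * (∑ j, pd j χ x * v j x) - (∑ j, pd j (pd j χ) x) * u x) := by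
  have hχj := fun j => ContDiffOn.pd isOpen_punctured hχ j
  have hχjj := fun j => ContDiffOn.pd isOpen_punctured (hχj j) j
  have l1 : LocallyIntegrableOn (fun x => χ x * F x) punctured :=
    LocallyIntegrableOn.contDiffOn_mul isOpen_punctured h.locInt hχ.continuousOn
  have l2 : ∀ j, LocallyIntegrableOn (fun x => pd j χ x * v j x) punctured := fun j =>
    LocallyIntegrableOn.contDiffOn_mul isOpen_punctured (h.deriv j).2.1 (hχj j).continuousOn
  have l3 : ∀ j, LocallyIntegrableOn (fun x => pd j (pd j χ) x * u x) punctured := fun j =>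
    LocallyIntegrableOn.contDiffOn_mul isOpen_punctured (h.deriv j).1 (hχjj j).continuousOn
  have l4 : ∀ j, LocallyIntegrableOn (fun x => pd j χ x * u x) punctured := fun j =>
    LocallyIntegrableOn.contDiffOn_mul isOpen_punctured (h.deriv j).1 (hχj j).continuousOn
  have l5 : ∀ j, LocallyIntegrableOn (fun x => χ x * v j x) punctured := fun j =>
    LocallyIntegrableOn.contDiffOn_mul isOpen_punctured (h.deriv j).2.1 hχ.continuousOn
  refine ⟨fun j => (h.deriv j).mul_smooth isOpen_punctured hχ, ?_, fun φ hφ => ?_⟩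
  · refine Eq.mp (congrArg (fun w => LocallyIntegrableOn w punctured) (funext fun x => ?_))
      ((l1.sub (((l2 0).add (l2 1)).add ((l2 0).add (l2 1)))).sub ((l3 0).add (l3 1)))
    simp only [Fin.sum_univ_two, Pi.add_apply, Pi.sub_apply]
    ring
  have ht := hφ.mul_contDiffOn isOpen_punctured hχ
  have e1 := h.eq _ ht
  rw [integral_finsetSum _ fun j _ => (ht.pd j).integrable_mul (h.deriv j).2.1] at e1
  have e2 : ∀ j, ∫ x, pd j (fun y => χ y * φ y) x * v j x =
      (∫ x, pd j φ x * (χ x * v j x)) + ∫ x, φ x * (pd j χ x * v j x) := fun j => by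
    rw [← integral_add ((hφ.pd j).integrable_mul (l5 j)) (hφ.integrable_mul (l2 j))]
    refine integral_congr_ae ?_
    filter_upwards [ae_mem_punctured] with x hx
    rw [pd_mul ((hχ.contDiffAt (isOpen_punctured.mem_nhds hx)).differentiableAt (by simp))
      (hφ.differentiable x)]
    ring
  have e3 : ∀ j, ∫ x, pd j φ x * (pd j χ x * u x) = - ((∫ x, φ x * (pd j χ x * v j x))
      + ∫ x, φ x * (pd j (pd j χ) x * u x)) := fun j => by
    rw [((h.deriv j).mul_smooth isOpen_punctured (hχj j)).test hφ,
      ← integral_add (hφ.integrable_mul (l2 j)) (hφ.integrable_mul (l3 j))]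
    simp only [mul_add]
  have e4 : ∀ j, ∫ x, pd j φ x * (χ x * v j x + pd j χ x * u x) =
      (∫ x, pd j φ x * (χ x * v j x)) + ∫ x, pd j φ x * (pd j χ x * u x) := fun j => by
    rw [← integral_add ((hφ.pd j).integrable_mul (l5 j)) ((hφ.pd j).integrable_mul (l4 j))]
    simp only [mul_add]
  have i2 := fun j => hφ.integrable_mul (l2 j)
  have i3 := fun j => hφ.integrable_mul (l3 j)
  have e5 : ∫ x, φ x * (χ x * F x - 2 * (∑ j, pd j χ x * v j x) - (∑ j, pd j (pd j χ) x) * u x)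
      = (∫ x, χ x * φ x * F x) - 2 * ((∫ x, φ x * (pd 0 χ x * v 0 x))
        + ∫ x, φ x * (pd 1 χ x * v 1 x)) - ((∫ x, φ x * (pd 0 (pd 0 χ) x * u x))
        + ∫ x, φ x * (pd 1 (pd 1 χ) x * u x)) := by
    have i22 : Integrable fun x => 2 * (φ x * (pd 0 χ x * v 0 x) + φ x * (pd 1 χ x * v 1 x)) :=
      ((i2 0).add (i2 1)).const_mul 2
    have i33 : Integrable fun x => φ x * (pd 0 (pd 0 χ) x * u x) + φ x * (pd 1 (pd 1 χ) x * u x) :=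
      (i3 0).add (i3 1)
    have i1 : Integrable fun x => χ x * φ x * F x
        - 2 * (φ x * (pd 0 χ x * v 0 x) + φ x * (pd 1 χ x * v 1 x)) :=
      (ht.integrable_mul h.locInt).sub i22
    rw [← integral_add (i2 0) (i2 1), ← integral_const_mul, ← integral_add (i3 0) (i3 1),
      ← integral_sub (ht.integrable_mul h.locInt) i22, ← integral_sub i1 i33]
    congr 1; ext x
    simp only [Fin.sum_univ_two]
    ring
  have i45 : ∀ j, Integrable fun x => pd j φ x * (χ x * v j x + pd j χ x * u x) := fun j =>
    (hφ.pd j).integrable_mul ((l5 j).add (l4 j))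
  rw [integral_finsetSum _ fun j _ => i45 j, e5, ← e1]
  simp only [Fin.sum_univ_two, e2, e4, e3]
  ring

lemma WeakLap.of_contDiffOn {χ : Plane → ℂ} (hχ : ContDiffOn ℝ ∞ χ punctured) :
    WeakLap χ (fun j => pd j χ) (fun x => - ∑ j, pd j (pd j χ) x) := by
  -- The product rule `WeakLap.mul_smooth` applied to the constant `1` gives the claim.
  have h1 : WeakLap (fun _ => 1) (fun _ _ => 0) (fun _ => 0) := by
    refine ⟨fun j => ?_, locallyIntegrableOn_const _, fun φ _ => by simp⟩
    refine (HasWeakDeriv.of_contDiffOn (χ := fun _ => 1) isOpen_punctured contDiffOn_const j).congr_ae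
      isOpen_punctured (ae_eq_refl _) (ae_of_all _ fun x => ?_)
    simp [pd]
  have := h1.mul_smooth hχ
  simpa using this

theorem WeakLap.memH_two (h : WeakLap u v F) (hu : MemLp u 2 volume)
    (hv : ∀ j, MemLp (v j) 2 volume) (hF : MemLp F 2 volume) : MemH 2 univ u :=
  memH_two_of_weak_laplacian hu hv hF
    (fun j => (h.deriv j).extend hu ((hv j).locallyIntegrable (by norm_num))) h.eq

/-- The angular derivative in terms of the gradient. -/
def angV (v : Fin 2 → Plane → ℂ) (x : Plane) : ℂ := x 0 * v 1 x - x 1 * v 0 x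

lemma sum_potential_mul (α : ℝ) (v : Fin 2 → Plane → ℂ) (x : Plane) :
    ∑ j, potential α j x * v j x = α * ((((‖x‖ ^ 2)⁻¹ : ℝ) : ℂ) * angV v x) := by
  simp only [Fin.sum_univ_two, potential, angV, Matrix.cons_val_zero, Matrix.cons_val_one,
    Matrix.cons_val_fin_one]
  push_cast
  ring

lemma sum_potential_sq (α : ℝ) (x : Plane) :
    ∑ j, potential α j x * potential α j x = α ^ 2 * (((‖x‖ ^ 2)⁻¹ : ℝ) : ℂ) := by
  by_cases hx : x = 0
  · simp [hx, potential]
  · have h1 : (‖x‖ : ℂ) ≠ 0 := by exact_mod_cast (norm_pos_iff.2 hx).ne'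
    have h2 : (‖x‖ : ℂ) ^ 2 = (x 0 : ℂ) ^ 2 + (x 1 : ℂ) ^ 2 := by exact_mod_cast norm_sq_plane x
    simp only [Fin.sum_univ_two, potential, Matrix.cons_val_zero, Matrix.cons_val_one,
      Matrix.cons_val_fin_one]
    push_cast
    field_simp
    rw [h2]
    ring

lemma contDiffOn_inv_sq : ContDiffOn ℝ ∞ (fun x : Plane => (((‖x‖ ^ 2)⁻¹ : ℝ) : ℂ)) punctured :=
  Complex.ofRealCLM.contDiff.comp_contDiffOn contDiffOn_inv_norm_sq

lemma locallyIntegrableOn_angV (h : ∀ j, HasWeakDeriv punctured j u (v j)) :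
    LocallyIntegrableOn (angV v) punctured :=
  (LocallyIntegrableOn.contDiffOn_mul isOpen_punctured (h 1).2.1
    (contDiff_coord 0).continuous.continuousOn).sub
  (LocallyIntegrableOn.contDiffOn_mul isOpen_punctured (h 0).2.1
    (contDiff_coord 1).continuous.continuousOn)

/-- The vector potential is divergence free. -/
lemma integral_potential_pd (h : ∀ j, HasWeakDeriv punctured j u (v j)) {φ : Plane → ℂ}
    (hφ : IsTest punctured φ) :
    ∫ x, ∑ j, pd j φ x * (potential α j x * u x)
      = - ∫ x, φ x * (α * ((((‖x‖ ^ 2)⁻¹ : ℝ) : ℂ) * angV v x)) := by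
  have := ((hasAngDeriv_of_hasWeakDeriv h).radial_mul contDiffOn_inv_sq
    (fun θ x => by rw [norm_rot])) _ (hφ.const_mul (α : ℂ))
  have e1 : (fun x => ∑ j, pd j φ x * (potential α j x * u x)) = fun x =>
      angD (fun y => α * φ y) x * ((((‖x‖ ^ 2)⁻¹ : ℝ) : ℂ) * u x) := by
    ext x
    simp only [angD, pd_const_mul (hφ.differentiable x), Fin.sum_univ_two, potential,
      Matrix.cons_val_zero, Matrix.cons_val_one, Matrix.cons_val_fin_one]
    push_cast
    ring
  rw [e1, this]
  congr 2; ext x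
  simp only [angV]
  ring

/-- The operator `H_α` in terms of the Laplacian. -/
theorem InV.inOp_iff (h : InV α u v) (hf : MemLp f 2 volume) :
    InOp α u v f ↔ WeakLap u v fun x =>
      f x + 2 * Complex.I * (α * ((((‖x‖ ^ 2)⁻¹ : ℝ) : ℂ) * angV v x))
        - α ^ 2 * ((((‖x‖ ^ 2)⁻¹ : ℝ) : ℂ) * u x) := by
  set q : Plane → ℂ := fun x => (((‖x‖ ^ 2)⁻¹ : ℝ) : ℂ) with hq
  have lf := locallyIntegrableOn_of_memLp hf punctured
  have l1 : LocallyIntegrableOn (fun x => (α : ℂ) * (q x * angV v x)) punctured :=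
    LocallyIntegrableOn.contDiffOn_mul isOpen_punctured (LocallyIntegrableOn.contDiffOn_mul
      isOpen_punctured (locallyIntegrableOn_angV h.deriv) contDiffOn_inv_sq.continuousOn)
      continuousOn_const
  have l2 : LocallyIntegrableOn (fun x => (α : ℂ) ^ 2 * (q x * u x)) punctured :=
    LocallyIntegrableOn.contDiffOn_mul isOpen_punctured (LocallyIntegrableOn.contDiffOn_mul
      isOpen_punctured (h.deriv 0).1 contDiffOn_inv_sq.continuousOn) continuousOn_const
  have l3 : LocallyIntegrableOn (fun x => f x + 2 * Complex.I * (α * (q x * angV v x))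
      - α ^ 2 * (q x * u x)) punctured :=
    (lf.add (LocallyIntegrableOn.contDiffOn_mul isOpen_punctured l1 continuousOn_const)).sub l2
  have l4 : ∀ j, LocallyIntegrableOn (fun x => potential α j x * u x) punctured := fun j =>
    LocallyIntegrableOn.contDiffOn_mul isOpen_punctured (h.deriv j).1
      (contDiffOn_potential α j).continuousOn
  have key : ∀ φ, IsTest punctured φ →
      ((∫ x, ∑ j, pd j φ x * (Complex.I * covD α j u (v j) x)
        = ∫ x, φ x * (f x - ∑ j, potential α j x * covD α j u (v j) x)) ↔
      ∫ x, ∑ j, pd j φ x * v j x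
        = ∫ x, φ x * (f x + 2 * Complex.I * (α * (q x * angV v x)) - α ^ 2 * (q x * u x))) := by
    intro φ hφ
    have i1 : Integrable fun x => ∑ j, pd j φ x * v j x :=
      integrable_finsetSum _ fun j _ => (hφ.pd j).integrable_mul (h.deriv j).2.1
    have i2 : Integrable fun x => ∑ j, pd j φ x * (potential α j x * u x) :=
      integrable_finsetSum _ fun j _ => (hφ.pd j).integrable_mul (l4 j)
    have i3 : Integrable fun x => φ x * (α * (q x * angV v x)) := hφ.integrable_mul l1
    have e1 : (∫ x, ∑ j, pd j φ x * (Complex.I * covD α j u (v j) x)) =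
        (∫ x, ∑ j, pd j φ x * v j x) - Complex.I * ∫ x, φ x * (α * (q x * angV v x)) := by
      have := integral_potential_pd (α := α) h.deriv hφ
      rw [sub_eq_add_neg, ← mul_neg, ← this, ← integral_const_mul,
        ← integral_add i1 (i2.const_mul _)]
      congr 1; ext x
      rw [Finset.mul_sum, ← Finset.sum_add_distrib]
      refine Finset.sum_congr rfl fun j _ => ?_
      simp only [covD]
      linear_combination (-pd j φ x * v j x) * Complex.I_sq
    have e2 : (∫ x, φ x * (f x - ∑ j, potential α j x * covD α j u (v j) x)) =
        (∫ x, φ x * (f x + 2 * Complex.I * (α * (q x * angV v x)) - α ^ 2 * (q x * u x)))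
          - Complex.I * ∫ x, φ x * (α * (q x * angV v x)) := by
      rw [← integral_const_mul, ← integral_sub (hφ.integrable_mul l3) (i3.const_mul _)]
      congr 1; ext x
      have h1 : ∑ j, potential α j x * covD α j u (v j) x =
          -Complex.I * (∑ j, potential α j x * v j x)
            + (∑ j, potential α j x * potential α j x) * u x := by
        simp only [Fin.sum_univ_two, covD]; ring
      rw [h1, sum_potential_mul, sum_potential_sq]
      ring
    rw [e1, e2]
    exact sub_left_inj
  have hiff := divergence_form_iff (α := α) h.memLp_cov hf
  constructor
  · intro ho
    exact ⟨h.deriv, l3, fun φ hφ => (key φ hφ).1 (hiff.1 ho.eq φ hφ)⟩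
  · intro hl
    exact ⟨h, hf, hiff.2 fun φ hφ => (key φ hφ).2 (hl.eq φ hφ)⟩

lemma InV.of_grad (hu : MemLp u 2 volume) (he : ∀ᵐ x : Plane, u (-x) = u x)
    (hd : ∀ j, HasWeakDeriv punctured j u (v j)) (hv : ∀ j, MemLp (v j) 2 volume)
    (hr : α ≠ 0 → MemLp (fun x => ((‖x‖⁻¹ : ℝ) : ℂ) * u x) 2 volume) : InV α u v := by
  refine ⟨hu, he, hd, fun j => ((hv j).const_mul _).add ?_⟩
  by_cases hα : α = 0
  · simp [hα, potential_zero]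
  · exact Anyon.memLp_potential_mul j hu.1 (hr hα)

/-- Passing from the Laplacian to `H_α` when the potential terms are square integrable. -/
lemma InV.inOp_of_weakLap (h : InV α u v) (hl : WeakLap u v F) (hF : MemLp F 2 volume)
    (ha : MemLp (fun x => (α : ℂ) * ((((‖x‖ ^ 2)⁻¹ : ℝ) : ℂ) * angV v x)) 2 volume)
    (hr : MemLp (fun x => (α : ℂ) ^ 2 * ((((‖x‖ ^ 2)⁻¹ : ℝ) : ℂ) * u x)) 2 volume) :
    ∃ f, InOp α u v f := by
  have hf := (hF.sub (ha.const_mul (2 * Complex.I))).add hr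
  refine ⟨_, (h.inOp_iff hf).2 (hl.congr_ae (ae_eq_refl _) (fun _ => ae_eq_refl _)
    (ae_of_all _ fun x => ?_))⟩
  simp only [Pi.add_apply, Pi.sub_apply]
  ring

lemma InOp.exists_weakLap (h : InOp α u v f)
    (ha : MemLp (fun x => (α : ℂ) * ((((‖x‖ ^ 2)⁻¹ : ℝ) : ℂ) * angV v x)) 2 volume)
    (hr : MemLp (fun x => (α : ℂ) ^ 2 * ((((‖x‖ ^ 2)⁻¹ : ℝ) : ℂ) * u x)) 2 volume) :
    ∃ F, MemLp F 2 volume ∧ WeakLap u v F := by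
  have h1 := (h.memLp_rhs.add (ha.const_mul (2 * Complex.I))).sub hr
  exact ⟨_, h1, (h.toInV.inOp_iff h.memLp_rhs).1 h⟩

lemma sector_zero_angD {φ : Plane → ℂ} (hφ : IsTest punctured φ) (x : Plane) :
    sector 0 (angD φ) x = 0 := by
  have hcr : Continuous fun s : ℝ => angD φ (rot s x) :=
    continuous_iff_continuousAt.2 fun s => (hasDerivAt_comp_rot hφ.angD.differentiable x s).continuousAt
  have h := intervalIntegral.integral_eq_sub_of_hasDerivAt (a := 0) (b := 2 * Real.pi)
    (fun s _ => hasDerivAt_comp_rot (hφ.differentiable) x s)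
    (hcr.intervalIntegrable _ _)
  have h2 : rot (2 * Real.pi) x = rot 0 x := by
    have := rot_add_two_pi 0 x
    rwa [zero_add] at this
  rw [h2, sub_self] at h
  simp [sector, h]

/-- Rotation invariant functions have no angular derivative. -/
lemma angV_eq_zero (hu : MemLp u 2 volume) (h0 : sector 0 u =ᵐ[volume] u)
    (hd : ∀ j, HasWeakDeriv punctured j u (v j)) : angV v =ᵐ[volume] 0 := by
  refine ae_eq_of_test_punctured (locallyIntegrableOn_angV hd)
    (locallyIntegrableOn_of_memLp (MemLp.zero' (p := 2)) _) fun φ hφ => ?_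
  have h1 := hasAngDeriv_of_hasWeakDeriv hd φ hφ
  have h2 : ∫ x, angD φ x * u x = 0 := by
    have h3 := integral_conj_mul_sector (hφ.conjugate.angD.memLp 2) hu 0
    simp only [sector_zero_angD hφ.conjugate, map_zero, zero_mul, integral_zero] at h3
    rw [← h3]
    refine integral_congr_ae ?_
    filter_upwards [h0] with x hx
    rw [hx]
    simp [angD, pd_conj (hφ.differentiable x)]
  rw [h2] at h1
  simpa [angV, eq_comm] using h1

/-! ### A Rellich inequality off the `s`-wave -/

variable {α : ℝ} {u f : Plane → ℂ} {v : Fin 2 → Plane → ℂ}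

/-- The regularised inverse square weight. -/
def invWeight (δ : ℝ) (x : Plane) : ℝ := (‖x‖ ^ 2 + δ)⁻¹

section weight
variable {δ : ℝ} (hδ : 0 < δ)

lemma invWeight_pos (hδ : 0 < δ) (x : Plane) : 0 < invWeight δ x := by
  unfold invWeight; positivity

lemma invWeight_le (hδ : 0 < δ) (x : Plane) : invWeight δ x ≤ δ⁻¹ :=
  inv_anti₀ hδ (by nlinarith [sq_nonneg ‖x‖])

lemma sq_mul_invWeight_le (hδ : 0 < δ) (x : Plane) : ‖x‖ ^ 2 * invWeight δ x ≤ 1 := by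
  unfold invWeight
  rw [← div_eq_mul_inv, div_le_one (by positivity)]
  linarith

lemma contDiff_invWeight (hδ : 0 < δ) : ContDiff ℝ ∞ fun x => ((invWeight δ x : ℝ) : ℂ) := by
  refine Complex.ofRealCLM.contDiff.comp (ContDiff.inv ?_ fun x => by positivity)
  exact (contDiff_norm_sq ℝ).add contDiff_const

lemma pd_invWeight (hδ : 0 < δ) (j : Fin 2) (x : Plane) :
    pd j (fun x => ((invWeight δ x : ℝ) : ℂ)) x = ((-(2 * x j * invWeight δ x ^ 2) : ℝ) : ℂ) := by
  have h0 : ‖x‖ ^ 2 + δ ≠ 0 := by positivity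
  have h1 : HasFDerivAt (fun x : Plane => ‖x‖ ^ 2 + δ) (2 • innerSL ℝ x) x :=
    (hasStrictFDerivAt_norm_sq x).hasFDerivAt.add_const δ
  have h2 : HasFDerivAt (invWeight δ) _ x := (hasDerivAt_inv h0).comp_hasFDerivAt x h1
  have h3 := Complex.ofRealCLM.hasFDerivAt.comp x h2
  have h4 : pd j (fun x => ((invWeight δ x : ℝ) : ℂ)) x = _ :=
    congrArg (fun L : Plane →L[ℝ] ℂ => L (e j)) h3.fderiv
  rw [h4]
  simp [e, invWeight, EuclideanSpace.inner_single_right]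
  ring

lemma abs_two_mul_invWeight_sq_le (hδ : 0 < δ) (hδ1 : δ ≤ 1) (j : Fin 2) (x : Plane) :
    |-(2 * x j * invWeight δ x ^ 2)| ≤ δ⁻¹ * δ⁻¹ := by
  have hp := (invWeight_pos hδ x).le
  have h1 : 2 * |x j| ≤ δ⁻¹ * (‖x‖ ^ 2 + δ) := by
    have h2 : 2 * |x j| ≤ ‖x‖ ^ 2 + 1 := by nlinarith [abs_coord_le x j, sq_nonneg (‖x‖ - 1)]
    have h3 : ‖x‖ ^ 2 ≤ δ⁻¹ * ‖x‖ ^ 2 := le_mul_of_one_le_left (by positivity) (one_le_inv₀ hδ |>.2 hδ1)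
    rw [mul_add, inv_mul_cancel₀ hδ.ne']
    linarith
  have h4 : (‖x‖ ^ 2 + δ) * invWeight δ x = 1 := mul_inv_cancel₀ (by positivity)
  rw [abs_neg, abs_mul, abs_mul, abs_two, abs_of_nonneg (by positivity : 0 ≤ invWeight δ x ^ 2)]
  calc 2 * |x j| * invWeight δ x ^ 2 ≤ δ⁻¹ * (‖x‖ ^ 2 + δ) * invWeight δ x ^ 2 :=
        mul_le_mul_of_nonneg_right h1 (by positivity)
    _ = δ⁻¹ * invWeight δ x := by linear_combination δ⁻¹ * invWeight δ x * h4
    _ ≤ δ⁻¹ * δ⁻¹ := mul_le_mul_of_nonneg_left (invWeight_le hδ x) (by positivity)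

end weight

lemma covD_smooth_mul (α : ℝ) (j : Fin 2) (w p u v : Plane → ℂ) (x : Plane) :
    covD α j (fun x => w x * u x) (fun x => w x * v x + p x * u x) x =
      w x * covD α j u v x - Complex.I * p x * u x := by
  simp only [covD]; ring

lemma InV.smooth_mul (h : InV α u v) {w : Plane → ℂ} (hw : ContDiff ℝ ∞ w)
    (he : ∀ x, w (-x) = w x) {C : ℝ} (hC : ∀ x, ‖w x‖ ≤ C) (hC' : ∀ j x, ‖pd j w x‖ ≤ C) :
    InV α (fun x => w x * u x) (fun j x => w x * v j x + pd j w x * u x) := by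
  have hpc : ∀ j, Continuous (pd j w) := fun j =>
    (hw.continuous_fderiv (by simp)).clm_apply continuous_const
  refine ⟨memLp_bdd_mul h.memLp hw.continuous.aestronglyMeasurable (ae_of_all _ hC), ?_,
    fun j => (h.deriv j).mul_smooth isOpen_punctured hw.contDiffOn, fun j => ?_⟩
  · filter_upwards [h.even] with x hx
    rw [he, hx]
  · have h1 := memLp_bdd_mul (h.memLp_cov j) hw.continuous.aestronglyMeasurable (ae_of_all _ hC)
    have h2 := memLp_bdd_mul h.memLp (hpc j).aestronglyMeasurable (ae_of_all _ (hC' j))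
    refine (h1.sub (h2.const_mul Complex.I)).ae_eq (ae_of_all _ fun x => ?_)
    simp only [Pi.sub_apply]
    rw [covD_smooth_mul, mul_assoc]

/-- Completing the square in the radial direction. -/
lemma weight_tangD_le (α : ℝ) (u : Plane → ℂ) (v : Fin 2 → Plane → ℂ) {δ : ℝ} (hδ : 0 < δ)
    {x : Plane} (hx : x ≠ 0) :
    invWeight δ x * ‖tangD α u v x‖ ^ 2 ≤
      (∑ j, conj (((invWeight δ x : ℝ) : ℂ) * covD α j u (v j) x
        - Complex.I * ((-(2 * x j * invWeight δ x ^ 2) : ℝ) : ℂ) * u x) * covD α j u (v j) x).re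
      + invWeight δ x * (‖x‖ ^ 2)⁻¹ * ‖u x‖ ^ 2 := by
  set w := invWeight δ x with hw
  have hwp : 0 < w := invWeight_pos hδ x
  have hr : 0 < ‖x‖ ^ 2 := by have := norm_pos_iff.2 hx; positivity
  set a := covD α 0 u (v 0) x with ha
  set b := covD α 1 u (v 1) x with hb
  have h2 : ‖x‖ ^ 2 = x 0 ^ 2 + x 1 ^ 2 := norm_sq_plane x
  have e1 : (∑ j, conj ((w : ℂ) * covD α j u (v j) x
        - Complex.I * ((-(2 * x j * w ^ 2) : ℝ) : ℂ) * u x) * covD α j u (v j) x).re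
      = w * (‖a‖ ^ 2 + ‖b‖ ^ 2)
        - 2 * w ^ 2 * (-Complex.I * -(conj (u x) * (x 0 * a + x 1 * b))).re := by
    rw [Fin.sum_univ_two, ← ha, ← hb, Complex.sq_norm, Complex.sq_norm, Complex.normSq_apply,
      Complex.normSq_apply]
    generalize w ^ 2 = W
    simp
    ring
  -- Pythagoras for the tangential and radial components of the covariant gradient.
  have e2 : ‖x‖ ^ 2 * ‖tangD α u v x‖ ^ 2 + ‖(x 0 : ℂ) * a + x 1 * b‖ ^ 2
      = ‖x‖ ^ 2 * (‖a‖ ^ 2 + ‖b‖ ^ 2) := by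
    have h3 : (‖x‖ : ℂ) * tangD α u v x = -(x 1) * a + x 0 * b := by
      have : (‖x‖ : ℂ) ≠ 0 := by exact_mod_cast (norm_pos_iff.2 hx).ne'
      simp only [tangD, ← ha, ← hb]; push_cast; field_simp
    have h4 := congrArg (fun z : ℂ => ‖z‖ ^ 2) h3
    simp only [norm_mul, Complex.norm_real, norm_norm, mul_pow] at h4
    rw [h4, h2, Complex.sq_norm, Complex.sq_norm, Complex.sq_norm, Complex.sq_norm,
      Complex.normSq_apply, Complex.normSq_apply, Complex.normSq_apply, Complex.normSq_apply]
    simp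
    ring
  set d := ‖(x 0 : ℂ) * a + x 1 * b‖ with hd
  have e3 : (-Complex.I * -(conj (u x) * (x 0 * a + x 1 * b))).re ≤ ‖u x‖ * d := by
    refine (Complex.re_le_norm _).trans (le_of_eq ?_)
    simp [hd]
  rw [e1]
  have e4 : ‖tangD α u v x‖ ^ 2 = (‖a‖ ^ 2 + ‖b‖ ^ 2) - (‖x‖ ^ 2)⁻¹ * d ^ 2 := by
    field_simp; linarith
  have hi := inv_pos.2 hr
  have e5 : w * ‖x‖ ^ 2 ≤ 1 := by rw [mul_comm]; exact sq_mul_invWeight_le hδ x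
  set ρ := (‖x‖ ^ 2)⁻¹ with hρ
  have e6 : w ≤ ρ := by
    have := mul_le_mul_of_nonneg_right e5 hi.le
    rwa [mul_assoc, mul_inv_cancel₀ hr.ne', mul_one, one_mul] at this
  rw [e4]
  -- The derivative of the weight costs `2 w² ‖u‖ d`. Since `w ≤ ρ = r^(-2)`, the radial energy `w ρ
  -- d²` and the added `w ρ ‖u‖²` together absorb it, with coefficient exactly one for `w ρ ‖u‖²`.
  have e7 : 2 * w * ‖u x‖ * d ≤ ρ * (d ^ 2 + ‖u x‖ ^ 2) := by
    have := mul_le_mul_of_nonneg_right e6 (by positivity : 0 ≤ 2 * ‖u x‖ * d)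
    nlinarith [mul_nonneg hi.le (sq_nonneg (d - ‖u x‖))]
  have e8 := mul_le_mul_of_nonneg_left e7 hwp.le
  have e9 := mul_le_mul_of_nonneg_left e3 (by positivity : 0 ≤ 2 * w ^ 2)
  nlinarith

/-- Monotone convergence: the regularised weights increase to `‖x‖^(-2)` off the origin as `δ`
decreases to zero. -/
lemma tendsto_lintegral_invWeight {g : Plane → ℂ} (hg : AEStronglyMeasurable g volume) :
    Tendsto (fun n : ℕ => ∫⁻ x, ENNReal.ofReal (invWeight (n + 1 : ℝ)⁻¹ x) * ‖g x‖ₑ ^ 2) atTop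
      (𝓝 (∫⁻ x, ENNReal.ofReal (‖x‖ ^ 2)⁻¹ * ‖g x‖ₑ ^ 2)) := by
  have hm : ∀ δ, Measurable (invWeight δ) := fun δ => by unfold invWeight; fun_prop
  refine lintegral_tendsto_of_tendsto_of_monotone (fun n => ?_) (ae_of_all _ fun x => ?_) ?_
  · exact (hm _).ennreal_ofReal.aemeasurable.mul (hg.enorm.pow_const 2)
  · intro m n hmn
    refine mul_le_mul_left (ENNReal.ofReal_le_ofReal ?_) _
    unfold invWeight
    gcongr
  · filter_upwards [ae_mem_punctured] with x hx
    have hx' : ‖x‖ ^ 2 ≠ 0 := pow_ne_zero 2 (norm_ne_zero_iff.2 hx)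
    refine ENNReal.Tendsto.mul_const (ENNReal.tendsto_ofReal ?_) (Or.inr (by simp))
    have h1 : Tendsto (fun n : ℕ => ‖x‖ ^ 2 + ((n : ℝ) + 1)⁻¹) atTop (𝓝 (‖x‖ ^ 2 + 0)) := by
      have := tendsto_one_div_add_atTop_nhds_zero_nat (𝕜 := ℝ)
      simp only [one_div] at this
      exact this.const_add _
    rw [add_zero] at h1
    exact h1.inv₀ hx'

lemma lintegral_weight_eq {g : Plane → ℂ} (hg : MemLp g 2 volume) {w : Plane → ℝ} (hw : ∀ x, 0 ≤ w x)
    (hm : Measurable w) {C : ℝ} (hC : ∀ x, w x ≤ C) :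
    Integrable (fun x => w x * ‖g x‖ ^ 2) ∧
    ∫⁻ x, ENNReal.ofReal (w x) * ‖g x‖ₑ ^ 2 = ENNReal.ofReal (∫ x, w x * ‖g x‖ ^ 2) := by
  have hi : Integrable (fun x => w x * ‖g x‖ ^ 2) := by
    refine Integrable.bdd_mul (c := C) ((memLp_two_iff_integrable_sq_norm hg.1).1 hg) hm.aestronglyMeasurable
      (ae_of_all _ fun x => ?_)
    rw [Real.norm_of_nonneg (hw x)]; exact hC x
  refine ⟨hi, ?_⟩
  rw [ofReal_integral_eq_lintegral_ofReal hi (ae_of_all _ fun x => by have := hw x; positivity)]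
  refine lintegral_congr fun x => ?_
  rw [ENNReal.ofReal_mul (hw x), ENNReal.ofReal_pow (norm_nonneg _), ofReal_norm]

/-- The regularised weighted estimate. -/
lemma InOp.integral_invWeight_le (h : InOp α u v f) (h0 : 0 ≤ α) (h1 : α < 1)
    (hs : sector 0 u =ᵐ[volume] 0) {δ : ℝ} (hδ : 0 < δ) (hδ1 : δ ≤ 1) :
    ∫ x, invWeight δ x * ‖tangD α u v x‖ ^ 2 ≤
      (2 - α) ^ 2 / ((2 - α) ^ 2 - 1) ^ 2 * ∫ x, ‖f x‖ ^ 2 := by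
  have hm : Measurable (invWeight δ) := by unfold invWeight; fun_prop
  have hw := fun x => (invWeight_pos hδ x).le
  set ρu : Plane → ℂ := fun x => ((‖x‖⁻¹ : ℝ) : ℂ) * u x with hρu
  have hu2 : MemLp ρu 2 volume := by
    refine (h.memLp_inv_perp h0 h1.le).ae_eq ?_
    filter_upwards [hs] with x hx
    simp [hρu, hx]
  have hρ : ∀ x, ‖ρu x‖ ^ 2 = (‖x‖ ^ 2)⁻¹ * ‖u x‖ ^ 2 := fun x => by
    rw [hρu, norm_mul, mul_pow, Complex.norm_real, Real.norm_of_nonneg (by positivity), inv_pow]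
  obtain ⟨iA, eA⟩ := lintegral_weight_eq h.memLp_tangD hw hm (invWeight_le hδ)
  obtain ⟨iB, eB⟩ := lintegral_weight_eq hu2 hw hm (invWeight_le hδ)
  have hB0 : 0 ≤ ∫ x, invWeight δ x * ‖ρu x‖ ^ 2 :=
    integral_nonneg fun x => by have := hw x; positivity
  have hA0 : 0 ≤ ∫ x, invWeight δ x * ‖tangD α u v x‖ ^ 2 :=
    integral_nonneg fun x => by have := hw x; positivity
  have hF0 : 0 ≤ ∫ x, ‖f x‖ ^ 2 := integral_nonneg fun x => by positivity
  -- The Hardy inequality off the s-wave with weight `1 / (r² (r² + δ))`; one factor `r²` cancels on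
  -- the right.
  have hardy : (2 - α) ^ 2 * (∫ x, invWeight δ x * ‖ρu x‖ ^ 2) ≤
      ∫ x, invWeight δ x * ‖tangD α u v x‖ ^ 2 := by
    have h2 := h.hardy_weight_perp h0 h1.le
      (W := fun r => ENNReal.ofReal ((r ^ 2 + δ)⁻¹ * (r ^ 2)⁻¹)) (by fun_prop)
    have e1 : ∫⁻ x : Plane, ENNReal.ofReal ((‖x‖ ^ 2 + δ)⁻¹ * (‖x‖ ^ 2)⁻¹)
        * ‖u x - sector 0 u x‖ₑ ^ 2
        = ∫⁻ x, ENNReal.ofReal (invWeight δ x) * ‖ρu x‖ₑ ^ 2 := by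
      refine lintegral_congr_ae ?_
      filter_upwards [hs] with x hx
      rw [hx, Pi.zero_apply, sub_zero, ENNReal.ofReal_mul (by positivity), mul_assoc, hρu,
        enorm_mul, mul_pow]
      congr 2
      rw [← ofReal_norm, ← ENNReal.ofReal_pow (norm_nonneg _), Complex.norm_real,
        Real.norm_of_nonneg (by positivity), inv_pow]
    have e2 : ∫⁻ x : Plane, ENNReal.ofReal ((‖x‖ ^ 2 + δ)⁻¹ * (‖x‖ ^ 2)⁻¹)
        * ENNReal.ofReal (‖x‖ ^ 2) * ‖tangD α u v x‖ₑ ^ 2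
        = ∫⁻ x, ENNReal.ofReal (invWeight δ x) * ‖tangD α u v x‖ₑ ^ 2 := by
      refine lintegral_congr_ae ?_
      filter_upwards [ae_mem_punctured] with x hx
      have hx' : ‖x‖ ^ 2 ≠ 0 := pow_ne_zero 2 (norm_ne_zero_iff.2 hx)
      rw [← ENNReal.ofReal_mul (by positivity), mul_assoc, inv_mul_cancel₀ hx', mul_one]
      rfl
    rw [e1, e2, eA, eB, ← ENNReal.ofReal_mul (by positivity)] at h2
    exact (ENNReal.ofReal_le_ofReal_iff hA0).1 h2
  -- The argument needs `q > 1`, which on `[0, 1]` holds precisely for `α < 1`.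
  set q := (2 - α) ^ 2 with hq
  have hq1 : 0 < q - 1 := by rw [hq]; nlinarith
  have hV := h.toInV.smooth_mul (contDiff_invWeight hδ)
    (fun x => by simp [invWeight]) (C := δ⁻¹ + δ⁻¹ * δ⁻¹)
    (fun x => by
      rw [Complex.norm_real, Real.norm_of_nonneg (hw x)]
      exact (invWeight_le hδ x).trans (le_add_of_nonneg_right (by positivity)))
    (fun j x => by
      rw [pd_invWeight hδ, Complex.norm_real, Real.norm_eq_abs]
      exact (abs_two_mul_invWeight_sq_le hδ hδ1 j x).trans (le_add_of_nonneg_left (by positivity)))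
  have heq := h.eq_of_inV h0 h1.le hV
  simp only [covD_smooth_mul, pd_invWeight hδ] at heq
  have iL : Integrable fun x => ∑ j, conj (((invWeight δ x : ℝ) : ℂ) * covD α j u (v j) x
        - Complex.I * ((-(2 * x j * invWeight δ x ^ 2) : ℝ) : ℂ) * u x) * covD α j u (v j) x := by
    refine integrable_finsetSum _ fun j _ => ?_
    have := Anyon.MemLp.integrable_mul_two (MemLp.conjugate (hV.memLp_cov j)) (h.memLp_cov j)
    simpa only [covD_smooth_mul, pd_invWeight hδ] using this
  have iF : Integrable fun x => ‖f x‖ ^ 2 := (memLp_two_iff_integrable_sq_norm h.memLp_rhs.1).1 h.memLp_rhs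
  have iR : Integrable fun x => conj (((invWeight δ x : ℝ) : ℂ) * u x) * f x :=
    Anyon.MemLp.integrable_mul_two (MemLp.conjugate hV.memLp) h.memLp_rhs
  -- The equation tested with `invWeight * u`, combined with the completed square; the price is one
  -- copy of the weighted norm of `u / r`.
  have s1 : ∫ x, invWeight δ x * ‖tangD α u v x‖ ^ 2 ≤
      (∫ x, (conj (((invWeight δ x : ℝ) : ℂ) * u x) * f x).re)
        + ∫ x, invWeight δ x * ‖ρu x‖ ^ 2 := by
    have hre : (∫ x, (conj (((invWeight δ x : ℝ) : ℂ) * u x) * f x).re) =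
        ∫ x, (∑ j, conj (((invWeight δ x : ℝ) : ℂ) * covD α j u (v j) x
        - Complex.I * ((-(2 * x j * invWeight δ x ^ 2) : ℝ) : ℂ) * u x) * covD α j u (v j) x).re :=
      (integral_re iR).trans ((congrArg Complex.re heq.symm).trans (integral_re iL).symm)
    have iLr : Integrable fun x => (∑ j, conj (((invWeight δ x : ℝ) : ℂ) * covD α j u (v j) x
        - Complex.I * ((-(2 * x j * invWeight δ x ^ 2) : ℝ) : ℂ) * u x) * covD α j u (v j) x).re :=
      iL.re
    rw [hre, ← integral_add iLr iB]
    refine integral_mono_ae iA (iLr.add iB) ?_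
    filter_upwards [ae_mem_punctured] with x hx
    have := weight_tangD_le α u v hδ hx
    rw [mul_assoc, ← hρ] at this
    exact this
  -- Young's inequality with parameter `q - 1`, so that the total coefficient of the weighted norm
  -- of `u / r` becomes `(q + 1) / 2 < q`.
  have s2 : ∫ x, (conj (((invWeight δ x : ℝ) : ℂ) * u x) * f x).re ≤
      (q - 1) / 2 * (∫ x, invWeight δ x * ‖ρu x‖ ^ 2) + (2 * (q - 1))⁻¹ * ∫ x, ‖f x‖ ^ 2 := by
    rw [← integral_const_mul, ← integral_const_mul, ← integral_add (iB.const_mul _) (iF.const_mul _)]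
    refine integral_mono_ae iR.re ((iB.const_mul _).add (iF.const_mul _)) ?_
    filter_upwards [ae_mem_punctured] with x hx
    refine (Complex.re_le_norm _).trans ?_
    have hx' : 0 < ‖x‖ ^ 2 := pow_pos (norm_pos_iff.2 hx) 2
    simp only [hρ]
    rw [norm_mul, RCLike.norm_conj, norm_mul, Complex.norm_real, Real.norm_of_nonneg (hw x)]
    set w := invWeight δ x
    have hwp := hw x
    have e5 : ‖x‖ ^ 2 * w ≤ 1 := sq_mul_invWeight_le hδ x
    set ρ := (‖x‖ ^ 2)⁻¹ with hρ'
    have hρp : 0 < ρ := inv_pos.2 hx'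
    have e6 : w ≤ ρ := by
      have := mul_le_mul_of_nonneg_left e5 hρp.le
      rwa [← mul_assoc, inv_mul_cancel₀ hx'.ne', mul_one, one_mul] at this
    have e7 : w * (‖u x‖ * ‖f x‖) ≤
        (q - 1) / 2 * (w * w * ‖u x‖ ^ 2) + (2 * (q - 1))⁻¹ * ‖f x‖ ^ 2 := by
      have : (q - 1) / 2 * (w * w * ‖u x‖ ^ 2) + (2 * (q - 1))⁻¹ * ‖f x‖ ^ 2
          - w * (‖u x‖ * ‖f x‖) = (2 * (q - 1))⁻¹ * ((q - 1) * (w * ‖u x‖) - ‖f x‖) ^ 2 := by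
        field_simp; ring
      have h3 : 0 ≤ (2 * (q - 1))⁻¹ * ((q - 1) * (w * ‖u x‖) - ‖f x‖) ^ 2 := by positivity
      linarith
    have e8 : w * w * ‖u x‖ ^ 2 ≤ w * (ρ * ‖u x‖ ^ 2) := by
      rw [mul_assoc]
      exact mul_le_mul_of_nonneg_left (mul_le_mul_of_nonneg_right e6 (by positivity)) hwp
    have e9 := mul_le_mul_of_nonneg_left e8 (by positivity : 0 ≤ (q - 1) / 2)
    linarith
  set A := ∫ x, invWeight δ x * ‖tangD α u v x‖ ^ 2
  set B := ∫ x, invWeight δ x * ‖ρu x‖ ^ 2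
  set F := ∫ x, ‖f x‖ ^ 2
  have s3 : A ≤ (q + 1) / 2 * B + (2 * (q - 1))⁻¹ * F := by linarith
  have hqp : 0 < q := by linarith
  -- The Hardy inequality bounds `B` by `A / q`; as `(q + 1) / (2 q) < 1`, this term is absorbed on
  -- the left.
  have s4 : (q + 1) / 2 * B ≤ (q + 1) / 2 * (q⁻¹ * A) := by
    refine mul_le_mul_of_nonneg_left ?_ (by positivity)
    rw [← div_eq_inv_mul, le_div_iff₀ hqp]; linarith
  have s5 : (q - 1) / (2 * q) * A ≤ (2 * (q - 1))⁻¹ * F := by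
    have : (q - 1) / (2 * q) * A = A - (q + 1) / 2 * (q⁻¹ * A) := by field_simp; ring
    linarith
  have s6 := mul_le_mul_of_nonneg_left s5 (by positivity : 0 ≤ 2 * q / (q - 1))
  calc A = 2 * q / (q - 1) * ((q - 1) / (2 * q) * A) := by field_simp
    _ ≤ _ := s6
    _ = _ := by field_simp

/-- The Rellich inequality: off the `s`-wave, elements of the operator domain have square integrable
`u / r²` and `∂_θ u / r²`. -/
theorem InOp.rellich (h : InOp α u v f) (h0 : 0 ≤ α) (h1 : α < 1)
    (hs : sector 0 u =ᵐ[volume] 0) :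
    MemLp (fun x => (((‖x‖ ^ 2)⁻¹ : ℝ) : ℂ) * u x) 2 volume ∧
    MemLp (fun x => (((‖x‖ ^ 2)⁻¹ : ℝ) : ℂ) * angV v x) 2 volume := by
  have hT := h.memLp_tangD
  have hfin : ∫⁻ x, ENNReal.ofReal (‖x‖ ^ 2)⁻¹ * ‖tangD α u v x‖ₑ ^ 2 < ⊤ := by
    -- The regularised bound does not depend on `δ`, so it survives the limit.
    refine (le_of_tendsto' (tendsto_lintegral_invWeight hT.1) fun n => ?_).trans_lt
      (ENNReal.ofReal_lt_top (r := (2 - α) ^ 2 / ((2 - α) ^ 2 - 1) ^ 2 * ∫ x, ‖f x‖ ^ 2))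
    have hδ : (0 : ℝ) < ((n : ℝ) + 1)⁻¹ := by positivity
    have hδ1 : ((n : ℝ) + 1)⁻¹ ≤ 1 := inv_le_one_of_one_le₀ (by simp)
    rw [(lintegral_weight_eq hT (fun x => (invWeight_pos hδ x).le)
      (by unfold invWeight; fun_prop) (invWeight_le hδ)).2]
    exact ENNReal.ofReal_le_ofReal (h.integral_invWeight_le h0 h1 hs hδ hδ1)
  have m1 : MemLp (fun x => ((‖x‖⁻¹ : ℝ) : ℂ) * tangD α u v x) 2 volume :=
    memLp_inv_norm_mul hT.1 hfin
  have m2 : MemLp (fun x => (((‖x‖ ^ 2)⁻¹ : ℝ) : ℂ) * u x) 2 volume := by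
    have h2 := h.hardy_weight_perp h0 h1.le
      (W := fun r => ENNReal.ofReal ((r ^ 2)⁻¹ * (r ^ 2)⁻¹)) (by fun_prop)
    have e2 : ∫⁻ x : Plane, ENNReal.ofReal ((‖x‖ ^ 2)⁻¹ * (‖x‖ ^ 2)⁻¹)
        * ENNReal.ofReal (‖x‖ ^ 2) * ‖tangD α u v x‖ₑ ^ 2
        = ∫⁻ x, ENNReal.ofReal (‖x‖ ^ 2)⁻¹ * ‖tangD α u v x‖ₑ ^ 2 := by
      refine lintegral_congr_ae ?_
      filter_upwards [ae_mem_punctured] with x hx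
      have hx' : ‖x‖ ^ 2 ≠ 0 := pow_ne_zero 2 (norm_ne_zero_iff.2 hx)
      rw [← ENNReal.ofReal_mul (by positivity), mul_assoc, inv_mul_cancel₀ hx', mul_one]
    rw [e2] at h2
    have h3 := h2.trans_lt hfin
    have h4 : (2 - α) ≠ 0 := by linarith
    have h5 := (ENNReal.mul_lt_top_iff.1 h3).elim (fun h => h.2) fun h => h.elim
      (fun h => absurd h (by simp [h4])) fun h => by rw [h]; exact ENNReal.zero_lt_top
    refine memLp_two_iff_lintegral.2 ⟨(aestronglyMeasurable_of_contDiffOn contDiffOn_inv_sq).mul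
      h.memLp.1, lt_of_eq_of_lt (lintegral_congr_ae ?_) h5⟩
    filter_upwards [hs] with x hx
    rw [hx, Pi.zero_apply, sub_zero, enorm_mul, mul_pow]
    congr 1
    rw [← ofReal_norm, ← ENNReal.ofReal_pow (norm_nonneg _), Complex.norm_real,
      Real.norm_of_nonneg (by positivity), sq ((‖x‖ ^ 2)⁻¹)]
  -- By `norm_mul_tangD` the angular derivative is `i r` times the tangential component minus `i α
  -- u`; divide by `r²`.
  refine ⟨m2, ((m1.const_mul Complex.I).sub (m2.const_mul (Complex.I * α))).ae_eq ?_⟩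
  filter_upwards [ae_mem_punctured] with x hx
  have h2 := norm_mul_tangD α u v hx
  have hx' : (‖x‖ : ℂ) ≠ 0 := by exact_mod_cast norm_ne_zero_iff.2 hx
  have h3 : tangD α u v x = (‖x‖ : ℂ)⁻¹ * (-Complex.I * angV v x + α * u x) := by
    rw [angV, ← h2, inv_mul_cancel_left₀ hx']
  simp only [Pi.sub_apply, h3]
  push_cast
  field_simp
  linear_combination (-angV v x) * Complex.I_sq

/-! ### Weak derivatives on the half-line -/

/-- Test functions on the open half-line. -/
def IsRadTest (η : ℝ → ℂ) : Prop := ContDiff ℝ ∞ η ∧ HasCompactSupport η ∧ tsupport η ⊆ Ioi 0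

/-- `q` is the weak derivative of `p` on the open half-line. -/
def HasRadDeriv (p q : ℝ → ℂ) : Prop :=
  LocallyIntegrableOn p (Ioi 0) ∧ LocallyIntegrableOn q (Ioi 0) ∧
    ∀ η, IsRadTest η → ∫ r, deriv η r * p r = - ∫ r, η r * q r

namespace IsRadTest
variable {η : ℝ → ℂ}

lemma mul_contDiffOn (h : IsRadTest η) {w : ℝ → ℂ} (hw : ContDiffOn ℝ ∞ w (Ioi 0)) :
    IsRadTest (fun r => w r * η r) := by
  refine ⟨?_, h.2.1.mul_left, (tsupport_mul_subset_right (f := w) (g := η)).trans h.2.2⟩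
  rw [contDiff_iff_contDiffAt]
  intro x
  by_cases hx : x ∈ Ioi (0 : ℝ)
  · exact (hw.contDiffAt (isOpen_Ioi.mem_nhds hx)).mul h.1.contDiffAt
  · have : (fun x => w x * η x) =ᶠ[𝓝 x] fun _ => 0 := by
      have hx' : x ∉ tsupport η := fun hh => hx (h.2.2 hh)
      filter_upwards [(notMem_tsupport_iff_eventuallyEq.1 hx')] with y hy
      simp [hy]
    exact contDiffAt_const.congr_of_eventuallyEq this

lemma deriv (h : IsRadTest η) : IsRadTest (deriv η) :=
  ⟨(contDiff_infty_iff_deriv.1 h.1).2, h.2.1.deriv, (tsupport_deriv_subset).trans h.2.2⟩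

lemma differentiable (h : IsRadTest η) : Differentiable ℝ η := h.1.differentiable (by simp)

lemma eq_zero (h : IsRadTest η) {r : ℝ} (hr : r ≤ 0) : η r = 0 :=
  image_eq_zero_of_notMem_tsupport fun hh => absurd (h.2.2 hh) (not_lt.2 hr)

lemma integrable_mul (h : IsRadTest η) {p : ℝ → ℂ} (hp : LocallyIntegrableOn p (Ioi 0)) :
    Integrable fun r => η r * p r := by
  have h1 : IntegrableOn (fun r => η r * p r) (tsupport η) :=
    (hp.integrableOn_compact_subset h.2.2 h.2.1).continuousOn_mul h.1.continuous.continuousOn h.2.1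
  rwa [integrableOn_iff_integrable_of_support_subset] at h1
  intro x hx
  exact subset_tsupport _ (left_ne_zero_of_mul hx)

lemma of_Icc (h : ContDiff ℝ ∞ η) {a b : ℝ} (ha : 0 < a) (h0 : ∀ r ∉ Icc a b, η r = 0) :
    IsRadTest η := by
  have hs : tsupport η ⊆ Icc a b :=
    closure_minimal (fun r hr => by_contra fun hh => hr (h0 r hh)) isClosed_Icc
  exact ⟨h, HasCompactSupport.intro isCompact_Icc h0, hs.trans fun r hr => ha.trans_le hr.1⟩

/-- The interval is enlarged to contain `1`, the base point of the primitives below, and is taken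
strictly larger than the support so that `η` vanishes at its endpoints. -/
lemma exists_Icc (h : IsRadTest η) :
    ∃ a b, 0 < a ∧ a < 1 ∧ 1 < b ∧ ∀ r ∉ Ioo a b, r ∉ tsupport η := by
  rcases (tsupport η).eq_empty_or_nonempty with he | hne
  · refine ⟨1 / 2, 2, by norm_num, by norm_num, by norm_num, fun r _ => ?_⟩
    simp [he]
  · obtain ⟨a, ha, hal⟩ := h.2.1.exists_isLeast hne
    obtain ⟨b, hb, hbl⟩ := h.2.1.exists_isGreatest hne
    have ha0 : 0 < a := h.2.2 ha
    refine ⟨min a 1 / 2, max b 1 + 1, by positivity, ?_, ?_, fun r hr => ?_⟩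
    · linarith [min_le_right a 1]
    · linarith [le_max_right b 1]
    · refine fun hh => hr ⟨?_, ?_⟩
      · have := hal hh
        have h3 : 0 < min a 1 := by positivity
        linarith [min_le_left a 1]
      · linarith [hbl hh, le_max_left b 1]

/-- Vanishing mean makes the primitive zero to the right of the support as well as to the left. -/
lemma primitive (h : IsRadTest η) (h0 : ∫ r, η r = 0) :
    IsRadTest fun r => ∫ t in (0 : ℝ)..r, η t := by
  obtain ⟨a, b, ha, ha1, hb1, hab'⟩ := h.exists_Icc
  have hab := fun r hr => image_eq_zero_of_notMem_tsupport (hab' r hr)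
  have hd : ∀ r, HasDerivAt (fun r => ∫ t in (0 : ℝ)..r, η t) (η r) r := fun r =>
    intervalIntegral.integral_hasDerivAt_right (h.1.continuous.intervalIntegrable _ _)
      (h.1.continuous.stronglyMeasurableAtFilter _ _) h.1.continuous.continuousAt
  have hi : Integrable η := h.1.continuous.integrable_of_hasCompactSupport h.2.1
  refine of_Icc (a := a) (b := b) (contDiff_infty_iff_deriv.2 ⟨fun r => (hd r).differentiableAt, ?_⟩) ha
    fun r hr => ?_
  · rw [show _root_.deriv (fun r => ∫ t in (0 : ℝ)..r, η t) = η from funext fun r => (hd r).deriv]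
    exact h.1
  · by_cases hra : r < a
    · rw [intervalIntegral.integral_zero_ae]
      refine ae_of_all _ fun t ht => hab t fun h => ?_
      rcases le_total 0 r with h1 | h1
      · rw [uIoc_of_le h1] at ht; linarith [ht.2, h.1]
      · rw [uIoc_of_ge h1] at ht; linarith [ht.2, h.1]
    · have hrb : b < r := by
        by_contra hh
        exact hr ⟨not_lt.1 hra, not_lt.1 hh⟩
      rw [intervalIntegral.integral_of_le (by linarith), setIntegral_eq_integral_of_forall_compl_eq_zero, h0]
      intro t ht
      refine hab t fun hh => ht ⟨by linarith [hh.1], by linarith [hh.2]⟩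

end IsRadTest

lemma exists_radTest : ∃ ρ : ℝ → ℂ, IsRadTest ρ ∧ ∫ r, ρ r = 1 := by
  let b : ContDiffBump (1 : ℝ) := ⟨1 / 4, 1 / 2, by norm_num, by norm_num⟩
  refine ⟨fun r => (b.normed volume r : ℂ), IsRadTest.of_Icc (a := 1 / 2) (b := 3 / 2)
    (Complex.ofRealCLM.contDiff.comp b.contDiff_normed) (by norm_num) fun r hr => ?_, ?_⟩
  · have : r ∉ tsupport (b.normed volume) := by
      rw [b.tsupport_normed_eq, Real.closedBall_eq_Icc]
      norm_num at hr ⊢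
      exact hr
    rw [image_eq_zero_of_notMem_tsupport this, Complex.ofReal_zero]
  · rw [integral_complex_ofReal, b.integral_normed, Complex.ofReal_one]

namespace HasRadDeriv
variable {p q p' q' : ℝ → ℂ}

lemma congr (h : HasRadDeriv p q) (hp : ∀ r, 0 < r → p r = p' r) (hq : ∀ r, 0 < r → q r = q' r) :
    HasRadDeriv p' q' := by
  have key : ∀ {a b : ℝ → ℂ}, (∀ r, 0 < r → a r = b r) → LocallyIntegrableOn a (Ioi 0) →
      LocallyIntegrableOn b (Ioi 0) := fun hab ha x hx => by
    obtain ⟨s, hs, hi⟩ := ha x hx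
    refine ⟨s ∩ Ioi 0, inter_mem hs self_mem_nhdsWithin, (hi.mono_set inter_subset_left).congr ?_⟩
    filter_upwards [ae_restrict_of_ae_restrict_of_subset inter_subset_right
      (ae_restrict_mem measurableSet_Ioi)] with r hr using hab r hr
  refine ⟨key hp h.1, key hq h.2.1, fun η hη => ?_⟩
  have e : ∀ {a b φ : ℝ → ℂ}, IsRadTest φ → (∀ r, 0 < r → a r = b r) →
      ∫ r, φ r * a r = ∫ r, φ r * b r := fun hφ hab => by
    congr 1; ext r
    rcases lt_or_ge 0 r with hr | hr
    · rw [hab r hr]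
    · rw [hφ.eq_zero hr, zero_mul, zero_mul]
  rw [← e hη.deriv hp, ← e hη hq, h.2.2 η hη]

lemma mul_smooth (h : HasRadDeriv p q) {w w' : ℝ → ℂ} (hw : ContDiffOn ℝ ∞ w (Ioi 0))
    (hw' : ∀ r, 0 < r → HasDerivAt w (w' r) r) (hc : ContinuousOn w' (Ioi 0)) :
    HasRadDeriv (fun r => w r * p r) (fun r => w r * q r + w' r * p r) := by
  have l1 : LocallyIntegrableOn (fun r => w r * q r) (Ioi 0) :=
    h.2.1.continuousOn_mul hw.continuousOn isOpen_Ioi.isLocallyClosed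
  have l2 : LocallyIntegrableOn (fun r => w' r * p r) (Ioi 0) :=
    h.1.continuousOn_mul hc isOpen_Ioi.isLocallyClosed
  have l3 : LocallyIntegrableOn (fun r => w r * p r) (Ioi 0) :=
    h.1.continuousOn_mul hw.continuousOn isOpen_Ioi.isLocallyClosed
  refine ⟨l3, l1.add l2, fun η hη => ?_⟩
  have ht := hη.mul_contDiffOn hw
  have h1 := h.2.2 _ ht
  have e1 : ∫ r, deriv (fun r => w r * η r) r * p r =
      (∫ r, deriv η r * (w r * p r)) + ∫ r, η r * (w' r * p r) := by
    rw [← integral_add (hη.deriv.integrable_mul l3) (hη.integrable_mul l2)]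
    congr 1; ext r
    rcases lt_or_ge 0 r with hr | hr
    · rw [((hw' r hr).fun_mul (hη.differentiable r).hasDerivAt).deriv]
      ring
    · rw [ht.deriv.eq_zero hr, hη.eq_zero hr, hη.deriv.eq_zero hr]; ring
  have e2 : ∫ r, η r * (w r * q r + w' r * p r) =
      (∫ r, w r * η r * q r) + ∫ r, η r * (w' r * p r) := by
    rw [← integral_add (ht.integrable_mul h.2.1) (hη.integrable_mul l2)]
    congr 1; ext r; ring
  rw [e2]
  rw [e1] at h1
  linear_combination h1

lemma sub (h : HasRadDeriv p q) (h' : HasRadDeriv p' q') :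
    HasRadDeriv (fun r => p r - p' r) (fun r => q r - q' r) := by
  refine ⟨h.1.sub h'.1, h.2.1.sub h'.2.1, fun η hη => ?_⟩
  have := congrArg₂ (· - ·) (h.2.2 η hη) (h'.2.2 η hη)
  simp only [mul_sub]
  rw [integral_sub (hη.deriv.integrable_mul h.1) (hη.deriv.integrable_mul h'.1),
    integral_sub (hη.integrable_mul h.2.1) (hη.integrable_mul h'.2.1)]
  linear_combination this

/-- Integration by parts against a primitive. -/
lemma integral_deriv_mul_primitive (hq : LocallyIntegrableOn q (Ioi 0)) {η : ℝ → ℂ}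
    (hη : IsRadTest η) :
    ∫ r, deriv η r * (∫ t in (1 : ℝ)..r, q t) = - ∫ r, η r * q r := by
  obtain ⟨a, b, ha, ha1, hb1, hab'⟩ := hη.exists_Icc
  have hab := fun r hr => image_eq_zero_of_notMem_tsupport (hab' r hr)
  have hsub : Icc a b ⊆ Ioi 0 := fun r hr => ha.trans_le hr.1
  have hqi : IntegrableOn q (Icc a b) := hq.integrableOn_compact_subset hsub isCompact_Icc
  have hqi' : IntegrableOn q (Ioc a b) := hqi.mono_set Ioc_subset_Icc_self
  have hd0 : ∀ r ∉ Ioc a b, deriv η r = 0 := fun r hr =>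
    image_eq_zero_of_notMem_tsupport fun hh =>
      hab' r (fun h => hr ⟨h.1, h.2.le⟩) (tsupport_deriv_subset hh)
  have hηi : IntegrableOn (deriv η) (Ioc a b) :=
    (hη.deriv.1.continuous.integrable_of_hasCompactSupport hη.deriv.2.1).integrableOn
  have hftc : ∀ s t, ∫ r in s..t, deriv η r = η t - η s := fun s t =>
    intervalIntegral.integral_deriv_eq_sub (fun r _ => hη.differentiable r)
      (hη.deriv.1.continuous.intervalIntegrable _ _)
  have hηa : η a = 0 := hab a (by simp)
  have hηb : η b = 0 := hab b (by simp)
  have hin : ∀ s t, s ∈ Icc a b → t ∈ Icc a b → IntervalIntegrable q volume s t := fun s t hs ht =>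
    (hqi.mono_set (uIcc_subset_Icc hs ht)).intervalIntegrable
  have e1 : ∫ r, deriv η r * (∫ t in (1 : ℝ)..r, q t) =
      ∫ r in Ioc a b, deriv η r * (∫ t in a..r, q t) := by
    rw [← setIntegral_eq_integral_of_forall_compl_eq_zero (s := Ioc a b)
      fun r hr => by rw [hd0 r hr, zero_mul]]
    -- Moving the base point from `1` to `a` changes the primitive by a constant, which `η'`
    -- integrates to zero.
    have e2 : ∫ r in Ioc a b, deriv η r * (∫ t in (1 : ℝ)..r, q t) =
        ∫ r in Ioc a b, (deriv η r * (∫ t in a..r, q t) - deriv η r * ∫ t in a..1, q t) := by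
      refine setIntegral_congr_fun measurableSet_Ioc fun r hr => ?_
      have := intervalIntegral.integral_interval_sub_left
        (hin a r ⟨le_rfl, by linarith⟩ ⟨hr.1.le, hr.2⟩) (hin a 1 ⟨le_rfl, by linarith⟩ ⟨ha1.le, hb1.le⟩)
      change _ = _
      rw [← this, mul_sub]
    have hcont : ContinuousOn (fun r => ∫ t in a..r, q t) (Icc a b) :=
      intervalIntegral.continuousOn_primitive_interval' (hin a b (by simp; linarith) (by simp; linarith))
        (by simp)|>.mono (by rw [uIcc_of_le (by linarith)])
    have i1 : IntegrableOn (fun r => deriv η r * (∫ t in a..r, q t)) (Ioc a b) :=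
      ((hη.deriv.1.continuous.continuousOn.mul hcont).integrableOn_compact isCompact_Icc).mono_set
        Ioc_subset_Icc_self
    rw [e2, integral_sub i1 (hηi.mul_const _), integral_mul_const,
      ← intervalIntegral.integral_of_le (by linarith : a ≤ b) (f := deriv η), hftc, hηa, hηb]
    ring
  -- Fubini on the triangle `t ≤ r`; the inner integral of `η'` over `(t, b]` is then `-η t`.
  have hprod : Integrable (fun z : ℝ × ℝ => (Ici z.2).indicator (fun _ => deriv η z.1 * q z.2) z.1)
      ((volume.restrict (Ioc a b)).prod (volume.restrict (Ioc a b))) := by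
    have h1 := Integrable.mul_prod hηi hqi'
    have h2 : MeasurableSet {z : ℝ × ℝ | z.2 ≤ z.1} := measurableSet_le measurable_snd measurable_fst
    refine (h1.indicator h2).congr (ae_of_all _ fun z => ?_)
    simp [indicator]
  have hsw := integral_integral_swap
    (f := fun r t => (Ici t).indicator (fun _ => deriv η r * q t) r) hprod
  rw [e1]
  have e3 : ∫ r in Ioc a b, deriv η r * (∫ t in a..r, q t) =
      ∫ r in Ioc a b, ∫ t in Ioc a b, (Ici t).indicator (fun _ => deriv η r * q t) r := by
    refine setIntegral_congr_fun measurableSet_Ioc fun r hr => ?_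
    have h1 : ∀ t, (Ici t).indicator (fun _ => deriv η r * q t) r =
        (Iic r).indicator (fun t => deriv η r * q t) t := fun t => by simp [indicator]
    simp only [h1]
    rw [setIntegral_indicator measurableSet_Iic, integral_const_mul,
      intervalIntegral.integral_of_le hr.1.le]
    congr 3
    ext t; simp only [mem_inter_iff, mem_Ioc, mem_Iic]
    constructor
    · rintro ⟨h3, h4⟩; exact ⟨⟨h3, h4.trans hr.2⟩, h4⟩
    · rintro ⟨⟨h3, _⟩, h4⟩; exact ⟨h3, h4⟩
  have e4 : ∫ t in Ioc a b, ∫ r in Ioc a b, (Ici t).indicator (fun _ => deriv η r * q t) r =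
      ∫ t in Ioc a b, -(η t * q t) := by
    refine setIntegral_congr_fun measurableSet_Ioc fun t ht => ?_
    have h0 : (fun r => (Ici t).indicator (fun _ => deriv η r * q t) r) =
        (Ici t).indicator fun r => deriv η r * q t := funext fun r => by simp [indicator]
    rw [h0, setIntegral_indicator measurableSet_Ici, integral_mul_const]
    have h1 : (Ioc a b ∩ Ici t : Set ℝ) =ᵐ[volume] (Ioc t b : Set ℝ) := by
      have : Ioc a b ∩ Ici t = Icc t b := by
        ext s; simp only [mem_inter_iff, mem_Ioc, mem_Ici, mem_Icc]
        constructor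
        · rintro ⟨⟨_, h3⟩, h4⟩; exact ⟨h4, h3⟩
        · rintro ⟨h3, h4⟩; exact ⟨⟨ht.1.trans_le h3, h4⟩, h3⟩
      rw [this]; exact Ioc_ae_eq_Icc.symm
    rw [setIntegral_congr_set h1, ← intervalIntegral.integral_of_le ht.2, hftc, hηb]
    ring
  rw [e3, hsw, e4, integral_neg, setIntegral_eq_integral_of_forall_compl_eq_zero]
  intro t ht
  rw [hab t fun h => ht ⟨h.1, h.2.le⟩, zero_mul]

/-- A function with a weak derivative is a primitive of it. -/
theorem exists_eq_primitive (h : HasRadDeriv p q) :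
    ∃ c : ℂ, ∀ᵐ r, 0 < r → p r = c + ∫ t in (1 : ℝ)..r, q t := by
  set Q : ℝ → ℂ := fun r => ∫ t in (1 : ℝ)..r, q t with hQ
  have hQc : ContinuousOn Q (Ioi 0) := by
    intro r hr
    have hr' : 0 < r := hr
    have hi : IntervalIntegrable q volume (min r 1 / 2) (max r 1 + 1) := by
      refine (h.2.1.integrableOn_compact_subset ?_ isCompact_uIcc).intervalIntegrable
      intro t ht
      have h3 : 0 < min r 1 / 2 := by positivity
      rw [uIcc_of_le (by linarith [min_le_left r 1, le_max_left r 1])] at ht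
      exact h3.trans_le ht.1
    have h3 : min r 1 / 2 < r := by linarith [min_le_left r 1]
    have h4 : r < max r 1 + 1 := by linarith [le_max_left r 1]
    have h5 := intervalIntegral.continuousOn_primitive_interval' hi (a := 1) (by
      rw [uIcc_of_le (by linarith)]
      constructor <;> linarith [min_le_right r 1, le_max_right r 1])
    rw [uIcc_of_le (by linarith)] at h5
    exact (h5.continuousAt (Icc_mem_nhds h3 h4)).continuousWithinAt
  have hPl : LocallyIntegrableOn (fun r => p r - Q r) (Ioi 0) :=
    h.1.sub (hQc.locallyIntegrableOn measurableSet_Ioi)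
  have hQl := hQc.locallyIntegrableOn (μ := volume) measurableSet_Ioi
  -- The du Bois-Reymond argument: `p - Q` has vanishing weak derivative, hence is constant.
  have h0 : ∀ η, IsRadTest η → ∫ r, deriv η r * (p r - Q r) = 0 := fun η hη => by
    simp only [mul_sub]
    rw [integral_sub (hη.deriv.integrable_mul h.1) (hη.deriv.integrable_mul hQl), h.2.2 η hη,
      integral_deriv_mul_primitive h.2.1 hη, sub_self]
  obtain ⟨ρ, hρ, hρ1⟩ := exists_radTest
  set c := ∫ r, ρ r * (p r - Q r) with hc
  have hmain : ∀ ζ, IsRadTest ζ → ∫ r, ζ r * (p r - Q r - c) = 0 := fun ζ hζ => by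
    have hζi : Integrable ζ := hζ.1.continuous.integrable_of_hasCompactSupport hζ.2.1
    have hρi : Integrable ρ := hρ.1.continuous.integrable_of_hasCompactSupport hρ.2.1
    set m := ∫ r, ζ r with hm
    -- Subtracting the multiple of `ρ` with the same integral makes the mean zero, so the difference
    -- is the derivative of a test function.
    have hτ : IsRadTest fun r => ζ r - m * ρ r := by
      obtain ⟨a, b, ha, ha1, hb1, hab⟩ := hζ.exists_Icc
      obtain ⟨a', b', ha', ha1', hb1', hab'⟩ := hρ.exists_Icc
      refine IsRadTest.of_Icc (a := min a a') (b := max b b') (hζ.1.sub (contDiff_const.mul hρ.1))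
        (lt_min ha ha') fun r hr => ?_
      rw [image_eq_zero_of_notMem_tsupport (hab r fun h => hr
          ⟨(min_le_left _ _).trans h.1.le, h.2.le.trans (le_max_left _ _)⟩),
        image_eq_zero_of_notMem_tsupport (hab' r fun h => hr
          ⟨(min_le_right _ _).trans h.1.le, h.2.le.trans (le_max_right _ _)⟩)]
      ring
    have hτ0 : ∫ r, (ζ r - m * ρ r) = 0 := by
      rw [integral_sub hζi (hρi.const_mul m), integral_const_mul, hρ1, ← hm]; ring
    have h1 := h0 _ (hτ.primitive hτ0)
    have h2 : deriv (fun r => ∫ t in (0 : ℝ)..r, (ζ t - m * ρ t)) = fun r => ζ r - m * ρ r :=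
      funext fun r => hτ.1.continuous.deriv_integral _ 0 r
    rw [h2] at h1
    have i1 := hζ.integrable_mul hPl
    have i2 := hρ.integrable_mul hPl
    have e1 : ∫ r, (ζ r - m * ρ r) * (p r - Q r) = (∫ r, ζ r * (p r - Q r)) - m * c := by
      rw [hc, ← integral_const_mul, ← integral_sub i1 (i2.const_mul m)]
      congr 1; ext r; ring
    have e2 : ∫ r, ζ r * (p r - Q r - c) = (∫ r, ζ r * (p r - Q r)) - m * c := by
      rw [hm, ← integral_mul_const, ← integral_sub i1 (hζi.mul_const c)]
      congr 1; ext r; ring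
    rw [e2, ← e1, h1]
  refine ⟨c, ?_⟩
  have key := isOpen_Ioi.ae_eq_zero_of_integral_contDiff_smul_eq_zero (μ := volume)
    (hPl.sub (locallyIntegrableOn_const c)) (by
    intro g hg hgc hgs
    have ht : IsRadTest (fun x => (g x : ℂ)) := by
      refine ⟨Complex.ofRealCLM.contDiff.comp hg, hgc.comp_left (g := fun r : ℝ => (r : ℂ)) (by simp), ?_⟩
      refine Subset.trans (closure_mono ?_) hgs
      intro x hx hx0
      exact hx (by simp [hx0])
    simpa using hmain _ ht)
  filter_upwards [key] with r hr hr0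
  have h3 : p r - Q r - c = 0 := hr hr0
  linear_combination h3

end HasRadDeriv

/-! ### The radial equation at the origin -/

lemma contDiffOn_rpowC (β : ℝ) : ContDiffOn ℝ ∞ (fun r : ℝ => ((r ^ β : ℝ) : ℂ)) (Ioi 0) :=
  Complex.ofRealCLM.contDiff.comp_contDiffOn
    (contDiffOn_id.rpow_const_of_ne fun r hr => (ne_of_gt hr : (r : ℝ) ≠ 0))

lemma hasDerivAt_rpowC (β : ℝ) {r : ℝ} (hr : 0 < r) :
    HasDerivAt (fun r : ℝ => ((r ^ β : ℝ) : ℂ)) ((β : ℂ) * ((r ^ (β - 1) : ℝ) : ℂ)) r := by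
  have := (Real.hasDerivAt_rpow_const (p := β) (Or.inl hr.ne')).ofReal_comp
  simpa using this

lemma HasRadDeriv.mul_rpow {p q : ℝ → ℂ} (h : HasRadDeriv p q) (β : ℝ) :
    HasRadDeriv (fun r => ((r ^ β : ℝ) : ℂ) * p r)
      (fun r => ((r ^ β : ℝ) : ℂ) * q r + (β : ℂ) * ((r ^ (β - 1) : ℝ) : ℂ) * p r) :=
  h.mul_smooth (contDiffOn_rpowC β) (fun _ hr => hasDerivAt_rpowC β hr)
    (continuousOn_const.mul (contDiffOn_rpowC (β - 1)).continuousOn)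

lemma HasRadDeriv.exists_eq_primitive_zero {p q : ℝ → ℂ} (h : HasRadDeriv p q)
    (hq : IntegrableOn q (Ioc 0 1)) :
    ∃ c : ℂ, ∀ᵐ r, r ∈ Ioc (0 : ℝ) 1 → p r = c + ∫ t in (0 : ℝ)..r, q t := by
  obtain ⟨c, hc⟩ := h.exists_eq_primitive
  refine ⟨c - ∫ t in (0 : ℝ)..1, q t, ?_⟩
  filter_upwards [hc] with r hr hr1
  have hi : ∀ s ∈ Ioc (0 : ℝ) 1, IntervalIntegrable q volume 0 s := fun s hs =>
    (intervalIntegrable_iff_integrableOn_Ioc_of_le hs.1.le).2 (hq.mono_set (Ioc_subset_Ioc_right hs.2))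
  rw [hr hr1.1, ← intervalIntegral.integral_interval_sub_left (hi r hr1) (hi 1 ⟨one_pos, le_rfl⟩)]
  ring

/-- Nonnegativity of the variance of `φ`, in the form `0 ≤ ∫ (r φ - m)²` with `m = ∫ φ`. -/
lemma sq_integral_le {φ : ℝ → ℝ} {r : ℝ} (hr : 0 < r) (h1 : IntegrableOn φ (Ioc 0 r))
    (h2 : IntegrableOn (fun t => φ t ^ 2) (Ioc 0 r)) :
    (∫ t in (0 : ℝ)..r, φ t) ^ 2 ≤ r * ∫ t in (0 : ℝ)..r, φ t ^ 2 := by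
  rw [intervalIntegral.integral_of_le hr.le, intervalIntegral.integral_of_le hr.le]
  set m := ∫ t in Ioc 0 r, φ t with hm
  have h3 : 0 ≤ ∫ t in Ioc 0 r, (r * φ t - m) ^ 2 := integral_nonneg fun t => sq_nonneg _
  have h4 : ∫ t in Ioc 0 r, (r * φ t - m) ^ 2 =
      r ^ 2 * (∫ t in Ioc 0 r, φ t ^ 2) - 2 * r * m * m + r * m ^ 2 := by
    have e : ∀ t, (r * φ t - m) ^ 2 = r ^ 2 * φ t ^ 2 - 2 * r * m * φ t + m ^ 2 := fun t => by ring
    have i1 : IntegrableOn (fun t => r ^ 2 * φ t ^ 2 - 2 * r * m * φ t) (Ioc 0 r) :=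
      (h2.const_mul _).sub (h1.const_mul _)
    simp only [e]
    rw [integral_add i1 (integrableOn_const (by simp)), integral_sub (h2.const_mul _) (h1.const_mul _),
      integral_const_mul, integral_const_mul, setIntegral_const]
    simp [Measure.real, hr.le]
    exact Or.inl hm.symm
  rw [h4] at h3
  nlinarith

section bounds
variable {f : ℝ → ℂ} (hfm : AEStronglyMeasurable f (volume.restrict (Ioc (0 : ℝ) 1)))
  (hfi : IntegrableOn (fun r => r * ‖f r‖ ^ 2) (Ioc 0 1))

lemma integrableOn_rpow_mul_norm (hfm : AEStronglyMeasurable f (volume.restrict (Ioc (0 : ℝ) 1)))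
    (hfi : IntegrableOn (fun r => r * ‖f r‖ ^ 2) (Ioc 0 1)) {β : ℝ} (hβ : 1 / 2 ≤ β) :
    IntegrableOn (fun r : ℝ => r ^ β * ‖f r‖) (Ioc 0 1) := by
  have h1 : IntegrableOn (fun r : ℝ => 1 + r * ‖f r‖ ^ 2) (Ioc 0 1) :=
    (integrableOn_const (by simp)).add hfi
  refine Integrable.mono' h1
    ((measurable_id.pow_const β).aestronglyMeasurable.mul hfm.norm) ?_
  filter_upwards [ae_restrict_mem measurableSet_Ioc] with r hr
  rw [Real.norm_of_nonneg (by have := hr.1; positivity)]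
  have h2 : r ^ β ≤ Real.sqrt r := by
    rw [Real.sqrt_eq_rpow]
    exact Real.rpow_le_rpow_of_exponent_ge hr.1 hr.2 hβ
  have h3 := mul_le_mul_of_nonneg_right h2 (norm_nonneg (f r))
  have h4 : r * ‖f r‖ ^ 2 = (Real.sqrt r * ‖f r‖) ^ 2 := by
    rw [mul_pow, Real.sq_sqrt hr.1.le]
  nlinarith [sq_nonneg (Real.sqrt r * ‖f r‖ - 1)]

lemma integrableOn_rpow_mul_sq (hfm : AEStronglyMeasurable f (volume.restrict (Ioc (0 : ℝ) 1)))
    (hfi : IntegrableOn (fun r => r * ‖f r‖ ^ 2) (Ioc 0 1)) {β : ℝ} (hβ : 1 ≤ β) :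
    IntegrableOn (fun r : ℝ => r ^ β * ‖f r‖ ^ 2) (Ioc 0 1) := by
  refine Integrable.mono' hfi
    ((measurable_id.pow_const β).aestronglyMeasurable.mul (hfm.norm.pow 2)) ?_
  filter_upwards [ae_restrict_mem measurableSet_Ioc] with r hr
  rw [Real.norm_of_nonneg (by have := hr.1; positivity)]
  refine mul_le_mul_of_nonneg_right ?_ (by positivity)
  have := Real.rpow_le_rpow_of_exponent_ge hr.1 hr.2 hβ
  rwa [Real.rpow_one] at this

/-- The weighted mass of `f` near the origin. -/
def mass (α : ℝ) (f : ℝ → ℂ) (r : ℝ) : ℝ := ∫ t in (0 : ℝ)..r, t ^ (2 - α) * ‖f t‖ ^ 2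

variable {α : ℝ}

lemma mass_nonneg (α : ℝ) (f : ℝ → ℂ) {r : ℝ} (hr : 0 ≤ r) : 0 ≤ mass α f r :=
  intervalIntegral.integral_nonneg hr fun t ht => by have := ht.1; positivity

lemma mass_mono (hfm : AEStronglyMeasurable f (volume.restrict (Ioc (0 : ℝ) 1)))
    (hfi : IntegrableOn (fun r => r * ‖f r‖ ^ 2) (Ioc 0 1)) (h1 : α < 1) {s r : ℝ} (hs : 0 ≤ s)
    (hsr : s ≤ r) (hr : r ≤ 1) : mass α f s ≤ mass α f r := by
  unfold mass
  rw [intervalIntegral.integral_of_le hs, intervalIntegral.integral_of_le (hs.trans hsr)]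
  refine setIntegral_mono_set ((integrableOn_rpow_mul_sq hfm hfi (by linarith)).mono_set
    (Ioc_subset_Ioc_right hr)) ?_ (Ioc_subset_Ioc_right hsr).eventuallyLE
  filter_upwards [ae_restrict_mem measurableSet_Ioc] with t ht
  have := ht.1
  simp only [Pi.zero_apply]
  positivity

/-- Split `t^(1+α) = t^(3α/2) * t^(1-α/2)`: the first factor is at most `r^(3α/2)`, and
Cauchy-Schwarz on the second gives `r` times `mass`. -/
lemma norm_integral_rpow_mul_sq_le
    (hfm : AEStronglyMeasurable f (volume.restrict (Ioc (0 : ℝ) 1)))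
    (hfi : IntegrableOn (fun r => r * ‖f r‖ ^ 2) (Ioc 0 1)) (h0 : 0 ≤ α) (h1 : α < 1) {r : ℝ}
    (hr : r ∈ Ioc (0 : ℝ) 1) :
    ‖∫ t in (0 : ℝ)..r, ((t ^ (1 + α) : ℝ) : ℂ) * f t‖ ^ 2 ≤ r ^ (1 + 3 * α) * mass α f r := by
  have hsub : Ioc 0 r ⊆ Ioc (0 : ℝ) 1 := Ioc_subset_Ioc_right hr.2
  have i1 : IntegrableOn (fun t : ℝ => t ^ (1 - α / 2) * ‖f t‖) (Ioc 0 r) :=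
    (integrableOn_rpow_mul_norm hfm hfi (by linarith)).mono_set hsub
  have e2 : ∀ t, 0 < t → (t ^ (1 - α / 2) * ‖f t‖) ^ 2 = t ^ (2 - α) * ‖f t‖ ^ 2 := fun t ht => by
    rw [mul_pow, ← Real.rpow_natCast, ← Real.rpow_mul ht.le]
    congr 2; push_cast; ring
  have i2 : IntegrableOn (fun t : ℝ => (t ^ (1 - α / 2) * ‖f t‖) ^ 2) (Ioc 0 r) :=
    ((integrableOn_rpow_mul_sq hfm hfi (β := 2 - α) (by linarith)).mono_set hsub).congr_fun
      (fun t ht => (e2 t ht.1).symm) measurableSet_Ioc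
  have h2 := sq_integral_le hr.1 i1 i2
  have e3 : (∫ t in (0 : ℝ)..r, (t ^ (1 - α / 2) * ‖f t‖) ^ 2) = mass α f r := by
    unfold mass
    rw [intervalIntegral.integral_of_le hr.1.le, intervalIntegral.integral_of_le hr.1.le]
    exact setIntegral_congr_fun measurableSet_Ioc fun t ht => e2 t ht.1
  rw [e3] at h2
  have h3 : ‖∫ t in (0 : ℝ)..r, ((t ^ (1 + α) : ℝ) : ℂ) * f t‖ ≤
      r ^ (3 * α / 2) * ∫ t in (0 : ℝ)..r, t ^ (1 - α / 2) * ‖f t‖ := by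
    rw [← intervalIntegral.integral_const_mul]
    refine intervalIntegral.norm_integral_le_of_norm_le hr.1.le (ae_of_all _ fun t ht => ?_)
      ((intervalIntegrable_iff_integrableOn_Ioc_of_le hr.1.le).2 (i1.const_mul _))
    rw [norm_mul, Complex.norm_real, Real.norm_of_nonneg (by have := ht.1; positivity), ← mul_assoc]
    refine mul_le_mul_of_nonneg_right ?_ (norm_nonneg _)
    rw [show 1 + α = 3 * α / 2 + (1 - α / 2) by ring, Real.rpow_add ht.1]
    exact mul_le_mul_of_nonneg_right (Real.rpow_le_rpow ht.1.le ht.2 (by positivity))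
      (Real.rpow_nonneg ht.1.le _)
  have h4 := pow_le_pow_left₀ (norm_nonneg _) h3 2
  refine h4.trans ?_
  rw [mul_pow]
  have e5 : (r ^ (3 * α / 2)) ^ 2 = r ^ (3 * α) := by
    rw [← Real.rpow_natCast, ← Real.rpow_mul hr.1.le]; congr 1; push_cast; ring
  rw [e5, Real.rpow_add hr.1, Real.rpow_one]
  have h6 := mul_le_mul_of_nonneg_left h2 (Real.rpow_nonneg hr.1.le (3 * α))
  linarith

end bounds

/-- Solutions of the radial equation of finite energy are `c r ^ α` plus a small remainder. -/
theorem radial_asymptotics {α : ℝ} (h0 : 0 ≤ α) (h1 : α < 1) {g p f : ℝ → ℂ}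
    (hg : HasRadDeriv g p)
    (hp : HasRadDeriv (fun r => (r : ℂ) * p r)
      (fun r => (α : ℂ) ^ 2 * ((r : ℂ)⁻¹ * g r) - r * f r))
    (hfl : LocallyIntegrableOn f (Ioi 0))
    (hpi : IntegrableOn (fun r => r * ‖p r‖ ^ 2) (Ioc 0 1))
    (hgi : IntegrableOn (fun r => α ^ 2 * (r⁻¹ * ‖g r‖ ^ 2)) (Ioc 0 1))
    (hfi : IntegrableOn (fun r => r * ‖f r‖ ^ 2) (Ioc 0 1)) :
    ∃ c : ℂ, ∀ᵐ r, r ∈ Ioc (0 : ℝ) 1 →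
      ‖g r - c * ((r ^ α : ℝ) : ℂ)‖ ^ 2 ≤ (2 / (1 - α)) ^ 2 * r ^ (1 + α) * mass α f r := by
  have hfm : AEStronglyMeasurable f (volume.restrict (Ioc (0 : ℝ) 1)) :=
    hfl.aestronglyMeasurable.mono_measure (Measure.restrict_mono (fun r hr => hr.1) le_rfl)
  have hα1 : 0 < 1 - α := by linarith
  set E : ℝ → ℂ := fun r => ∫ t in (0 : ℝ)..r, ((t ^ (1 + α) : ℝ) : ℂ) * f t with hE
  have hEb : ∀ r ∈ Ioc (0 : ℝ) 1, ‖E r‖ ^ 2 ≤ r ^ (1 + 3 * α) * mass α f r := fun r hr =>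
    norm_integral_rpow_mul_sq_le hfm hfi h0 h1 hr
  have hmm : ∀ {s r : ℝ}, 0 ≤ s → s ≤ r → r ≤ 1 → mass α f s ≤ mass α f r := fun hs hsr hr =>
    mass_mono hfm hfi h1 hs hsr hr
  -- the first order equation for `r ^ α (r p - α g)`
  have hA : HasRadDeriv (fun r => ((r ^ α : ℝ) : ℂ) * (r * p r) - (α : ℂ) * ((r ^ α : ℝ) : ℂ) * g r)
      (fun r => -(((r ^ (1 + α) : ℝ) : ℂ) * f r)) := by
    have ha := hg.mul_smooth (w := fun r => (α : ℂ) * ((r ^ α : ℝ) : ℂ))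
      (w' := fun r => (α : ℂ) * ((α : ℂ) * ((r ^ (α - 1) : ℝ) : ℂ)))
      (contDiffOn_const.mul (contDiffOn_rpowC α)) (fun r hr => (hasDerivAt_rpowC α hr).const_mul _)
      (continuousOn_const.mul (continuousOn_const.mul (contDiffOn_rpowC (α - 1)).continuousOn))
    refine ((hp.mul_rpow α).sub ha).congr (fun r _ => rfl) fun r hr => ?_
    have hr' : (r : ℂ) ≠ 0 := by exact_mod_cast hr.ne'
    rw [Real.rpow_sub_one hr.ne', Real.rpow_add hr, Real.rpow_one]
    push_cast
    field_simp
    ring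
  have hEi : IntegrableOn (fun r : ℝ => ((r ^ (1 + α) : ℝ) : ℂ) * f r) (Ioc 0 1) := by
    refine (integrableOn_rpow_mul_norm hfm hfi (β := 1 + α) (by linarith)).mono'
      ((Complex.measurable_ofReal.comp (measurable_id.pow_const (1 + α))).aestronglyMeasurable.mul hfm) ?_
    filter_upwards [ae_restrict_mem measurableSet_Ioc] with r hr
    rw [norm_mul, Complex.norm_real, Real.norm_of_nonneg (by have := hr.1; positivity)]
  obtain ⟨c₁, hc₁⟩ := hA.exists_eq_primitive_zero hEi.neg
  -- The constant belongs to the singular solution `r^(-α)`, or the logarithm if `α = 0`. Finite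
  -- energy excludes it: otherwise `‖c₁‖² / r` would be dominated by an integrable function on `(0,
  -- 1]`.
  have hA0 : c₁ = 0 := by
    by_contra hne
    have hb : IntegrableOn (fun r => 4 * (r * ‖p r‖ ^ 2 + α ^ 2 * (r⁻¹ * ‖g r‖ ^ 2)) + 2 * mass α f 1)
        (Ioc 0 1) := ((hpi.add hgi).const_mul 4).add (integrableOn_const (by simp))
    have hinv : IntegrableOn (fun r : ℝ => ‖c₁‖ ^ 2 * r⁻¹) (Ioc 0 1) := by
      refine Integrable.mono' hb (by fun_prop) ?_
      rw [ae_restrict_iff' measurableSet_Ioc]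
      filter_upwards [hc₁] with r hr1 hr
      have hr0 := hr.1
      have h2 := hr1 hr
      rw [intervalIntegral.integral_neg] at h2
      rw [Real.norm_of_nonneg (by positivity)]
      set A := ((r ^ α : ℝ) : ℂ) * (r * p r) - (α : ℂ) * ((r ^ α : ℝ) : ℂ) * g r with hAdef
      have h3 : c₁ = A + E r := by rw [h2]; ring
      have h4 : ‖c₁‖ ^ 2 ≤ 2 * ‖A‖ ^ 2 + 2 * ‖E r‖ ^ 2 := by
        have := norm_add_le A (E r)
        rw [← h3] at this
        nlinarith [norm_nonneg c₁, sq_nonneg (‖A‖ - ‖E r‖)]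
      have h5 : ‖A‖ ≤ r * ‖p r‖ + α * ‖g r‖ := by
        have hrα : r ^ α ≤ 1 := Real.rpow_le_one hr0.le hr.2 h0
        have : A = ((r ^ α : ℝ) : ℂ) * (r * p r - α * g r) := by rw [hAdef]; ring
        rw [this, norm_mul, Complex.norm_real, Real.norm_of_nonneg (by positivity)]
        refine (mul_le_of_le_one_left (norm_nonneg _) hrα).trans ((norm_sub_le _ _).trans (le_of_eq ?_))
        rw [norm_mul, norm_mul, Complex.norm_real, Complex.norm_real, Real.norm_of_nonneg hr0.le,
          Real.norm_of_nonneg h0]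
      have h6 : ‖A‖ ^ 2 ≤ 2 * (r ^ 2 * ‖p r‖ ^ 2 + α ^ 2 * ‖g r‖ ^ 2) := by
        have := pow_le_pow_left₀ (norm_nonneg _) h5 2
        nlinarith [sq_nonneg (r * ‖p r‖ - α * ‖g r‖)]
      have h7 : ‖E r‖ ^ 2 ≤ r * mass α f 1 := by
        refine (hEb r hr).trans (mul_le_mul ?_ (hmm hr0.le hr.2 le_rfl) (mass_nonneg _ _ hr0.le) hr0.le)
        have := Real.rpow_le_rpow_of_exponent_ge hr0 hr.2 (by linarith : 1 ≤ 1 + 3 * α)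
        rwa [Real.rpow_one] at this
      have h8 : ‖c₁‖ ^ 2 ≤ (4 * (r * ‖p r‖ ^ 2 + α ^ 2 * (r⁻¹ * ‖g r‖ ^ 2)) + 2 * mass α f 1) * r := by
        have : (4 * (r * ‖p r‖ ^ 2 + α ^ 2 * (r⁻¹ * ‖g r‖ ^ 2)) + 2 * mass α f 1) * r =
          4 * (r ^ 2 * ‖p r‖ ^ 2 + α ^ 2 * ‖g r‖ ^ 2) + 2 * (r * mass α f 1) := by
          field_simp
        rw [this]; linarith
      rw [← div_eq_mul_inv, div_le_iff₀ hr0]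
      exact h8
    have h9 : IntegrableOn (fun r : ℝ => r⁻¹) (Ioc 0 1) := by
      have := hinv.const_mul (‖c₁‖ ^ 2)⁻¹
      refine this.congr (ae_of_all _ fun r => ?_)
      have : ‖c₁‖ ≠ 0 := norm_ne_zero_iff.2 hne
      field_simp
    have := intervalIntegrable_inv_iff.1
      ((intervalIntegrable_iff_integrableOn_Ioc_of_le zero_le_one).2 h9)
    simp at this
  -- the first order equation for `r ^ (-α) g`
  have hB := hg.mul_rpow (-α)
  -- The derivative of `r^(-α) g` is `-r^(-2α-1) E`. With `‖E‖ ≤ r^((1+3α)/2) √mass` the exponents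
  -- add up to `-(1+α)/2`, which is greater than `-1` because `α < 1`.
  have hD : ∀ᵐ r, r ∈ Ioc (0 : ℝ) 1 →
      ‖((r ^ (-α) : ℝ) : ℂ) * p r + ((-α : ℝ) : ℂ) * ((r ^ (-α - 1) : ℝ) : ℂ) * g r‖ ≤
        r ^ (-(1 + α) / 2) * Real.sqrt (mass α f r) := by
    filter_upwards [hc₁] with r hr1 hr
    have hr0 := hr.1
    have h2 := hr1 hr
    rw [intervalIntegral.integral_neg, hA0, zero_add] at h2
    have hEr := hEb r hr
    have e1 : ((r ^ (-α) : ℝ) : ℂ) * p r + ((-α : ℝ) : ℂ) * ((r ^ (-α - 1) : ℝ) : ℂ) * g r =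
        ((r ^ (-2 * α - 1) : ℝ) : ℂ) * -E r := by
      rw [hE]
      simp only
      rw [← h2]
      have e3 : r ^ (-α) = r ^ (-2 * α - 1) * (r ^ α * r) := by
        rw [← Real.rpow_add_one hr0.ne', ← Real.rpow_add hr0]; congr 1; ring
      have e4 : r ^ (-α - 1) = r ^ (-2 * α - 1) * r ^ α := by
        rw [← Real.rpow_add hr0]; congr 1; ring
      rw [e3, e4]
      push_cast
      ring
    rw [e1, norm_mul, norm_neg, Complex.norm_real, Real.norm_of_nonneg (by positivity)]
    have h5 : ‖E r‖ ≤ r ^ ((1 + 3 * α) / 2) * Real.sqrt (mass α f r) := by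
      refine le_of_sq_le_sq ?_ (by positivity)
      have e5 : (r ^ ((1 + 3 * α) / 2)) ^ 2 = r ^ (1 + 3 * α) := by
        rw [← Real.rpow_natCast, ← Real.rpow_mul hr0.le]; congr 1; push_cast; ring
      rw [mul_pow, Real.sq_sqrt (mass_nonneg _ _ hr0.le), e5]
      exact hEr
    refine (mul_le_mul_of_nonneg_left h5 (by positivity)).trans (le_of_eq ?_)
    rw [← mul_assoc, ← Real.rpow_add hr0]
    congr 2; ring
  have hpow : ∀ r, 0 ≤ r → IntervalIntegrable (fun s : ℝ => s ^ (-(1 + α) / 2)) volume 0 r :=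
    fun r _ => intervalIntegral.intervalIntegrable_rpow' (by linarith)
  have hDi : IntegrableOn (fun r => ((r ^ (-α) : ℝ) : ℂ) * p r
      + ((-α : ℝ) : ℂ) * ((r ^ (-α - 1) : ℝ) : ℂ) * g r) (Ioc 0 1) := by
    refine Integrable.mono' (((intervalIntegrable_iff_integrableOn_Ioc_of_le zero_le_one).1
      (hpow 1 zero_le_one)).mul_const (Real.sqrt (mass α f 1)))
      (hB.2.1.aestronglyMeasurable.mono_measure (Measure.restrict_mono (fun r hr => hr.1) le_rfl)) ?_
    rw [ae_restrict_iff' measurableSet_Ioc]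
    filter_upwards [hD] with r hr1 hr
    refine (hr1 hr).trans (mul_le_mul_of_nonneg_left (Real.sqrt_le_sqrt (hmm hr.1.le hr.2 le_rfl)) ?_)
    exact Real.rpow_nonneg hr.1.le _
  obtain ⟨c, hc⟩ := hB.exists_eq_primitive_zero hDi
  refine ⟨c, ?_⟩
  filter_upwards [hc] with r hr1 hr
  have hr0 := hr.1
  have h2 := hr1 hr
  -- Integrate the bound from `0` to `r`; as `mass` is monotone it may be frozen at `r`, and the
  -- power contributes `2 / (1 - α) * r^((1-α)/2)`.
  have h3 : ‖((r ^ (-α) : ℝ) : ℂ) * g r - c‖ ≤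
      r ^ ((1 - α) / 2) * (2 / (1 - α)) * Real.sqrt (mass α f r) := by
    rw [h2, add_sub_cancel_left]
    have h4 := intervalIntegral.norm_integral_le_of_norm_le hr0.le (μ := volume)
      (f := fun r => ((r ^ (-α) : ℝ) : ℂ) * p r + ((-α : ℝ) : ℂ) * ((r ^ (-α - 1) : ℝ) : ℂ) * g r)
      (g := fun s => s ^ (-(1 + α) / 2) * Real.sqrt (mass α f r)) (by
        filter_upwards [hD] with s hs1 hs
        refine (hs1 ⟨hs.1, hs.2.trans hr.2⟩).trans (mul_le_mul_of_nonneg_left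
          (Real.sqrt_le_sqrt (hmm hs.1.le hs.2 hr.2)) (Real.rpow_nonneg hs.1.le _)))
      ((hpow r hr0.le).mul_const _)
    refine h4.trans (le_of_eq ?_)
    rw [intervalIntegral.integral_mul_const, integral_rpow (Or.inl (by linarith))]
    have e1 : -(1 + α) / 2 + 1 = (1 - α) / 2 := by ring
    rw [e1, Real.zero_rpow (by positivity), sub_zero]
    field_simp
  have e5 : g r - c * ((r ^ α : ℝ) : ℂ) = ((r ^ α : ℝ) : ℂ) * (((r ^ (-α) : ℝ) : ℂ) * g r - c) := by
    have : ((r ^ α : ℝ) : ℂ) * ((r ^ (-α) : ℝ) : ℂ) = 1 := by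
      rw [← Complex.ofReal_mul, ← Real.rpow_add hr0]; simp
    linear_combination (-g r) * this
  rw [e5, norm_mul, mul_pow, Complex.norm_real, Real.norm_of_nonneg (by positivity)]
  have h6 := mul_le_mul_of_nonneg_left (pow_le_pow_left₀ (norm_nonneg _) h3 2)
    (by positivity : 0 ≤ (r ^ α) ^ 2)
  refine h6.trans (le_of_eq ?_)
  rw [mul_pow, mul_pow, Real.sq_sqrt (mass_nonneg _ _ hr0.le)]
  have e7 : (r ^ α) ^ 2 * (r ^ ((1 - α) / 2)) ^ 2 = r ^ (1 + α) := by
    rw [← mul_pow, ← Real.rpow_add hr0, ← Real.rpow_natCast, ← Real.rpow_mul hr0.le]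
    congr 1; push_cast; ring
  rw [← e7]; ring

/-! ### Polar coordinates -/

lemma exists_rot_eq (x : Plane) : ∃ θ : ℝ, x = rot θ (‖x‖ • e 0) := by
  set z : ℂ := ⟨x 0, x 1⟩ with hz
  have hn : ‖z‖ = ‖x‖ := by
    have : ‖z‖ ^ 2 = ‖x‖ ^ 2 := by
      rw [Complex.sq_norm, Complex.normSq_apply, norm_sq_plane]; ring
    exact (sq_eq_sq₀ (norm_nonneg _) (norm_nonneg _)).1 this
  refine ⟨z.arg, ?_⟩
  apply plane_ext
  · have := Complex.norm_mul_cos_arg z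
    rw [hn] at this
    simp only [rot_apply_zero, e]
    simp
    linarith
  · have := Complex.norm_mul_sin_arg z
    rw [hn] at this
    simp only [rot_apply_one, e]
    simp
    linarith

/-- The radial profile of the `s`-wave component. -/
def profile (u : Plane → ℂ) (r : ℝ) : ℂ := sector 0 u (r • e 0)

lemma sector_zero_eq_profile (u : Plane → ℂ) (x : Plane) : sector 0 u x = profile u ‖x‖ := by
  obtain ⟨θ, hθ⟩ := exists_rot_eq x
  conv_lhs => rw [hθ, sector_zero_rot]
  rfl

lemma sector_zero_radial {w : Plane → ℂ} (hw : ∀ θ x, w (rot θ x) = w x) (x : Plane) :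
    sector 0 w x = w x := by
  have h := sector_radial_mul hw 0 (fun _ => 1) x
  have h1 : sector 0 (fun _ => (1 : ℂ)) x = 1 := by
    have : (Real.pi : ℂ) ≠ 0 := by exact_mod_cast Real.pi_ne_zero
    simp [sector]
    field_simp
  simpa [h1] using h

/-- The length of the unit circle. -/
def circleLength : ℝ := 2 * (volume : Measure Plane).real (Metric.ball 0 1)

lemma circleLength_ne_zero : circleLength ≠ 0 := by
  unfold circleLength
  have : 0 < (volume : Measure Plane).real (Metric.ball 0 1) :=
    ENNReal.toReal_pos (Metric.measure_ball_pos _ _ one_pos).ne' measure_ball_lt_top.ne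
  positivity

lemma integral_radial (F : ℝ → ℂ) :
    ∫ x : Plane, F ‖x‖ = circleLength * ∫ r in Ioi (0 : ℝ), r * F r := by
  rw [integral_fun_norm_addHaar]
  simp [circleLength, mul_assoc]

lemma integrable_radial_iff {F : ℝ → ℝ} :
    Integrable (fun x : Plane => F ‖x‖) ↔ IntegrableOn (fun r => r * F r) (Ioi 0) := by
  rw [integrable_fun_norm_addHaar]
  simp

/-- In polar coordinates the indicator of a null set of radii has zero integral over the plane. -/
lemma ae_norm {P : ℝ → Prop} (h : ∀ᵐ r, P r) : ∀ᵐ x : Plane, P ‖x‖ := by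
  obtain ⟨S, hS, hSm, hS0⟩ := exists_measurable_superset_of_null (ae_iff.1 h)
  have hz : (fun r : ℝ => r * S.indicator (fun _ => (1 : ℝ)) r) =ᵐ[volume] 0 := by
    filter_upwards [measure_eq_zero_iff_ae_notMem.1 hS0] with r hr
    simp [hr]
  have hi : Integrable fun x : Plane => S.indicator (fun _ => (1 : ℝ)) ‖x‖ := by
    rw [integrable_radial_iff]
    exact ((integrable_zero _ _ _).congr hz.symm).integrableOn
  have h0 : ∫ x : Plane, S.indicator (fun _ => (1 : ℝ)) ‖x‖ = 0 := by
    rw [integral_fun_norm_addHaar]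
    have : ∫ y in Ioi (0 : ℝ), y ^ (Module.finrank ℝ Plane - 1) • S.indicator (fun _ => (1 : ℝ)) y = 0 := by
      refine integral_eq_zero_of_ae (ae_restrict_of_ae ?_)
      filter_upwards [hz] with r hr
      simpa using hr
    rw [this]; simp
  have h1 := (integral_eq_zero_iff_of_nonneg (fun x => indicator_nonneg (fun _ _ => zero_le_one) _)
    hi).1 h0
  filter_upwards [h1] with x hx
  by_contra hP
  have : ‖x‖ ∈ S := hS hP
  simp [this] at hx

/-- Polar coordinates over a compact set of positive radii, where the Jacobian `r` can be divided
out. -/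
lemma locallyIntegrableOn_of_memLp_radial {p : ℝ → ℂ} (h : MemLp (fun x : Plane => p ‖x‖) 2 volume) :
    LocallyIntegrableOn p (Ioi 0) := by
  rw [locallyIntegrableOn_iff isOpen_Ioi.isLocallyClosed]
  intro K hK hKc
  have hcl : IsClosed {x : Plane | ‖x‖ ∈ K} := hKc.isClosed.preimage continuous_norm
  have hKx : IsCompact {x : Plane | ‖x‖ ∈ K} := by
    obtain ⟨R, hR⟩ := hKc.isBounded.exists_norm_le
    refine (isCompact_closedBall (0 : Plane) R).of_isClosed_subset hcl fun x hx => ?_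
    have := hR _ hx
    rw [norm_norm] at this
    simpa using this
  have h1 : IntegrableOn (fun x : Plane => p ‖x‖) {x | ‖x‖ ∈ K} :=
    (h.locallyIntegrable (by norm_num)).integrableOn_isCompact hKx
  rw [← integrable_indicator_iff hcl.measurableSet] at h1
  have h2 : Integrable fun x : Plane => K.indicator p ‖x‖ := h1
  rw [integrable_fun_norm_addHaar] at h2
  have h3 : IntegrableOn (fun r : ℝ => (r : ℂ) * p r) K := by
    refine (h2.mono_set hK).congr_fun (fun r hr => ?_) hKc.measurableSet
    simp [hr]
  have h4 := h3.continuousOn_mul (g := fun r : ℝ => (r : ℂ)⁻¹)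
    (Complex.continuous_ofReal.continuousOn.inv₀ fun r hr => by
      exact_mod_cast (ne_of_gt (hK hr : (0 : ℝ) < r))) hKc
  refine h4.congr_fun (fun r hr => ?_) hKc.measurableSet
  have : (r : ℂ) ≠ 0 := by exact_mod_cast (ne_of_gt (hK hr : (0 : ℝ) < r))
  simp only
  rw [inv_mul_cancel_left₀ this]

lemma integrableOn_sq_of_memLp_radial {p : ℝ → ℂ} (h : MemLp (fun x : Plane => p ‖x‖) 2 volume) :
    IntegrableOn (fun r => r * ‖p r‖ ^ 2) (Ioc 0 1) := by
  have h1 := (memLp_two_iff_integrable_sq_norm h.1).1 h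
  exact ((integrable_radial_iff (F := fun r => ‖p r‖ ^ 2)).1 h1).mono_set fun r hr => hr.1

namespace IsRadTest
variable {η : ℝ → ℂ}

lemma isTest (h : IsRadTest η) : IsTest punctured fun x : Plane => η ‖x‖ := by
  have hsub : tsupport (fun x : Plane => η ‖x‖) ⊆ {x | ‖x‖ ∈ tsupport η} :=
    closure_minimal (fun x hx => subset_tsupport _ hx) ((isClosed_tsupport η).preimage continuous_norm)
  refine ⟨?_, ?_, fun x hx => ?_⟩
  · rw [contDiff_iff_contDiffAt]
    intro x
    -- The norm is not smooth at the origin, but there `η ‖·‖` vanishes in a neighbourhood.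
    by_cases hx : x = 0
    · have h0 : (0 : ℝ) ∉ tsupport η := fun hh => lt_irrefl (0 : ℝ) (h.2.2 hh)
      have h1 : ∀ᶠ y : Plane in 𝓝 x, η ‖y‖ = 0 := by
        have : Tendsto (fun y : Plane => ‖y‖) (𝓝 x) (𝓝 0) := by
          have := continuous_norm.tendsto x
          rwa [hx, norm_zero, ← hx] at this
        exact this.eventually (notMem_tsupport_iff_eventuallyEq.1 h0)
      exact contDiffAt_const.congr_of_eventuallyEq h1
    · exact h.1.contDiffAt.comp x (contDiffAt_norm ℝ hx)
  · obtain ⟨R, hR⟩ := h.2.1.isBounded.exists_norm_le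
    refine HasCompactSupport.intro (isCompact_closedBall (0 : Plane) R) fun x hx => ?_
    refine image_eq_zero_of_notMem_tsupport fun hh => hx ?_
    have := hR _ hh
    rw [norm_norm] at this
    simpa using this
  · intro h0
    have := h.2.2 (hsub hx)
    rw [mem_singleton_iff.1 h0, norm_zero] at this
    exact lt_irrefl (0 : ℝ) this

lemma pd_radial (h : IsRadTest η) (j : Fin 2) {x : Plane} (hx : x ≠ 0) :
    pd j (fun x : Plane => η ‖x‖) x = (_root_.deriv η ‖x‖) * ((x j * ‖x‖⁻¹ : ℝ) : ℂ) := by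
  have h1 : HasFDerivAt (fun x : Plane => Real.sqrt (‖x‖ ^ 2)) _ x :=
    (hasStrictFDerivAt_norm_sq x).hasFDerivAt.sqrt (by positivity)
  simp only [Real.sqrt_sq (norm_nonneg _)] at h1
  have h2 : HasFDerivAt (fun x : Plane => η ‖x‖) _ x :=
    (h.differentiable ‖x‖).hasDerivAt.hasFDerivAt.comp x h1
  have h3 : pd j (fun x : Plane => η ‖x‖) x = _ := congrArg (fun L : Plane →L[ℝ] ℂ => L (e j)) h2.fderiv
  rw [h3]
  simp [e, EuclideanSpace.inner_single_right]
  field_simp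

lemma integral_sector (h : IsRadTest η) {w : Plane → ℂ} (hw : MemLp w 2 volume) :
    ∫ x : Plane, η ‖x‖ * w x = circleLength * ∫ r in Ioi (0 : ℝ), r * (η r * profile w r) := by
  have h1 := integral_conj_mul_sector (MemLp.conjugate (h.isTest.memLp 2)) hw 0
  have h2 : ∀ x, sector 0 (fun x : Plane => conj (η ‖x‖)) x = conj (η ‖x‖) :=
    sector_zero_radial fun θ x => by rw [norm_rot]
  simp only [h2, Complex.conj_conj, sector_zero_eq_profile w] at h1
  rw [← h1, ← integral_radial]

end IsRadTest

/-- The radial derivative in terms of the gradient. -/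
def radV (v : Fin 2 → Plane → ℂ) (x : Plane) : ℂ :=
  ((x 0 * ‖x‖⁻¹ : ℝ) : ℂ) * v 0 x + ((x 1 * ‖x‖⁻¹ : ℝ) : ℂ) * v 1 x

lemma memLp_radV {v : Fin 2 → Plane → ℂ} (hv : ∀ j, MemLp (v j) 2 volume) :
    MemLp (radV v) 2 volume :=
  (memLp_unit_mul (hv 0) 0).add (memLp_unit_mul (hv 1) 1)

lemma memLp_profile {w : Plane → ℂ} (hw : MemLp w 2 volume) :
    MemLp (fun x : Plane => profile w ‖x‖) 2 volume := by
  have := memLp_sector hw 0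
  rwa [show sector 0 w = fun x => profile w ‖x‖ from funext (sector_zero_eq_profile w)] at this

lemma setIntegral_radTest {η : ℝ → ℂ} (h : IsRadTest η) (p : ℝ → ℂ) :
    ∫ r in Ioi (0 : ℝ), η r * p r = ∫ r, η r * p r :=
  setIntegral_eq_integral_of_forall_compl_eq_zero fun r hr => by
    rw [h.eq_zero (not_lt.1 hr), zero_mul]

variable {α : ℝ} {u F f : Plane → ℂ} {v : Fin 2 → Plane → ℂ}

/-- Test with the radial vector field `x * ζ ‖x‖`, where `ζ = r^(-2) η` is chosen so that the
divergence is `r^(-1) η'`; the factor `r^(-1)` then cancels the polar Jacobian. -/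
lemma hasRadDeriv_profile (hu : MemLp u 2 volume) (hv : ∀ j, MemLp (v j) 2 volume)
    (hd : ∀ j, HasWeakDeriv punctured j u (v j)) :
    HasRadDeriv (profile u) (profile (radV v)) := by
  refine ⟨locallyIntegrableOn_of_memLp_radial (memLp_profile hu),
    locallyIntegrableOn_of_memLp_radial (memLp_profile (memLp_radV hv)), fun η hη => ?_⟩
  have hζ := hη.mul_contDiffOn (contDiffOn_rpowC (-2))
  have hη1 := hη.mul_contDiffOn (contDiffOn_rpowC (-1))
  have hη2 := hη.deriv.mul_contDiffOn (contDiffOn_rpowC (-1))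
  set ζ : ℝ → ℂ := fun r => ((r ^ (-2 : ℝ) : ℝ) : ℂ) * η r with hζdef
  have ht : ∀ j : Fin 2, IsTest punctured fun x : Plane => (x j : ℂ) * ζ ‖x‖ := fun j =>
    hζ.isTest.mul_contDiff (contDiff_coord j)
  have h1 := congrArg₂ (· + ·) ((hd 0).test (ht 0)) ((hd 1).test (ht 1))
  rw [← integral_add (((ht 0).pd 0).integrable_mul (hd 0).1) (((ht 1).pd 1).integrable_mul (hd 1).1),
    ← neg_add, ← integral_add ((ht 0).integrable_mul (hd 0).2.1) ((ht 1).integrable_mul (hd 1).2.1)] at h1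
  have e1 : (∫ x : Plane, (pd 0 (fun x : Plane => (x 0 : ℂ) * ζ ‖x‖) x * u x
      + pd 1 (fun x : Plane => (x 1 : ℂ) * ζ ‖x‖) x * u x)) =
      ∫ x : Plane, ((‖x‖ ^ (-1 : ℝ) : ℝ) : ℂ) * deriv η ‖x‖ * u x := by
    refine integral_congr_ae ?_
    filter_upwards [ae_mem_punctured] with x hx
    have hx0 : 0 < ‖x‖ := norm_pos_iff.2 hx
    have hc : (‖x‖ : ℂ) ≠ 0 := by exact_mod_cast hx0.ne'
    have hp : ∀ j : Fin 2, pd j (fun x : Plane => (x j : ℂ)) x = 1 := fun j => by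
      have h2 := ((Complex.ofRealCLM.comp
        (EuclideanSpace.proj j : Plane →L[ℝ] ℝ)).hasFDerivAt (x := x)).fderiv
      have h3 : pd j (fun x : Plane => (x j : ℂ)) x = _ :=
        congrArg (fun L : Plane →L[ℝ] ℂ => L (e j)) h2
      rw [h3]
      simp [e]
    have hdζ : deriv ζ ‖x‖ = ((‖x‖ ^ (-2 : ℝ) : ℝ) : ℂ) * deriv η ‖x‖
        + ((-2 : ℝ) : ℂ) * ((‖x‖ ^ ((-2 : ℝ) - 1) : ℝ) : ℂ) * η ‖x‖ := by
      rw [((hasDerivAt_rpowC (-2) hx0).fun_mul (hη.differentiable ‖x‖).hasDerivAt).deriv]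
      ring
    have e2 : ∀ j : Fin 2, pd j (fun x : Plane => (x j : ℂ) * ζ ‖x‖) x =
        x j * (deriv ζ ‖x‖ * ((x j * ‖x‖⁻¹ : ℝ) : ℂ)) + ζ ‖x‖ := fun j => by
      rw [pd_mul ((contDiff_coord j).differentiable (by simp) x) (hζ.isTest.differentiable x), hp,
        hζ.pd_radial j hx]
      ring
    have h2 : (‖x‖ : ℂ) ^ 2 = (x 0 : ℂ) ^ 2 + (x 1 : ℂ) ^ 2 := by exact_mod_cast norm_sq_plane x
    have r1 : ‖x‖ ^ (-2 : ℝ) = (‖x‖ ^ 2)⁻¹ := by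
      rw [Real.rpow_neg hx0.le]; norm_num
    have r2 : ‖x‖ ^ ((-2 : ℝ) - 1) = (‖x‖ ^ 3)⁻¹ := by
      rw [show (-2 : ℝ) - 1 = -(3 : ℕ) by norm_num, Real.rpow_neg hx0.le, Real.rpow_natCast]
    rw [e2, e2, hdζ, hζdef]
    simp only
    rw [r1, r2, Real.rpow_neg_one]
    push_cast
    field_simp
    linear_combination (-(u x) * (deriv η ‖x‖ * ‖x‖ - 2 * η ‖x‖)) * h2
  have e3 : (∫ x : Plane, ((x 0 : ℂ) * ζ ‖x‖ * v 0 x + (x 1 : ℂ) * ζ ‖x‖ * v 1 x)) =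
      ∫ x : Plane, ((‖x‖ ^ (-1 : ℝ) : ℝ) : ℂ) * η ‖x‖ * radV v x := by
    refine integral_congr_ae ?_
    filter_upwards [ae_mem_punctured] with x hx
    have hx0 : 0 < ‖x‖ := norm_pos_iff.2 hx
    have hc : (‖x‖ : ℂ) ≠ 0 := by exact_mod_cast hx0.ne'
    have r1 : ‖x‖ ^ (-2 : ℝ) = (‖x‖ ^ 2)⁻¹ := by
      rw [Real.rpow_neg hx0.le]; norm_num
    rw [hζdef, radV]
    simp only
    rw [r1, Real.rpow_neg_one]
    push_cast
    field_simp
  rw [e1, e3, hη2.integral_sector hu, hη1.integral_sector (memLp_radV hv), ← mul_neg] at h1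
  have h3 := mul_left_cancel₀ (by exact_mod_cast circleLength_ne_zero) h1
  have e4 : ∀ (a b : ℝ → ℂ), ∫ r in Ioi (0 : ℝ), (r : ℂ) * (((r ^ (-1 : ℝ) : ℝ) : ℂ) * a r * b r) =
      ∫ r in Ioi (0 : ℝ), a r * b r := fun a b => by
    refine setIntegral_congr_fun measurableSet_Ioi fun r hr => ?_
    have : (r : ℂ) ≠ 0 := by exact_mod_cast (ne_of_gt (hr : (0 : ℝ) < r))
    simp only [Real.rpow_neg_one]
    push_cast
    field_simp
  rwa [e4, e4, setIntegral_radTest hη.deriv, setIntegral_radTest hη] at h3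

/-- Test with radial functions: their gradients see only the radial derivative of `u`, and the polar
Jacobian puts the weight `r` into the equation. -/
lemma hasRadDeriv_radial (hu : MemLp u 2 volume)
    (hv : ∀ j, MemLp (v j) 2 volume) (hf : MemLp f 2 volume)
    (hw : WeakLap u v fun x => f x - α ^ 2 * ((((‖x‖ ^ 2)⁻¹ : ℝ) : ℂ) * u x)) :
    HasRadDeriv (fun r => (r : ℂ) * profile (radV v) r)
      (fun r => (α : ℂ) ^ 2 * ((r : ℂ)⁻¹ * profile u r) - r * profile f r) := by
  have lp := locallyIntegrableOn_of_memLp_radial (memLp_profile (memLp_radV hv))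
  have lu := locallyIntegrableOn_of_memLp_radial (memLp_profile hu)
  have lf := locallyIntegrableOn_of_memLp_radial (memLp_profile hf)
  have hcont : ContinuousOn (fun r : ℝ => (r : ℂ)) (Ioi 0) := Complex.continuous_ofReal.continuousOn
  have hcont' : ContinuousOn (fun r : ℝ => (r : ℂ)⁻¹) (Ioi 0) :=
    hcont.inv₀ fun r hr => by exact_mod_cast (ne_of_gt (hr : (0 : ℝ) < r))
  have l1 : LocallyIntegrableOn (fun r : ℝ => (α : ℂ) ^ 2 * ((r : ℂ)⁻¹ * profile u r)) (Ioi 0) :=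
    (lu.continuousOn_mul hcont' isOpen_Ioi.isLocallyClosed).continuousOn_mul continuousOn_const
      isOpen_Ioi.isLocallyClosed
  have l2 : LocallyIntegrableOn (fun r : ℝ => (r : ℂ) * profile f r) (Ioi 0) :=
    lf.continuousOn_mul hcont isOpen_Ioi.isLocallyClosed
  refine ⟨lp.continuousOn_mul hcont isOpen_Ioi.isLocallyClosed, l1.sub l2, fun η hη => ?_⟩
  have h1 := hw.eq _ hη.isTest
  have e1 : (∫ x : Plane, ∑ j, pd j (fun x : Plane => η ‖x‖) x * v j x) =
      ∫ x : Plane, deriv η ‖x‖ * radV v x := by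
    refine integral_congr_ae ?_
    filter_upwards [ae_mem_punctured] with x hx
    rw [Fin.sum_univ_two, hη.pd_radial 0 hx, hη.pd_radial 1 hx, radV]
    ring
  have hη2 := hη.mul_contDiffOn (contDiffOn_rpowC (-2))
  have e2 : (∫ x : Plane, η ‖x‖ * (f x - α ^ 2 * ((((‖x‖ ^ 2)⁻¹ : ℝ) : ℂ) * u x))) =
      (∫ x : Plane, η ‖x‖ * f x)
        - α ^ 2 * ∫ x : Plane, ((‖x‖ ^ (-2 : ℝ) : ℝ) : ℂ) * η ‖x‖ * u x := by
    rw [← integral_const_mul, ← integral_sub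
      (hη.isTest.integrable_mul (locallyIntegrableOn_of_memLp hf _))
      ((hη2.isTest.integrable_mul (locallyIntegrableOn_of_memLp hu _)).const_mul _)]
    congr 1; ext x
    have r1 : ‖x‖ ^ (-2 : ℝ) = (‖x‖ ^ 2)⁻¹ := by
      rw [Real.rpow_neg (norm_nonneg _)]; norm_num
    rw [r1]; ring
  rw [e1, e2, hη.deriv.integral_sector (memLp_radV hv), hη.integral_sector hf,
    hη2.integral_sector hu] at h1
  have h3 : ∫ r in Ioi (0 : ℝ), (r : ℂ) * (deriv η r * profile (radV v) r) =
      (∫ r in Ioi (0 : ℝ), (r : ℂ) * (η r * profile f r))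
        - α ^ 2 * ∫ r in Ioi (0 : ℝ), (r : ℂ) * (((r ^ (-2 : ℝ) : ℝ) : ℂ) * η r * profile u r) := by
    refine mul_left_cancel₀ (by exact_mod_cast circleLength_ne_zero : (circleLength : ℂ) ≠ 0) ?_
    rw [h1]; ring
  have e4 : ∫ r in Ioi (0 : ℝ), (r : ℂ) * (deriv η r * profile (radV v) r) =
      ∫ r : ℝ, deriv η r * (r * profile (radV v) r) := by
    rw [← setIntegral_radTest hη.deriv]
    congr 1; ext r; ring
  have e5 : ∫ r in Ioi (0 : ℝ), (r : ℂ) * (η r * profile f r) = ∫ r : ℝ, η r * (r * profile f r) := by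
    rw [← setIntegral_radTest hη]
    congr 1; ext r; ring
  have e6 : (α : ℂ) ^ 2 * ∫ r in Ioi (0 : ℝ), (r : ℂ) * (((r ^ (-2 : ℝ) : ℝ) : ℂ) * η r * profile u r) =
      ∫ r : ℝ, η r * ((α : ℂ) ^ 2 * ((r : ℂ)⁻¹ * profile u r)) := by
    rw [← setIntegral_radTest hη, ← integral_const_mul]
    refine setIntegral_congr_fun measurableSet_Ioi fun r hr => ?_
    have hr0 : (0 : ℝ) < r := hr
    have : (r : ℂ) ≠ 0 := by exact_mod_cast hr0.ne'
    have r1 : r ^ (-2 : ℝ) = (r ^ 2)⁻¹ := by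
      rw [Real.rpow_neg hr0.le]; norm_num
    rw [r1]; push_cast
    field_simp
  rw [e4, e5, e6] at h3
  simp only [mul_sub]
  rw [h3, integral_sub (hη.integrable_mul l1) (hη.integrable_mul l2)]
  ring

/-! ### Behaviour of the `s`-wave at the origin -/

section mass
variable {α : ℝ} {f : ℝ → ℂ}

/-- On `(0, r]` one has `t^(2-α) ≤ r^(1-α) t`. The remaining integral tends to zero with `r`, the
source of the little-o. -/
lemma mass_le (hfm : AEStronglyMeasurable f (volume.restrict (Ioc (0 : ℝ) 1)))
    (hfi : IntegrableOn (fun r => r * ‖f r‖ ^ 2) (Ioc 0 1)) (h1 : α < 1) {r : ℝ}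
    (hr : r ∈ Ioc (0 : ℝ) 1) :
    mass α f r ≤ r ^ (1 - α) * ∫ t in (0 : ℝ)..r, t * ‖f t‖ ^ 2 := by
  unfold mass
  have hsub : Ioc 0 r ⊆ Ioc (0 : ℝ) 1 := Ioc_subset_Ioc_right hr.2
  rw [intervalIntegral.integral_of_le hr.1.le, intervalIntegral.integral_of_le hr.1.le,
    ← integral_const_mul]
  refine setIntegral_mono_on ((integrableOn_rpow_mul_sq hfm hfi (by linarith)).mono_set hsub)
    ((hfi.mono_set hsub).const_mul _) measurableSet_Ioc fun t ht => ?_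
  rw [show 2 - α = (1 - α) + 1 by ring, Real.rpow_add_one ht.1.ne', mul_assoc]
  exact mul_le_mul_of_nonneg_right (Real.rpow_le_rpow ht.1.le ht.2 (by linarith))
    (by have := ht.1; positivity)

/-- A Hardy-type estimate by Fubini: integrating in `r` first, `∫_t^1 r^(α-2) dr ≤ t^(α-1) / (1 -
α)`, which turns the weight `t^(2-α)` into `t`. -/
lemma integrableOn_rpow_mul_mass (hfm : AEStronglyMeasurable f (volume.restrict (Ioc (0 : ℝ) 1)))
    (hfi : IntegrableOn (fun r => r * ‖f r‖ ^ 2) (Ioc 0 1)) (h1 : α < 1) :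
    IntegrableOn (fun r : ℝ => r ^ (α - 2) * mass α f r) (Ioc 0 1) := by
  set μ := volume.restrict (Ioc (0 : ℝ) 1) with hμ
  have hα : 0 < 1 - α := by linarith
  have hm : AEStronglyMeasurable (fun z : ℝ × ℝ => {z : ℝ × ℝ | z.2 ≤ z.1}.indicator
      (fun z => z.1 ^ (α - 2) * (z.2 ^ (2 - α) * ‖f z.2‖ ^ 2)) z) (μ.prod μ) := by
    refine AEStronglyMeasurable.indicator ?_ (measurableSet_le measurable_snd measurable_fst)
    refine AEStronglyMeasurable.mul ?_ ?_
    · exact (measurable_fst.pow_const _).aestronglyMeasurable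
    · exact ((measurable_id.pow_const (2 - α)).aestronglyMeasurable.mul
        (hfm.norm.pow 2)).comp_snd
  have hin : ∀ᵐ t ∂μ, Integrable (fun r => {z : ℝ × ℝ | z.2 ≤ z.1}.indicator
      (fun z => z.1 ^ (α - 2) * (z.2 ^ (2 - α) * ‖f z.2‖ ^ 2)) (r, t)) μ ∧
      ∫ r, ‖{z : ℝ × ℝ | z.2 ≤ z.1}.indicator
      (fun z => z.1 ^ (α - 2) * (z.2 ^ (2 - α) * ‖f z.2‖ ^ 2)) (r, t)‖ ∂μ
        ≤ (1 - α)⁻¹ * (t * ‖f t‖ ^ 2) := by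
    filter_upwards [ae_restrict_mem measurableSet_Ioc] with t ht
    have ht0 := ht.1
    have e1 : (fun r => {z : ℝ × ℝ | z.2 ≤ z.1}.indicator
        (fun z => z.1 ^ (α - 2) * (z.2 ^ (2 - α) * ‖f z.2‖ ^ 2)) (r, t)) =
        (Ici t).indicator fun r => r ^ (α - 2) * (t ^ (2 - α) * ‖f t‖ ^ 2) := by
      ext r; simp [indicator]
    have hset : (Ici t ∩ Ioc 0 1 : Set ℝ) = Icc t 1 := by
      ext s; simp only [mem_inter_iff, mem_Ioc, mem_Ici, mem_Icc]
      exact ⟨fun h => ⟨h.1, h.2.2⟩, fun h => ⟨h.1, ht0.trans_le h.1, h.2⟩⟩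
    have hpi : IntervalIntegrable (fun r : ℝ => r ^ (α - 2)) volume t 1 :=
      intervalIntegral.intervalIntegrable_rpow (Or.inr (by
        rw [uIcc_of_le ht.2]; exact fun h => not_lt.2 h.1 ht0))
    have hpi' : IntegrableOn (fun r : ℝ => r ^ (α - 2)) (Icc t 1) :=
      (intervalIntegrable_iff_integrableOn_Icc_of_le ht.2).1 hpi
    constructor
    · rw [e1, integrable_indicator_iff measurableSet_Ici, IntegrableOn, hμ,
        Measure.restrict_restrict measurableSet_Ici, hset]
      exact hpi'.mul_const _
    · have e2 : (∫ r, ‖{z : ℝ × ℝ | z.2 ≤ z.1}.indicator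
          (fun z => z.1 ^ (α - 2) * (z.2 ^ (2 - α) * ‖f z.2‖ ^ 2)) (r, t)‖ ∂μ) =
          ∫ r, (Ici t).indicator (fun r => r ^ (α - 2) * (t ^ (2 - α) * ‖f t‖ ^ 2)) r ∂μ := by
        refine integral_congr_ae ?_
        filter_upwards [ae_restrict_mem measurableSet_Ioc] with r hr
        rw [congrFun e1 r, Real.norm_of_nonneg]
        refine indicator_nonneg (fun s hs => ?_) r
        have : 0 < s := ht0.trans_le hs
        positivity
      rw [e2, integral_indicator measurableSet_Ici, hμ,
        Measure.restrict_restrict measurableSet_Ici, hset, integral_mul_const,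
        integral_Icc_eq_integral_Ioc, ← intervalIntegral.integral_of_le ht.2,
        integral_rpow (Or.inr ⟨by linarith, by
          rw [uIcc_of_le ht.2]; exact fun h => not_lt.2 h.1 ht0⟩)]
      have e3 : t ^ (α - 2 + 1) * t ^ (2 - α) = t := by
        rw [← Real.rpow_add ht0]; convert Real.rpow_one t using 2; ring
      have e4 : (1 ^ (α - 2 + 1) - t ^ (α - 2 + 1)) / (α - 2 + 1) =
          (1 - α)⁻¹ * (t ^ (α - 2 + 1) - 1) := by
        rw [Real.one_rpow, show α - 2 + 1 = -(1 - α) by ring, div_neg, div_eq_inv_mul]; ring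
      rw [e4]
      have e5 : (1 - α)⁻¹ * (t ^ (α - 2 + 1) - 1) * (t ^ (2 - α) * ‖f t‖ ^ 2) =
          (1 - α)⁻¹ * (t * ‖f t‖ ^ 2) - (1 - α)⁻¹ * (t ^ (2 - α) * ‖f t‖ ^ 2) := by
        linear_combination ((1 - α)⁻¹ * ‖f t‖ ^ 2) * e3
      rw [e5]
      have : 0 ≤ (1 - α)⁻¹ * (t ^ (2 - α) * ‖f t‖ ^ 2) := by positivity
      linarith
  have hint : Integrable (fun z : ℝ × ℝ => {z : ℝ × ℝ | z.2 ≤ z.1}.indicator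
      (fun z => z.1 ^ (α - 2) * (z.2 ^ (2 - α) * ‖f z.2‖ ^ 2)) z) (μ.prod μ) := by
    refine (integrable_prod_iff' hm).2 ⟨hin.mono fun t h => h.1, ?_⟩
    refine Integrable.mono' (hfi.const_mul (1 - α)⁻¹) hm.norm.prod_swap.integral_prod_right' ?_
    filter_upwards [hin] with t h
    rw [Real.norm_of_nonneg (integral_nonneg fun _ => norm_nonneg _)]
    exact h.2
  refine hint.integral_prod_left.congr ?_
  filter_upwards [ae_restrict_mem measurableSet_Ioc] with r hr
  have e1 : (fun t => {z : ℝ × ℝ | z.2 ≤ z.1}.indicator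
      (fun z => z.1 ^ (α - 2) * (z.2 ^ (2 - α) * ‖f z.2‖ ^ 2)) (r, t)) =
      (Iic r).indicator fun t => r ^ (α - 2) * (t ^ (2 - α) * ‖f t‖ ^ 2) := by
    ext t; simp [indicator]
  have hset : (Iic r ∩ Ioc 0 1 : Set ℝ) = Ioc 0 r := by
    ext s; simp only [mem_inter_iff, mem_Ioc, mem_Iic]
    exact ⟨fun h => ⟨h.2.1, h.1⟩, fun h => ⟨h.2, h.1, h.2.trans hr.2⟩⟩
  rw [e1, integral_indicator measurableSet_Iic, hμ, Measure.restrict_restrict measurableSet_Iic,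
    hset, integral_const_mul, mass, intervalIntegral.integral_of_le hr.1.le]

end mass

variable {α : ℝ} {u f : Plane → ℂ} {v : Fin 2 → Plane → ℂ}

/-- The `s`-wave part of an element of the operator domain is `c r ^ α` up to a remainder which is
`o(r)` and square integrable against `r ^ (-4)`. -/
theorem InOp.radial_asymptotics (h : InOp α u v f) (h0 : 0 ≤ α) (h1 : α < 1)
    (hs : sector 0 u =ᵐ[volume] u) :
    ∃ c : ℂ, ((fun x : Plane => u x - c * ((‖x‖ ^ α : ℝ) : ℂ))
        =o[ae (volume : Measure Plane) ⊓ 𝓝 0] fun x : Plane => ‖x‖) ∧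
      MemLp (fun x : Plane => (((‖x‖ ^ 2)⁻¹ : ℝ) : ℂ) * (u x - c * ((‖x‖ ^ α : ℝ) : ℂ))) 2
        (volume.restrict (Metric.ball 0 1)) := by
  have hv := h.memLp_grad h0 h1.le
  have hf := h.memLp_rhs
  have hang := angV_eq_zero h.memLp hs h.deriv
  have hw : WeakLap u v fun x => f x - α ^ 2 * ((((‖x‖ ^ 2)⁻¹ : ℝ) : ℂ) * u x) := by
    refine ((h.toInV.inOp_iff hf).1 h).congr_ae (ae_eq_refl _) (fun _ => ae_eq_refl _) ?_
    filter_upwards [hang] with x hx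
    rw [hx]; simp
  have hmp := memLp_profile (memLp_radV hv)
  have hmf := memLp_profile hf
  have hmu := memLp_profile h.memLp
  -- The factor `α²` makes this trivial at `α = 0`, where no Hardy inequality holds for the s-wave.
  have hgi : IntegrableOn (fun r => α ^ 2 * (r⁻¹ * ‖profile u r‖ ^ 2)) (Ioc 0 1) := by
    rcases h0.eq_or_lt with rfl | hα
    · simp
    · have h2 : MemLp (fun x : Plane => ((‖x‖⁻¹ : ℝ) : ℂ) * profile u ‖x‖) 2 volume := by
        refine (h.memLp_inv hα h1.le).ae_eq ?_
        filter_upwards [hs] with x hx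
        rw [← sector_zero_eq_profile, hx]
      have h3 := integrableOn_sq_of_memLp_radial (p := fun r => ((r⁻¹ : ℝ) : ℂ) * profile u r) h2
      have h4 : IntegrableOn (fun r => α ^ 2 * (r * ‖((r⁻¹ : ℝ) : ℂ) * profile u r‖ ^ 2)) (Ioc 0 1) :=
        h3.const_mul (α ^ 2)
      refine h4.congr_fun (fun r hr => ?_) measurableSet_Ioc
      have hr0 := hr.1
      simp only
      rw [norm_mul, Complex.norm_real, Real.norm_of_nonneg (by positivity)]
      field_simp
  have hlf := locallyIntegrableOn_of_memLp_radial hmf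
  have hfi := integrableOn_sq_of_memLp_radial hmf
  have hfm : AEStronglyMeasurable (profile f) (volume.restrict (Ioc (0 : ℝ) 1)) :=
    hlf.aestronglyMeasurable.mono_measure (Measure.restrict_mono (fun r hr => hr.1) le_rfl)
  obtain ⟨c, hc⟩ := Anyon.radial_asymptotics h0 h1 (hasRadDeriv_profile h.memLp hv h.deriv)
    (hasRadDeriv_radial h.memLp hv hf hw) hlf (integrableOn_sq_of_memLp_radial hmp) hgi hfi
  set K := (2 / (1 - α)) ^ 2 with hK
  have hK0 : 0 ≤ K := sq_nonneg _
  have hmain : ∀ᵐ x : Plane, ‖x‖ ∈ Ioc (0 : ℝ) 1 →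
      ‖u x - c * ((‖x‖ ^ α : ℝ) : ℂ)‖ ^ 2 ≤ K * ‖x‖ ^ (1 + α) * mass α (profile f) ‖x‖ := by
    filter_upwards [ae_norm hc, hs] with x hx hx2 hx1
    rw [← hx2, sector_zero_eq_profile]
    exact hx hx1
  refine ⟨c, ?_, ?_⟩
  · rw [isLittleO_iff]
    intro ε hε
    have hi1 : IntervalIntegrable (fun t => t * ‖profile f t‖ ^ 2) volume 0 1 :=
      (intervalIntegrable_iff_integrableOn_Ioc_of_le zero_le_one).2 hfi
    -- This is the factor in front of `r²` in the bound for the squared remainder; its decay gives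
    -- `o(r)` and not only `O(r)`.
    have hM : Tendsto (fun r => K * ∫ t in (0 : ℝ)..r, t * ‖profile f t‖ ^ 2) (𝓝[≥] 0) (𝓝 (K * 0)) := by
      refine Tendsto.const_mul K ?_
      have h2 := intervalIntegral.continuousOn_primitive_interval' hi1 (a := 0) (by simp)
      rw [uIcc_of_le zero_le_one] at h2
      have h3 := h2 0 (by simp)
      have h4 : 𝓝[Icc (0 : ℝ) 1] 0 = 𝓝[≥] 0 := nhdsWithin_Icc_eq_nhdsGE zero_lt_one
      rw [ContinuousWithinAt, h4] at h3
      simpa using h3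
    rw [mul_zero] at hM
    have hn : Tendsto (fun x : Plane => ‖x‖) (𝓝 0) (𝓝[≥] 0) := by
      refine tendsto_nhdsWithin_iff.2 ⟨?_, Eventually.of_forall fun x => norm_nonneg x⟩
      have := continuous_norm.tendsto (0 : Plane)
      rwa [norm_zero] at this
    have hev := hn.eventually (hM.eventually (gt_mem_nhds (by positivity : 0 < ε ^ 2)))
    have hb : ∀ᶠ x : Plane in 𝓝 0, ‖x‖ < 1 := by
      have := Metric.ball_mem_nhds (0 : Plane) one_pos
      filter_upwards [this] with x hx
      simpa using hx
    have hae : ∀ᶠ x in ae (volume : Measure Plane) ⊓ 𝓝 0, ‖x‖ ∈ Ioc (0 : ℝ) 1 →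
      ‖u x - c * ((‖x‖ ^ α : ℝ) : ℂ)‖ ^ 2 ≤ K * ‖x‖ ^ (1 + α) * mass α (profile f) ‖x‖ :=
      Filter.Eventually.filter_mono inf_le_left hmain
    have hae2 : ∀ᶠ x in ae (volume : Measure Plane) ⊓ 𝓝 0, x ∈ punctured :=
      Filter.Eventually.filter_mono inf_le_left ae_mem_punctured
    filter_upwards [hae, hae2, hev.filter_mono inf_le_right, hb.filter_mono inf_le_right] with
      x h2 h3 h4 h5
    have hx0 : 0 < ‖x‖ := norm_pos_iff.2 h3
    have h6 := h2 ⟨hx0, h5.le⟩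
    have h7 := mass_le hfm hfi h1 (r := ‖x‖) ⟨hx0, h5.le⟩
    set M := ∫ t in (0 : ℝ)..‖x‖, t * ‖profile f t‖ ^ 2
    have h8 : ‖u x - c * ((‖x‖ ^ α : ℝ) : ℂ)‖ ^ 2 ≤ (ε * ‖x‖) ^ 2 := by
      have h9 := mul_le_mul_of_nonneg_left h7 (by positivity : 0 ≤ K * ‖x‖ ^ (1 + α))
      have h10 : ‖x‖ ^ (1 + α) * ‖x‖ ^ (1 - α) = ‖x‖ ^ 2 := by
        rw [← Real.rpow_add hx0, ← Real.rpow_natCast]; congr 1; push_cast; ring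
      have h11 : K * ‖x‖ ^ (1 + α) * (‖x‖ ^ (1 - α) * M) = ‖x‖ ^ 2 * (K * M) := by
        rw [← h10]; ring
      rw [h11] at h9
      have h12 := mul_le_mul_of_nonneg_left h4.le (by positivity : 0 ≤ ‖x‖ ^ 2)
      rw [mul_pow]
      linarith
    rw [norm_norm]
    exact le_of_sq_le_sq h8 (by positivity)
  · have hmeas : AEStronglyMeasurable
        (fun x : Plane => (((‖x‖ ^ 2)⁻¹ : ℝ) : ℂ) * (u x - c * ((‖x‖ ^ α : ℝ) : ℂ))) volume := by
      refine (aestronglyMeasurable_of_contDiffOn contDiffOn_inv_sq).mul (h.memLp.1.sub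
        (AEStronglyMeasurable.const_mul ?_ c))
      exact (Complex.measurable_ofReal.comp (measurable_norm.pow_const α)).aestronglyMeasurable
    rw [memLp_two_iff_integrable_sq_norm hmeas.restrict]
    -- Multiplying the squared remainder by `r^(-4)` leaves `r^(α-3) * mass`, and the Jacobian
    -- raises the exponent to `α - 2`, as in `integrableOn_rpow_mul_mass`.
    have hR : IntegrableOn (fun x : Plane => (fun r : ℝ => K * (r ^ (α - 3) * mass α (profile f) r)) ‖x‖)
        (Metric.ball 0 1) := by
      refine (integrableOn_fun_norm_addHaar volume
        (f := fun r => K * (r ^ (α - 3) * mass α (profile f) r))).2 ?_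
      have h2 : IntegrableOn (fun r : ℝ => K * (r ^ (α - 2) * mass α (profile f) r)) (Ioo 0 1) :=
        ((integrableOn_rpow_mul_mass hfm hfi h1).mono_set Ioo_subset_Ioc_self).const_mul K
      refine h2.congr_fun (fun r hr => ?_) measurableSet_Ioo
      have e1 : r ^ (α - 2) = r * r ^ (α - 3) := by
        rw [mul_comm, ← Real.rpow_add_one hr.1.ne']; congr 1; ring
      simp [e1]
      ring
    refine Integrable.mono' hR (hmeas.restrict.norm.pow 2) ?_
    rw [ae_restrict_iff' measurableSet_ball]
    filter_upwards [hmain, ae_mem_punctured] with x hx hx0 hx1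
    have hx0 : 0 < ‖x‖ := norm_pos_iff.2 hx0
    have h2 := hx ⟨hx0, by simpa using (mem_ball_zero_iff.1 hx1).le⟩
    rw [Real.norm_of_nonneg (by positivity), norm_mul, mul_pow, Complex.norm_real,
      Real.norm_of_nonneg (by positivity)]
    refine (mul_le_mul_of_nonneg_left h2 (by positivity)).trans (le_of_eq ?_)
    have e2 : ‖x‖ ^ (1 + α) = ‖x‖ ^ (α - 3) * ‖x‖ ^ 4 := by
      rw [← Real.rpow_natCast ‖x‖ 4, ← Real.rpow_add hx0]; congr 1; push_cast; ring
    rw [e2]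
    field_simp

/-! ### The model singularity -/

variable {α : ℝ} {u f : Plane → ℂ} {v : Fin 2 → Plane → ℂ}

lemma IsTest.memH {φ : Plane → ℂ} (h : IsTest univ φ) (k : ℕ) : MemH k univ φ := by
  induction k generalizing φ with
  | zero =>
    change MemLp φ 2 (volume.restrict univ)
    rw [Measure.restrict_univ]
    exact h.memLp 2
  | succ k ih =>
    refine ⟨?_, fun j => ⟨_, HasWeakDeriv.of_contDiffOn isOpen_univ h.contDiff.contDiffOn j,
      ih (h.pd j)⟩⟩
    rw [Measure.restrict_univ]
    exact h.memLp 2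

lemma InV.const_mul (h : InV α u v) (c : ℂ) : InV α (fun x => c * u x) (fun j x => c * v j x) := by
  refine ⟨h.memLp.const_mul c, ?_, fun j => (h.deriv j).const_mul c, fun j => ?_⟩
  · filter_upwards [h.even] with x hx
    rw [hx]
  · refine ((h.memLp_cov j).const_mul c).ae_eq (ae_of_all _ fun x => ?_)
    simp only [covD]; ring

lemma InOp.const_mul (h : InOp α u v f) (c : ℂ) :
    InOp α (fun x => c * u x) (fun j x => c * v j x) (fun x => c * f x) := by
  refine ⟨h.toInV.const_mul c, h.memLp_rhs.const_mul c, fun φ hφ => ?_⟩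
  have := congrArg (c * ·) (h.eq φ hφ)
  simp only [← integral_const_mul] at this
  refine Eq.trans (congrArg _ (funext fun x => ?_)) (this.trans (congrArg _ (funext fun x => ?_)))
  · rw [Finset.mul_sum]
    exact Finset.sum_congr rfl fun j _ => by simp only [covD]; ring
  · ring

lemma InOp.add {u' f' : Plane → ℂ} {v' : Fin 2 → Plane → ℂ} (h : InOp α u v f)
    (h' : InOp α u' v' f') :
    InOp α (fun x => u x + u' x) (fun j x => v j x + v' j x) (fun x => f x + f' x) := by
  have := h.sub (h'.const_mul (-1))
  simpa [sub_eq_add_neg] using this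

lemma InV.congr_ae {u' : Plane → ℂ} (h : InV α u v) (hu : u =ᵐ[volume] u') : InV α u' v := by
  refine ⟨h.memLp.ae_eq hu, ?_, fun j => (h.deriv j).congr_ae isOpen_punctured hu (ae_eq_refl _),
    fun j => (h.memLp_cov j).ae_eq ?_⟩
  · filter_upwards [h.even, hu, ae_neg hu] with x h1 h2 h3
    rw [← h2, ← h3, h1]
  · filter_upwards [hu] with x hx
    simp only [covD, hx]

lemma InOp.congr_ae {u' : Plane → ℂ} (h : InOp α u v f) (hu : u =ᵐ[volume] u') : InOp α u' v f := by
  refine ⟨h.toInV.congr_ae hu, h.memLp_rhs, fun φ hφ => ?_⟩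
  rw [← h.eq φ hφ]
  refine integral_congr_ae ?_
  filter_upwards [hu] with x hx
  simp only [covD, hx]

/-- The power `r ^ β` on the plane. -/
def rpowC (β : ℝ) (x : Plane) : ℂ := ((‖x‖ ^ β : ℝ) : ℂ)

lemma contDiffOn_rpow_norm (β : ℝ) : ContDiffOn ℝ ∞ (rpowC β) punctured := fun x hx =>
  (Complex.ofRealCLM.contDiff.contDiffAt.comp x ((contDiffAt_norm ℝ hx).rpow_const_of_ne
    (norm_ne_zero_iff.2 hx))).contDiffWithinAt

lemma pd_rpowC (β : ℝ) (j : Fin 2) {x : Plane} (hx : x ≠ 0) :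
    pd j (rpowC β) x = β * rpowC (β - 2) x * x j := by
  have hx0 : 0 < ‖x‖ := norm_pos_iff.2 hx
  have h1 : HasFDerivAt (fun x : Plane => Real.sqrt (‖x‖ ^ 2)) _ x :=
    (hasStrictFDerivAt_norm_sq x).hasFDerivAt.sqrt (by positivity)
  simp only [Real.sqrt_sq (norm_nonneg _)] at h1
  have h2 : HasFDerivAt (rpowC β) _ x :=
    (hasDerivAt_rpowC β hx0).hasFDerivAt.comp x h1
  have h3 : pd j (rpowC β) x = _ := congrArg (fun L : Plane →L[ℝ] ℂ => L (e j)) h2.fderiv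
  rw [h3]
  have h4 : ‖x‖ ^ (β - 1) = ‖x‖ ^ (β - 2) * ‖x‖ := by
    rw [← Real.rpow_add_one hx0.ne']; congr 1; ring
  have hc : (‖x‖ : ℂ) ≠ 0 := by exact_mod_cast hx0.ne'
  simp [e, EuclideanSpace.inner_single_right, rpowC, h4]
  field_simp

/-- The coefficient is `2β + β(β - 2)`. For `β = α` this is what the term `α² / r²` of `H_α`
cancels. -/
lemma sum_pd_pd_rpowC (β : ℝ) {x : Plane} (hx : x ≠ 0) :
    ∑ j, pd j (pd j (rpowC β)) x = β ^ 2 * rpowC (β - 2) x := by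
  have hx0 : 0 < ‖x‖ := norm_pos_iff.2 hx
  have e1 : ∀ j : Fin 2, pd j (pd j (rpowC β)) x =
      β * rpowC (β - 2) x + β * (β - 2) * rpowC (β - 4) x * x j ^ 2 := fun j => by
    have hev : pd j (rpowC β) =ᶠ[𝓝 x] fun y => (β * rpowC (β - 2) y) * y j := by
      filter_upwards [isOpen_punctured.mem_nhds hx] with y hy using pd_rpowC β j hy
    have hd : DifferentiableAt ℝ (rpowC (β - 2)) x :=
      ((contDiffOn_rpow_norm (β - 2)).contDiffAt (isOpen_punctured.mem_nhds hx)).differentiableAt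
        (by simp)
    have hp : pd j (fun x : Plane => (x j : ℂ)) x = 1 := by
      have h2 := ((Complex.ofRealCLM.comp
        (EuclideanSpace.proj j : Plane →L[ℝ] ℝ)).hasFDerivAt (x := x)).fderiv
      have h3 : pd j (fun x : Plane => (x j : ℂ)) x = _ :=
        congrArg (fun L : Plane →L[ℝ] ℂ => L (e j)) h2
      rw [h3]
      simp [e]
    have h4 : pd j (pd j (rpowC β)) x = pd j (fun y => (β * rpowC (β - 2) y) * y j) x :=
      congrArg (fun L : Plane →L[ℝ] ℂ => L (e j)) hev.fderiv_eq
    rw [h4, pd_mul (hd.const_mul _) ((contDiff_coord j).differentiable (by simp) x), hp,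
      pd_const_mul hd, pd_rpowC _ _ hx, show β - 2 - 2 = β - 4 by ring]
    push_cast
    ring
  have h2 : (‖x‖ : ℂ) ^ 2 = (x 0 : ℂ) ^ 2 + (x 1 : ℂ) ^ 2 := by exact_mod_cast norm_sq_plane x
  have h5 : rpowC (β - 2) x = rpowC (β - 4) x * (‖x‖ : ℂ) ^ 2 := by
    unfold rpowC
    rw [← Complex.ofReal_pow, ← Complex.ofReal_mul, ← Real.rpow_add_natCast hx0.ne']
    congr 2; push_cast; ring
  rw [Fin.sum_univ_two, e1, e1, h5, h2]
  ring

lemma weakLap_rpowC (β : ℝ) :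
    WeakLap (rpowC β) (fun j => pd j (rpowC β)) (fun x => -(β ^ 2 * rpowC (β - 2) x)) :=
  (WeakLap.of_contDiffOn (contDiffOn_rpow_norm β)).congr_ae (ae_eq_refl _) (fun _ => ae_eq_refl _) (by
    filter_upwards [ae_mem_punctured] with x hx
    rw [sum_pd_pd_rpowC β hx])

/-- A cut-off equal to one on the unit disc. -/
def kappa (x : Plane) : ℂ := 1 - chi 1 x

lemma isTest_kappa : IsTest univ kappa := isTest_one_sub_chi one_pos

lemma kappa_eq_one {x : Plane} (hx : ‖x‖ ≤ 1) : kappa x = 1 := by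
  rw [kappa, chi_eq_zero one_pos hx, sub_zero]

lemma kappa_eq_zero {x : Plane} (hx : 2 ≤ ‖x‖) : kappa x = 0 := by
  rw [kappa, chi_eq_one one_pos (by linarith), sub_self]

lemma norm_kappa_le (x : Plane) : ‖kappa x‖ ≤ 2 := by
  refine (norm_sub_le _ _).trans ?_
  have := norm_chi_le 1 x
  simp only [norm_one]
  linarith

/-- `kappa` is constant near the origin. Hence all terms produced by cutting off `r^α` are
themselves test functions off the origin. -/
lemma isTest_pd_kappa (j : Fin 2) : IsTest punctured (pd j kappa) := by
  have h := isTest_kappa.pd j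
  refine ⟨h.1, h.2.1, fun x hx h0 => ?_⟩
  rw [mem_singleton_iff.1 h0] at hx
  refine (notMem_tsupport_iff_eventuallyEq.2 ?_) hx
  filter_upwards [Metric.ball_mem_nhds (0 : Plane) one_pos] with y hy
  have hy' : ‖y‖ < 1 := by simpa using hy
  have : kappa =ᶠ[𝓝 y] fun _ => 1 := by
    filter_upwards [(isOpen_lt continuous_norm continuous_const).mem_nhds hy'] with z hz
    exact kappa_eq_one (le_of_lt hz)
  simp [pd, this.fderiv_eq]

/-- The model singularity `r ^ α`, cut off away from the origin. -/
def cutPow (α : ℝ) (x : Plane) : ℂ := kappa x * rpowC α x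

lemma cutPow_eq {x : Plane} (hx : ‖x‖ ≤ 1) : cutPow α x = ((‖x‖ ^ α : ℝ) : ℂ) := by
  rw [cutPow, kappa_eq_one hx, one_mul, rpowC]

lemma cutPow_rot (θ : ℝ) (x : Plane) : cutPow α (rot θ x) = cutPow α x := by
  simp only [cutPow, kappa, chi_rot, rpowC, norm_rot]

lemma cutPow_neg (x : Plane) : cutPow α (-x) = cutPow α x := by
  simp only [cutPow, kappa, chi, rpowC, norm_neg]

lemma continuous_rpowC (h0 : 0 ≤ α) : Continuous (rpowC α) :=
  Complex.continuous_ofReal.comp (continuous_norm.rpow_const fun _ => Or.inr h0)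

lemma memLp_test_mul_rpowC {φ : Plane → ℂ} (hφ : IsTest univ φ) (h0 : 0 ≤ α) :
    MemLp (fun x => φ x * rpowC α x) 2 volume :=
  (hφ.continuous.mul (continuous_rpowC h0)).memLp_of_hasCompactSupport hφ.2.1.mul_right

/-- In polar coordinates the integrand is `r^(2α-1)` up to a bounded factor, integrable at zero
because `α > 0`. -/
lemma memLp_kappa_mul_rpowC (hα : 0 < α) :
    MemLp (fun x => kappa x * rpowC (α - 1) x) 2 volume := by
  have hm : AEStronglyMeasurable (fun x => kappa x * rpowC (α - 1) x) volume :=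
    isTest_kappa.continuous.aestronglyMeasurable.mul
      (Complex.measurable_ofReal.comp (measurable_norm.pow_const (α - 1))).aestronglyMeasurable
  rw [memLp_two_iff_integrable_sq_norm hm]
  have hR : IntegrableOn (fun x : Plane => (fun r : ℝ => 4 * (r ^ (2 * α - 2))) ‖x‖)
      (Metric.ball 0 2) := by
    refine (integrableOn_fun_norm_addHaar volume (f := fun r : ℝ => 4 * (r ^ (2 * α - 2)))).2 ?_
    have h2 : IntegrableOn (fun r : ℝ => 4 * r ^ (2 * α - 1)) (Ioo 0 2) :=
      (((intervalIntegrable_iff_integrableOn_Ioc_of_le zero_le_two).1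
        (intervalIntegral.intervalIntegrable_rpow' (by linarith))).mono_set
          Ioo_subset_Ioc_self).const_mul 4
    refine h2.congr_fun (fun r hr => ?_) measurableSet_Ioo
    have e1 : r ^ (2 * α - 1) = r ^ (2 * α - 2) * r := by
      rw [← Real.rpow_add_one hr.1.ne']; congr 1; ring
    simp [e1]
    ring
  rw [← integrable_indicator_iff Metric.isOpen_ball.measurableSet] at hR
  refine Integrable.mono' hR (hm.norm.pow 2) (ae_of_all _ fun x => ?_)
  rw [Real.norm_of_nonneg (by positivity)]
  by_cases hx : x ∈ Metric.ball (0 : Plane) 2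
  · rw [indicator_of_mem hx, norm_mul, mul_pow, rpowC, Complex.norm_real,
      Real.norm_of_nonneg (by positivity)]
    have h1 : (‖x‖ ^ (α - 1)) ^ 2 = ‖x‖ ^ (2 * α - 2) := by
      rw [← Real.rpow_natCast, ← Real.rpow_mul (norm_nonneg _)]; congr 1; push_cast; ring
    rw [h1]
    refine mul_le_mul_of_nonneg_right ?_ (by positivity)
    nlinarith [norm_kappa_le x, norm_nonneg (kappa x)]
  · rw [indicator_of_notMem hx, kappa_eq_zero (by simpa using hx)]
    simp

/-- The model singularity lies in the operator domain. -/
theorem exists_inOp_cutPow (h0 : 0 ≤ α) : ∃ v f, InOp α (cutPow α) v f := by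
  have hl := (weakLap_rpowC α).mul_smooth (isTest_kappa.contDiff.contDiffOn (s := punctured))
  set V : Fin 2 → Plane → ℂ := fun j x => kappa x * pd j (rpowC α) x + pd j kappa x * rpowC α x with hV
  have hmem : MemLp (cutPow α) 2 volume := memLp_test_mul_rpowC isTest_kappa h0
  have hgrad : ∀ j, MemLp (V j) 2 volume := fun j => by
    refine MemLp.add ?_ (memLp_test_mul_rpowC ((isTest_pd_kappa j).mono (subset_univ _)) h0)
    -- At `α = 0` the power is constant and its gradient vanishes, so the failure of `r^(-1)` to be
    -- square integrable does no harm.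
    rcases h0.eq_or_lt with rfl | hα
    · refine (MemLp.zero' (p := 2)).ae_eq ?_
      filter_upwards [ae_mem_punctured] with x hx
      rw [pd_rpowC _ _ hx]; simp
    · refine ((memLp_unit_mul (memLp_kappa_mul_rpowC hα) j).const_mul (α : ℂ)).ae_eq ?_
      filter_upwards [ae_mem_punctured] with x hx
      have hx0 : 0 < ‖x‖ := norm_pos_iff.2 hx
      have e1 : ‖x‖ ^ (α - 2) = ‖x‖ ^ (α - 1) * ‖x‖⁻¹ := by
        rw [← div_eq_mul_inv, ← Real.rpow_sub_one hx0.ne']; congr 1; ring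
      rw [pd_rpowC _ _ hx, rpowC, rpowC, e1]
      push_cast
      ring
  have hang : angV V =ᵐ[volume] 0 :=
    angV_eq_zero hmem (ae_of_all _ (sector_zero_radial cutPow_rot)) hl.deriv
  have hinv : InV α (cutPow α) V := by
    refine InV.of_grad hmem (ae_of_all _ cutPow_neg) hl.deriv hgrad fun hα => ?_
    refine (memLp_kappa_mul_rpowC (lt_of_le_of_ne h0 (Ne.symm hα))).ae_eq ?_
    filter_upwards [ae_mem_punctured] with x hx
    have hx0 : 0 < ‖x‖ := norm_pos_iff.2 hx
    rw [cutPow, rpowC, rpowC, Real.rpow_sub_one hx0.ne']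
    push_cast
    ring
  have ht : ∀ j, IsTest punctured fun x => pd j (rpowC α) x * pd j kappa x := fun j =>
    (isTest_pd_kappa j).mul_contDiffOn isOpen_punctured
      (ContDiffOn.pd isOpen_punctured (contDiffOn_rpow_norm α) j)
  have ht2 : ∀ j, IsTest punctured fun x => rpowC α x * pd j (pd j kappa) x := fun j =>
    ((isTest_pd_kappa j).pd j).mul_contDiffOn isOpen_punctured (contDiffOn_rpow_norm α)
  -- `H_α` annihilates `r^α`, so only the terms with derivatives of the cut-off remain.
  have hF : MemLp (fun x => -2 * (∑ j, pd j (rpowC α) x * pd j kappa x)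
      - ∑ j, rpowC α x * pd j (pd j kappa) x) 2 volume :=
    ((memLp_finsetSum _ fun j _ => (ht j).memLp 2).const_mul (-2)).sub
      (memLp_finsetSum _ fun j _ => (ht2 j).memLp 2)
  refine ⟨V, _, (hinv.inOp_iff hF).2 (hl.congr_ae (ae_eq_refl _) (fun _ => ae_eq_refl _) ?_)⟩
  filter_upwards [hang, ae_mem_punctured] with x hx hxp
  have hx0 : 0 < ‖x‖ := norm_pos_iff.2 hxp
  have e1 : rpowC (α - 2) x = (((‖x‖ ^ 2)⁻¹ : ℝ) : ℂ) * rpowC α x := by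
    unfold rpowC
    rw [← Complex.ofReal_mul, Real.rpow_sub hx0, div_eq_inv_mul]
    norm_num
  rw [hx, cutPow, e1]
  simp only [Fin.sum_univ_two, Pi.zero_apply]
  ring

/-! ### Regularity of the elements of the operator domain -/

variable {α : ℝ} {u f : Plane → ℂ} {v : Fin 2 → Plane → ℂ}

lemma memLp_inv_sq_of_ball {w : Plane → ℂ} (hw : MemLp w 2 volume)
    (h : MemLp (fun x : Plane => (((‖x‖ ^ 2)⁻¹ : ℝ) : ℂ) * w x) 2
      (volume.restrict (Metric.ball 0 1))) :
    MemLp (fun x : Plane => (((‖x‖ ^ 2)⁻¹ : ℝ) : ℂ) * w x) 2 volume := by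
  have hm : AEStronglyMeasurable (fun x : Plane => (((‖x‖ ^ 2)⁻¹ : ℝ) : ℂ) * w x) volume :=
    (aestronglyMeasurable_of_contDiffOn contDiffOn_inv_sq).mul hw.1
  rw [memLp_two_iff_integrable_sq_norm hm]
  rw [memLp_two_iff_integrable_sq_norm hm.restrict] at h
  have h2 : IntegrableOn (fun x : Plane => ‖(((‖x‖ ^ 2)⁻¹ : ℝ) : ℂ) * w x‖ ^ 2)
      (Metric.ball 0 1)ᶜ := by
    refine Integrable.mono' (((memLp_two_iff_integrable_sq_norm hw.1).1 hw).integrableOn)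
      (hm.norm.pow 2).restrict ?_
    filter_upwards [ae_restrict_mem measurableSet_ball.compl] with x hx
    have hx1 : 1 ≤ ‖x‖ := by simpa using hx
    rw [Real.norm_of_nonneg (by positivity), norm_mul, mul_pow, Complex.norm_real,
      Real.norm_of_nonneg (by positivity)]
    refine mul_le_of_le_one_left (by positivity) (pow_le_one₀ (by positivity) ?_)
    exact inv_le_one_of_one_le₀ (one_le_pow₀ hx1)
  have h3 := IntegrableOn.union h h2
  rwa [union_compl_self, integrableOn_univ] at h3

/-- Regularity from the square integrability of the potential terms. -/
lemma InOp.memH_two (h : InOp α u v f) (h0 : 0 ≤ α) (h1 : α ≤ 1)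
    (ha : MemLp (fun x => (((‖x‖ ^ 2)⁻¹ : ℝ) : ℂ) * angV v x) 2 volume)
    (hr : MemLp (fun x => (((‖x‖ ^ 2)⁻¹ : ℝ) : ℂ) * u x) 2 volume) : MemH 2 univ u := by
  obtain ⟨F, hF, hl⟩ := h.exists_weakLap (ha.const_mul (α : ℂ)) (hr.const_mul ((α : ℂ) ^ 2))
  exact hl.memH_two h.memLp (h.memLp_grad h0 h1) hF

/-- The part of non-zero angular momentum is in `H²`. -/
theorem InOp.memH_two_sub_sector (h : InOp α u v f) (h0 : 0 ≤ α) (h1 : α < 1) :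
    MemH 2 univ (fun x => u x - sector 0 u x) := by
  have hd := h.sub (h.sector_zero h0 h1.le)
  have hs : sector 0 (fun x => u x - sector 0 u x) =ᵐ[volume] 0 := by
    filter_upwards [sector_sub_sector_zero h.memLp 0] with x hx
    rw [hx]; simp
  obtain ⟨hr, ha⟩ := hd.rellich h0 h1 hs
  exact hd.memH_two h0 h1.le ha hr

theorem InOp.memH_two_sector (h : InOp α u v f) (h0 : 0 ≤ α) (h1 : α < 1) {n : ℤ} (hn : n ≠ 0) :
    MemH 2 univ (sector n u) := by
  refine ((h.memH_two_sub_sector h0 h1).sector n).congr isOpen_univ (ae_restrict_of_ae ?_)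
  filter_upwards [sector_sub_sector_zero h.memLp n] with x hx
  rw [hx, if_neg hn]

lemma sector_zero_sector_zero (u : Plane → ℂ) : sector 0 (sector 0 u) = sector 0 u := by
  ext x; rw [sector_sector, if_pos rfl]

/-- A radial element of the operator domain is a multiple of the model singularity plus an `H²`
function. -/
theorem InOp.exists_sub_cutPow (h : InOp α u v f) (h0 : 0 ≤ α) (h1 : α < 1)
    (hs : sector 0 u =ᵐ[volume] u) :
    ∃ c : ℂ, MemH 2 univ (fun x => u x - c * cutPow α x) ∧
      ((fun x : Plane => u x - c * ((‖x‖ ^ α : ℝ) : ℂ))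
        =o[ae (volume : Measure Plane) ⊓ 𝓝 0] fun x : Plane => ‖x‖) := by
  obtain ⟨c, hc, hL⟩ := h.radial_asymptotics h0 h1 hs
  refine ⟨c, ?_, hc⟩
  obtain ⟨v', f', hR⟩ := exists_inOp_cutPow h0
  have hd := h.sub (hR.const_mul c)
  have hrad : sector 0 (fun x => u x - c * cutPow α x) =ᵐ[volume] fun x => u x - c * cutPow α x := by
    filter_upwards [sector_sub h.memLp (hR.memLp.const_mul c) 0, hs] with x h2 h3
    rw [h2, h3, sector_zero_radial (w := fun x => c * cutPow α x) fun θ x => by rw [cutPow_rot]]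
  refine hd.memH_two h0 h1.le ?_ (memLp_inv_sq_of_ball hd.memLp (hL.ae_eq ?_))
  · refine (MemLp.zero' (p := 2)).ae_eq ?_
    filter_upwards [angV_eq_zero hd.memLp hrad hd.deriv] with x hx
    rw [hx]; simp
  · filter_upwards [ae_restrict_mem measurableSet_ball] with x hx
    rw [cutPow_eq (by simpa using (mem_ball_zero_iff.1 hx).le)]

/-- The conditions that describe the operator domain. -/
theorem InOp.explicit (h : InOp α u v f) (h0 : 0 ≤ α) (h1 : α < 1) :
    (∀ n : ℤ, n ≠ 0 → MemH 2 univ (sector n u)) ∧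
    MemH 2 univ (u - sector 0 u) ∧
    (∀ ε : ℝ, 0 < ε → MemH 2 (Metric.closedBall (0 : Plane) ε)ᶜ (sector 0 u)) ∧
    MemH 1 univ (sector 0 u) ∧
    ∃ c : ℂ,
      ((fun x : Plane => sector 0 u x - c * ((‖x‖ ^ α : ℝ) : ℂ))
        =o[ae (volume : Measure Plane) ⊓ 𝓝 0] fun x : Plane => ‖x‖) ∧
      MemH 2 (Metric.ball (0 : Plane) 1) (fun x : Plane => sector 0 u x - c * ((‖x‖ ^ α : ℝ) : ℂ)) := by
  have hz := h.sector_zero h0 h1.le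
  obtain ⟨c, hH, ho⟩ := hz.exists_sub_cutPow h0 h1 (ae_of_all _ fun x => by
    rw [sector_zero_sector_zero])
  refine ⟨fun n hn => h.memH_two_sector h0 h1 hn, h.memH_two_sub_sector h0 h1, fun ε hε => ?_,
    hz.memH_one h0 h1.le, c, ho, ?_⟩
  · have ht : IsTest univ fun x => rpowC α x * (chi (ε / 2) x * kappa x) := by
      have h2 : IsTest punctured fun x => chi (ε / 2) x * kappa x :=
        isTest_chi_mul isTest_kappa (by positivity)
      exact (h2.mul_contDiffOn isOpen_punctured (contDiffOn_rpow_norm α)).mono (subset_univ _)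
    have hsum := (hH.add ((ht.memH 2).const_mul c)).mono
      (subset_univ ((Metric.closedBall (0 : Plane) ε)ᶜ))
    refine hsum.congr Metric.isClosed_closedBall.isOpen_compl ?_
    filter_upwards [ae_restrict_mem Metric.isClosed_closedBall.isOpen_compl.measurableSet] with x hx
    have hx' : ε < ‖x‖ := by simpa using hx
    rw [chi_eq_one (by positivity) (by linarith), cutPow]
    ring
  · refine (hH.mono (subset_univ (Metric.ball (0 : Plane) 1))).congr Metric.isOpen_ball ?_
    filter_upwards [ae_restrict_mem measurableSet_ball] with x hx
    rw [cutPow_eq (by simpa using (mem_ball_zero_iff.1 hx).le)]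

/-! ### Gluing Sobolev functions -/

section glue

/-- The unit disc. -/
def innerDisc : Set Plane := Metric.ball 0 1

/-- The exterior of a smaller disc. -/
def outerRegion : Set Plane := (Metric.closedBall 0 (1 / 4))ᶜ

lemma isOpen_innerDisc : IsOpen innerDisc := Metric.isOpen_ball

lemma isOpen_outerRegion : IsOpen outerRegion := Metric.isClosed_closedBall.isOpen_compl

lemma innerDisc_union_outerRegion : innerDisc ∪ outerRegion = univ := by
  refine eq_univ_of_forall fun x => ?_
  rcases lt_or_ge ‖x‖ 1 with h | h
  · exact Or.inl (by simpa [innerDisc] using h)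
  · exact Or.inr (by simp [outerRegion]; linarith)

lemma LocallyIntegrableOn.glue {w : Plane → ℂ} (h1 : LocallyIntegrableOn w innerDisc)
    (h2 : LocallyIntegrableOn w outerRegion) : LocallyIntegrableOn w univ := by
  intro x _
  rw [nhdsWithin_univ]
  have hx : x ∈ innerDisc ∪ outerRegion := by rw [innerDisc_union_outerRegion]; trivial
  rcases hx with hx | hx
  · have := h1 x hx
    rwa [isOpen_innerDisc.nhdsWithin_eq hx] at this
  · have := h2 x hx
    rwa [isOpen_outerRegion.nhdsWithin_eq hx] at this

/-- The test function is split by `chi (1 / 3)`, whose transition between radii `1/3` and `2/3` lies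
inside the overlap `1/4 < ‖x‖ < 1`. -/
lemma HasWeakDeriv.glue {j : Fin 2} {u v : Plane → ℂ} (h1 : HasWeakDeriv innerDisc j u v)
    (h2 : HasWeakDeriv outerRegion j u v) : HasWeakDeriv univ j u v := by
  refine hasWeakDeriv_iff.2 ⟨LocallyIntegrableOn.glue h1.1 h2.1, LocallyIntegrableOn.glue h1.2.1 h2.2.1,
    fun φ hφ => ?_⟩
  have hε : (0 : ℝ) < 1 / 3 := by norm_num
  have t0 : IsTest univ fun x => chi (1 / 3) x * φ x := hφ.mul_contDiff (chi_contDiff _)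
  have t2 : IsTest outerRegion fun x => chi (1 / 3) x * φ x := by
    refine ⟨t0.1, t0.2.1, fun x hx => ?_⟩
    have hcl : IsClosed {x : Plane | 1 / 3 ≤ ‖x‖} := isClosed_le continuous_const continuous_norm
    have hsub : tsupport (fun x => chi (1 / 3) x * φ x) ⊆ {x : Plane | 1 / 3 ≤ ‖x‖} := by
      refine closure_minimal (fun y hy => ?_) hcl
      by_contra hh
      exact hy (by simp only; rw [chi_eq_zero hε (not_le.1 hh).le, zero_mul])
    have h3 : 1 / 3 ≤ ‖x‖ := hsub hx
    simp only [outerRegion, mem_compl_iff, Metric.mem_closedBall, dist_zero_right, not_le]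
    linarith
  have t1' := (isTest_one_sub_chi hε).mul_contDiff hφ.contDiff
  have t1 : IsTest innerDisc fun x => φ x * (1 - chi (1 / 3) x) := by
    refine ⟨t1'.1, t1'.2.1, fun x hx => ?_⟩
    have hcl : IsClosed {x : Plane | ‖x‖ ≤ 2 / 3} := isClosed_le continuous_norm continuous_const
    have hsub : tsupport (fun x => φ x * (1 - chi (1 / 3) x)) ⊆ {x : Plane | ‖x‖ ≤ 2 / 3} := by
      refine closure_minimal (fun y hy => ?_) hcl
      by_contra hh
      refine hy ?_
      have h3 : 2 / 3 < ‖y‖ := not_le.1 hh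
      simp only
      rw [chi_eq_one hε (by linarith), sub_self, mul_zero]
    have h3 : ‖x‖ ≤ 2 / 3 := hsub hx
    simp only [innerDisc, Metric.mem_ball, dist_zero_right]
    linarith
  have e1 := h1.test t1
  have e2 := h2.test t2
  have hsplit : φ = fun x => φ x * (1 - chi (1 / 3) x) + chi (1 / 3) x * φ x := by
    ext x; ring
  have hpd : ∀ x, pd j φ x * u x = pd j (fun x => φ x * (1 - chi (1 / 3) x)) x * u x
      + pd j (fun x => chi (1 / 3) x * φ x) x * u x := fun x => by
    conv_lhs => rw [hsplit]
    rw [pd_add (t1.differentiable x) (t2.differentiable x)]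
    ring
  have hφv : ∀ x, φ x * v x = φ x * (1 - chi (1 / 3) x) * v x + chi (1 / 3) x * φ x * v x :=
    fun x => by ring
  simp only [hpd, hφv]
  rw [integral_add ((t1.pd j).integrable_mul h1.1) ((t2.pd j).integrable_mul h2.1),
    integral_add (t1.integrable_mul h1.2.1) (t2.integrable_mul h2.2.1), e1, e2]
  ring

lemma MemLp.glue {u : Plane → ℂ} (h1 : MemLp u 2 (volume.restrict innerDisc))
    (h2 : MemLp u 2 (volume.restrict outerRegion)) : MemLp u 2 (volume.restrict univ) := by
  have hm : AEStronglyMeasurable u (volume.restrict univ) := by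
    rw [← innerDisc_union_outerRegion]
    exact aestronglyMeasurable_union_iff.2 ⟨h1.1, h2.1⟩
  rw [memLp_two_iff_integrable_sq_norm hm, ← innerDisc_union_outerRegion]
  exact IntegrableOn.union ((memLp_two_iff_integrable_sq_norm h1.1).1 h1)
    ((memLp_two_iff_integrable_sq_norm h2.1).1 h2)

/-- The weak derivatives on the two regions agree on the overlap by uniqueness, so they patch to one
function, to which the induction hypothesis applies. -/
lemma MemH.glue {k : ℕ} {u : Plane → ℂ} (h1 : MemH k innerDisc u) (h2 : MemH k outerRegion u) :
    MemH k univ u := by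
  induction k generalizing u with
  | zero => exact MemLp.glue h1 h2
  | succ k ih =>
    refine ⟨MemLp.glue h1.1 h2.1, fun j => ?_⟩
    obtain ⟨v, hv, hv'⟩ := h1.2 j
    obtain ⟨w, hw, hw'⟩ := h2.2 j
    classical
    have hun := (hv.mono (inter_subset_left (t := outerRegion))).unique
      (hw.mono (inter_subset_right (s := innerDisc)))
      (isOpen_innerDisc.inter isOpen_outerRegion)
    have ha : v =ᵐ[volume.restrict innerDisc] innerDisc.piecewise v w := by
      filter_upwards [ae_restrict_mem isOpen_innerDisc.measurableSet] with x hx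
      rw [piecewise_eq_of_mem _ _ _ hx]
    have hb : w =ᵐ[volume.restrict outerRegion] innerDisc.piecewise v w := by
      rw [Filter.EventuallyEq, ae_restrict_iff' isOpen_outerRegion.measurableSet]
      filter_upwards [hun] with x hx hxo
      by_cases hxi : x ∈ innerDisc
      · rw [piecewise_eq_of_mem _ _ _ hxi, hx ⟨hxi, hxo⟩]
      · rw [piecewise_eq_of_notMem _ _ _ hxi]
    exact ⟨innerDisc.piecewise v w, (hv.congr isOpen_innerDisc ae_eq_rfl ha).glue
      (hw.congr isOpen_outerRegion ae_eq_rfl hb), ih (hv'.congr isOpen_innerDisc ha)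
      (hw'.congr isOpen_outerRegion hb)⟩

end glue

/-! ### The explicit conditions suffice -/

variable {α : ℝ} {u f : Plane → ℂ} {v : Fin 2 → Plane → ℂ}

lemma MemH.exists_inOp_zero (h : MemH 2 univ u) (he : ∀ᵐ x : Plane, u (-x) = u x) :
    ∃ v f, InOp 0 u v f := by
  have hu := h.1
  rw [Measure.restrict_univ] at hu
  choose v hv hv1 using h.2
  have hvL : ∀ j, MemLp (v j) 2 volume := fun j => by
    have := (hv1 j).1
    rwa [Measure.restrict_univ] at this
  choose w hw hw0 using fun j => (hv1 j).2 j
  have hwL : ∀ j, MemLp (w j) 2 volume := fun j => by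
    have : MemLp (w j) 2 (volume.restrict univ) := hw0 j
    rwa [Measure.restrict_univ] at this
  have hF : MemLp (fun x => -∑ j, w j x) 2 volume := (memLp_finsetSum _ fun j _ => hwL j).neg
  have hd : ∀ j, HasWeakDeriv punctured j u (v j) := fun j => (hv j).mono (subset_univ _)
  have hl : WeakLap u v fun x => -∑ j, w j x := by
    refine ⟨hd, locallyIntegrableOn_of_memLp hF _, fun φ hφ => ?_⟩
    have hφ' := hφ.mono (subset_univ _)
    have i1 : ∀ j, Integrable fun x => φ x * w j x := fun j => hφ'.integrable_mul (hw j).2.1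
    rw [integral_finsetSum _ fun j _ => (hφ'.pd j).integrable_mul (hw j).1]
    simp only [(hw _).test hφ', mul_neg, Finset.mul_sum]
    rw [integral_neg, integral_finsetSum _ fun j _ => i1 j, Finset.sum_neg_distrib]
  refine ⟨v, _, ((InV.of_grad hu he hd hvL fun hh => absurd rfl hh).inOp_iff hF).2 ?_⟩
  simpa using hl

/-- `H_α` differs from `-Δ` by `r^(-2)` times `∂_θ u` and `u`, up to constants. Once both terms are
square integrable, the value of `α` does not affect membership in the operator domain. -/
lemma InOp.of_zero (h : InOp 0 u v f)
    (ha : MemLp (fun x => (((‖x‖ ^ 2)⁻¹ : ℝ) : ℂ) * angV v x) 2 volume)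
    (hr : MemLp (fun x => (((‖x‖ ^ 2)⁻¹ : ℝ) : ℂ) * u x) 2 volume) (α : ℝ) :
    ∃ f', InOp α u v f' := by
  have hl := (h.toInV.inOp_iff h.memLp_rhs).1 h
  simp only [Complex.ofReal_zero, zero_mul, mul_zero, add_zero, ne_eq, OfNat.ofNat_ne_zero,
    not_false_eq_true, zero_pow, sub_zero] at hl
  refine (InV.of_grad h.memLp h.even h.deriv (h.memLp_grad le_rfl zero_le_one) fun _ => ?_).inOp_of_weakLap
    hl h.memLp_rhs (ha.const_mul _) (hr.const_mul _)
  refine MemLp.of_le (h.memLp.norm.add hr.norm) ?_ (ae_of_all _ fun x => ?_)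
  · exact (Complex.measurable_ofReal.comp measurable_norm.inv).aestronglyMeasurable.mul h.memLp.1
  · simp only [Pi.add_apply]
    rw [norm_mul, norm_mul, Complex.norm_real, Complex.norm_real, Real.norm_of_nonneg (by positivity),
      Real.norm_of_nonneg (by positivity), Real.norm_of_nonneg (by positivity)]
    have : ‖x‖⁻¹ ≤ 1 + (‖x‖ ^ 2)⁻¹ := by
      rw [← inv_pow]; nlinarith [sq_nonneg (‖x‖⁻¹ - 1), sq_nonneg (‖x‖⁻¹)]
    nlinarith [mul_le_mul_of_nonneg_right this (norm_nonneg (u x))]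

/-- Sets of full measure are dense. This makes limits along the filter unique. -/
lemma neBot_ae_inf_nhds : (ae (volume : Measure Plane) ⊓ 𝓝 0).NeBot := by
  rw [inf_neBot_iff]
  intro s hs t ht
  have hd : Dense {x | x ∈ s} := Measure.dense_of_ae (μ := volume) hs
  have := mem_closure_iff_nhds.1 (hd 0) t ht
  rwa [inter_comm] at this

/-- A radial `H²` function that is `o(r)` at the origin is in the operator domain. -/
lemma MemH.exists_inOp_radial (h : MemH 2 univ u) (hrad : ∀ θ x, u (rot θ x) = u x)
    (ho : u =o[ae (volume : Measure Plane) ⊓ 𝓝 0] fun x : Plane => ‖x‖) (α : ℝ) :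
    ∃ v f, InOp α u v f := by
  have he : ∀ x : Plane, u (-x) = u x := fun x => by rw [← rot_pi, hrad]
  obtain ⟨v, f, h2⟩ := h.exists_inOp_zero (ae_of_all _ he)
  have hs : Anyon.sector 0 u =ᵐ[volume] u := ae_of_all _ (sector_zero_radial hrad)
  -- The asymptotics at `α = 0` give `u = c + o(r)`; as `u` is `o(r)` as well, `c = 0`, and then the
  -- weighted bound on the remainder is a bound on `u / r²`.
  obtain ⟨c, hc, hL⟩ := h2.radial_asymptotics le_rfl zero_lt_one hs
  have hc0 : c = 0 := by
    have := neBot_ae_inf_nhds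
    have h3 := ho.sub hc
    simp only [Real.rpow_zero, Complex.ofReal_one, mul_one, sub_sub_cancel] at h3
    have h4 : Tendsto (fun x : Plane => ‖x‖) (ae (volume : Measure Plane) ⊓ 𝓝 0) (𝓝 0) := by
      have := (continuous_norm.tendsto (0 : Plane)).mono_left
        (inf_le_right (a := ae (volume : Measure Plane)))
      rwa [norm_zero] at this
    exact tendsto_nhds_unique tendsto_const_nhds (h3.trans_tendsto h4)
  have hq : MemLp (fun x => (((‖x‖ ^ 2)⁻¹ : ℝ) : ℂ) * u x) 2 volume := by
    refine memLp_inv_sq_of_ball h2.memLp ?_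
    simpa [hc0] using hL
  have hang : MemLp (fun x => (((‖x‖ ^ 2)⁻¹ : ℝ) : ℂ) * angV v x) 2 volume := by
    refine (MemLp.zero' (p := 2)).ae_eq ?_
    filter_upwards [angV_eq_zero h2.memLp hs h2.deriv] with x hx
    rw [hx]; simp
  exact ⟨v, h2.of_zero hang hq α⟩

/-- The explicit conditions imply membership in the operator domain. -/
theorem exists_inOp_of_explicit (h0 : 0 ≤ α) (hu : MemLp u 2 volume)
    (he : ∀ᵐ x : Plane, u (-x) = u x) (hΨ : MemH 2 univ (u - sector 0 u))
    (hε : ∀ ε : ℝ, 0 < ε → MemH 2 (Metric.closedBall (0 : Plane) ε)ᶜ (sector 0 u)) {c : ℂ}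
    (ho : (fun x : Plane => sector 0 u x - c * ((‖x‖ ^ α : ℝ) : ℂ))
        =o[ae (volume : Measure Plane) ⊓ 𝓝 0] fun x : Plane => ‖x‖)
    (hb : MemH 2 (Metric.ball (0 : Plane) 1)
      (fun x : Plane => sector 0 u x - c * ((‖x‖ ^ α : ℝ) : ℂ))) :
    ∃ v f, InOp α u v f := by
  -- the non-radial part
  have hz : ∀ x : Plane, sector 0 u (-x) = sector 0 u x := fun x => by rw [← rot_pi, sector_zero_rot]
  obtain ⟨v₁, f₁, h1⟩ := hΨ.exists_inOp_zero (by
    filter_upwards [he] with x hx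
    simp only [Pi.sub_apply, hx, hz])
  have hs1 : sector 0 (u - sector 0 u) =ᵐ[volume] 0 := by
    filter_upwards [sector_sub_sector_zero hu 0] with x hx
    exact hx.trans (by simp)
  -- The Rellich inequality for the free Laplacian, whose constant `(2 - 0)² = 4` exceeds one.
  obtain ⟨hr1, ha1⟩ := h1.rellich le_rfl zero_lt_one hs1
  obtain ⟨f₁', h1'⟩ := h1.of_zero ha1 hr1 α
  -- the radial part
  obtain ⟨v₂, f₂, h2⟩ := exists_inOp_cutPow (α := α) h0
  -- Near the origin this is the hypothesis on the remainder; away from it both terms are separately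
  -- `H²`, the model singularity being smooth there. The two regions are glued.
  have hw : MemH 2 univ (fun x => sector 0 u x - c * cutPow α x) := by
    refine MemH.glue ?_ ?_
    · refine hb.congr isOpen_innerDisc ?_
      filter_upwards [ae_restrict_mem isOpen_innerDisc.measurableSet] with x hx
      rw [cutPow_eq (by simpa using (mem_ball_zero_iff.1 hx).le)]
    · have ht : IsTest univ fun x => rpowC α x * (chi (1 / 8) x * kappa x) := by
        have h2 : IsTest punctured fun x => chi (1 / 8) x * kappa x :=
          isTest_chi_mul isTest_kappa (by positivity)
        exact (h2.mul_contDiffOn isOpen_punctured (contDiffOn_rpow_norm α)).mono (subset_univ _)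
      have hsum := (hε (1 / 4) (by norm_num)).add (((ht.memH 2).const_mul (-c)).mono
        (subset_univ ((Metric.closedBall (0 : Plane) (1 / 4))ᶜ)))
      refine hsum.congr isOpen_outerRegion ?_
      filter_upwards [ae_restrict_mem isOpen_outerRegion.measurableSet] with x hx
      have hx' : 1 / 4 < ‖x‖ := by simpa [outerRegion] using hx
      rw [chi_eq_one (by positivity) (by linarith), cutPow]
      ring
  have hwo : (fun x => sector 0 u x - c * cutPow α x)
      =o[ae (volume : Measure Plane) ⊓ 𝓝 0] fun x : Plane => ‖x‖ := by
    refine ho.congr' ?_ EventuallyEq.rfl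
    refine Filter.Eventually.filter_mono inf_le_right ?_
    filter_upwards [Metric.ball_mem_nhds (0 : Plane) one_pos] with x hx
    rw [cutPow_eq (by simpa using (mem_ball_zero_iff.1 hx).le)]
  obtain ⟨v₃, f₃, h3⟩ := hw.exists_inOp_radial
    (fun θ x => by rw [sector_zero_rot, cutPow_rot]) hwo α
  -- The decomposition is `u = (u - u_0) + (u_0 - c r^α κ) + c r^α κ`, with `κ` the cut-off.
  refine ⟨_, _, ((h1'.add h3).add (h2.const_mul c)).congr_ae (ae_of_all _ fun x => ?_)⟩
  simp only [Pi.sub_apply]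
  ring

end Anyon

end

theorem mainTheorem4 :
    (∀ α : ℝ, α ∈ Set.Icc (0 : ℝ) 1 →
      Anyon.FormIsClosed α ∧ ∀ ψ ∈ Anyon.formDomain α, 0 ≤ Anyon.form α (Anyon.rep ψ)) ∧
    (∀ α : ℝ, α ∈ Set.Ioo (0 : ℝ) 1 →
      ∀ ψ ∈ Anyon.formDomain α, Anyon.MemH 1 Set.univ (Anyon.rep ψ)) ∧
    (∀ α : ℝ, α ∈ Set.Icc (0 : ℝ) 1 →
      ∃ H : Anyon.L2even →ₗ.[ℂ] Anyon.L2even,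
        Anyon.IsAssociatedOperator α H ∧
        Dense (H.domain : Set Anyon.L2even) ∧
        IsSelfAdjoint H ∧
        (∀ ψ : H.domain, Anyon.IsH α (Anyon.rep (ψ : Anyon.L2even)) (Anyon.rep (H ψ))) ∧
        (H.domain : Set Anyon.L2even) =
          {ψ | ψ ∈ Anyon.formDomain α ∧
            ∃ f : Anyon.Plane → ℂ, MeasureTheory.MemLp f 2 MeasureTheory.volume ∧
              Anyon.IsH α (Anyon.rep ψ) f} ∧
        (α < 1 → (H.domain : Set Anyon.L2even) = Anyon.explicitDomain α)) := by
  refine ⟨fun α hα => ⟨Anyon.formIsClosed hα.1 hα.2, fun ψ _ => Anyon.form_nonneg α _⟩,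
    fun α hα ψ hψ => Anyon.memH_one_of_mem_formDomain hα.1.le hα.2.le hψ, fun α hα => ?_⟩
  obtain ⟨H, hassoc, hdense, hsa, hH, hdom, hop⟩ := Anyon.exists_operator hα.1 hα.2
  refine ⟨H, hassoc, hdense, hsa, hH, hdom, fun h1 => Set.ext fun ψ => (hop ψ).trans ⟨?_, ?_⟩⟩
  · rintro ⟨v, f, h⟩
    exact h.explicit hα.1 h1
  · rintro ⟨-, hΨ, hε, -, c, ho, hb⟩
    exact Anyon.exists_inOp_of_explicit hα.1 (Anyon.memLp_rep ψ) (Anyon.rep_even ψ) hΨ hε ho hb
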